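/- Let $d\ge 1$, $k\in\mathbb N$ with $2k>d$, and let $\hbar,m,\beta,\nu>0$. Put $X_k=L^2(\mathbb R^{2d},(1+|v|^{2k})\,dx\,dv;\mathbb R)$, $X_k^v=L^2(\mathbb R^d,(1+|v|^{2k})\,dv;\mathbb R)$, $H^j_x=H^j(\mathbb R^d_x)$ and $H^j_k=H^j_x\otimes X_k^v$, i.e. the weak $x$-derivatives up to order $j$ lie in $X_k$. For a real potential $V=V(x)$ let $\mathcal F$ be the unitary Fourier transform $v\to\eta$, $\delta V(x,\eta)=\frac1\hbar\big[V(x+\frac{\hbar\eta}{2m})-V(x-\frac{\hbar\eta}{2m})\big]$, $\Theta[V]w=\mathcal F^{-1}(i\,\delta V\,\mathcal Fw)$, $n[w](x)=\int w(x,v)\,dv$, $F(v)=(\frac{\beta m}{2\pi})^{d/2}e^{-\beta m|v|^2/2}$, $$\Omega w=\nu F(v)\Big\{1+\frac{\hbar^2\beta^2}{24}\Big[-\frac1m\Delta V+\beta\sum_{r,s}v_rv_s\,\partial^2_{x_rx_s}V\Big]\Big\}n[w],$$ $\mathcal A w=\Theta[V]w$, $\mathcal Cw=-(\nu w-\Omega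 w)$, $Sw=-v\cdot\nabla_xw$ (in the sense of distributions, with domain $\{w\in X_k: Sw\in X_k\}$), $$M=\nu\,\mathcal F^{-1}\Big\{\frac{\mathcal FF(\eta)}{\nu-i\,\delta V(x,\eta)}\Big(1-\frac{\beta\hbar^2}{24m^2}\sum_{r,s}\eta_r\eta_s\,\partial^2_{x_rx_s}V(x)\Big)\Big\},$$ $\mathcal Pw=M\,n[w]$, $\mathcal Q=\mathcal I-\mathcal P$, and $(X_k)^0=\{w\in X_k: n[w]=0\}$. Let $\nu_k,\nu_{k+2}\in(0,\nu)$ and $R\in\mathbb R$. There are constants $M_1,M_2,M_3$, depending only on $d,k,\hbar,m,\beta,\nu,\nu_k,\nu_{k+2},R$, such that for every $V\in H^{k+2}_x$ with $\|V\|_{H^{k+2}_x}\le R$ and every $w_0\in H^1_{k+1}$ the following holds. There are unique continuously differentiable functions $\tilde\psi_0,\tilde\varphi_1,\tilde\psi_1:[0,\infty)\to X_k$, with $\tilde\psi_0,\tilde\psi_1$ valued in $(X_k)^0$ and $\tilde\varphi_1$ valued in the range of $\mathcal P$, which satisfy for all $\tau\ge0$ (all terms being defined in $X_k$) $$\tilde\psi_0'=\mathcal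 Q(\mathcal A+\mathcal C)\mathcal Q\tilde\psi_0,\quad \tilde\psi_0(0)=\mathcal Qw_0;\qquad \tilde\varphi_1'=\mathcal PS\mathcal Q\tilde\psi_0,\quad \lim_{\tau\to\infty}\tilde\varphi_1(\tau)=0;$$ $$\tilde\psi_1'=\mathcal Q(\mathcal A+\mathcal C)\mathcal Q\tilde\psi_1+\mathcal QS\mathcal Q\tilde\psi_0,\quad \tilde\psi_1(0)=[\mathcal Q(\mathcal A+\mathcal C)\mathcal Q]^{-1}\mathcal QS\mathcal P\,(\mathcal Pw_0),$$ where the inverse is taken on $(X_k)^0$; and for all $\tau\ge0$ $$\|\tilde\psi_0(\tau)\|_{X_k}\le M_1e^{-\nu_k\tau}\|w_0\|_{X_k},\quad \|\tilde\varphi_1(\tau)\|_{X_k}\le M_2e^{-\nu_{k+2}\tau}\|w_0\|_{H^1_{k+1}},\quad \|\tilde\psi_1(\tau)\|_{X_k}\le M_3e^{-\nu_{k+2}\tau}\|w_0\|_{H^1_{k+1}}.$$ -/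

import Mathlib

open MeasureTheory Set Filter Topology
open scoped ContDiff

noncomputable section

namespace WignerBGK

/-- Position space and velocity space: `ℝ^d` with the Euclidean norm. -/
abbrev E (d : ℕ) := EuclideanSpace ℝ (Fin d)

/-- Phase space `ℝ^{2d}`, points `(x, v)`. -/
abbrev Phase (d : ℕ) := E d × E d

/-- The physical constants (reduced Planck constant, mass, inverse temperature, collision
frequency), all positive. -/
structure Constants where
  hbar : ℝ
  m : ℝ
  beta : ℝ
  nu : ℝ
  hbar_pos : 0 < hbar
  m_pos : 0 < m
  beta_pos : 0 < beta
  nu_pos : 0 < nu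

/-! ### Weak derivatives and Sobolev spaces -/

section Sobolev

variable {ι F : Type*} [Fintype ι] [NormedAddCommGroup F] [NormedSpace ℝ F] [MeasureSpace F]

/-- `g` is the weak derivative `∂_{a 0} ⋯ ∂_{a (j-1)} u` along the vectors `a 0, …, a (j-1)`. -/
def HasWeakDeriv {j : ℕ} (a : Fin j → F) (u g : F → ℝ) : Prop :=
  LocallyIntegrable u ∧ LocallyIntegrable g ∧
    ∀ φ : F → ℝ, ContDiff ℝ ∞ φ → HasCompactSupport φ →
      ∫ z, u z * iteratedFDeriv ℝ j φ z a = (-1) ^ j * ∫ z, g z * φ z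

open Classical in
/-- The weak derivative of `u` along the vectors `a` (unique up to a null set),
or `0` when there is none. -/
def weakDeriv {j : ℕ} (a : Fin j → F) (u : F → ℝ) : F → ℝ :=
  if h : ∃ g, HasWeakDeriv a u g then h.choose else 0

/-- All weak derivatives of `u` of order at most `n` along the directions `dir i` exist and
belong to `L²(μ)`. -/
def MemSob (dir : ι → F) (μ : Measure F) (n : ℕ) (u : F → ℝ) : Prop :=
  ∀ j ≤ n, ∀ I : Fin j → ι, ∃ g, HasWeakDeriv (fun l => dir (I l)) u g ∧ MemLp g 2 μ

/-- The Sobolev norm: square root of the sum of the squared `L²(μ)` norms of all weak derivatives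
of order at most `n` along the directions `dir i`. -/
def sobNorm (dir : ι → F) (μ : Measure F) (n : ℕ) (u : F → ℝ) : ℝ :=
  Real.sqrt (∑ j ∈ Finset.range (n + 1), ∑ I : Fin j → ι,
    (eLpNorm (weakDeriv (fun l => dir (I l)) u) 2 μ).toReal ^ 2)

end Sobolev

variable {d : ℕ}

/-- The standard basis of `ℝ^d`. -/
def e (i : Fin d) : E d := EuclideanSpace.single i 1

/-- The `x`-directions in phase space. -/
def ex (i : Fin d) : Phase d := (e i, 0)

/-- `V ∈ H^n_x`. -/
def MemHx (n : ℕ) (V : E d → ℝ) : Prop := MemSob (e (d := d)) volume n V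

/-- The norm of `H^n_x`. -/
def normHx (n : ℕ) (V : E d → ℝ) : ℝ := sobNorm (e (d := d)) volume n V

/-- The measure `(1 + |v|^{2k}) dx dv`. -/
def weightMeasure (d k : ℕ) : Measure (Phase d) :=
  volume.withDensity fun z => ENNReal.ofReal (1 + ‖z.2‖ ^ (2 * k))

/-- The space `X_k = L²(ℝ^{2d}, (1 + |v|^{2k}) dx dv; ℝ)`. -/
abbrev X (d k : ℕ) := Lp ℝ 2 (weightMeasure d k)

/-- The norm of `X_k`, for functions. -/
def normX (k : ℕ) (w : Phase d → ℝ) : ℝ := (eLpNorm w 2 (weightMeasure d k)).toReal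

/-- `w ∈ H^n_k = H^n_x ⊗ X_k^v`: the weak `x`-derivatives of order at most `n` are in `X_k`. -/
def MemH (n k : ℕ) (w : Phase d → ℝ) : Prop := MemSob (ex (d := d)) (weightMeasure d k) n w

/-- The norm of `H^n_k`. -/
def normH (n k : ℕ) (w : Phase d → ℝ) : ℝ := sobNorm (ex (d := d)) (weightMeasure d k) n w

/-! ### The operators of the Wigner-BGK equation -/

/-- Unitary Fourier transform `v → η`. -/
def fourierV (f : E d → ℂ) (η : E d) : ℂ :=
  (((2 * Real.pi) ^ (-(d : ℝ) / 2) : ℝ) : ℂ) *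
    ∫ v, Complex.exp (-(Complex.I * ((inner ℝ v η : ℝ) : ℂ))) * f v

/-- Inverse unitary Fourier transform `η → v`. -/
def invFourierV (g : E d → ℂ) (v : E d) : ℂ :=
  (((2 * Real.pi) ^ (-(d : ℝ) / 2) : ℝ) : ℂ) *
    ∫ η, Complex.exp (Complex.I * ((inner ℝ v η : ℝ) : ℂ)) * g η

/-- `δV(x, η) = (V(x + ħη/(2m)) - V(x - ħη/(2m))) / ħ`. -/
def deltaV (c : Constants) (V : E d → ℝ) (x η : E d) : ℝ :=
  (V (x + (c.hbar / (2 * c.m)) • η) - V (x - (c.hbar / (2 * c.m)) • η)) / c.hbar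

/-- The pseudo-differential operator `Θ[V] w = 𝓕⁻¹ (i δV 𝓕 w)`. The value is real because `δV` is
odd in `η` and `w` is real. -/
def theta (c : Constants) (V : E d → ℝ) (w : Phase d → ℝ) (z : Phase d) : ℝ :=
  (invFourierV (fun η => Complex.I * ((deltaV c V z.1 η : ℝ) : ℂ) *
    fourierV (fun v => ((w (z.1, v) : ℝ) : ℂ)) η) z.2).re

/-- The position density `n[w](x) = ∫ w(x, v) dv`. -/
def density (w : Phase d → ℝ) (x : E d) : ℝ := ∫ v, w (x, v)

/-- The normalized Maxwellian `F`. -/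
def maxwellian (c : Constants) (v : E d) : ℝ :=
  (c.beta * c.m / (2 * Real.pi)) ^ ((d : ℝ) / 2) * Real.exp (-(c.beta * c.m * ‖v‖ ^ 2 / 2))

/-- The second derivative `∂²V / ∂x_r ∂x_s`. -/
def hess (V : E d → ℝ) (r s : Fin d) : E d → ℝ := weakDeriv ![e r, e s] V

/-- The operator `Ω`. -/
def omega (c : Constants) (V : E d → ℝ) (w : Phase d → ℝ) (z : Phase d) : ℝ :=
  c.nu * maxwellian c z.2 *
    (1 + c.hbar ^ 2 * (c.beta ^ 2 / 24) *
      (-(1 / c.m) * ∑ r, hess V r r z.1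
        + c.beta * ∑ r, ∑ s, z.2 r * z.2 s * hess V r s z.1)) * density w z.1

/-- The operator `𝒜 + 𝒞`, where `𝒜 w = Θ[V] w` and `𝒞 w = -(ν w - Ω w)`. -/
def AC (c : Constants) (V : E d → ℝ) (w : Phase d → ℝ) (z : Phase d) : ℝ :=
  theta c V w z - (c.nu * w z - omega c V w z)

/-- The function `M(x, v)` which spans the kernel of `𝒜 + 𝒞` for fixed `x`:
`M = ν 𝓕⁻¹ ( 𝓕F / (ν - i δV) (1 - βħ²/(24 m²) ∑ η_r η_s ∂²V/∂x_r∂x_s) )`. The value is real because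
the function inside takes complex conjugate values at `η` and `-η`. -/
def kerM (c : Constants) (V : E d → ℝ) (z : Phase d) : ℝ :=
  ((c.nu : ℂ) * invFourierV (fun η =>
    fourierV (fun v => ((maxwellian c v : ℝ) : ℂ)) η /
        ((c.nu : ℂ) - Complex.I * ((deltaV c V z.1 η : ℝ) : ℂ)) *
      ((1 - c.beta * c.hbar ^ 2 / (24 * c.m ^ 2) *
        ∑ r, ∑ s, η r * η s * hess V r s z.1 : ℝ) : ℂ)) z.2).re

/-- The projection `𝒫 w = M ∫ w dv`. -/
def projP (c : Constants) (V : E d → ℝ) (w : Phase d → ℝ) (z : Phase d) : ℝ :=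
  kerM c V z * density w z.1

/-- The projection `𝒬 = I - 𝒫`. -/
def projQ (c : Constants) (V : E d → ℝ) (w : Phase d → ℝ) (z : Phase d) : ℝ :=
  w z - projP c V w z

/-- The operator `𝒬(𝒜 + 𝒞)𝒬`. -/
def QACQ (c : Constants) (V : E d → ℝ) (w : Phase d → ℝ) : Phase d → ℝ :=
  projQ c V (AC c V (projQ c V w))

/-- `w ∈ D(S)` and `S w = g` in `X_k`, where `S w = -v·∇ₓ w` in the sense of distributions. -/
def IsStreaming {k : ℕ} (w g : X d k) : Prop :=
  ∀ φ : Phase d → ℝ, ContDiff ℝ ∞ φ → HasCompactSupport φ →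
    ∫ z, w z * fderiv ℝ φ z (z.2, 0) = ∫ z, g z * φ z

/-- `w` is in the domain of the operator `𝒬 S 𝒬`, resp. `𝒫 S 𝒬`, `𝒬 S 𝒫`, in `X_k` and is mapped
to `g`; here `L` and `R` are the outer and the inner projection. -/
def IsSandwichS (k : ℕ) (L R : (Phase d → ℝ) → Phase d → ℝ) (w g : Phase d → ℝ) : Prop :=
  ∃ q s : X d k, q =ᵐ[volume] R w ∧ IsStreaming q s ∧ g =ᵐ[volume] L s

/-- `w ∈ (X_k)^0`: the velocity mean of `w` vanishes. -/
def MeanZero {k : ℕ} (w : X d k) : Prop := density w =ᵐ[volume] 0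

/-- The functions `ψ₀`, `φ₁`, `ψ₁` of the fast time `τ ∈ [0, ∞)` with values in `X_k` are
(classical) solutions of the equations of the initial layer, with initial datum `w₀`:
`ψ₀' = 𝒬(𝒜+𝒞)𝒬 ψ₀`, `ψ₀(0) = 𝒬 w₀`; `φ₁' = 𝒫S𝒬 ψ₀`, `φ₁(τ) → 0` as `τ → ∞`;
`ψ₁' = 𝒬(𝒜+𝒞)𝒬 ψ₁ + 𝒬S𝒬 ψ₀`, `ψ₁(0) = [𝒬(𝒜+𝒞)𝒬]⁻¹ 𝒬S𝒫 (𝒫 w₀)`, the inverse being taken on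
`(X_k)^0`. The `ψ`'s take values in `(X_k)^0` and `φ₁` in the range of `𝒫`. -/
structure IsInitialLayer (c : Constants) (V : E d → ℝ) (k : ℕ) (w₀ : Phase d → ℝ)
    (ψ₀ φ₁ ψ₁ : ℝ → X d k) : Prop where
  psi0_c1 : ContDiffOn ℝ 1 ψ₀ (Ici 0)
  psi0_mem : ∀ τ, 0 ≤ τ → MeanZero (ψ₀ τ)
  psi0_eq : ∀ τ, 0 ≤ τ → (derivWithin ψ₀ (Ici 0) τ : X d k) =ᵐ[volume] QACQ c V (ψ₀ τ)
  psi0_init : ψ₀ 0 =ᵐ[volume] projQ c V w₀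
  phi1_c1 : ContDiffOn ℝ 1 φ₁ (Ici 0)
  phi1_mem : ∀ τ, 0 ≤ τ → projP c V (φ₁ τ) =ᵐ[volume] φ₁ τ
  phi1_eq : ∀ τ, 0 ≤ τ →
    IsSandwichS k (projP c V) (projQ c V) (ψ₀ τ) (derivWithin φ₁ (Ici 0) τ : X d k)
  phi1_lim : Tendsto φ₁ atTop (𝓝 0)
  psi1_c1 : ContDiffOn ℝ 1 ψ₁ (Ici 0)
  psi1_mem : ∀ τ, 0 ≤ τ → MeanZero (ψ₁ τ)
  psi1_eq : ∀ τ, 0 ≤ τ → ∃ g : Phase d → ℝ,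
    IsSandwichS k (projQ c V) (projQ c V) (ψ₀ τ) g ∧
      (derivWithin ψ₁ (Ici 0) τ : X d k) =ᵐ[volume] QACQ c V (ψ₁ τ) + g
  psi1_init : IsSandwichS k (projQ c V) (projP c V) (projP c V w₀) (QACQ c V (ψ₁ 0))

end WignerBGK

end

/-! On $(X_k)^0$ both $\mathcal P$ and $\Omega$ vanish, so $\mathcal Q(\mathcal A+\mathcal
C)\mathcal Q$ acts there as the bounded operator $T=\Theta[V]-\nu$. The theorem rests on one
estimate: $e^{tT}$ decays in $X_k$ at any prescribed rate below $\nu$, with a constant depending on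
$V$ only through its Sobolev bound.

On almost every fibre $\Theta[V]$ is a convolution in $v$ whose kernel is a rescaled Fourier
transform of $V$ times a phase (`integral_kerK_exp`, `theta_ae_eq_convTheta`), and Sobolev
regularity of $V$ becomes a polynomial weight on the kernel (`exists_isPotential`). The kernel is
odd in the shift, so $\Theta[V]$ is skew-symmetric in $L^2$, and in a weighted space only the
commutator with the weight survives. With the equivalent weight $1+(\varepsilon|v|)^{2k}$ this
commutator contributes $O(\sqrt\varepsilon)$ to the quadratic form (`lintegral_commutator_le`,
`theta_form_le`). A small $\varepsilon$ therefore makes $T$ dissipative with any rate $\gamma<\nu$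
(`exists_dissipative`), and dissipativity yields both the decay of $e^{tT}$ and the inverse
$T^{-1}$.

The projection is $\mathcal P=-T^{-1}\Omega$: the Fourier transform in $v$ turns
$(\nu-\Theta)p=\Omega w$ into a division by $\nu-i\,\delta V$, whose modulus is at least $\nu$, and
the result is the explicit formula for $M$ (`fourierV_correction`, `kerMOf_mul_density_ae_eq`). All
projection identities then follow from $TP=-\Omega$, $\Omega T=-\nu\Omega$, $\Omega^2=\nu\Omega$
(`IsCollision`).

The streaming operator is unbounded, so $\psi_0$ has to be followed inside its domain. This is done
on the space `SobX` of functions in $X_{k+1}$ with one weak $x$-derivative there, from which $S$ is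
bounded into $X_k$. The derivative of a convolution is the convolution of the derivative plus a
bounded term, so the evolution of $(w,\nabla_xw)$ is triangular and keeps the decay rate up to an
arbitrarily small loss (`Dissipative.triangular`, `exists_sob_dissipative`). The initial datum
$\mathcal Qw_0$ also has to lie in this space. That reduces to $\Omega$ preserving one
$x$-derivative, where third derivatives of $V$ multiply a density; they are not bounded but have
enough regularity for the product estimate `lintegral_product_sq_le`.

The layer itself is then linear algebra (`exists_layer`). With $D$ the generator on `SobX` and
$y(t)=e^{tD}y(0)$ the lift of $\psi_0$, the decaying primitive of $\mathcal PS\psi_0$ is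
$\varphi_1=\mathcal PSD^{-1}y$, and $(y,\psi_1)$ solves a triangular system whose dissipativity
replaces the Duhamel estimate. Uniqueness is uniqueness for linear equations with bounded generator
(`IsInitialLayer.unique`). -/

noncomputable section

namespace WignerBGK

section

/-! ### Exponentially stable bounded generators -/

section Semigroup

variable {H H₁ H₂ : Type*} [NormedAddCommGroup H] [NormedSpace ℝ H]
  [NormedAddCommGroup H₁] [NormedSpace ℝ H₁] [NormedAddCommGroup H₂] [NormedSpace ℝ H₂]

/-- `T` is dissipative with rate `γ` with respect to an inner product which is equivalent to the
norm, with lower constant `c` and upper constant `C`. -/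
def Dissipative (c C γ : ℝ) (T : H →L[ℝ] H) : Prop :=
  ∃ B : H →L[ℝ] H →L[ℝ] ℝ, (∀ x y, B x y = B y x) ∧ (∀ x, c * ‖x‖ ^ 2 ≤ B x x) ∧
    (∀ x y, |B x y| ≤ C * ‖x‖ * ‖y‖) ∧ ∀ x, B (T x) x ≤ -γ * B x x

theorem hasDerivAt_exp_apply [CompleteSpace H] (T : H →L[ℝ] H) (x : H) (t : ℝ) :
    HasDerivAt (fun t : ℝ => NormedSpace.exp (t • T) x) (T (NormedSpace.exp (t • T) x)) t := by
  have h := hasDerivAt_exp_smul_const' (𝕂 := ℝ) T t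
  have h2 := (ContinuousLinearMap.apply ℝ H x).hasFDerivAt.comp_hasDerivAt t h
  exact h2

/-- Along $u'=Tu$ the quantity $e^{2\gamma t}B(u,u)$ is nonincreasing. The factor $\sqrt{C/c}$ only
pays for passing between $B$ and the norm. -/
theorem Dissipative.norm_exp_le [CompleteSpace H] {c C γ : ℝ} {T : H →L[ℝ] H}
    (h : Dissipative c C γ T) (hc : 0 < c) {t : ℝ} (ht : 0 ≤ t) (x : H) :
    ‖NormedSpace.exp (t • T) x‖ ≤ Real.sqrt (C / c) * Real.exp (-γ * t) * ‖x‖ := by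
  obtain ⟨B, hs, hl, hu, hd⟩ := h
  set u : ℝ → H := fun t => NormedSpace.exp (t • T) x with hu_def
  have hder : ∀ t, HasDerivAt u (T (u t)) t := hasDerivAt_exp_apply T x
  set f : ℝ → ℝ := fun t => Real.exp (2 * γ * t) * B (u t) (u t) with hf
  have hfd : ∀ t, HasDerivAt f (Real.exp (2 * γ * t) * (2 * γ) * B (u t) (u t) +
      Real.exp (2 * γ * t) * (B (u t) (T (u t)) + B (T (u t)) (u t))) t := by
    intro t
    have h1 : HasDerivAt (fun t : ℝ => Real.exp (2 * γ * t)) (Real.exp (2 * γ * t) * (2 * γ)) t := by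
      simpa using ((hasDerivAt_id t).const_mul (2 * γ)).exp
    have h2 := B.hasFDerivAt_of_bilinear (hder t).hasFDerivAt (hder t).hasFDerivAt
    have h3 := h2.hasDerivAt
    have h4 := h1.mul h3
    convert! h4 using 1
    simp
  have hanti : Antitone f := by
    refine antitone_of_deriv_nonpos (fun t => (hfd t).differentiableAt) fun t => ?_
    rw [(hfd t).deriv, hs (u t) (T (u t))]
    have := hd (u t)
    have he := Real.exp_pos (2 * γ * t)
    nlinarith
  have h0 : u 0 = x := by simp [hu_def, NormedSpace.exp_zero]
  have hft : f t ≤ f 0 := hanti ht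
  simp only [hf, mul_zero, Real.exp_zero, one_mul, h0] at hft
  have hx := hu x x
  have hBx : B x x ≤ C * ‖x‖ ^ 2 := by
    have := le_abs_self (B x x); nlinarith
  have hlt := hl (u t)
  have he := Real.exp_pos (2 * γ * t)
  have key : ‖u t‖ ^ 2 ≤ C / c * (Real.exp (-γ * t)) ^ 2 * ‖x‖ ^ 2 := by
    have e1 : Real.exp (-γ * t) ^ 2 = (Real.exp (2 * γ * t))⁻¹ := by
      rw [← Real.exp_neg, ← Real.exp_nat_mul]; congr 1; push_cast; ring
    rw [e1]
    have h5 : Real.exp (2 * γ * t) * (c * ‖u t‖ ^ 2) ≤ C * ‖x‖ ^ 2 := by nlinarith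
    have : C / c * (Real.exp (2 * γ * t))⁻¹ * ‖x‖ ^ 2
        = (C * ‖x‖ ^ 2) / (Real.exp (2 * γ * t) * c) := by field_simp
    rw [this, le_div_iff₀ (by positivity)]
    nlinarith
  -- For $C<0$ the two-sided bound on $B(x,x)$ forces $x=0$; both sides of the claim then vanish.
  by_cases hC : 0 ≤ C
  · have : C / c = Real.sqrt (C / c) ^ 2 := (Real.sq_sqrt (by positivity)).symm
    rw [this, ← mul_pow, ← mul_pow] at key
    exact le_of_sq_le_sq key (by positivity)
  · have hx0 : ‖x‖ ^ 2 ≤ 0 := by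
      by_contra hcon
      push Not at hcon
      have := hl x
      nlinarith
    have h7 : C / c * Real.exp (-γ * t) ^ 2 * ‖x‖ ^ 2 ≤ 0 := by
      have : ‖x‖ ^ 2 = 0 := le_antisymm hx0 (by positivity)
      simp [this]
    have h8 : ‖u t‖ = 0 := by
      have : ‖u t‖ ^ 2 = 0 := le_antisymm (key.trans h7) (by positivity)
      simpa using this
    change ‖u t‖ ≤ _
    rw [h8]; positivity

/-- Integrate $\frac{d}{ds}e^{sT}=Te^{sT}=e^{sT}T$ over $[0,t]$. Both orders of multiplication are
kept because a two-sided inverse of $T$ is extracted from them. -/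
theorem exp_sub_one_eq [CompleteSpace H] (T : H →L[ℝ] H) (t : ℝ) :
    ∃ G : H →L[ℝ] H, NormedSpace.exp (t • T) - 1 = T * G ∧ NormedSpace.exp (t • T) - 1 = G * T := by
  have hcont : Continuous fun s : ℝ => NormedSpace.exp (s • T) :=
    continuous_iff_continuousAt.2 fun s => (hasDerivAt_exp_smul_const (𝕂 := ℝ) T s).continuousAt
  refine ⟨∫ s in (0 : ℝ)..t, NormedSpace.exp (s • T), ?_, ?_⟩
  · have h := intervalIntegral.integral_eq_sub_of_hasDerivAt
      (fun s _ => hasDerivAt_exp_smul_const' (𝕂 := ℝ) T s)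
      ((continuous_const.mul hcont).intervalIntegrable 0 t)
    rw [zero_smul, NormedSpace.exp_zero] at h
    rw [← h]
    exact (ContinuousLinearMap.mul ℝ (H →L[ℝ] H) T).intervalIntegral_comp_comm
      (hcont.intervalIntegrable 0 t)
  · have h := intervalIntegral.integral_eq_sub_of_hasDerivAt
      (fun s _ => hasDerivAt_exp_smul_const (𝕂 := ℝ) T s)
      ((hcont.mul continuous_const).intervalIntegrable 0 t)
    rw [zero_smul, NormedSpace.exp_zero] at h
    rw [← h]
    exact ((ContinuousLinearMap.mul ℝ (H →L[ℝ] H)).flip T).intervalIntegral_comp_comm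
      (hcont.intervalIntegrable 0 t)

/-- For large $t$ the norm of $e^{tT}$ is below $1$, so $1-e^{tT}$ is invertible by a Neumann
series, and it factors through $T$ on either side. This works in every Banach space, in particular
on products with the sup norm. The bound comes from testing $Ty=x$ with $y$ in the form $B$. -/
theorem Dissipative.exists_inverse [CompleteSpace H] {c C γ : ℝ} {T : H →L[ℝ] H}
    (h : Dissipative c C γ T) (hc : 0 < c) (hγ : 0 < γ) :
    ∃ S : H →L[ℝ] H, (∀ x, T (S x) = x) ∧ (∀ x, S (T x) = x) ∧
      ∀ x, ‖S x‖ ≤ C / (c * γ) * ‖x‖ := by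
  obtain ⟨t, ht0, ht⟩ : ∃ t : ℝ, 0 ≤ t ∧ Real.sqrt (C / c) * Real.exp (-γ * t) < 1 := by
    have h1 : Tendsto (fun t : ℝ => Real.sqrt (C / c) * Real.exp (-γ * t)) atTop (𝓝 0) := by
      have : Tendsto (fun t : ℝ => Real.exp (-γ * t)) atTop (𝓝 0) :=
        Real.tendsto_exp_atBot.comp (tendsto_id.const_mul_atTop_of_neg (neg_lt_zero.2 hγ))
      simpa using this.const_mul (Real.sqrt (C / c))
    obtain ⟨t, h2, h3⟩ := ((h1.eventually (gt_mem_nhds one_pos)).and (eventually_ge_atTop 0)).exists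
    exact ⟨t, h3, h2⟩
  have hn : ‖NormedSpace.exp (t • T)‖ < 1 :=
    (ContinuousLinearMap.opNorm_le_bound _ (by positivity) (fun x => h.norm_exp_le hc ht0 x)).trans_lt
      ht
  obtain ⟨G, hG1, hG2⟩ := exp_sub_one_eq T t
  obtain ⟨U, hU⟩ := isUnit_one_sub_of_norm_lt_one hn
  have e1 : T * G = -(U : H →L[ℝ] H) := by rw [← hG1, hU]; abel
  have e2 : G * T = -(U : H →L[ℝ] H) := by rw [← hG2, hU]; abel
  have r1 : T * (G * -(↑U⁻¹ : H →L[ℝ] H)) = 1 := by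
    rw [← mul_assoc, e1]; simp
  have r2 : (-(↑U⁻¹ : H →L[ℝ] H) * G) * T = 1 := by
    rw [mul_assoc, e2]; simp
  have r3 : -(↑U⁻¹ : H →L[ℝ] H) * G = G * -(↑U⁻¹ : H →L[ℝ] H) := left_inv_eq_right_inv r2 r1
  have hTS : ∀ x, T ((G * -(↑U⁻¹ : H →L[ℝ] H)) x) = x := fun x => by
    simpa using congrArg (fun f : H →L[ℝ] H => f x) r1
  refine ⟨G * -(↑U⁻¹ : H →L[ℝ] H), hTS, fun x => ?_, fun x => ?_⟩
  · rw [r3] at r2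
    simpa using congrArg (fun f : H →L[ℝ] H => f x) r2
  · set y := (G * -(↑U⁻¹ : H →L[ℝ] H)) x with hy
    have hTy : T y = x := hTS x
    obtain ⟨B, hs, hl, hu, hd⟩ := h
    have h1 := hd y
    have h2 := hl y
    have h3 := (neg_le_abs _).trans (hu (T y) y)
    rw [hTy] at h1 h3
    rw [div_mul_eq_mul_div, le_div_iff₀ (by positivity)]
    -- The sign of $C$ is not assumed. For $y=0$ the claim is $0\le C\|x\|$, which follows from
    -- $c\|x\|^2\le B(x,x)\le C\|x\|^2$.
    rcases (norm_nonneg y).eq_or_lt with h0 | h0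
    · rw [← h0, zero_mul]
      by_contra hcon
      push Not at hcon
      have hx : 0 < ‖x‖ := by
        rcases (norm_nonneg x).eq_or_lt with h5 | h5
        · rw [← h5] at hcon; simp at hcon
        · exact h5
      have := hl x
      have h6 := (le_abs_self _).trans (hu x x)
      have : 0 < c * ‖x‖ ^ 2 := by positivity
      nlinarith
    · have : γ * (c * ‖y‖ ^ 2) ≤ C * ‖x‖ * ‖y‖ := by nlinarith
      have h4 : (‖y‖ * (c * γ)) * ‖y‖ ≤ (C * ‖x‖) * ‖y‖ := by nlinarith
      exact le_of_mul_le_mul_right h4 h0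

/-- Linear equations with bounded generator have at most one solution on `[0, ∞)`. -/
theorem eqOn_of_linear_ode (T : H →L[ℝ] H) {f g r : ℝ → H}
    (hf : ∀ t, 0 ≤ t → HasDerivWithinAt f (T (f t) + r t) (Ici 0) t)
    (hg : ∀ t, 0 ≤ t → HasDerivWithinAt g (T (g t) + r t) (Ici 0) t) (h0 : f 0 = g 0) :
    EqOn f g (Ici 0) := by
  intro t ht
  have ht' : (0 : ℝ) ≤ t := ht
  have hmain : EqOn f g (Icc 0 t) := by
    refine ODE_solution_unique_of_mem_Icc_right (v := fun t x => T x + r t) (s := fun _ => univ)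
      (K := ‖T‖₊) (fun s _ => ?_) ?_ ?_ (fun _ _ => mem_univ _) ?_ ?_ (fun _ _ => mem_univ _) h0
    · refine LipschitzWith.lipschitzOnWith ?_
      refine LipschitzWith.of_dist_le_mul fun x y => ?_
      rw [dist_add_right, dist_eq_norm, dist_eq_norm, ← map_sub]
      exact T.le_opNorm _
    · exact fun s hs => ((hf s hs.1).continuousWithinAt).mono Icc_subset_Ici_self
    · exact fun s hs => (hf s hs.1).mono (Ici_subset_Ici.2 hs.1)
    · exact fun s hs => ((hg s hs.1).continuousWithinAt).mono Icc_subset_Ici_self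
    · exact fun s hs => (hg s hs.1).mono (Ici_subset_Ici.2 hs.1)
  exact hmain ⟨ht', le_rfl⟩

/-- The form is the sum of the forms of the components. The norm on the product is the sup norm, so
the upper bound picks up the number of components, while the lower bound only needs the component
where the supremum is attained. -/
theorem Dissipative.pi {ι : Type*} [Fintype ι] {c C γ : ℝ} {T : H →L[ℝ] H}
    (h : Dissipative c C γ T) (hC : 0 ≤ C) (hc : 0 ≤ c) :
    Dissipative c (Fintype.card ι * C) γ
      (ContinuousLinearMap.pi fun i : ι => T.comp (ContinuousLinearMap.proj i)) := by
  obtain ⟨B, hs, hl, hu, hd⟩ := h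
  have e : ∀ x y : ι → H, (∑ i : ι, B.bilinearComp (ContinuousLinearMap.proj i)
      (ContinuousLinearMap.proj i)) x y = ∑ i, B (x i) (y i) := by
    intro x y; simp
  have hpos : ∀ x, 0 ≤ B x x := fun x => (by positivity : 0 ≤ c * ‖x‖ ^ 2).trans (hl x)
  refine ⟨∑ i : ι, B.bilinearComp (ContinuousLinearMap.proj i) (ContinuousLinearMap.proj i),
    ?_, ?_, ?_, ?_⟩
  · intro x y; rw [e, e]; exact Finset.sum_congr rfl fun i _ => hs _ _
  · intro x
    rw [e]
    rcases isEmpty_or_nonempty ι with h | h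
    · have : x = 0 := Subsingleton.elim _ _
      simp [this]
    · obtain ⟨i, hi⟩ : ∃ i, ‖x‖ = ‖x i‖ := by
        obtain ⟨i, -, hi⟩ := Finset.exists_mem_eq_sup' (Finset.univ_nonempty (α := ι))
          (fun i => ‖x i‖)
        refine ⟨i, le_antisymm ?_ (norm_le_pi_norm x i)⟩
        rw [← hi]
        exact (pi_norm_le_iff_of_nonneg ((norm_nonneg (x i)).trans
          (Finset.le_sup' (fun i => ‖x i‖) (Finset.mem_univ i)))).2
          fun j => Finset.le_sup' (fun i => ‖x i‖) (Finset.mem_univ j)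
      rw [hi]
      exact (hl _).trans (Finset.single_le_sum (f := fun i => B (x i) (x i))
        (fun i _ => hpos _) (Finset.mem_univ i))
  · intro x y
    rw [e]
    refine (Finset.abs_sum_le_sum_abs _ _).trans ?_
    refine (Finset.sum_le_card_nsmul _ _ (C * ‖x‖ * ‖y‖) fun i _ => (hu _ _).trans ?_).trans ?_
    · have := norm_le_pi_norm x i
      have := norm_le_pi_norm y i
      gcongr
    · simp [mul_assoc]
  · intro x
    rw [e, e, Finset.mul_sum]
    exact Finset.sum_le_sum fun i _ => hd _

/-- The operator `(x, y) ↦ (T₁ x, T₂ y + K x)`. -/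
def triangular (T₁ : H₁ →L[ℝ] H₁) (T₂ : H₂ →L[ℝ] H₂) (K : H₁ →L[ℝ] H₂) :
    (H₁ × H₂) →L[ℝ] (H₁ × H₂) :=
  (T₁.comp (ContinuousLinearMap.fst ℝ H₁ H₂)).prod
    (T₂.comp (ContinuousLinearMap.snd ℝ H₁ H₂) + K.comp (ContinuousLinearMap.fst ℝ H₁ H₂))

theorem triangular_apply (T₁ : H₁ →L[ℝ] H₁) (T₂ : H₂ →L[ℝ] H₂) (K : H₁ →L[ℝ] H₂) (z : H₁ × H₂) :
    triangular T₁ T₂ K z = (T₁ z.1, T₂ z.2 + K z.1) := rfl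

/-- In the form $L\,B_1+B_2$ the coupling term $B_2(Kx,y)$ is absorbed by Young's inequality, using
the surplus $\gamma-\gamma'$ of the rate. The new constants depend only on the old ones and on
$\kappa$, not on the operators, and this keeps the final estimates uniform in the potential. -/
theorem Dissipative.triangular {c₁ C₁ c₂ C₂ κ γ γ' : ℝ} (hc₁ : 0 < c₁) (hc₂ : 0 < c₂)
    (hC₁ : 0 ≤ C₁) (hC₂ : 0 ≤ C₂) (hγ : γ' < γ) :
    ∃ c C : ℝ, 0 < c ∧ 0 ≤ C ∧ ∀ (T₁ : H₁ →L[ℝ] H₁) (T₂ : H₂ →L[ℝ] H₂) (K : H₁ →L[ℝ] H₂),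
      Dissipative c₁ C₁ γ T₁ → Dissipative c₂ C₂ γ T₂ → ‖K‖ ≤ κ →
      Dissipative c C γ' (WignerBGK.triangular T₁ T₂ K) := by
  set δ := γ - γ' with hδ
  have hδ0 : 0 < δ := sub_pos.2 hγ
  -- Chosen so that $L\delta c_1s^2-C_2\kappa\,st+\delta c_2t^2$ has nonpositive discriminant, which
  -- is `hLδ`.
  set L : ℝ := 1 + (C₂ * κ) ^ 2 / (4 * δ ^ 2 * c₁ * c₂) with hL
  have hL0 : 0 < L := by positivity
  have hLδ : (C₂ * κ) ^ 2 ≤ 4 * (L * δ * c₁) * (δ * c₂) := by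
    have : (C₂ * κ) ^ 2 / (4 * δ ^ 2 * c₁ * c₂) ≤ L := by rw [hL]; linarith
    rw [div_le_iff₀ (by positivity)] at this
    nlinarith
  refine ⟨min (L * c₁) c₂, L * C₁ + C₂, by positivity, by positivity, ?_⟩
  rintro T₁ T₂ K ⟨B₁, s₁, l₁, u₁, d₁⟩ ⟨B₂, s₂, l₂, u₂, d₂⟩ hK
  refine ⟨L • B₁.bilinearComp (ContinuousLinearMap.fst ℝ H₁ H₂) (ContinuousLinearMap.fst ℝ H₁ H₂) +
    B₂.bilinearComp (ContinuousLinearMap.snd ℝ H₁ H₂) (ContinuousLinearMap.snd ℝ H₁ H₂),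
    ?_, ?_, ?_, ?_⟩
  · intro x y; simp [s₁ x.1, s₂ x.2]
  · intro x
    simp only [_root_.add_apply, _root_.smul_apply,
      ContinuousLinearMap.bilinearComp_apply, ContinuousLinearMap.coe_fst',
      ContinuousLinearMap.coe_snd', smul_eq_mul]
    have h1 := l₁ x.1
    have h2 := l₂ x.2
    have m1 : min (L * c₁) c₂ ≤ L * c₁ := min_le_left _ _
    have m2 : min (L * c₁) c₂ ≤ c₂ := min_le_right _ _
    have p1 : 0 ≤ L * (c₁ * ‖x.1‖ ^ 2) := by positivity
    have p2 : 0 ≤ c₂ * ‖x.2‖ ^ 2 := by positivity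
    have h3 : L * (c₁ * ‖x.1‖ ^ 2) ≤ L * B₁ x.1 x.1 := by gcongr
    rw [Prod.norm_def]
    rcases max_choice ‖x.1‖ ‖x.2‖ with h | h <;> rw [h]
    · have : min (L * c₁) c₂ * ‖x.1‖ ^ 2 ≤ L * c₁ * ‖x.1‖ ^ 2 := by gcongr
      linarith
    · have : min (L * c₁) c₂ * ‖x.2‖ ^ 2 ≤ c₂ * ‖x.2‖ ^ 2 := by gcongr
      linarith
  · intro x y
    simp only [_root_.add_apply, _root_.smul_apply,
      ContinuousLinearMap.bilinearComp_apply, ContinuousLinearMap.coe_fst',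
      ContinuousLinearMap.coe_snd', smul_eq_mul]
    refine (abs_add_le _ _).trans ?_
    rw [abs_mul, abs_of_pos hL0]
    have h1 := u₁ x.1 y.1
    have h2 := u₂ x.2 y.2
    have a1 : C₁ * ‖x.1‖ * ‖y.1‖ ≤ C₁ * ‖x‖ * ‖y‖ := by
      gcongr <;> simp [Prod.norm_def]
    have a2 : C₂ * ‖x.2‖ * ‖y.2‖ ≤ C₂ * ‖x‖ * ‖y‖ := by
      gcongr <;> simp [Prod.norm_def]
    nlinarith
  · intro x
    simp only [_root_.add_apply, _root_.smul_apply,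
      ContinuousLinearMap.bilinearComp_apply, ContinuousLinearMap.coe_fst',
      ContinuousLinearMap.coe_snd', smul_eq_mul, triangular_apply, map_add]
    have h1 := d₁ x.1
    have h2 := d₂ x.2
    have h3 : B₂ (K x.1) x.2 ≤ C₂ * κ * ‖x.1‖ * ‖x.2‖ := by
      refine ((le_abs_self _).trans (u₂ _ _)).trans ?_
      have : ‖K x.1‖ ≤ κ * ‖x.1‖ := (K.le_opNorm _).trans (by gcongr)
      calc C₂ * ‖K x.1‖ * ‖x.2‖ ≤ C₂ * (κ * ‖x.1‖) * ‖x.2‖ := by gcongr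
        _ = _ := by ring
    have h4 : C₂ * κ * ‖x.1‖ * ‖x.2‖ ≤ L * δ * c₁ * ‖x.1‖ ^ 2 + δ * c₂ * ‖x.2‖ ^ 2 := by
      set a := L * δ * c₁ with ha
      set b := δ * c₂ with hb
      have ha0 : 0 < a := by positivity
      have hsq : 0 ≤ (2 * a * ‖x.1‖ - C₂ * κ * ‖x.2‖) ^ 2 := sq_nonneg _
      have h5 : (C₂ * κ) ^ 2 * ‖x.2‖ ^ 2 ≤ 4 * a * b * ‖x.2‖ ^ 2 := by gcongr
      have h6 : 4 * a * (C₂ * κ * ‖x.1‖ * ‖x.2‖) ≤ 4 * a * (a * ‖x.1‖ ^ 2 + b * ‖x.2‖ ^ 2) := by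
        nlinarith
      exact le_of_mul_le_mul_left h6 (by positivity)
    have h5 : L * δ * (c₁ * ‖x.1‖ ^ 2) ≤ L * δ * B₁ x.1 x.1 := by gcongr; exact l₁ _
    have h6 : δ * (c₂ * ‖x.2‖ ^ 2) ≤ δ * B₂ x.2 x.2 := by gcongr; exact l₂ _
    have h7 : L * B₁ (T₁ x.1) x.1 ≤ L * (-γ * B₁ x.1 x.1) := by gcongr
    have h8 : γ' = γ - δ := by rw [hδ]; ring
    rw [h8]
    nlinarith

theorem Dissipative.restrict {c C γ : ℝ} {T : H →L[ℝ] H} (h : Dissipative c C γ T)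
    (D : Submodule ℝ H) (hD : ∀ x : D, T x ∈ D) :
    Dissipative c C γ ((T.comp D.subtypeL).codRestrict D hD) := by
  obtain ⟨B, hs, hl, hu, hd⟩ := h
  refine ⟨B.bilinearComp D.subtypeL D.subtypeL, ?_, ?_, ?_, ?_⟩
  · intro x y; simp [hs (x : H)]
  · intro x; simpa using hl (x : H)
  · intro x y; simpa using hu (x : H) (y : H)
  · intro x; exact hd (x : H)

end Semigroup

end

section

/-! ### Square-integrable functions and bounded operators given by pointwise formulas -/

section PointwiseOperators

variable {α β : Type*} [MeasurableSpace α] [MeasurableSpace β]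

theorem eLpNorm_two_sq {F : Type*} [NormedAddCommGroup F] (μ : Measure α) (w : α → F) :
    eLpNorm w 2 μ ^ 2 = ∫⁻ z, ‖w z‖ₑ ^ 2 ∂μ := by
  have := eLpNorm_nnreal_pow_eq_lintegral (μ := μ) (f := w) (p := 2) (by norm_num)
  simpa using this

theorem enorm_sq_eq_lintegral {μ : Measure α} (w : Lp ℝ 2 μ) :
    ‖w‖ₑ ^ 2 = ∫⁻ z, ‖w z‖ₑ ^ 2 ∂μ := by
  rw [← eLpNorm_two_sq, Lp.enorm_def]

theorem memLp_two_of_lintegral_lt_top {F : Type*} [NormedAddCommGroup F] {μ : Measure α}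
    {w : α → F} (hm : AEStronglyMeasurable w μ) (h : ∫⁻ z, ‖w z‖ₑ ^ 2 ∂μ < ⊤) : MemLp w 2 μ := by
  refine ⟨hm, ?_⟩
  rw [← eLpNorm_two_sq] at h
  by_contra hcon
  rw [not_lt, top_le_iff] at hcon
  rw [hcon] at h
  simp at h

theorem MemLp.lintegral_sq_lt_top {F : Type*} [NormedAddCommGroup F] {μ : Measure α}
    {w : α → F} (h : MemLp w 2 μ) : ∫⁻ z, ‖w z‖ₑ ^ 2 ∂μ < ⊤ := by
  rw [← eLpNorm_two_sq]; exact ENNReal.pow_lt_top h.2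

theorem eLpNorm_le_of_lintegral_sq_le {F G : Type*} [NormedAddCommGroup F] [NormedAddCommGroup G]
    {μ : Measure α} {ν : Measure β}
    {w : α → F} {u : β → G} {C : ℝ} (hC : 0 ≤ C)
    (h : ∫⁻ z, ‖u z‖ₑ ^ 2 ∂ν ≤ ENNReal.ofReal (C ^ 2) * ∫⁻ z, ‖w z‖ₑ ^ 2 ∂μ) :
    eLpNorm u 2 ν ≤ ENNReal.ofReal C * eLpNorm w 2 μ := by
  rw [← eLpNorm_two_sq, ← eLpNorm_two_sq, ENNReal.ofReal_pow hC, ← mul_pow] at h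
  exact (ENNReal.pow_right_strictMono two_ne_zero).le_iff_le.1 h

/-- A bounded operator between `L²` spaces which is given by a formula for functions. -/
theorem exists_clm_of_pointwise {μ : Measure α} {ν : Measure β} (f : (α → ℝ) → β → ℝ) {C : ℝ}
    (hC : 0 ≤ C)
    (hm : ∀ w, StronglyMeasurable w → MemLp w 2 μ → AEStronglyMeasurable (f w) ν)
    (hb : ∀ w, StronglyMeasurable w → MemLp w 2 μ →
      ∫⁻ z, ‖f w z‖ₑ ^ 2 ∂ν ≤ ENNReal.ofReal (C ^ 2) * ∫⁻ z, ‖w z‖ₑ ^ 2 ∂μ)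
    (hcongr : ∀ w w', w =ᵐ[μ] w' → f w =ᵐ[ν] f w')
    (hadd : ∀ w w', StronglyMeasurable w → MemLp w 2 μ → StronglyMeasurable w' → MemLp w' 2 μ →
      f (w + w') =ᵐ[ν] f w + f w')
    (hsmul : ∀ (r : ℝ) w, StronglyMeasurable w → MemLp w 2 μ → f (r • w) =ᵐ[ν] r • f w) :
    ∃ T : Lp ℝ 2 μ →L[ℝ] Lp ℝ 2 ν, ‖T‖ ≤ C ∧ ∀ w : Lp ℝ 2 μ, T w =ᵐ[ν] f w := by
  have hle : ∀ w : Lp ℝ 2 μ, eLpNorm (f w) 2 ν ≤ ENNReal.ofReal C * eLpNorm w 2 μ := fun w =>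
    eLpNorm_le_of_lintegral_sq_le hC (hb w (Lp.stronglyMeasurable w) (Lp.memLp w))
  have hL : ∀ w : Lp ℝ 2 μ, MemLp (f w) 2 ν := fun w =>
    ⟨hm w (Lp.stronglyMeasurable w) (Lp.memLp w),
      (hle w).trans_lt (ENNReal.mul_lt_top ENNReal.ofReal_lt_top (Lp.memLp w).2)⟩
  let T₀ : Lp ℝ 2 μ →ₗ[ℝ] Lp ℝ 2 ν :=
    { toFun := fun w => (hL w).toLp
      map_add' := fun w w' => by
        rw [← MemLp.toLp_add, MemLp.toLp_eq_toLp_iff]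
        exact (hcongr _ _ (Lp.coeFn_add w w')).trans (hadd _ _ (Lp.stronglyMeasurable w)
          (Lp.memLp w) (Lp.stronglyMeasurable w') (Lp.memLp w'))
      map_smul' := fun r w => by
        rw [RingHom.id_apply, ← MemLp.toLp_const_smul, MemLp.toLp_eq_toLp_iff]
        exact (hcongr _ _ (Lp.coeFn_smul r w)).trans (hsmul r _ (Lp.stronglyMeasurable w)
          (Lp.memLp w)) }
  have hT : ∀ w, ‖T₀ w‖ ≤ C * ‖w‖ := fun w => by
    change ‖(hL w).toLp‖ ≤ _
    rw [Lp.norm_toLp, Lp.norm_def]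
    refine (ENNReal.toReal_mono (ENNReal.mul_ne_top ENNReal.ofReal_ne_top (Lp.memLp w).2.ne)
      (hle w)).trans ?_
    rw [ENNReal.toReal_mul, ENNReal.toReal_ofReal hC]
  exact ⟨T₀.mkContinuous C hT, LinearMap.mkContinuous_norm_le _ hC _,
    fun w => (hL w).coeFn_toLp⟩

end PointwiseOperators

/-! ### Young inequalities with polynomial weights -/

section Young

theorem lintegral_mul_sq_le {α : Type*} [MeasurableSpace α] {μ : Measure α}
    {f g : α → ENNReal} (hf : AEMeasurable f μ) (hg : AEMeasurable g μ) :
    (∫⁻ a, f a * g a ∂μ) ^ 2 ≤ (∫⁻ a, f a ^ 2 ∂μ) * ∫⁻ a, g a ^ 2 ∂μ := by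
  have h := ENNReal.lintegral_mul_le_Lp_mul_Lq μ Real.HolderConjugate.two_two hf hg
  calc (∫⁻ a, f a * g a ∂μ) ^ 2 ≤ ((∫⁻ a, f a ^ (2 : ℝ) ∂μ) ^ (1 / 2 : ℝ) *
        (∫⁻ a, g a ^ (2 : ℝ) ∂μ) ^ (1 / 2 : ℝ)) ^ 2 := by gcongr; exact h
    _ = _ := by
      rw [mul_pow, ← ENNReal.rpow_natCast, ← ENNReal.rpow_natCast, ← ENNReal.rpow_mul,
        ← ENNReal.rpow_mul]
      norm_num

theorem add_sq_le_two_mul (a b : ENNReal) : (a + b) ^ 2 ≤ 2 * (a ^ 2 + b ^ 2) := by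
  have := ENNReal.rpow_add_le_mul_rpow_add_rpow a b (p := 2) (by norm_num)
  norm_num at this
  exact this

/-- Cauchy-Schwarz with respect to the measure with density `f`. -/
theorem lintegral_mul_sq_le_weight {α : Type*} [MeasurableSpace α] {μ : Measure α}
    {f g : α → ENNReal} (hf : AEMeasurable f μ) (hg : AEMeasurable g μ) :
    (∫⁻ a, f a * g a ∂μ) ^ 2 ≤ (∫⁻ a, f a ∂μ) * ∫⁻ a, f a * g a ^ 2 ∂μ := by
  have hs : ∀ t : ENNReal, (t ^ (1 / 2 : ℝ)) ^ 2 = t := fun t => by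
    rw [← ENNReal.rpow_natCast, ← ENNReal.rpow_mul]; norm_num
  have hs' : ∀ t : ENNReal, t ^ (1 / 2 : ℝ) * t ^ (1 / 2 : ℝ) = t := fun t => by
    rw [← sq, hs]
  have h := lintegral_mul_sq_le (μ := μ) (f := fun a => f a ^ (1 / 2 : ℝ))
    (g := fun a => f a ^ (1 / 2 : ℝ) * g a) (hf.pow_const _) ((hf.pow_const _).mul hg)
  simpa only [← mul_assoc, hs', mul_pow, hs] using h

variable {G : Type*} [AddCommGroup G] [MeasurableSpace G] [MeasurableAdd₂ G]
  {μ : Measure G} [SFinite μ] [μ.IsAddLeftInvariant]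

/-- Young's inequality $L^1*L^2\to L^2$: Cauchy–Schwarz with respect to the density $f$, then
Tonelli and translation invariance. -/
theorem lintegral_conv_sq_le_left {f g : G → ENNReal} (hf : Measurable f) (hg : Measurable g) :
    ∫⁻ v, (∫⁻ y, f y * g (v + y) ∂μ) ^ 2 ∂μ ≤ (∫⁻ y, f y ∂μ) ^ 2 * ∫⁻ v, g v ^ 2 ∂μ := by
  calc ∫⁻ v, (∫⁻ y, f y * g (v + y) ∂μ) ^ 2 ∂μ
      ≤ ∫⁻ v, (∫⁻ y, f y ∂μ) * ∫⁻ y, f y * g (v + y) ^ 2 ∂μ ∂μ := by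
        refine lintegral_mono fun v => lintegral_mul_sq_le_weight hf.aemeasurable ?_
        exact (hg.comp (measurable_const_add v)).aemeasurable
    _ = (∫⁻ y, f y ∂μ) * ∫⁻ v, ∫⁻ y, f y * g (v + y) ^ 2 ∂μ ∂μ := by
        rw [lintegral_const_mul]
        exact Measurable.lintegral_prod_right' (f := fun p : G × G => f p.2 * g (p.1 + p.2) ^ 2)
          (by fun_prop)
    _ = (∫⁻ y, f y ∂μ) * ∫⁻ y, f y * ∫⁻ v, g v ^ 2 ∂μ ∂μ := by
        rw [lintegral_lintegral_swap (by fun_prop)]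
        congr 1
        refine lintegral_congr fun y => ?_
        rw [lintegral_const_mul _ (by fun_prop)]
        congr 1
        exact lintegral_add_right_eq_self (fun v => g v ^ 2) y
    _ = _ := by
        rw [lintegral_mul_const _ hf]; ring

/-- Now $L^2*L^1\to L^2$: the density in the Cauchy–Schwarz inequality is $g(v+\cdot)$, whose mass
is independent of $v$. -/
theorem lintegral_conv_sq_le_right {f g : G → ENNReal} (hf : Measurable f) (hg : Measurable g) :
    ∫⁻ v, (∫⁻ y, f y * g (v + y) ∂μ) ^ 2 ∂μ ≤ (∫⁻ y, f y ^ 2 ∂μ) * (∫⁻ v, g v ∂μ) ^ 2 := by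
  have e : ∀ v, ∫⁻ y, g (v + y) ∂μ = ∫⁻ y, g y ∂μ := fun v =>
    lintegral_add_left_eq_self (fun y => g y) v
  calc ∫⁻ v, (∫⁻ y, f y * g (v + y) ∂μ) ^ 2 ∂μ
      ≤ ∫⁻ v, (∫⁻ y, g y ∂μ) * ∫⁻ y, g (v + y) * f y ^ 2 ∂μ ∂μ := by
        refine lintegral_mono fun v => ?_
        rw [← e v]
        simp_rw [mul_comm (f _)]
        exact lintegral_mul_sq_le_weight (hg.comp (measurable_const_add v)).aemeasurable
          hf.aemeasurable
    _ = (∫⁻ y, g y ∂μ) * ∫⁻ v, ∫⁻ y, g (v + y) * f y ^ 2 ∂μ ∂μ := by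
        rw [lintegral_const_mul]
        exact Measurable.lintegral_prod_right' (f := fun p : G × G => g (p.1 + p.2) * f p.2 ^ 2)
          (by fun_prop)
    _ = (∫⁻ y, g y ∂μ) * ∫⁻ y, (∫⁻ v, g v ∂μ) * f y ^ 2 ∂μ := by
        rw [lintegral_lintegral_swap (by fun_prop)]
        congr 1
        refine lintegral_congr fun y => ?_
        rw [lintegral_mul_const _ (by fun_prop)]
        congr 1
        exact lintegral_add_right_eq_self (fun v => g v) y
    _ = _ := by
        rw [lintegral_const_mul _ (by fun_prop)]; ring

end Young

variable {d : ℕ}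

/-- The rescaled velocity weight `1 + |ε v|^{2k}`. -/
def wt (k : ℕ) (ε : ℝ) (v : E d) : ℝ := 1 + (ε * ‖v‖) ^ (2 * k)

theorem wt_pos (k : ℕ) (ε : ℝ) (v : E d) : 0 < wt k ε v := by
  unfold wt
  have : 0 ≤ (ε * ‖v‖) ^ (2 * k) := by rw [pow_mul']; positivity
  linarith

theorem one_le_wt (k : ℕ) (ε : ℝ) (v : E d) : 1 ≤ wt k ε v := by
  unfold wt
  have : 0 ≤ (ε * ‖v‖) ^ (2 * k) := by rw [pow_mul']; positivity
  linarith

theorem continuous_wt (k : ℕ) (ε : ℝ) : Continuous (wt k ε : E d → ℝ) := by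
  unfold wt; fun_prop

theorem measurable_wt (k : ℕ) (ε : ℝ) : Measurable (wt k ε : E d → ℝ) :=
  (continuous_wt k ε).measurable

theorem wt_one (k : ℕ) (v : E d) : wt k 1 v = 1 + ‖v‖ ^ (2 * k) := by simp [wt]

theorem one_add_pow_le_wt (k : ℕ) (v : E d) : (1 + ‖v‖) ^ (2 * k) ≤ 2 ^ (2 * k) * wt k 1 v := by
  rw [wt_one]
  have h := norm_nonneg v
  calc (1 + ‖v‖) ^ (2 * k) ≤ 2 ^ (2 * k - 1) * (1 ^ (2 * k) + ‖v‖ ^ (2 * k)) :=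
        add_pow_le zero_le_one h _
    _ ≤ 2 ^ (2 * k) * (1 + ‖v‖ ^ (2 * k)) := by
        rw [one_pow]
        gcongr
        · norm_num
        · omega

/-- `∫ dv / (1 + |v|^{2k})`, finite for `2k > d`. -/
def invWt (d k : ℕ) : ENNReal := ∫⁻ v : E d, ENNReal.ofReal (wt k 1 v)⁻¹

theorem invWt_lt_top {k : ℕ} (hk : d < 2 * k) : invWt d k < ⊤ := by
  have h := finite_integral_one_add_norm (E := E d) (μ := volume) (r := (2 * k : ℕ))
    (by simpa using (by exact_mod_cast hk : (d : ℝ) < ((2 * k : ℕ) : ℝ)))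
  have : invWt d k ≤ ENNReal.ofReal (2 ^ (2 * k)) *
      ∫⁻ v : E d, ENNReal.ofReal ((1 + ‖v‖) ^ (-((2 * k : ℕ) : ℝ))) := by
    rw [← lintegral_const_mul _ (by fun_prop)]
    refine lintegral_mono fun v => ?_
    rw [← ENNReal.ofReal_mul (by positivity)]
    refine ENNReal.ofReal_le_ofReal ?_
    rw [Real.rpow_neg (by positivity), Real.rpow_natCast]
    have h1 := one_add_pow_le_wt k v
    have h2 : 0 < (1 + ‖v‖) ^ (2 * k) := by positivity
    rw [← div_eq_mul_inv, le_div_iff₀ h2, inv_mul_le_iff₀ (wt_pos _ _ _)]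
    linarith
  exact this.trans_lt (ENNReal.mul_lt_top ENNReal.ofReal_lt_top h)

/-- The substitution $v\mapsto\varepsilon v$ costs a factor $\varepsilon^{-d}$, which the powers of
$\varepsilon$ in the commutator estimate have to beat. -/
theorem lintegral_inv_wt (k : ℕ) {ε : ℝ} (hε : 0 < ε) :
    ∫⁻ v : E d, ENNReal.ofReal (wt k ε v)⁻¹ = ENNReal.ofReal (ε⁻¹ ^ d) * invWt d k := by
  have h : ∀ v : E d, wt k ε v = wt k 1 (ε • v) := fun v => by
    simp [wt, norm_smul, abs_of_pos hε]
  simp_rw [h]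
  have hm : Measurable fun v : E d => ENNReal.ofReal (wt k 1 v)⁻¹ :=
    (measurable_wt k 1).inv.ennreal_ofReal
  rw [← lintegral_map hm (measurable_const_smul ε), Measure.map_addHaar_smul _ hε.ne',
    lintegral_smul_measure]
  simp [invWt, abs_of_pos hε]

/-- Cauchy–Schwarz between the weight and its inverse: the weighted $L^2$ norm controls the $L^1$
norm as soon as the inverse weight is integrable. -/
theorem lintegral_sq_le_wt (k : ℕ) (ε : ℝ) {g : E d → ENNReal} (hg : Measurable g) :
    (∫⁻ v, g v) ^ 2 ≤ (∫⁻ v : E d, ENNReal.ofReal (wt k ε v)⁻¹) *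
      ∫⁻ v, ENNReal.ofReal (wt k ε v) * g v ^ 2 := by
  have h := lintegral_mul_sq_le_weight (μ := (volume : Measure (E d)))
    (f := fun v => ENNReal.ofReal (wt k ε v)⁻¹)
    (g := fun v => ENNReal.ofReal (wt k ε v) * g v)
    (measurable_wt k ε).inv.ennreal_ofReal.aemeasurable
    ((measurable_wt k ε).ennreal_ofReal.mul hg).aemeasurable
  have e : ∀ v : E d, ENNReal.ofReal (wt k ε v)⁻¹ * ENNReal.ofReal (wt k ε v) = 1 := fun v => by
    rw [← ENNReal.ofReal_mul (inv_nonneg.2 (wt_pos _ _ _).le), inv_mul_cancel₀ (wt_pos _ _ _).ne',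
      ENNReal.ofReal_one]
  have e2 : ∀ v : E d, ENNReal.ofReal (wt k ε v)⁻¹ * (ENNReal.ofReal (wt k ε v) * g v) ^ 2 =
      ENNReal.ofReal (wt k ε v) * g v ^ 2 := fun v => by
    rw [mul_pow, ← mul_assoc, sq (ENNReal.ofReal (wt k ε v)), ← mul_assoc, e, one_mul]
  simp_rw [← mul_assoc, e, one_mul] at h
  simp_rw [e2] at h
  exact h

/-- A weighted Young inequality. -/
theorem lintegral_conv_sq_le_wt (k : ℕ) (ε : ℝ) (hε : 0 ≤ ε) {m : E d → E d → ENNReal}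
    {α β g : E d → ENNReal} (hα : Measurable α) (hβ : Measurable β) (hg : Measurable g)
    (hm : ∀ v y, m v y ≤ α y * ENNReal.ofReal (1 + (ε * ‖v + y‖) ^ k) + β y) :
    ∫⁻ v, (∫⁻ y, m v y * g (v + y)) ^ 2 ≤
      (4 * (∫⁻ y, α y) ^ 2 + 2 * ((∫⁻ y, β y ^ 2) * ∫⁻ v : E d, ENNReal.ofReal (wt k ε v)⁻¹)) *
        ∫⁻ v, ENNReal.ofReal (wt k ε v) * g v ^ 2 := by
  -- Since $p^2$ is at most twice the weight, $pg$ lies in $L^2$ and the $\alpha$-part is of type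
  -- $L^1*L^2$. The $\beta$-part is of type $L^2*L^1$, with $\|g\|_{L^1}$ controlled through the
  -- inverse weight.
  set p : E d → ENNReal := fun v => ENNReal.ofReal (1 + (ε * ‖v‖) ^ k) with hp
  have hpm : Measurable p := by fun_prop
  have hp2 : ∀ v, p v ^ 2 ≤ 2 * ENNReal.ofReal (wt k ε v) := fun v => by
    have h2 : (2 : ENNReal) * ENNReal.ofReal (wt k ε v) = ENNReal.ofReal (2 * wt k ε v) := by
      rw [ENNReal.ofReal_mul (by norm_num)]; simp
    rw [hp, ← ENNReal.ofReal_pow (by positivity), h2]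
    refine ENNReal.ofReal_le_ofReal ?_
    unfold wt
    rw [mul_comm 2 k, pow_mul]
    nlinarith [sq_nonneg (1 - (ε * ‖v‖) ^ k)]
  have h1 : ∀ v, (∫⁻ y, m v y * g (v + y)) ^ 2 ≤
      2 * ((∫⁻ y, α y * (p (v + y) * g (v + y))) ^ 2 + (∫⁻ y, β y * g (v + y)) ^ 2) := fun v => by
    refine le_trans ?_ (add_sq_le_two_mul _ _)
    gcongr
    rw [← lintegral_add_left (by fun_prop)]
    refine lintegral_mono fun y => ?_
    rw [← mul_assoc, ← add_mul]
    gcongr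
    exact hm v y
  calc ∫⁻ v, (∫⁻ y, m v y * g (v + y)) ^ 2
      ≤ ∫⁻ v, 2 * ((∫⁻ y, α y * (p (v + y) * g (v + y))) ^ 2 + (∫⁻ y, β y * g (v + y)) ^ 2) :=
        lintegral_mono h1
    _ = 2 * (∫⁻ v, (∫⁻ y, α y * (p (v + y) * g (v + y))) ^ 2) +
        2 * ∫⁻ v, (∫⁻ y, β y * g (v + y)) ^ 2 := by
        have m1 : Measurable fun v => ∫⁻ y, α y * (p (v + y) * g (v + y)) :=
          Measurable.lintegral_prod_right'
            (f := fun q : E d × E d => α q.2 * (p (q.1 + q.2) * g (q.1 + q.2))) (by fun_prop)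
        have m2 : Measurable fun v => ∫⁻ y, β y * g (v + y) :=
          Measurable.lintegral_prod_right' (f := fun q : E d × E d => β q.2 * g (q.1 + q.2))
            (by fun_prop)
        rw [lintegral_const_mul _ (by fun_prop), lintegral_add_left (by fun_prop), mul_add]
    _ ≤ 2 * ((∫⁻ y, α y) ^ 2 * ∫⁻ v, (p v * g v) ^ 2) +
        2 * ((∫⁻ y, β y ^ 2) * (∫⁻ v, g v) ^ 2) := by
        gcongr
        · exact lintegral_conv_sq_le_left hα (hpm.mul hg)
        · exact lintegral_conv_sq_le_right hβ hg
    _ ≤ 2 * ((∫⁻ y, α y) ^ 2 * (2 * ∫⁻ v, ENNReal.ofReal (wt k ε v) * g v ^ 2)) +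
        2 * ((∫⁻ y, β y ^ 2) * ((∫⁻ v : E d, ENNReal.ofReal (wt k ε v)⁻¹) *
          ∫⁻ v, ENNReal.ofReal (wt k ε v) * g v ^ 2)) := by
        gcongr
        · rw [← lintegral_const_mul 2 (f := fun v => ENNReal.ofReal (wt k ε v) * g v ^ 2)
            ((measurable_wt k ε).ennreal_ofReal.mul (hg.pow_const 2))]
          refine lintegral_mono fun v => ?_
          rw [mul_pow, ← mul_assoc]
          gcongr
          exact hp2 v
        · exact lintegral_sq_le_wt k ε hg
    _ = _ := by ring

end

section

variable {d : ℕ}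

/-! ### The weighted spaces -/

/-- The weight never vanishes, so null sets coincide. This is why almost-everywhere identities
between elements of $X_k$ can be stated for Lebesgue measure. -/
theorem ae_weightMeasure (d k : ℕ) : ae (weightMeasure d k) = ae (volume : Measure (Phase d)) := by
  ext s
  have hm : Measurable fun z : Phase d => ENNReal.ofReal (1 + ‖z.2‖ ^ (2 * k)) := by fun_prop
  have h := ae_withDensity_iff (μ := (volume : Measure (Phase d))) (p := fun z => z ∈ s) hm
  have h0 : ∀ z : Phase d, ENNReal.ofReal (1 + ‖z.2‖ ^ (2 * k)) ≠ 0 := fun z => by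
    have : 0 < 1 + ‖z.2‖ ^ (2 * k) := by positivity
    simpa using this
  refine h.trans ?_
  simp [h0, Filter.Eventually]

theorem aestronglyMeasurable_weightMeasure_iff {k : ℕ} {w : Phase d → ℝ} :
    AEStronglyMeasurable w (weightMeasure d k) ↔ AEStronglyMeasurable w volume :=
  ⟨fun ⟨g, hg, h⟩ => ⟨g, hg, by rwa [EventuallyEq, ae_weightMeasure] at h⟩,
    fun ⟨g, hg, h⟩ => ⟨g, hg, by rwa [EventuallyEq, ae_weightMeasure]⟩⟩

theorem lintegral_weightMeasure (k : ℕ) (f : Phase d → ENNReal) :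
    ∫⁻ z, f z ∂(weightMeasure d k) = ∫⁻ z, ENNReal.ofReal (wt k 1 z.2) * f z := by
  simp_rw [wt_one]
  exact lintegral_withDensity_eq_lintegral_mul_non_measurable _ (by fun_prop)
    (Eventually.of_forall fun z => ENNReal.ofReal_lt_top) f

theorem integral_weightMeasure (k : ℕ) (f : Phase d → ℝ) :
    ∫ z, f z ∂(weightMeasure d k) = ∫ z, wt k 1 z.2 * f z := by
  rw [weightMeasure, integral_withDensity_eq_integral_toReal_smul (by fun_prop)
    (Eventually.of_forall fun z => ENNReal.ofReal_lt_top)]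
  refine integral_congr_ae (Eventually.of_forall fun z => ?_)
  have : 0 ≤ 1 + ‖z.2‖ ^ (2 * k) := by positivity
  simp [ENNReal.toReal_ofReal this, wt_one]

theorem volume_phase : (volume : Measure (Phase d)) = (volume : Measure (E d)).prod volume := rfl

theorem ae_phase_of_ae_ae {p : Phase d → Prop} (hp : MeasurableSet {z | p z})
    (h : ∀ᵐ x : E d, ∀ᵐ v : E d, p (x, v)) : ∀ᵐ z : Phase d, p z :=
  (Measure.ae_prod_iff_ae_ae hp).2 h

theorem ae_ae_of_ae_phase {p : Phase d → Prop} (h : ∀ᵐ z : Phase d, p z) :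
    ∀ᵐ x : E d, ∀ᵐ v : E d, p (x, v) := Measure.ae_ae_of_ae_prod h

/-! ### Velocity convolutions -/

/-- `Re (i c(y) exp(i μ x·y))`. -/
def kerK (μ : ℝ) (c : E d → ℂ) (x y : E d) : ℝ :=
  (Complex.I * c y * Complex.exp (Complex.I * ((μ * inner ℝ x y : ℝ) : ℂ))).re

/-- The operator `w ↦ ∫ K(x, y) w(x, v + y) dy`. -/
def convTheta (μ : ℝ) (c : E d → ℂ) (w : Phase d → ℝ) (z : Phase d) : ℝ :=
  ∫ y, kerK μ c z.1 y * w (z.1, z.2 + y)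

theorem abs_kerK_le (μ : ℝ) (c : E d → ℂ) (x y : E d) : |kerK μ c x y| ≤ ‖c y‖ := by
  refine (Complex.abs_re_le_norm _).trans ?_
  rw [mul_comm Complex.I ((_ : ℝ) : ℂ), norm_mul, Complex.norm_exp_ofReal_mul_I]
  simp

theorem enorm_kerK_le (μ : ℝ) (c : E d → ℂ) (x y : E d) : ‖kerK μ c x y‖ₑ ≤ ‖c y‖ₑ := by
  rw [← ofReal_norm, ← ofReal_norm]
  exact ENNReal.ofReal_le_ofReal (abs_kerK_le μ c x y)

theorem measurable_kerK (μ : ℝ) {c : E d → ℂ} (hc : Measurable c) :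
    Measurable fun p : E d × E d => kerK μ c p.1 p.2 := by
  unfold kerK
  refine Complex.measurable_re.comp ((measurable_const.mul (hc.comp measurable_snd)).mul ?_)
  have : Continuous fun p : E d × E d =>
      Complex.exp (Complex.I * ((μ * inner ℝ p.1 p.2 : ℝ) : ℂ)) := by fun_prop
  exact this.measurable

/-- This oddness, a consequence of the Hermitian symmetry of $c$, is what makes the convolution
skew-symmetric in unweighted $L^2$. -/
theorem kerK_neg (μ : ℝ) {c : E d → ℂ} (hc : ∀ y, c (-y) = starRingEnd ℂ (c y)) (x y : E d) :
    kerK μ c x (-y) = -kerK μ c x y := by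
  unfold kerK
  rw [hc, ← Complex.conj_re (Complex.I * c y * _)]
  simp only [inner_neg_right, map_mul, Complex.conj_I, ← Complex.exp_conj, Complex.conj_ofReal]
  rw [← Complex.neg_re]
  congr 1
  push_cast
  ring_nf

theorem enorm_neg_eq {c : E d → ℂ} (hc : ∀ y, c (-y) = starRingEnd ℂ (c y)) (y : E d) :
    ‖c (-y)‖ₑ = ‖c y‖ₑ := by
  rw [hc, ← ofReal_norm, ← ofReal_norm, RCLike.norm_conj]

/-- The squared weighted norm of a kernel. -/
def cw (k : ℕ) (c : E d → ℂ) : ENNReal := ∫⁻ y, ENNReal.ofReal (wt k 1 y) * ‖c y‖ₑ ^ 2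

theorem cw_le_cw_succ (k : ℕ) (c : E d → ℂ) : cw k c ≤ 2 * cw (k + 1) c := by
  unfold cw
  rw [← lintegral_const_mul' _ _ (by simp)]
  refine lintegral_mono fun y => ?_
  rw [← mul_assoc]
  gcongr
  have h2 : (2 : ENNReal) * ENNReal.ofReal (wt (k + 1) 1 y) = ENNReal.ofReal (2 * wt (k + 1) 1 y) := by
    rw [ENNReal.ofReal_mul (by norm_num)]; simp
  rw [h2]
  refine ENNReal.ofReal_le_ofReal ?_
  rw [wt_one, wt_one]
  have h0 := norm_nonneg y
  rcases le_total ‖y‖ 1 with h | h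
  · have := pow_le_one₀ h0 h (n := 2 * k)
    have : 0 ≤ ‖y‖ ^ (2 * (k + 1)) := by positivity
    linarith
  · have := pow_le_pow_right₀ h (show 2 * k ≤ 2 * (k + 1) by omega)
    have : 0 ≤ ‖y‖ ^ (2 * k) := by positivity
    linarith

theorem lintegral_kernel_sq_le (k : ℕ) {c : E d → ℂ} (hc : Measurable c) :
    (∫⁻ y, ‖c y‖ₑ) ^ 2 ≤ invWt d k * cw k c :=
  lintegral_sq_le_wt k 1 hc.enorm

/-- A factor $|y|$ in the kernel costs one more order of the weight:
$(1+|y|^{2k})|y|^2\le2(1+|y|^{2(k+1)})$. -/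
theorem lintegral_norm_mul_kernel_sq_le (k : ℕ) {c : E d → ℂ} (hc : Measurable c) :
    (∫⁻ y, ENNReal.ofReal ‖y‖ * ‖c y‖ₑ) ^ 2 ≤ invWt d k * (2 * cw (k + 1) c) := by
  refine (lintegral_sq_le_wt k 1 (by fun_prop)).trans ?_
  unfold invWt cw
  gcongr
  rw [← lintegral_const_mul' _ _ (by simp)]
  refine lintegral_mono fun y => ?_
  rw [mul_pow, ← mul_assoc, ← mul_assoc]
  refine mul_le_mul_left ?_ _
  have h2 : (2 : ENNReal) * ENNReal.ofReal (wt (k + 1) 1 y) = ENNReal.ofReal (2 * wt (k + 1) 1 y) := by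
    rw [ENNReal.ofReal_mul (by norm_num)]; simp
  rw [h2, ← ENNReal.ofReal_pow (norm_nonneg _), ← ENNReal.ofReal_mul (wt_pos _ _ _).le]
  refine ENNReal.ofReal_le_ofReal ?_
  rw [wt_one, wt_one]
  have h0 := norm_nonneg y
  have e : ‖y‖ ^ (2 * (k + 1)) = ‖y‖ ^ (2 * k) * ‖y‖ ^ 2 := by ring
  rw [e]
  have : 0 ≤ ‖y‖ ^ (2 * k) * ‖y‖ ^ 2 := by positivity
  rcases le_total ‖y‖ 1 with h | h
  · have := pow_le_one₀ h0 h (n := 2)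
    nlinarith
  · have := one_le_pow₀ h (n := 2 * k)
    nlinarith [sq_nonneg ‖y‖]

theorem lintegral_pow_mul_kernel_sq_le (k : ℕ) (c : E d → ℂ) :
    ∫⁻ y, (ENNReal.ofReal (‖y‖ ^ k) * ‖c y‖ₑ) ^ 2 ≤ cw k c := by
  refine lintegral_mono fun y => ?_
  rw [mul_pow]
  gcongr
  rw [← ENNReal.ofReal_pow (by positivity)]
  refine ENNReal.ofReal_le_ofReal ?_
  rw [wt_one, ← pow_mul, mul_comm]
  linarith

/-- The output weight is distributed by $|v|^k\lesssim|v+y|^k+|y|^k$. Where it falls on $w$, the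
kernel is used in $L^1$; where it falls on the kernel, $|y|^kc$ is used in $L^2$ and $w$ in $L^1$.
Both kernel norms are controlled by `cw k c`. -/
theorem lintegral_conv_bound (k : ℕ) {c : E d → ℂ} (hc : Measurable c) {w : Phase d → ℝ}
    (hw : Measurable w) :
    ∫⁻ z : Phase d, ENNReal.ofReal (wt k 1 z.2) * (∫⁻ y, ‖c y‖ₑ * ‖w (z.1, z.2 + y)‖ₑ) ^ 2 ≤
      (6 * 4 ^ k * (invWt d k * cw k c)) *
        ∫⁻ z : Phase d, ENNReal.ofReal (wt k 1 z.2) * ‖w z‖ₑ ^ 2 := by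
  have hJ : Measurable fun z : Phase d => ∫⁻ y, ‖c y‖ₑ * ‖w (z.1, z.2 + y)‖ₑ :=
    Measurable.lintegral_prod_right'
      (f := fun q : Phase d × E d => ‖c q.2‖ₑ * ‖w (q.1.1, q.1.2 + q.2)‖ₑ)
      ((hc.enorm.comp measurable_snd).mul (hw.enorm.comp (by fun_prop)))
  have hwt : Measurable fun z : Phase d => ENNReal.ofReal (wt k 1 z.2) :=
    ((measurable_wt k 1).comp measurable_snd).ennreal_ofReal
  have m1 : Measurable fun z : Phase d => ENNReal.ofReal (wt k 1 z.2) *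
      (∫⁻ y, ‖c y‖ₑ * ‖w (z.1, z.2 + y)‖ₑ) ^ 2 := hwt.mul (hJ.pow_const 2)
  have m2 : Measurable fun z : Phase d => ENNReal.ofReal (wt k 1 z.2) * ‖w z‖ₑ ^ 2 :=
    hwt.mul (hw.enorm.pow_const 2)
  rw [volume_phase, lintegral_prod _ m1.aemeasurable, lintegral_prod _ m2.aemeasurable,
    ← lintegral_const_mul _ m2.lintegral_prod_right']
  refine lintegral_mono fun x => ?_
  simp only
  have hg : Measurable fun v => ‖w (x, v)‖ₑ := (hw.comp (by fun_prop : Measurable fun v => (x, v))).enorm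
  have h := lintegral_conv_sq_le_wt (d := d) k 1 zero_le_one
    (m := fun v y => ENNReal.ofReal (1 + ‖v‖ ^ k) * ‖c y‖ₑ)
    (α := fun y => ENNReal.ofReal (2 ^ k) * ‖c y‖ₑ)
    (β := fun y => ENNReal.ofReal (2 ^ k) * (ENNReal.ofReal (‖y‖ ^ k) * ‖c y‖ₑ))
    (g := fun v => ‖w (x, v)‖ₑ) (by fun_prop) (by fun_prop) hg (fun v y => by
      have : ENNReal.ofReal (2 ^ k) * ‖c y‖ₑ * ENNReal.ofReal (1 + (1 * ‖v + y‖) ^ k) +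
          ENNReal.ofReal (2 ^ k) * (ENNReal.ofReal (‖y‖ ^ k) * ‖c y‖ₑ) =
          (ENNReal.ofReal (2 ^ k) * (ENNReal.ofReal (1 + (1 * ‖v + y‖) ^ k) +
            ENNReal.ofReal (‖y‖ ^ k))) * ‖c y‖ₑ := by ring
      rw [this]
      gcongr
      rw [← ENNReal.ofReal_add (by positivity) (by positivity), ← ENNReal.ofReal_mul (by positivity)]
      refine ENNReal.ofReal_le_ofReal ?_
      have h1 : ‖v‖ ≤ ‖v + y‖ + ‖y‖ := by
        calc ‖v‖ = ‖(v + y) - y‖ := by rw [add_sub_cancel_right]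
          _ ≤ _ := norm_sub_le _ _
      have h2 : ‖v‖ ^ k ≤ 2 ^ (k - 1) * (‖v + y‖ ^ k + ‖y‖ ^ k) :=
        (pow_le_pow_left₀ (norm_nonneg _) h1 k).trans
          (add_pow_le (norm_nonneg _) (norm_nonneg _) k)
      have h3 : (2 : ℝ) ^ (k - 1) ≤ 2 ^ k := pow_le_pow_right₀ (by norm_num) (by omega)
      have h4 : (1 : ℝ) ≤ 2 ^ k := one_le_pow₀ (by norm_num)
      have h5 : 0 ≤ ‖v + y‖ ^ k + ‖y‖ ^ k := by positivity
      rw [one_mul]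
      nlinarith)
  calc ∫⁻ v, ENNReal.ofReal (wt k 1 v) * (∫⁻ y, ‖c y‖ₑ * ‖w (x, v + y)‖ₑ) ^ 2
      ≤ ∫⁻ v, (∫⁻ y, (ENNReal.ofReal (1 + ‖v‖ ^ k) * ‖c y‖ₑ) * ‖w (x, v + y)‖ₑ) ^ 2 := by
        refine lintegral_mono fun v => ?_
        simp_rw [mul_assoc]
        rw [lintegral_const_mul', mul_pow]
        · gcongr
          rw [← ENNReal.ofReal_pow (by positivity)]
          refine ENNReal.ofReal_le_ofReal ?_
          rw [wt_one, mul_comm 2 k, pow_mul]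
          have : 0 ≤ ‖v‖ ^ k := by positivity
          nlinarith
        · exact ENNReal.ofReal_ne_top
    _ ≤ _ := h
    _ ≤ _ := by
        gcongr
        have e1 : ∫⁻ y, ENNReal.ofReal (2 ^ k) * ‖c y‖ₑ = ENNReal.ofReal (2 ^ k) * ∫⁻ y, ‖c y‖ₑ :=
          lintegral_const_mul' _ _ ENNReal.ofReal_ne_top
        have e2 : ∫⁻ y, (ENNReal.ofReal (2 ^ k) * (ENNReal.ofReal (‖y‖ ^ k) * ‖c y‖ₑ)) ^ 2 =
            ENNReal.ofReal (2 ^ k) ^ 2 * ∫⁻ y, (ENNReal.ofReal (‖y‖ ^ k) * ‖c y‖ₑ) ^ 2 := by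
          rw [← lintegral_const_mul' _ _ (by simp)]
          simp_rw [mul_pow]
        have e3 : ENNReal.ofReal (2 ^ k) ^ 2 = 4 ^ k := by
          rw [ENNReal.ofReal_pow (by norm_num), ← pow_mul, mul_comm, pow_mul]
          norm_num
        rw [e1, e2, mul_pow, e3]
        change _ + 2 * (_ * invWt d k) ≤ _
        calc 4 * (4 ^ k * (∫⁻ y, ‖c y‖ₑ) ^ 2) +
              2 * (4 ^ k * (∫⁻ y, (ENNReal.ofReal (‖y‖ ^ k) * ‖c y‖ₑ) ^ 2) * invWt d k)
            ≤ 4 * (4 ^ k * (invWt d k * cw k c)) + 2 * (4 ^ k * cw k c * invWt d k) := by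
              gcongr
              · exact lintegral_kernel_sq_le k hc
              · exact lintegral_pow_mul_kernel_sq_le k c
          _ = _ := by ring

end

/-! ### Boundedness of the velocity convolution on the weighted space -/

section

variable {d : ℕ}

theorem ae_phase_fst {p : E d → Prop} (h : ∀ᵐ x : E d, p x) : ∀ᵐ z : Phase d, p z.1 :=
  (Measure.quasiMeasurePreserving_fst (μ := (volume : Measure (E d)))
    (ν := (volume : Measure (E d)))).ae h

theorem measurable_convTheta (μ : ℝ) {c : E d → ℂ} (hc : Measurable c) {w : Phase d → ℝ}
    (hw : Measurable w) : Measurable (convTheta μ c w) := by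
  have h : StronglyMeasurable fun p : Phase d × E d =>
      kerK μ c p.1.1 p.2 * w (p.1.1, p.1.2 + p.2) := by
    refine Measurable.stronglyMeasurable (Measurable.mul ?_ (hw.comp (by fun_prop)))
    exact (measurable_kerK μ hc).comp (by fun_prop : Measurable fun p : Phase d × E d => (p.1.1, p.2))
  exact (h.integral_prod_right' (ν := (volume : Measure (E d)))).measurable

theorem measurable_conv_enorm {c : E d → ℂ} (hc : Measurable c) {w : Phase d → ℝ}
    (hw : Measurable w) : Measurable fun z : Phase d => ∫⁻ y, ‖c y‖ₑ * ‖w (z.1, z.2 + y)‖ₑ :=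
  Measurable.lintegral_prod_right'
    (f := fun q : Phase d × E d => ‖c q.2‖ₑ * ‖w (q.1.1, q.1.2 + q.2)‖ₑ)
    ((hc.enorm.comp measurable_snd).mul (hw.enorm.comp (by fun_prop)))

theorem convTheta_congr (μ : ℝ) (c : E d → ℂ) {w w' : Phase d → ℝ} (h : w =ᵐ[volume] w') :
    convTheta μ c w =ᵐ[volume] convTheta μ c w' := by
  filter_upwards [ae_phase_fst (ae_ae_of_ae_phase h)] with z hz
  refine integral_congr_ae ?_
  have h2 := (quasiMeasurePreserving_add_left (volume : Measure (E d)) z.2).ae hz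
  filter_upwards [h2] with y hy
  rw [hy]

/-- The weighted `L²` norm is finite. -/
def FinW (k : ℕ) (w : Phase d → ℝ) : Prop :=
  ∫⁻ z : Phase d, ENNReal.ofReal (wt k 1 z.2) * ‖w z‖ₑ ^ 2 < ⊤

theorem MemLp.finW {k : ℕ} {w : Phase d → ℝ} (h : MemLp w 2 (weightMeasure d k)) : FinW k w := by
  have := MemLp.lintegral_sq_lt_top h
  rwa [lintegral_weightMeasure] at this

theorem lintegral_conv_lt_top {k : ℕ} (hk : d < 2 * k) {c : E d → ℂ} (hc : Measurable c)
    (hcw : cw k c < ⊤) {w : Phase d → ℝ} (hw : Measurable w) (hfin : FinW k w) :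
    ∫⁻ z : Phase d, ENNReal.ofReal (wt k 1 z.2) * (∫⁻ y, ‖c y‖ₑ * ‖w (z.1, z.2 + y)‖ₑ) ^ 2 < ⊤ := by
  refine (lintegral_conv_bound k hc hw).trans_lt (ENNReal.mul_lt_top ?_ hfin)
  refine ENNReal.mul_lt_top (ENNReal.mul_lt_top (by simp) (by simp)) ?_
  exact ENNReal.mul_lt_top (invWt_lt_top hk) hcw

theorem ae_integrable_conv {k : ℕ} (hk : d < 2 * k) (μ : ℝ) {c : E d → ℂ} (hc : Measurable c)
    (hcw : cw k c < ⊤) {w : Phase d → ℝ} (hw : Measurable w) (hfin : FinW k w) :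
    ∀ᵐ z : Phase d, Integrable fun y => kerK μ c z.1 y * w (z.1, z.2 + y) := by
  have hm := measurable_conv_enorm hc hw
  have hwt : Measurable fun z : Phase d => ENNReal.ofReal (wt k 1 z.2) :=
    ((measurable_wt k 1).comp measurable_snd).ennreal_ofReal
  have h := ae_lt_top (hwt.mul (hm.pow_const 2)) (lintegral_conv_lt_top hk hc hcw hw hfin).ne
  filter_upwards [h] with z hz
  have hz' : ∫⁻ y, ‖c y‖ₑ * ‖w (z.1, z.2 + y)‖ₑ < ⊤ := by
    by_contra hcon
    rw [not_lt, top_le_iff] at hcon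
    have h0 : ENNReal.ofReal (wt k 1 z.2) ≠ 0 := by simpa using wt_pos k 1 z.2
    simp only [Pi.mul_apply, hcon] at hz
    rw [ENNReal.top_pow two_ne_zero, ENNReal.mul_top h0] at hz
    exact lt_irrefl _ hz
  refine ⟨?_, ?_⟩
  · refine Measurable.aestronglyMeasurable (Measurable.mul ?_ (hw.comp (by fun_prop)))
    exact (measurable_kerK μ hc).comp (by fun_prop : Measurable fun y : E d => (z.1, y))
  · refine lt_of_le_of_lt (lintegral_mono fun y => ?_) hz'
    rw [enorm_mul]
    gcongr
    exact enorm_kerK_le μ c _ _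

theorem enorm_convTheta_le (μ : ℝ) (c : E d → ℂ) (w : Phase d → ℝ) (z : Phase d) :
    ‖convTheta μ c w z‖ₑ ≤ ∫⁻ y, ‖c y‖ₑ * ‖w (z.1, z.2 + y)‖ₑ := by
  refine (enorm_integral_le_lintegral_enorm _).trans (lintegral_mono fun y => ?_)
  rw [enorm_mul]
  gcongr
  exact enorm_kerK_le μ c _ _

/-- The norm bound for the operator with a kernel of squared weighted norm `b`. -/
def thetaBound (d k : ℕ) (b : ℝ) : ℝ := Real.sqrt (6 * 4 ^ k * ((invWt d k).toReal * b))

theorem exists_theta {k : ℕ} (hk : d < 2 * k) (μ : ℝ) {b : ℝ} (hb : 0 ≤ b) {c : E d → ℂ}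
    (hc : Measurable c) (hcw : cw k c ≤ ENNReal.ofReal b) :
    ∃ T : X d k →L[ℝ] X d k, ‖T‖ ≤ thetaBound d k b ∧
      ∀ w : X d k, T w =ᵐ[volume] convTheta μ c w := by
  have hcw' : cw k c < ⊤ := hcw.trans_lt ENNReal.ofReal_lt_top
  have h := exists_clm_of_pointwise (μ := weightMeasure d k) (ν := weightMeasure d k)
    (convTheta μ c) (C := thetaBound d k b) (Real.sqrt_nonneg _)
    (fun w hw _ => (measurable_convTheta μ hc hw.measurable).aestronglyMeasurable)
    (fun w hw hL => by
      rw [lintegral_weightMeasure, lintegral_weightMeasure]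
      calc ∫⁻ z : Phase d, ENNReal.ofReal (wt k 1 z.2) * ‖convTheta μ c w z‖ₑ ^ 2
          ≤ ∫⁻ z : Phase d, ENNReal.ofReal (wt k 1 z.2) *
            (∫⁻ y, ‖c y‖ₑ * ‖w (z.1, z.2 + y)‖ₑ) ^ 2 := by
            refine lintegral_mono fun z => ?_
            gcongr
            exact enorm_convTheta_le μ c w z
        _ ≤ _ := lintegral_conv_bound k hc hw.measurable
        _ ≤ _ := by
            gcongr
            unfold thetaBound
            rw [Real.sq_sqrt (by positivity), ENNReal.ofReal_mul (by positivity),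
              ENNReal.ofReal_mul (p := (invWt d k).toReal) ENNReal.toReal_nonneg, ENNReal.ofReal_toReal (invWt_lt_top hk).ne,
              ENNReal.ofReal_mul (by norm_num), ENNReal.ofReal_pow (by norm_num)]
            norm_num
            gcongr)
    (fun w w' h => by
      rw [EventuallyEq, ae_weightMeasure] at h ⊢
      exact convTheta_congr μ c h)
    (fun w w' hw hL hw' hL' => by
      rw [EventuallyEq, ae_weightMeasure]
      filter_upwards [ae_integrable_conv hk μ hc hcw' hw.measurable (MemLp.finW hL),
        ae_integrable_conv hk μ hc hcw' hw'.measurable (MemLp.finW hL')] with z h1 h2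
      simp only [convTheta, Pi.add_apply, mul_add]
      exact integral_add h1 h2)
    (fun r w hw hL => by
      refine Eventually.of_forall fun z => ?_
      simp only [convTheta, Pi.smul_apply, smul_eq_mul, mul_left_comm _ r]
      exact integral_const_mul r _)
  obtain ⟨T, hT, hTw⟩ := h
  refine ⟨T, hT, fun w => ?_⟩
  have := hTw w
  rwa [EventuallyEq, ae_weightMeasure] at this

/-! ### Pairings -/

/-- The duality between the weighted space and the space with the inverse weight. Elements of $X_k$
are paired in this way with test functions and with weighted elements of $X_k$. -/
theorem lintegral_mul_sq_le_wt (k : ℕ) {f g : Phase d → ENNReal} (hf : Measurable f)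
    (hg : Measurable g) :
    (∫⁻ z, f z * g z) ^ 2 ≤ (∫⁻ z : Phase d, ENNReal.ofReal (wt k 1 z.2) * f z ^ 2) *
      ∫⁻ z : Phase d, ENNReal.ofReal (wt k 1 z.2)⁻¹ * g z ^ 2 := by
  set s : Phase d → ENNReal := fun z => ENNReal.ofReal (Real.sqrt (wt k 1 z.2)) with hs
  set t : Phase d → ENNReal := fun z => ENNReal.ofReal (Real.sqrt (wt k 1 z.2))⁻¹ with ht
  have hwt : Measurable fun z : Phase d => wt k 1 z.2 := (measurable_wt k 1).comp measurable_snd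
  have hsm : Measurable s := hwt.sqrt.ennreal_ofReal
  have htm : Measurable t := hwt.sqrt.inv.ennreal_ofReal
  have hst : ∀ z, s z * t z = 1 := fun z => by
    have : 0 < Real.sqrt (wt k 1 z.2) := Real.sqrt_pos.2 (wt_pos _ _ _)
    rw [hs, ht, ← ENNReal.ofReal_mul this.le, mul_inv_cancel₀ this.ne', ENNReal.ofReal_one]
  have hs2 : ∀ z, s z ^ 2 = ENNReal.ofReal (wt k 1 z.2) := fun z => by
    rw [hs, ← ENNReal.ofReal_pow (Real.sqrt_nonneg _), Real.sq_sqrt (wt_pos _ _ _).le]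
  have ht2 : ∀ z, t z ^ 2 = ENNReal.ofReal (wt k 1 z.2)⁻¹ := fun z => by
    rw [ht, ← ENNReal.ofReal_pow (inv_nonneg.2 (Real.sqrt_nonneg _)), inv_pow,
      Real.sq_sqrt (wt_pos _ _ _).le]
  have h := lintegral_mul_sq_le (μ := (volume : Measure (Phase d))) (f := fun z => s z * f z)
    (g := fun z => t z * g z) (hsm.mul hf).aemeasurable (htm.mul hg).aemeasurable
  simp_rw [mul_pow, hs2, ht2] at h
  convert h using 4 with z
  rw [mul_mul_mul_comm, hst, one_mul]

theorem measurable_pairing (μ : ℝ) {c : E d → ℂ} (hc : Measurable c) {w : Phase d → ℝ}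
    (hw : Measurable w) {g : Phase d → ℝ} (hg : Measurable g) :
    Measurable fun p : E d × Phase d =>
      kerK μ c p.2.1 p.1 * w (p.2.1, p.2.2 + p.1) * g p.2 := by
  refine Measurable.mul (Measurable.mul ?_ (hw.comp (by fun_prop))) (hg.comp measurable_snd)
  exact (measurable_kerK μ hc).comp (by fun_prop : Measurable fun p : E d × Phase d => (p.2.1, p.1))

theorem integrable_pairing {k : ℕ} (hk : d < 2 * k) (μ : ℝ) {c : E d → ℂ} (hc : Measurable c)
    (hcw : cw k c < ⊤) {w : Phase d → ℝ} (hw : Measurable w) (hfin : FinW k w)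
    {g : Phase d → ℝ} (hg : Measurable g)
    (hgfin : ∫⁻ z : Phase d, ENNReal.ofReal (wt k 1 z.2)⁻¹ * ‖g z‖ₑ ^ 2 < ⊤) :
    Integrable (fun p : E d × Phase d => kerK μ c p.2.1 p.1 * w (p.2.1, p.2.2 + p.1) * g p.2)
      (volume.prod volume) := by
  refine ⟨(measurable_pairing μ hc hw hg).aestronglyMeasurable, ?_⟩
  have hJ := measurable_conv_enorm hc hw
  have h1 := lintegral_mul_sq_le_wt k hJ hg.enorm
  have h2 : (∫⁻ z, (∫⁻ y, ‖c y‖ₑ * ‖w (z.1, z.2 + y)‖ₑ) * ‖g z‖ₑ) < ⊤ := by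
    by_contra hcon
    rw [not_lt, top_le_iff] at hcon
    rw [hcon, ENNReal.top_pow two_ne_zero, top_le_iff] at h1
    exact (ENNReal.mul_lt_top (lintegral_conv_lt_top hk hc hcw hw hfin) hgfin).ne h1
  refine lt_of_le_of_lt ?_ h2
  rw [lintegral_prod_symm _ (measurable_pairing μ hc hw hg).enorm.aemeasurable]
  refine lintegral_mono fun z => ?_
  simp only
  rw [← lintegral_mul_const' _ _ enorm_ne_top]
  refine lintegral_mono fun y => ?_
  rw [enorm_mul, enorm_mul]
  gcongr
  exact enorm_kerK_le μ c _ _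

theorem integral_convTheta_mul {k : ℕ} (hk : d < 2 * k) (μ : ℝ) {c : E d → ℂ} (hc : Measurable c)
    (hcw : cw k c < ⊤) {w : Phase d → ℝ} (hw : Measurable w) (hfin : FinW k w)
    {g : Phase d → ℝ} (hg : Measurable g)
    (hgfin : ∫⁻ z : Phase d, ENNReal.ofReal (wt k 1 z.2)⁻¹ * ‖g z‖ₑ ^ 2 < ⊤) :
    ∫ z, convTheta μ c w z * g z =
      ∫ p : E d × Phase d, kerK μ c p.2.1 p.1 * w (p.2.1, p.2.2 + p.1) * g p.2
        ∂(volume.prod volume) := by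
  rw [integral_prod_symm _ (integrable_pairing hk μ hc hcw hw hfin hg hgfin)]
  refine integral_congr_ae (Eventually.of_forall fun z => ?_)
  simp only [convTheta]
  rw [integral_mul_const]

theorem measurePreserving_shear (s : E d → E d) (hs : Measurable s) :
    MeasurePreserving (fun p : E d × Phase d => (p.1, (p.2.1, p.2.2 + s p.1)))
      (volume.prod volume) (volume.prod volume) := by
  refine MeasurePreserving.skew_product (f := id) (g := fun y (z : Phase d) => (z.1, z.2 + s y))
    (MeasurePreserving.id _) (by unfold Function.uncurry; fun_prop)
    (Eventually.of_forall fun y => ?_)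
  exact ((MeasurePreserving.id (volume : Measure (E d))).prod
    (measurePreserving_add_right (volume : Measure (E d)) (s y))).map_eq

/-- The map $(y,x,v)\mapsto(-y,x,v+y)$ is an involution that exchanges $w(x,v+y)$ with $w(x,v)$.
Averaging the quadratic form over it isolates the commutator with the weight. -/
theorem measurePreserving_flip :
    MeasurePreserving (fun p : E d × Phase d => (-p.1, (p.2.1, p.2.2 + p.1)))
      (volume.prod volume) (volume.prod volume) := by
  have h := ((Measure.measurePreserving_neg (volume : Measure (E d))).prod
    (MeasurePreserving.id (volume : Measure (Phase d)))).comp (measurePreserving_shear id measurable_id)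
  exact h

/-! ### Dissipativity -/

/-- From $|a^k-b^k|\le k|a-b|\max(a,b)^{k-1}$ and $|a-b|\le\varepsilon|y|$: every term gains a
factor from the shift. The two summands have the shape required of $m$ in the weighted Young
inequality `lintegral_conv_sq_le_wt`. -/
theorem abs_pow_sub_pow_le_of_norm (k : ℕ) {ε : ℝ} (hε : 0 ≤ ε) (v y : E d) :
    |(ε * ‖v + y‖) ^ k - (ε * ‖v‖) ^ k| ≤
      k * 2 ^ k * (ε * ‖y‖) * (1 + (ε * ‖v + y‖) ^ k) + k * 2 ^ k * (ε ^ k * ‖y‖ ^ k) := by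
  rcases Nat.eq_zero_or_pos k with rfl | hk
  · simp
  set a := ε * ‖v + y‖ with ha
  set b := ε * ‖v‖ with hb
  set t := ε * ‖y‖ with ht
  have ha0 : 0 ≤ a := by positivity
  have hb0 : 0 ≤ b := by positivity
  have ht0 : 0 ≤ t := by positivity
  have hab : |a - b| ≤ t := by
    rw [ha, hb, ← mul_sub, abs_mul, abs_of_nonneg hε]
    refine mul_le_mul_of_nonneg_left ?_ hε
    have := abs_norm_sub_norm_le (v + y) v
    simpa using this
  have hba : b ≤ a + t := by have := (abs_le.1 hab).1; linarith
  have h1 := abs_pow_sub_pow_le a b k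
  have h2 : max |a| |b| ≤ a + t := by
    rw [abs_of_nonneg ha0, abs_of_nonneg hb0]; exact max_le (by linarith) hba
  have h3 : (a + t) ^ (k - 1) ≤ 2 ^ (k - 1 - 1) * (a ^ (k - 1) + t ^ (k - 1)) :=
    add_pow_le ha0 ht0 _
  have h4 : (2 : ℝ) ^ (k - 1 - 1) ≤ 2 ^ k := pow_le_pow_right₀ (by norm_num) (by omega)
  have h5 : a ^ (k - 1) ≤ 1 + a ^ k := by
    rcases le_total a 1 with h | h
    · have := pow_le_one₀ ha0 h (n := k - 1)
      have : 0 ≤ a ^ k := by positivity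
      linarith
    · have := pow_le_pow_right₀ h (show k - 1 ≤ k by omega)
      linarith
  have h6 : ε ^ k * ‖y‖ ^ k = t * t ^ (k - 1) := by
    rw [← mul_pow, ← ht, ← pow_succ', Nat.sub_add_cancel hk]
  rw [h6]
  calc |a ^ k - b ^ k| ≤ |a - b| * k * max |a| |b| ^ (k - 1) := h1
    _ ≤ t * k * (a + t) ^ (k - 1) := by gcongr
    _ ≤ t * k * (2 ^ k * ((1 + a ^ k) + t ^ (k - 1))) := by
        refine mul_le_mul_of_nonneg_left (h3.trans ?_) (by positivity)
        gcongr
    _ = _ := by ring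

/-- Of the two terms of `abs_pow_sub_pow_le_of_norm`, the first contributes $\varepsilon^2$. The
second contributes $\varepsilon^{2k}$ against the loss $\varepsilon^{-d}$ from the inverse weight.
Both are at most $\varepsilon$, because $2k\ge d+1$ and $\varepsilon\le1$. The extra factor $|y|$ is
the reason for the kernel norm of order $k+1$. -/
theorem lintegral_commutator_le (k : ℕ) (hk : d < 2 * k) {ε : ℝ} (hε : 0 < ε) (hε1 : ε ≤ 1)
    {c : E d → ℂ} (hc : Measurable c) {w : Phase d → ℝ} (hw : Measurable w) :
    ∫⁻ z : Phase d, (∫⁻ y, (‖c y‖ₑ * ENNReal.ofReal |(ε * ‖z.2 + y‖) ^ k - (ε * ‖z.2‖) ^ k|) *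
        ‖w (z.1, z.2 + y)‖ₑ) ^ 2 ≤
      (ENNReal.ofReal (12 * (k * 2 ^ k) ^ 2 * ε) * (invWt d k * cw (k + 1) c)) *
        ∫⁻ z : Phase d, ENNReal.ofReal (wt k ε z.2) * ‖w z‖ₑ ^ 2 := by
  have hJ : Measurable fun z : Phase d => ∫⁻ y, (‖c y‖ₑ * ENNReal.ofReal
      |(ε * ‖z.2 + y‖) ^ k - (ε * ‖z.2‖) ^ k|) * ‖w (z.1, z.2 + y)‖ₑ :=
    Measurable.lintegral_prod_right'
      (f := fun q : Phase d × E d => (‖c q.2‖ₑ * ENNReal.ofReal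
        |(ε * ‖q.1.2 + q.2‖) ^ k - (ε * ‖q.1.2‖) ^ k|) * ‖w (q.1.1, q.1.2 + q.2)‖ₑ)
      (Measurable.mul ((hc.enorm.comp measurable_snd).mul (by
        refine Measurable.ennreal_ofReal ?_
        have : Continuous fun q : Phase d × E d =>
          |(ε * ‖q.1.2 + q.2‖) ^ k - (ε * ‖q.1.2‖) ^ k| := by fun_prop
        exact this.measurable)) (hw.enorm.comp (by fun_prop)))
  have m2 : Measurable fun z : Phase d => ENNReal.ofReal (wt k ε z.2) * ‖w z‖ₑ ^ 2 :=
    ((measurable_wt k ε).comp measurable_snd).ennreal_ofReal.mul (hw.enorm.pow_const 2)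
  rw [volume_phase, lintegral_prod _ (hJ.pow_const 2).aemeasurable, lintegral_prod _ m2.aemeasurable,
    ← lintegral_const_mul _ m2.lintegral_prod_right']
  refine lintegral_mono fun x => ?_
  simp only
  have hg : Measurable fun v => ‖w (x, v)‖ₑ :=
    (hw.comp (by fun_prop : Measurable fun v => (x, v))).enorm
  set A : ℝ := k * 2 ^ k with hA
  have hA0 : 0 ≤ A := by positivity
  refine (lintegral_conv_sq_le_wt (d := d) k ε hε.le
    (m := fun v y => ‖c y‖ₑ * ENNReal.ofReal |(ε * ‖v + y‖) ^ k - (ε * ‖v‖) ^ k|)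
    (α := fun y => ENNReal.ofReal (A * ε) * (ENNReal.ofReal ‖y‖ * ‖c y‖ₑ))
    (β := fun y => ENNReal.ofReal (A * ε ^ k) * (ENNReal.ofReal (‖y‖ ^ k) * ‖c y‖ₑ))
    (g := fun v => ‖w (x, v)‖ₑ) (by fun_prop) (by fun_prop) hg (fun v y => ?_)).trans ?_
  · calc ‖c y‖ₑ * ENNReal.ofReal |(ε * ‖v + y‖) ^ k - (ε * ‖v‖) ^ k|
        ≤ ‖c y‖ₑ * ENNReal.ofReal ((A * ε) * ‖y‖ * (1 + (ε * ‖v + y‖) ^ k) +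
            (A * ε ^ k) * ‖y‖ ^ k) := by
          gcongr
          refine (abs_pow_sub_pow_le_of_norm k hε.le v y).trans (le_of_eq ?_)
          rw [← hA]; ring
      _ = _ := by
          rw [ENNReal.ofReal_add (by positivity) (by positivity), ENNReal.ofReal_mul (by positivity),
            ENNReal.ofReal_mul (by positivity), ENNReal.ofReal_mul (p := A * ε ^ k) (by positivity)]
          ring
  · gcongr
    rw [lintegral_const_mul' _ _ ENNReal.ofReal_ne_top]
    simp_rw [mul_pow (ENNReal.ofReal (A * ε ^ k))]
    rw [lintegral_const_mul' _ _ (by simp), mul_pow, lintegral_inv_wt k hε]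
    have b1 := lintegral_norm_mul_kernel_sq_le k hc
    have b2 := (lintegral_pow_mul_kernel_sq_le k c).trans (cw_le_cw_succ k c)
    have e1 : ENNReal.ofReal (A * ε) ^ 2 ≤ ENNReal.ofReal (A ^ 2 * ε) := by
      rw [← ENNReal.ofReal_pow (by positivity)]
      refine ENNReal.ofReal_le_ofReal ?_
      rw [mul_pow]
      have : ε ^ 2 ≤ ε := by nlinarith
      gcongr
    have e2 : ENNReal.ofReal (A * ε ^ k) ^ 2 * ENNReal.ofReal (ε⁻¹ ^ d) ≤
        ENNReal.ofReal (A ^ 2 * ε) := by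
      rw [← ENNReal.ofReal_pow (by positivity), ← ENNReal.ofReal_mul (by positivity)]
      refine ENNReal.ofReal_le_ofReal ?_
      rw [mul_pow, mul_assoc]
      gcongr
      rw [← pow_mul, mul_comm k 2, inv_pow, ← div_eq_mul_inv, div_le_iff₀ (by positivity),
        ← pow_succ']
      -- The assumption $d<2k$ enters here as $d+1\le2k$.
      exact pow_le_pow_of_le_one hε.le hε1 (by omega)
    calc 4 * (ENNReal.ofReal (A * ε) ^ 2 * (∫⁻ y, ENNReal.ofReal ‖y‖ * ‖c y‖ₑ) ^ 2) +
          2 * ((ENNReal.ofReal (A * ε ^ k) ^ 2 *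
            ∫⁻ y, (ENNReal.ofReal (‖y‖ ^ k) * ‖c y‖ₑ) ^ 2) *
            (ENNReal.ofReal (ε⁻¹ ^ d) * invWt d k))
        = 4 * (ENNReal.ofReal (A * ε) ^ 2 * (∫⁻ y, ENNReal.ofReal ‖y‖ * ‖c y‖ₑ) ^ 2) +
          2 * ((ENNReal.ofReal (A * ε ^ k) ^ 2 * ENNReal.ofReal (ε⁻¹ ^ d)) *
            ((∫⁻ y, (ENNReal.ofReal (‖y‖ ^ k) * ‖c y‖ₑ) ^ 2) * invWt d k)) := by ring
      _ ≤ 4 * (ENNReal.ofReal (A ^ 2 * ε) * (invWt d k * (2 * cw (k + 1) c))) +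
          2 * (ENNReal.ofReal (A ^ 2 * ε) * (2 * cw (k + 1) c * invWt d k)) := by gcongr
      _ = 12 * ENNReal.ofReal (A ^ 2 * ε) * (invWt d k * cw (k + 1) c) := by ring
      _ = _ := by
          rw [mul_assoc 12 (A ^ 2) ε, ENNReal.ofReal_mul (p := 12) (by norm_num),
            ENNReal.ofReal_ofNat]

end

/-! ### Dissipativity with respect to the rescaled weight -/

section

variable {d : ℕ}

theorem wt_mono {k : ℕ} {ε : ℝ} (hε : 0 ≤ ε) (hε1 : ε ≤ 1) (v : E d) : wt k ε v ≤ wt k 1 v := by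
  unfold wt; gcongr

theorem pow_mul_wt_le {k : ℕ} {ε : ℝ} (hε : 0 ≤ ε) (hε1 : ε ≤ 1) (v : E d) :
    ε ^ (2 * k) * wt k 1 v ≤ wt k ε v := by
  unfold wt
  rw [mul_pow, mul_pow, one_pow, one_mul]
  have := pow_le_one₀ hε hε1 (n := 2 * k)
  linarith

/-- Averaging the triple integral with its image under the flip cancels the skew-symmetric part and
leaves the factor $p(v)^2-p(v+y)^2$, where $p(v)=(\varepsilon|v|)^k$. This difference of squares
factorizes: one factor is the commutator estimated in `lintegral_commutator_le`, the other is
absorbed by the weight. The constant is $O(\sqrt\varepsilon)$. -/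
theorem theta_form_le {k : ℕ} (hk : d < 2 * k) (μ : ℝ) {ε : ℝ} (hε : 0 < ε) (hε1 : ε ≤ 1)
    {c : E d → ℂ} (hc : Measurable c) (hherm : ∀ y, c (-y) = starRingEnd ℂ (c y)) {b : ℝ}
    (hb : 0 ≤ b) (hcw : cw (k + 1) c ≤ ENNReal.ofReal b) {w : Phase d → ℝ} (hw : Measurable w)
    (hfin : FinW k w) :
    |∫ z : Phase d, convTheta μ c w z * (wt k ε z.2 * w z)| ≤
      Real.sqrt (12 * (k * 2 ^ k) ^ 2 * ε * ((invWt d k).toReal * b)) *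
        (∫⁻ z : Phase d, ENNReal.ofReal (wt k ε z.2) * ‖w z‖ₑ ^ 2).toReal := by
  have hcw' : cw k c < ⊤ := (cw_le_cw_succ k c).trans_lt
    (ENNReal.mul_lt_top (by simp) (hcw.trans_lt ENNReal.ofReal_lt_top))
  have hwtm : Measurable fun z : Phase d => wt k ε z.2 := (measurable_wt k ε).comp measurable_snd
  set N : ENNReal := ∫⁻ z : Phase d, ENNReal.ofReal (wt k ε z.2) * ‖w z‖ₑ ^ 2 with hN
  have hNtop : N < ⊤ := by
    refine lt_of_le_of_lt (lintegral_mono fun z => ?_) hfin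
    gcongr
    exact wt_mono hε.le hε1 _
  have hg : Measurable fun z : Phase d => wt k ε z.2 * w z := hwtm.mul hw
  have hgfin : ∫⁻ z : Phase d, ENNReal.ofReal (wt k 1 z.2)⁻¹ * ‖wt k ε z.2 * w z‖ₑ ^ 2 < ⊤ := by
    refine lt_of_le_of_lt (lintegral_mono fun z => ?_) hNtop
    simp only
    rw [enorm_mul, mul_pow, ← mul_assoc, Real.enorm_of_nonneg (wt_pos _ _ _).le,
      ← ENNReal.ofReal_pow (wt_pos _ _ _).le, ← ENNReal.ofReal_mul (inv_nonneg.2 (wt_pos _ _ _).le)]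
    gcongr
    rw [inv_mul_le_iff₀ (wt_pos _ _ _), sq]
    exact mul_le_mul_of_nonneg_right (wt_mono hε.le hε1 _) (wt_pos _ _ _).le
  set G : E d × Phase d → ℝ := fun p =>
    kerK μ c p.2.1 p.1 * w (p.2.1, p.2.2 + p.1) * (wt k ε p.2.2 * w p.2) with hG
  have hGi : Integrable G (volume.prod volume) :=
    integrable_pairing hk μ hc hcw' hw hfin hg hgfin
  rw [integral_convTheta_mul hk μ hc hcw' hw hfin hg hgfin]
  change |∫ p, G p ∂(volume.prod volume)| ≤ _
  have hσ := measurePreserving_flip (d := d)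
  have hGm : Measurable G := measurable_pairing μ hc hw hg
  have hflip : ∫ p, G p ∂(volume.prod volume) =
      ∫ p : E d × Phase d, G (-p.1, (p.2.1, p.2.2 + p.1)) ∂(volume.prod volume) := by
    conv_lhs => rw [← hσ.map_eq]
    rw [integral_map hσ.measurable.aemeasurable hGm.aestronglyMeasurable]
  have hGi' : Integrable (fun p : E d × Phase d => G (-p.1, (p.2.1, p.2.2 + p.1)))
      (volume.prod volume) := hσ.integrable_comp_of_integrable hGi
  have h2 : 2 * ∫ p, G p ∂(volume.prod volume) =
      ∫ p, (G p + G (-p.1, (p.2.1, p.2.2 + p.1))) ∂(volume.prod volume) := by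
    rw [integral_add hGi hGi', ← hflip]; ring
  -- `H` carries the factor $p(v)$ and its image under the flip carries $p(v+y)$. Their sum
  -- therefore bounds the integrand with $|p(v)-p(v+y)|\,(p(v)+p(v+y))$, and both have the same
  -- integral.
  set H : E d × Phase d → ENNReal := fun p =>
    ((‖c p.1‖ₑ * ENNReal.ofReal |(ε * ‖p.2.2 + p.1‖) ^ k - (ε * ‖p.2.2‖) ^ k|) *
      ‖w (p.2.1, p.2.2 + p.1)‖ₑ) * (ENNReal.ofReal ((ε * ‖p.2.2‖) ^ k) * ‖w p.2‖ₑ) with hH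
  have hHm : Measurable H := by
    have c1 : Continuous fun p : E d × Phase d =>
      |(ε * ‖p.2.2 + p.1‖) ^ k - (ε * ‖p.2.2‖) ^ k| := by fun_prop
    have c2 : Continuous fun p : E d × Phase d => (ε * ‖p.2.2‖) ^ k := by fun_prop
    have w1 : Measurable fun p : E d × Phase d => w (p.2.1, p.2.2 + p.1) := hw.comp (by fun_prop)
    exact (((hc.enorm.comp measurable_fst).mul c1.measurable.ennreal_ofReal).mul w1.enorm).mul
      (c2.measurable.ennreal_ofReal.mul (hw.enorm.comp measurable_snd))
  have hbound : ∀ p : E d × Phase d, ‖G p + G (-p.1, (p.2.1, p.2.2 + p.1))‖ₑ ≤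
      H p + H (-p.1, (p.2.1, p.2.2 + p.1)) := fun p => by
    have e : G p + G (-p.1, (p.2.1, p.2.2 + p.1)) =
        kerK μ c p.2.1 p.1 * w (p.2.1, p.2.2 + p.1) * w p.2 *
          (((ε * ‖p.2.2‖) ^ k - (ε * ‖p.2.2 + p.1‖) ^ k) *
            ((ε * ‖p.2.2‖) ^ k + (ε * ‖p.2.2 + p.1‖) ^ k)) := by
      simp only [hG, kerK_neg μ hherm, add_neg_cancel_right, Prod.mk.eta]
      unfold wt
      ring
    have e2 : H p + H (-p.1, (p.2.1, p.2.2 + p.1)) =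
        ‖c p.1‖ₑ * ‖w (p.2.1, p.2.2 + p.1)‖ₑ * ‖w p.2‖ₑ *
          (ENNReal.ofReal |(ε * ‖p.2.2‖) ^ k - (ε * ‖p.2.2 + p.1‖) ^ k| *
            (ENNReal.ofReal ((ε * ‖p.2.2‖) ^ k) + ENNReal.ofReal ((ε * ‖p.2.2 + p.1‖) ^ k))) := by
      simp only [hH, enorm_neg_eq hherm, add_neg_cancel_right, Prod.mk.eta]
      rw [abs_sub_comm ((ε * ‖p.2.2 + p.1‖) ^ k)]
      ring
    rw [e, e2, ← ENNReal.ofReal_add (by positivity) (by positivity)]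
    simp only [enorm_mul]
    rw [Real.enorm_eq_ofReal_abs ((ε * ‖p.2.2‖) ^ k - _),
      Real.enorm_of_nonneg (r := (ε * ‖p.2.2‖) ^ k + _) (by positivity)]
    gcongr
    exact enorm_kerK_le μ c _ _
  have hHN : (∫⁻ p, H p ∂(volume.prod volume)) ^ 2 ≤
      (ENNReal.ofReal (12 * (k * 2 ^ k) ^ 2 * ε) * (invWt d k * cw (k + 1) c)) * N * N := by
    rw [lintegral_prod_symm _ hHm.aemeasurable]
    have e : ∀ z : Phase d, ∫⁻ y, H (y, z) =
        (∫⁻ y, (‖c y‖ₑ * ENNReal.ofReal |(ε * ‖z.2 + y‖) ^ k - (ε * ‖z.2‖) ^ k|) *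
          ‖w (z.1, z.2 + y)‖ₑ) * (ENNReal.ofReal ((ε * ‖z.2‖) ^ k) * ‖w z‖ₑ) := fun z => by
      rw [← lintegral_mul_const' _ _ (ENNReal.mul_ne_top ENNReal.ofReal_ne_top enorm_ne_top)]
    simp_rw [e]
    refine (lintegral_mul_sq_le ?_ ?_).trans ?_
    · have hm : Measurable fun q : Phase d × E d => (‖c q.2‖ₑ * ENNReal.ofReal
          |(ε * ‖q.1.2 + q.2‖) ^ k - (ε * ‖q.1.2‖) ^ k|) * ‖w (q.1.1, q.1.2 + q.2)‖ₑ := by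
        have c1 : Continuous fun q : Phase d × E d =>
          |(ε * ‖q.1.2 + q.2‖) ^ k - (ε * ‖q.1.2‖) ^ k| := by fun_prop
        exact ((hc.enorm.comp measurable_snd).mul c1.measurable.ennreal_ofReal).mul
          (hw.enorm.comp (by fun_prop))
      exact hm.lintegral_prod_right'.aemeasurable
    · have c2 : Continuous fun z : Phase d => (ε * ‖z.2‖) ^ k := by fun_prop
      exact (c2.measurable.ennreal_ofReal.mul hw.enorm).aemeasurable
    · gcongr
      · exact lintegral_commutator_le k hk hε hε1 hc hw
      · refine lintegral_mono fun z => ?_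
        rw [mul_pow, ← ENNReal.ofReal_pow (by positivity)]
        gcongr
        unfold wt
        rw [← pow_mul, mul_comm k 2]
        linarith
  have hHflip : ∫⁻ p : E d × Phase d, H (-p.1, (p.2.1, p.2.2 + p.1)) ∂(volume.prod volume) =
      ∫⁻ p, H p ∂(volume.prod volume) := hσ.lintegral_comp hHm
  have hfinal : ‖∫ p, G p ∂(volume.prod volume)‖ₑ ≤ ∫⁻ p, H p ∂(volume.prod volume) := by
    have h3 : ‖2 * ∫ p, G p ∂(volume.prod volume)‖ₑ ≤ 2 * ∫⁻ p, H p ∂(volume.prod volume) := by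
      rw [h2]
      refine (enorm_integral_le_lintegral_enorm _).trans ((lintegral_mono hbound).trans ?_)
      rw [lintegral_add_left hHm, hHflip, two_mul]
    rw [enorm_mul, Real.enorm_of_nonneg (by norm_num : (0 : ℝ) ≤ 2), ENNReal.ofReal_ofNat] at h3
    exact (ENNReal.mul_le_mul_iff_right (by simp) (by simp)).1 h3
  set s : ℝ := 12 * (k * 2 ^ k) ^ 2 * ε * ((invWt d k).toReal * b) with hs
  have hs0 : 0 ≤ s := by positivity
  have hle : ‖∫ p, G p ∂(volume.prod volume)‖ₑ ^ 2 ≤ ENNReal.ofReal ((Real.sqrt s * N.toReal) ^ 2) := by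
    calc ‖∫ p, G p ∂(volume.prod volume)‖ₑ ^ 2 ≤ (∫⁻ p, H p ∂(volume.prod volume)) ^ 2 := by
          gcongr
      _ ≤ _ := hHN
      _ ≤ (ENNReal.ofReal (12 * (k * 2 ^ k) ^ 2 * ε) * (invWt d k * ENNReal.ofReal b)) * N * N := by
          gcongr
      _ = _ := by
          rw [mul_pow (Real.sqrt s), Real.sq_sqrt hs0, hs,
            ENNReal.ofReal_mul (q := N.toReal ^ 2) (by positivity),
            ENNReal.ofReal_mul (q := (invWt d k).toReal * b) (by positivity),
            ENNReal.ofReal_mul (p := (invWt d k).toReal) ENNReal.toReal_nonneg,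
            ENNReal.ofReal_toReal (invWt_lt_top hk).ne,
            ENNReal.ofReal_pow ENNReal.toReal_nonneg, ENNReal.ofReal_toReal hNtop.ne]
          ring
  rw [Real.enorm_eq_ofReal_abs, ← ENNReal.ofReal_pow (abs_nonneg _),
    ENNReal.ofReal_le_ofReal_iff (by positivity)] at hle
  exact le_of_sq_le_sq hle (by positivity)

/-- Multiplication by the bounded function `wt k ε / wt k 1`. -/
theorem exists_weight_operator (k : ℕ) {ε : ℝ} (hε : 0 ≤ ε) (hε1 : ε ≤ 1) :
    ∃ N : X d k →L[ℝ] X d k, ‖N‖ ≤ 1 ∧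
      ∀ w : X d k, N w =ᵐ[volume] fun z => (wt k 1 z.2)⁻¹ * wt k ε z.2 * w z := by
  have hm : Measurable fun z : Phase d => (wt k 1 z.2)⁻¹ * wt k ε z.2 :=
    ((measurable_wt k 1).comp measurable_snd).inv.mul ((measurable_wt k ε).comp measurable_snd)
  obtain ⟨T, hT, hTw⟩ := exists_clm_of_pointwise (μ := weightMeasure d k) (ν := weightMeasure d k)
    (fun w z => (wt k 1 z.2)⁻¹ * wt k ε z.2 * w z) (C := 1) zero_le_one
    (fun w hw _ => (hm.mul hw.measurable).aestronglyMeasurable)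
    (fun w hw _ => by
      rw [one_pow, ENNReal.ofReal_one, one_mul]
      refine lintegral_mono fun z => ?_
      simp only
      gcongr
      rw [enorm_mul]
      refine mul_le_of_le_one_left' ?_
      rw [Real.enorm_of_nonneg (mul_nonneg (inv_nonneg.2 (wt_pos _ _ _).le) (wt_pos _ _ _).le),
        ← ENNReal.ofReal_one]
      refine ENNReal.ofReal_le_ofReal ?_
      rw [inv_mul_le_iff₀ (wt_pos _ _ _), mul_one]
      exact wt_mono hε hε1 _)
    (fun w w' h => by filter_upwards [h] with z hz; rw [hz])
    (fun w w' _ _ _ _ => Eventually.of_forall fun z => by simp [mul_add])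
    (fun r w _ _ => Eventually.of_forall fun z => by simp; ring)
  refine ⟨T, hT, fun w => ?_⟩
  have := hTw w
  rwa [EventuallyEq, ae_weightMeasure] at this

theorem inner_X_eq {k : ℕ} (u w : X d k) :
    inner ℝ u w = ∫ z : Phase d, wt k 1 z.2 * (u z * w z) := by
  rw [L2.inner_def, integral_weightMeasure]
  refine integral_congr_ae (Eventually.of_forall fun z => ?_)
  simp [mul_comm]

/-- The form is the $L^2$ inner product with weight $1+(\varepsilon|v|)^{2k}$, realized as $\langle
N\cdot,\cdot\rangle$ in $X_k$. It is equivalent to the norm with lower constant $\varepsilon^{2k}$.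
The term $-\nu$ contributes exactly $-\nu$, and the convolution at most $\nu-\gamma$ once
$\varepsilon$ is small. The constants are fixed before the kernel, whose size enters only through
`b`. -/
theorem exists_dissipative {k : ℕ} (hk : d < 2 * k) (μ : ℝ) {b : ℝ} (hb : 0 ≤ b) {ν γ : ℝ}
    (hγ : γ < ν) :
    ∃ c₀ C₀ : ℝ, 0 < c₀ ∧ 0 ≤ C₀ ∧ ∀ c : E d → ℂ, Measurable c →
      (∀ y, c (-y) = starRingEnd ℂ (c y)) → cw (k + 1) c ≤ ENNReal.ofReal b →
      ∀ T : X d k →L[ℝ] X d k, (∀ w, T w =ᵐ[volume] convTheta μ c w) →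
        Dissipative c₀ C₀ γ (T - ν • 1) := by
  set A : ℝ := 12 * (k * 2 ^ k) ^ 2 * ((invWt d k).toReal * b) with hA
  have hA0 : 0 ≤ A := by positivity
  -- Makes $A\varepsilon\le(\nu-\gamma)^2$; the summand $1$ in the denominator covers $A=0$.
  set ε : ℝ := min 1 ((ν - γ) ^ 2 / (A + 1)) with hε
  have hδ : 0 < ν - γ := sub_pos.2 hγ
  have hε0 : 0 < ε := by positivity
  have hε1 : ε ≤ 1 := min_le_left _ _
  have hAε : Real.sqrt (12 * (k * 2 ^ k) ^ 2 * ε * ((invWt d k).toReal * b)) ≤ ν - γ := by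
    refine Real.sqrt_le_iff.2 ⟨hδ.le, ?_⟩
    have h1 : ε ≤ (ν - γ) ^ 2 / (A + 1) := min_le_right _ _
    rw [le_div_iff₀ (by positivity)] at h1
    have h2 : 12 * (k * 2 ^ k) ^ 2 * ε * ((invWt d k).toReal * b) = A * ε := by rw [hA]; ring
    rw [h2]
    nlinarith
  obtain ⟨N, hN, hNw⟩ := exists_weight_operator (d := d) k hε0.le hε1
  refine ⟨ε ^ (2 * k), 1, by positivity, zero_le_one, fun c hc hherm hcw T hT => ?_⟩
  have form : ∀ u w : X d k, inner ℝ (N u) w = ∫ z : Phase d, u z * (wt k ε z.2 * w z) :=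
    fun u w => by
      rw [inner_X_eq]
      refine integral_congr_ae ?_
      filter_upwards [hNw u] with z hz
      rw [hz]
      have := (wt_pos k 1 z.2).ne'
      field_simp
  have sqform : ∀ w : X d k, inner ℝ (N w) w =
      (∫⁻ z : Phase d, ENNReal.ofReal (wt k ε z.2) * ‖w z‖ₑ ^ 2).toReal := fun w => by
    have hwm : Measurable w := (Lp.stronglyMeasurable w).measurable
    rw [form, integral_eq_lintegral_of_nonneg_ae]
    · congr 1
      refine lintegral_congr fun z => ?_
      rw [← ofReal_norm, ← ENNReal.ofReal_pow (norm_nonneg _), ← ENNReal.ofReal_mul (wt_pos _ _ _).le]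
      congr 1
      rw [Real.norm_eq_abs, sq_abs]
      ring
    · refine Eventually.of_forall fun z => ?_
      have : 0 ≤ wt k ε z.2 * (w z * w z) := mul_nonneg (wt_pos _ _ _).le (mul_self_nonneg _)
      simp only [Pi.zero_apply]
      linarith
    · exact (hwm.mul (((measurable_wt k ε).comp measurable_snd).mul hwm)).aestronglyMeasurable
  refine ⟨(innerSL ℝ).comp N, ?_, ?_, ?_, ?_⟩
  · intro u w
    simp only [ContinuousLinearMap.comp_apply, innerSL_apply_apply, form]
    exact integral_congr_ae (Eventually.of_forall fun z => by simp only; ring)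
  · intro w
    simp only [ContinuousLinearMap.comp_apply, innerSL_apply_apply]
    have hnorm : ‖w‖ ^ 2 = (∫⁻ z : Phase d, ENNReal.ofReal (wt k 1 z.2) * ‖w z‖ₑ ^ 2).toReal := by
      rw [← lintegral_weightMeasure, ← enorm_sq_eq_lintegral, ENNReal.toReal_pow, toReal_enorm]
    rw [sqform, hnorm, ← ENNReal.toReal_ofReal (by positivity : 0 ≤ ε ^ (2 * k)),
      ← ENNReal.toReal_mul]
    refine ENNReal.toReal_mono ?_ ?_
    · refine ne_of_lt (lt_of_le_of_lt (lintegral_mono fun z => ?_) (MemLp.finW (Lp.memLp w)))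
      gcongr
      exact wt_mono hε0.le hε1 _
    · rw [← lintegral_const_mul' _ _ ENNReal.ofReal_ne_top]
      refine lintegral_mono fun z => ?_
      rw [← mul_assoc, ← ENNReal.ofReal_mul (by positivity)]
      gcongr
      exact pow_mul_wt_le hε0.le hε1 _
  · intro u w
    simp only [ContinuousLinearMap.comp_apply, innerSL_apply_apply]
    refine (abs_real_inner_le_norm _ _).trans ?_
    gcongr
    refine (N.le_opNorm u).trans ?_
    gcongr
  · intro w
    simp only [ContinuousLinearMap.comp_apply, innerSL_apply_apply, _root_.sub_apply,
      _root_.smul_apply, one_apply_eq_self, map_sub, map_smul]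
    have h1 : inner ℝ (N (T w)) w ≤ (ν - γ) * inner ℝ (N w) w := by
      have e : inner ℝ (N (T w)) w = ∫ z : Phase d, convTheta μ c w z * (wt k ε z.2 * w z) := by
        rw [form]
        refine integral_congr_ae ?_
        filter_upwards [hT w] with z hz
        rw [hz]
      rw [e, sqform]
      refine (le_abs_self _).trans ((theta_form_le hk μ hε0 hε1 hc hherm hb hcw
        (Lp.stronglyMeasurable w).measurable (MemLp.finW (Lp.memLp w))).trans ?_)
      gcongr
    simp only [smul_eq_mul]
    linarith

end

section

variable {d : ℕ}

/-! ### The Fourier transform on `L²` -/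

section Fourier

open FourierTransform SchwartzMap

/-- `g` is the Fourier transform of the square-integrable function `f`. -/
structure IsFT (f g : E d → ℂ) : Prop where
  left : MemLp f 2
  right : MemLp g 2
  pair : ∀ φ : 𝓢(E d, ℂ), ∫ x, g x * φ x = ∫ x, f x * 𝓕 φ x

theorem exists_isFT {f : E d → ℂ} (hf : MemLp f 2) :
    ∃ g, Measurable g ∧ IsFT f g ∧ ∫⁻ x, ‖g x‖ₑ ^ 2 = ∫⁻ x, ‖f x‖ₑ ^ 2 := by
  set F : Lp ℂ 2 (volume : Measure (E d)) := hf.toLp with hF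
  have hFf : F =ᵐ[volume] f := hf.coeFn_toLp
  refine ⟨(𝓕 F : Lp ℂ 2 (volume : Measure (E d))), (Lp.stronglyMeasurable _).measurable,
    ⟨hf, Lp.memLp _, fun φ => ?_⟩, ?_⟩
  · have h := congrArg (fun T => T φ) (Lp.fourier_toTemperedDistribution_eq F)
    simp only [TemperedDistribution.fourier_apply, Lp.toTemperedDistribution_apply] at h
    calc ∫ x, (𝓕 F : Lp ℂ 2 (volume : Measure (E d))) x * φ x = ∫ x, F x * 𝓕 φ x := by
          simpa [mul_comm] using h.symm
      _ = _ := by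
          refine integral_congr_ae ?_
          filter_upwards [hFf] with x hx
          rw [hx]
  · rw [← eLpNorm_two_sq, ← eLpNorm_two_sq, ← Lp.enorm_def]
    congr 1
    rw [← ofReal_norm, Lp.norm_fourier_eq, ofReal_norm, hF, Lp.enorm_toLp]

theorem ae_eq_of_schwartz {g g' : E d → ℂ} (hg : LocallyIntegrable g) (hg' : LocallyIntegrable g')
    (h : ∀ φ : 𝓢(E d, ℂ), ∫ x, g x * φ x = ∫ x, g' x * φ x) : g =ᵐ[volume] g' := by
  refine ae_eq_of_integral_contDiff_smul_eq hg hg' fun φ hφ hs => ?_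
  have hs' : HasCompactSupport fun x => (φ x : ℂ) := hs.comp_left (g := Complex.ofReal) (by simp)
  have := h (hs'.toSchwartzMap (Complex.ofRealCLM.contDiff.comp hφ))
  have e : ∀ x, (hs'.toSchwartzMap (Complex.ofRealCLM.contDiff.comp hφ)) x = (φ x : ℂ) :=
    fun x => rfl
  simp_rw [e] at this
  simpa [mul_comm] using this

theorem locallyIntegrable_of_memLp_two {F : Type*} [NormedAddCommGroup F] {f : E d → F}
    (h : MemLp f 2) : LocallyIntegrable f :=
  h.locallyIntegrable (by norm_num)

theorem IsFT.unique {f g g' : E d → ℂ} (h : IsFT f g) (h' : IsFT f g') : g =ᵐ[volume] g' :=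
  ae_eq_of_schwartz (locallyIntegrable_of_memLp_two h.right) (locallyIntegrable_of_memLp_two h'.right)
    fun φ => (h.pair φ).trans (h'.pair φ).symm

theorem IsFT.congr {f f' g g' : E d → ℂ} (h : IsFT f g) (hf : f =ᵐ[volume] f')
    (hg : g =ᵐ[volume] g') : IsFT f' g' := by
  refine ⟨h.left.ae_eq hf, h.right.ae_eq hg, fun φ => ?_⟩
  have e1 : ∫ x, g' x * φ x = ∫ x, g x * φ x :=
    integral_congr_ae (by filter_upwards [hg] with x hx; rw [hx])
  have e2 : ∫ x, f' x * 𝓕 φ x = ∫ x, f x * 𝓕 φ x :=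
    integral_congr_ae (by filter_upwards [hf] with x hx; rw [hx])
  rw [e1, e2, h.pair]

theorem integral_fourier_mul_eq {f g : E d → ℂ} (hf : Integrable f) (hg : Integrable g) :
    ∫ x, 𝓕 f x * g x = ∫ x, f x * 𝓕 g x := by
  have := VectorFourier.integral_fourierIntegral_smul_eq_flip (μ := (volume : Measure (E d)))
    (ν := (volume : Measure (E d))) (L := innerₗ (E d)) (f := f) (g := g)
    Real.continuous_fourierChar continuous_inner hf hg
  simpa [Real.fourier_eq, VectorFourier.fourierIntegral, real_inner_comm] using this

theorem integral_fourierInv_mul_eq {f g : E d → ℂ} (hf : Integrable f) (hg : Integrable g) :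
    ∫ x, 𝓕⁻ f x * g x = ∫ x, f x * 𝓕⁻ g x := by
  have h := integral_fourier_mul_eq hf.comp_neg hg
  have e1 : 𝓕 (fun x => f (-x)) = 𝓕⁻ f := (Real.fourierInv_eq_fourier_comp_neg f).symm
  rw [e1] at h
  rw [h, ← integral_neg_eq_self]
  refine integral_congr_ae (Eventually.of_forall fun x => ?_)
  simp [Real.fourierInv_eq_fourier_neg]

/-- The transform defined by an integral and the one defined by duality agree on $L^1\cap L^2$,
since both satisfy the multiplication formula against Schwartz functions. -/
theorem isFT_of_integrable {f : E d → ℂ} (hf : Integrable f) (hf2 : MemLp f 2) :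
    IsFT f (𝓕 f) := by
  obtain ⟨g, -, hg, -⟩ := exists_isFT hf2
  have hcont : Continuous (𝓕 f) :=
    VectorFourier.fourierIntegral_continuous Real.continuous_fourierChar continuous_inner hf
  have : g =ᵐ[volume] 𝓕 f := by
    refine ae_eq_of_schwartz (locallyIntegrable_of_memLp_two hg.right) hcont.locallyIntegrable fun φ => ?_
    rw [hg.pair, integral_fourier_mul_eq hf φ.integrable, SchwartzMap.fourier_coe]
  exact hg.congr (ae_eq_refl _) this

theorem continuous_fourierInv_of_integrable {f : E d → ℂ} (hf : Integrable f) :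
    Continuous (𝓕⁻ f) := by
  rw [Real.fourierInv_eq_fourier_comp_neg]
  exact VectorFourier.fourierIntegral_continuous Real.continuous_fourierChar continuous_inner
    hf.comp_neg

theorem IsFT.ae_eq_fourierInv {f g : E d → ℂ} (h : IsFT f g) (hg : Integrable g) :
    f =ᵐ[volume] 𝓕⁻ g := by
  refine ae_eq_of_schwartz (locallyIntegrable_of_memLp_two h.left)
    (continuous_fourierInv_of_integrable hg).locallyIntegrable fun φ => ?_
  rw [integral_fourierInv_mul_eq hg φ.integrable]
  have := h.pair (𝓕⁻ φ)
  rw [FourierTransform.fourier_fourierInv_eq] at this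
  rw [← this, SchwartzMap.fourierInv_coe]

theorem ae_eq_fourierInv_fourier {f : E d → ℂ} (hf : Integrable f) (hf' : Integrable (𝓕 f)) :
    f =ᵐ[volume] 𝓕⁻ (𝓕 f) := by
  refine ae_eq_of_schwartz hf.locallyIntegrable
    (continuous_fourierInv_of_integrable hf').locallyIntegrable fun φ => ?_
  have h1 := integral_fourierInv_mul_eq hf' φ.integrable
  have h2 := integral_fourier_mul_eq hf (𝓕⁻ φ).integrable
  rw [h1, ← SchwartzMap.fourierInv_coe, h2, ← SchwartzMap.fourier_coe,
    FourierTransform.fourier_fourierInv_eq]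

/-- The multiplication formula holds when the second function is a Schwartz function; both sides are
continuous in it for the $L^2$ norm by Plancherel, so density extends it to all of $L^2$. -/
theorem IsFT.integral_mul {f g u v : E d → ℂ} (h : IsFT f g) (h' : IsFT u v) :
    ∫ x, g x * u x = ∫ x, f x * v x := by
  have key : ∀ U : Lp ℂ 2 (volume : Measure (E d)),
      inner ℂ (h.right.star.toLp) U = inner ℂ (h.left.star.toLp) (𝓕 U : Lp ℂ 2 (volume : Measure (E d))) := by
    intro U
    refine DenseRange.induction_on (p := fun U : Lp ℂ 2 (volume : Measure (E d)) =>
      inner ℂ (h.right.star.toLp) U = inner ℂ (h.left.star.toLp) (𝓕 U : Lp ℂ 2 (volume : Measure (E d))))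
      (SchwartzMap.denseRange_toLpCLM (p := 2) ENNReal.ofNat_ne_top) U ?_ ?_
    · refine isClosed_eq (by fun_prop) ?_
      exact continuous_const.inner (Lp.fourierTransformₗᵢ (E d) ℂ).continuous
    · intro φ
      simp only [toLpCLM_apply]
      have e : (𝓕 (φ.toLp 2) : Lp ℂ 2 (volume : Measure (E d))) = (𝓕 φ).toLp 2 :=
        SchwartzMap.toLp_fourier_eq φ
      rw [e, L2.inner_def, L2.inner_def]
      have e1 := h.pair φ
      have l : ∫ a, inner ℂ ((h.right.star.toLp : Lp ℂ 2 (volume : Measure (E d))) a) (φ.toLp 2 volume a) = ∫ x, g x * φ x := by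
        refine integral_congr_ae ?_
        filter_upwards [h.right.star.coeFn_toLp, φ.coeFn_toLp 2 volume] with x hx hy
        rw [hx, hy]
        simp [mul_comm]
      have r : ∫ a, inner ℂ ((h.left.star.toLp : Lp ℂ 2 (volume : Measure (E d))) a) ((𝓕 φ).toLp 2 volume a) = ∫ x, f x * 𝓕 φ x := by
        refine integral_congr_ae ?_
        filter_upwards [h.left.star.coeFn_toLp, (𝓕 φ).coeFn_toLp 2 volume] with x hx hy
        rw [hx, hy]
        simp [mul_comm]
      rw [l, r, e1]
  have h2 := key h'.left.toLp
  have hv : (𝓕 (h'.left.toLp) : Lp ℂ 2 (volume : Measure (E d))) =ᵐ[volume] v := by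
    have : IsFT u (𝓕 (h'.left.toLp) : Lp ℂ 2 (volume : Measure (E d))) := by
      refine ⟨h'.left, Lp.memLp _, fun φ => ?_⟩
      have h := congrArg (fun T => T φ) (Lp.fourier_toTemperedDistribution_eq h'.left.toLp)
      simp only [TemperedDistribution.fourier_apply, Lp.toTemperedDistribution_apply] at h
      calc ∫ x, (𝓕 (h'.left.toLp) : Lp ℂ 2 (volume : Measure (E d))) x * φ x = ∫ x, (h'.left.toLp : Lp ℂ 2 (volume : Measure (E d))) x * 𝓕 φ x := by
            simpa [mul_comm] using h.symm
        _ = _ := by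
            refine integral_congr_ae ?_
            filter_upwards [h'.left.coeFn_toLp] with x hx
            rw [hx]
    exact this.unique h'
  rw [L2.inner_def, L2.inner_def] at h2
  have l : ∫ a, inner ℂ ((h.right.star.toLp : Lp ℂ 2 (volume : Measure (E d))) a)
      ((h'.left.toLp : Lp ℂ 2 (volume : Measure (E d))) a) = ∫ x, g x * u x := by
    refine integral_congr_ae ?_
    filter_upwards [h.right.star.coeFn_toLp, h'.left.coeFn_toLp] with x hx hy
    rw [hx, hy]
    simp [mul_comm]
  have r : ∫ a, inner ℂ ((h.left.star.toLp : Lp ℂ 2 (volume : Measure (E d))) a) ((𝓕 (h'.left.toLp) : Lp ℂ 2 (volume : Measure (E d))) a) =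
      ∫ x, f x * v x := by
    refine integral_congr_ae ?_
    filter_upwards [h.left.star.coeFn_toLp, hv] with x hx hy
    rw [hx, hy]
    simp [mul_comm]
  rw [← l, ← r, h2]

end Fourier

end

section

/-! ### Weak derivatives -/

section WeakDerivatives

variable {F : Type*} [NormedAddCommGroup F] [NormedSpace ℝ F] [MeasureSpace F]

/-- `g` is the weak derivative of `u` along `b`. -/
def IsWeak (b : F) (u g : F → ℝ) : Prop :=
  ∀ φ : F → ℝ, ContDiff ℝ ∞ φ → HasCompactSupport φ →
    ∫ z, u z * fderiv ℝ φ z b = -∫ z, g z * φ z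

/-- Testing the derivative of order $j$ with $\partial_b\varphi$ and comparing signs. This allows
derivatives of higher order to be treated one direction at a time. -/
theorem HasWeakDeriv.isWeak_snoc {j : ℕ} {a : Fin j → F} {b : F} {u g g' : F → ℝ}
    (h : HasWeakDeriv a u g) (h' : HasWeakDeriv (Fin.snoc a b : Fin (j + 1) → F) u g') :
    IsWeak b g g' := by
  intro φ hφ hs
  have hφ1 : ContDiff ℝ ∞ fun z => fderiv ℝ φ z := hφ.fderiv_right (m := ∞) (by simp)
  have hφ' : ContDiff ℝ ∞ fun z => fderiv ℝ φ z b := hφ1.clm_apply contDiff_const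
  have e : ∀ z, iteratedFDeriv ℝ j (fun z => fderiv ℝ φ z b) z a =
      iteratedFDeriv ℝ (j + 1) φ z (Fin.snoc a b : Fin (j + 1) → F) := fun z => by
    rw [iteratedFDeriv_succ_apply_right, Fin.init_snoc, Fin.snoc_last]
    have := (ContinuousLinearMap.apply ℝ ℝ b).iteratedFDeriv_comp_left (i := j)
      (f := fun z => fderiv ℝ φ z) (x := z) (n := ∞) hφ1.contDiffAt (by exact_mod_cast le_top)
    have h2 := congrArg (fun T => T a) this
    exact h2
  have h1 := h.2.2 _ hφ' (hs.fderiv_apply ℝ b)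
  have h2 := h'.2.2 φ hφ hs
  simp_rw [e] at h1
  rw [h2, pow_succ] at h1
  have h3 : ((-1 : ℝ) ^ j) * ((-1 : ℝ) ^ j) = 1 := by
    rw [← mul_pow]; simp
  have h4 := congrArg (fun t => (-1 : ℝ) ^ j * t) h1
  simp only [← mul_assoc, h3, one_mul] at h4
  linarith

theorem eLpNorm_weakDeriv_le {ι : Type*} [Fintype ι] {dir : ι → F} {μ : Measure F} {n : ℕ} (u : F → ℝ)
    {j : ℕ} (hj : j ≤ n) (I : Fin j → ι) :
    (eLpNorm (weakDeriv (fun l => dir (I l)) u) 2 μ).toReal ≤ sobNorm dir μ n u := by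
  unfold sobNorm
  refine Real.le_sqrt_of_sq_le ?_
  refine le_trans ?_ (Finset.single_le_sum (f := fun j => ∑ I : Fin j → ι,
    (eLpNorm (weakDeriv (fun l => dir (I l)) u) 2 μ).toReal ^ 2)
    (fun _ _ => Finset.sum_nonneg fun _ _ => sq_nonneg _)
    (Finset.mem_range.2 (Nat.lt_succ_of_le hj)))
  exact Finset.single_le_sum (f := fun I : Fin j → ι =>
    (eLpNorm (weakDeriv (fun l => dir (I l)) u) 2 μ).toReal ^ 2)
    (fun _ _ => sq_nonneg _) (Finset.mem_univ I)

variable [FiniteDimensional ℝ F] [BorelSpace F]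

theorem HasWeakDeriv.unique {j : ℕ} {a : Fin j → F} {u g g' : F → ℝ}
    (h : HasWeakDeriv a u g) (h' : HasWeakDeriv a u g') : g =ᵐ[volume] g' := by
  refine ae_eq_of_integral_contDiff_smul_eq h.2.1 h'.2.1 fun φ hφ hs => ?_
  have h1 := (h.2.2 φ hφ hs).symm.trans (h'.2.2 φ hφ hs)
  have := mul_left_cancel₀ (pow_ne_zero j (by norm_num : (-1 : ℝ) ≠ 0)) h1
  simpa [mul_comm] using this

theorem HasWeakDeriv.ae_eq_of_zero {a : Fin 0 → F} {u g : F → ℝ} (h : HasWeakDeriv a u g) :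
    u =ᵐ[volume] g := by
  refine ae_eq_of_integral_contDiff_smul_eq h.1 h.2.1 fun φ hφ hs => ?_
  have h1 := h.2.2 φ hφ hs
  simpa [mul_comm] using h1

variable {ι : Type*}

/-- `weakDeriv` is an arbitrary choice, but weak derivatives are unique up to null sets, so the
chosen one inherits the integrability of the one provided by `MemSob`. -/
theorem MemSob.weakDeriv_spec {dir : ι → F} {μ : Measure F} {n : ℕ} {u : F → ℝ} (h : MemSob dir μ n u)
    (hμ : μ ≪ volume) {j : ℕ} (hj : j ≤ n) (I : Fin j → ι) :
    HasWeakDeriv (fun l => dir (I l)) u (weakDeriv (fun l => dir (I l)) u) ∧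
      MemLp (weakDeriv (fun l => dir (I l)) u) 2 μ := by
  obtain ⟨g, hg, hgL⟩ := h j hj I
  have hex : ∃ g, HasWeakDeriv (fun l => dir (I l)) u g := ⟨g, hg⟩
  have hw : HasWeakDeriv (fun l => dir (I l)) u (WignerBGK.weakDeriv (fun l => dir (I l)) u) := by
    unfold WignerBGK.weakDeriv
    rw [dif_pos hex]
    exact hex.choose_spec
  exact ⟨hw, hgL.ae_eq (hμ.ae_eq (hg.unique hw))⟩

end WeakDerivatives

/-! ### Cutoff functions -/

variable {d : ℕ}

/-- A fixed smooth bump function. -/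
def bump (d : ℕ) : ContDiffBump (0 : E d) := ⟨1, 2, zero_lt_one, one_lt_two⟩

/-- A smooth cutoff function which is `1` on the ball of radius `n + 1`. -/
def cutoff (n : ℕ) (x : E d) : ℝ := bump d (((n : ℝ) + 1)⁻¹ • x)

theorem contDiff_cutoff (n : ℕ) : ContDiff ℝ ∞ (cutoff n : E d → ℝ) :=
  (bump d).contDiff.comp (by fun_prop : ContDiff ℝ ∞ fun x : E d => ((n : ℝ) + 1)⁻¹ • x)

theorem hasCompactSupport_cutoff (n : ℕ) : HasCompactSupport (cutoff n : E d → ℝ) := by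
  have h : ((n : ℝ) + 1)⁻¹ ≠ 0 := by positivity
  exact (bump d).hasCompactSupport.comp_homeomorph (Homeomorph.smulOfNeZero _ h)

theorem abs_cutoff_le (n : ℕ) (x : E d) : |cutoff n x| ≤ 1 := by
  rw [cutoff, abs_of_nonneg (bump d).nonneg]
  exact (bump d).le_one

theorem tendsto_cutoff (x : E d) : Tendsto (fun n => cutoff n x) atTop (𝓝 1) := by
  have h1 : Tendsto (fun n : ℕ => ((n : ℝ) + 1)⁻¹ • x) atTop (𝓝 ((0 : ℝ) • x)) := by
    refine Tendsto.smul_const ?_ x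
    simpa using tendsto_one_div_add_atTop_nhds_zero_nat (𝕜 := ℝ)
  rw [zero_smul] at h1
  have h2 : (bump d) 0 = 1 :=
    (bump d).one_of_mem_closedBall (Metric.mem_closedBall_self (by simp [bump]))
  have h3 := ((bump d).continuous.tendsto 0).comp h1
  rw [h2] at h3
  exact h3

theorem exists_fderiv_cutoff_le (b : E d) :
    ∃ C : ℝ, 0 ≤ C ∧ ∀ n (x : E d), |fderiv ℝ (cutoff n : E d → ℝ) x b| ≤ C * ((n : ℝ) + 1)⁻¹ := by
  have hc : Continuous fun x => fderiv ℝ (bump d) x b :=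
    (((bump d).contDiff (n := 1)).continuous_fderiv (by simp)).clm_apply continuous_const
  obtain ⟨C, hC⟩ := hc.bounded_above_of_compact_support
    ((bump d).hasCompactSupport.fderiv_apply ℝ b)
  refine ⟨C, (norm_nonneg _).trans (hC 0), fun n x => ?_⟩
  have hd : HasFDerivAt (cutoff n : E d → ℝ)
      ((fderiv ℝ (bump d) (((n : ℝ) + 1)⁻¹ • x)).comp
        (((n : ℝ) + 1)⁻¹ • ContinuousLinearMap.id ℝ (E d))) x := by
    have h1 : HasFDerivAt (fun x : E d => ((n : ℝ) + 1)⁻¹ • x)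
        (((n : ℝ) + 1)⁻¹ • ContinuousLinearMap.id ℝ (E d)) x :=
      (((n : ℝ) + 1)⁻¹ • ContinuousLinearMap.id ℝ (E d)).hasFDerivAt
    exact HasFDerivAt.comp x
      (((bump d).contDiff (n := 1)).differentiable (by simp) _).hasFDerivAt h1
  rw [hd.fderiv]
  simp only [ContinuousLinearMap.comp_apply, _root_.smul_apply, ContinuousLinearMap.id_apply,
    map_smul, smul_eq_mul, abs_mul]
  rw [abs_of_nonneg (by positivity : (0 : ℝ) ≤ ((n : ℝ) + 1)⁻¹), mul_comm]
  gcongr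
  exact hC _

/-- The test functions in the definition of a weak derivative need not have compact support. -/
theorem IsWeak.integral_eq {b : E d} {u g : E d → ℝ} (h : IsWeak b u g) (hu : MemLp u 2)
    (hg : MemLp g 2) {ψ : E d → ℝ} (hψ : ContDiff ℝ ∞ ψ) (hψ2 : MemLp ψ 2)
    (hψ' : MemLp (fun x => fderiv ℝ ψ x b) 2) :
    ∫ x, u x * fderiv ℝ ψ x b = -∫ x, g x * ψ x := by
  obtain ⟨C, hC0, hC⟩ := exists_fderiv_cutoff_le b
  have hder : ∀ n x, fderiv ℝ (fun x => cutoff n x * ψ x) x b =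
      cutoff n x * fderiv ℝ ψ x b + fderiv ℝ (cutoff n : E d → ℝ) x b * ψ x := fun n x => by
    rw [fderiv_fun_mul ((contDiff_cutoff n).differentiable (by simp) x)
      (hψ.differentiable (by simp) x)]
    simp [mul_comm]
  have heq : ∀ n, ∫ x, (u x * (cutoff n x * fderiv ℝ ψ x b) +
      u x * (fderiv ℝ (cutoff n : E d → ℝ) x b * ψ x)) = -∫ x, g x * (cutoff n x * ψ x) := fun n => by
    rw [← h _ ((contDiff_cutoff n).mul hψ) (hasCompactSupport_cutoff n).mul_right]
    refine integral_congr_ae (Eventually.of_forall fun x => ?_)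
    simp only [hder]; ring
  have i1 : Integrable fun x => u x * fderiv ℝ ψ x b := hu.integrable_mul hψ'
  have i2 : Integrable fun x => u x * ψ x := hu.integrable_mul hψ2
  have i3 : Integrable fun x => g x * ψ x := hg.integrable_mul hψ2
  have hcc : ∀ n, Continuous (cutoff n : E d → ℝ) := fun n => (contDiff_cutoff n).continuous
  have hcf : ∀ n, Continuous fun x : E d => fderiv ℝ (cutoff n : E d → ℝ) x b := fun n =>
    ((contDiff_cutoff n).continuous_fderiv (by simp)).clm_apply continuous_const
  have l1 : Tendsto (fun n => ∫ x, (u x * (cutoff n x * fderiv ℝ ψ x b) +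
      u x * (fderiv ℝ (cutoff n : E d → ℝ) x b * ψ x))) atTop (𝓝 (∫ x, u x * fderiv ℝ ψ x b)) := by
    refine tendsto_integral_of_dominated_convergence
      (fun x => ‖u x * fderiv ℝ ψ x b‖ + C * ‖u x * ψ x‖) (fun n => ?_)
      (i1.norm.add (i2.norm.const_mul C)) (fun n => Eventually.of_forall fun x => ?_)
      (Eventually.of_forall fun x => ?_)
    · exact (hu.1.mul ((hcc n).aestronglyMeasurable.mul hψ'.1)).add
        (hu.1.mul ((hcf n).aestronglyMeasurable.mul hψ2.1))
    · refine (norm_add_le _ _).trans (add_le_add ?_ ?_)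
      · rw [mul_left_comm, norm_mul]
        exact mul_le_of_le_one_left (norm_nonneg _) (abs_cutoff_le n x)
      · rw [mul_left_comm, norm_mul]
        gcongr
        refine (hC n x).trans (mul_le_of_le_one_right hC0 ?_)
        exact inv_le_one_of_one_le₀ (by linarith [n.cast_nonneg (α := ℝ)])
    · have h1 := (tendsto_cutoff x).mul_const (fderiv ℝ ψ x b)
      have h2 : Tendsto (fun n => fderiv ℝ (cutoff n : E d → ℝ) x b) atTop (𝓝 0) := by
        refine squeeze_zero_norm (fun n => hC n x) ?_
        have := (tendsto_one_div_add_atTop_nhds_zero_nat (𝕜 := ℝ)).const_mul C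
        simpa using this
      have h3 := (h1.const_mul (u x)).add ((h2.mul_const (ψ x)).const_mul (u x))
      simpa using h3
  have l2 : Tendsto (fun n => -∫ x, g x * (cutoff n x * ψ x)) atTop (𝓝 (-∫ x, g x * ψ x)) := by
    refine Tendsto.neg (tendsto_integral_of_dominated_convergence (fun x => ‖g x * ψ x‖)
      (fun n => ?_) i3.norm (fun n => Eventually.of_forall fun x => ?_)
      (Eventually.of_forall fun x => ?_))
    · exact hg.1.mul ((hcc n).aestronglyMeasurable.mul hψ2.1)
    · rw [mul_left_comm, norm_mul]
      exact mul_le_of_le_one_left (norm_nonneg _) (abs_cutoff_le n x)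
    · have h1 := ((tendsto_cutoff x).mul_const (ψ x)).const_mul (g x)
      simpa using h1
  simp_rw [heq] at l1
  exact tendsto_nhds_unique l1 l2

section Fourier

open FourierTransform SchwartzMap LineDeriv

/-- Weak derivatives are tested with real functions, so the real and imaginary parts of the Schwartz
function are inserted separately; compact support is removed by `IsWeak.integral_eq`. -/
theorem IsWeak.integral_schwartz {b : E d} {u g : E d → ℝ} (h : IsWeak b u g) (hu : MemLp u 2)
    (hg : MemLp g 2) (φ : 𝓢(E d, ℂ)) :
    ∫ x, (u x : ℂ) * (∂_{b} φ) x = -∫ x, (g x : ℂ) * φ x := by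
  have i1 : Integrable fun x => (u x : ℂ) * (∂_{b} φ) x :=
    MemLp.integrable_mul hu.ofReal ((∂_{b} φ).memLp 2)
  have i2 : Integrable fun x => (g x : ℂ) * φ x :=
    MemLp.integrable_mul hg.ofReal (φ.memLp 2)
  have hφd : ∀ x, DifferentiableAt ℝ φ x := fun x => φ.differentiable x
  have part : ∀ L : ℂ →L[ℝ] ℝ,
      ∫ x, u x * L ((∂_{b} φ) x) = -∫ x, g x * L (φ x) := fun L => by
    have hd : ∀ x, fderiv ℝ (fun x => L (φ x)) x b = L ((∂_{b} φ) x) := fun x => by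
      have := (L.hasFDerivAt.comp x (hφd x).hasFDerivAt).fderiv
      have h2 : fderiv ℝ (fun x => L (φ x)) x = L.comp (fderiv ℝ φ x) := this
      rw [h2, SchwartzMap.lineDerivOp_apply_eq_fderiv]
      rfl
    have := h.integral_eq hu hg (ψ := fun x => L (φ x)) (L.contDiff.comp (φ.smooth ⊤))
      (L.comp_memLp' (φ.memLp 2)) (by
        simp_rw [hd]; exact L.comp_memLp' ((∂_{b} φ).memLp 2))
    simpa only [hd] using this
  have hre := part Complex.reCLM
  have him := part Complex.imCLM
  apply Complex.ext
  · have e1 := integral_re (𝕜 := ℂ) i1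
    have e2 := integral_re (𝕜 := ℂ) i2
    simp only [RCLike.re_eq_complex_re, Complex.re_ofReal_mul] at e1 e2
    rw [Complex.neg_re, ← e1, ← e2]
    exact hre
  · have e1 := integral_im (𝕜 := ℂ) i1
    have e2 := integral_im (𝕜 := ℂ) i2
    simp only [RCLike.im_eq_complex_im, Complex.im_ofReal_mul] at e1 e2
    rw [Complex.neg_im, ← e1, ← e2]
    exact him

/-- Test the weak derivative with $\mathcal F\varphi$ and use that $\partial_b\mathcal F\varphi$ is
the transform of $-2\pi i\langle\xi,b\rangle\varphi$. -/
theorem IsWeak.fourier_eq {b : E d} {u g : E d → ℝ} (h : IsWeak b u g) (hu : MemLp u 2)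
    (hg : MemLp g 2) {a a' : E d → ℂ} (ha : IsFT (fun x => (u x : ℂ)) a)
    (ha' : IsFT (fun x => (g x : ℂ)) a') :
    a' =ᵐ[volume] fun ξ => 2 * Real.pi * Complex.I * (inner ℝ ξ b : ℝ) * a ξ := by
  have hT : (fun ξ : E d => (inner ℝ ξ b : ℝ)).HasTemperateGrowth :=
    ((innerSL ℝ).flip b).hasTemperateGrowth
  refine ae_eq_of_schwartz (locallyIntegrable_of_memLp_two ha'.right) ?_ fun φ => ?_
  · have hc : ContinuousOn (fun ξ : E d => 2 * Real.pi * Complex.I * ((inner ℝ ξ b : ℝ) : ℂ)) univ := by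
      fun_prop
    have := (locallyIntegrableOn_univ.2 (locallyIntegrable_of_memLp_two ha.right)).continuousOn_mul
      hc isOpen_univ.isLocallyClosed
    rw [locallyIntegrableOn_univ] at this
    exact this
  · rw [ha'.pair]
    have h1 := h.integral_schwartz hu hg (𝓕 φ)
    rw [SchwartzMap.lineDerivOp_fourier_eq, ← ha.pair] at h1
    have h2 : ∫ x, (g x : ℂ) * 𝓕 φ x = -(-∫ x, (g x : ℂ) * 𝓕 φ x) := (neg_neg _).symm
    rw [h2, ← h1, ← integral_neg]
    refine integral_congr_ae (Eventually.of_forall fun ξ => ?_)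
    simp only [_root_.smul_apply, SchwartzMap.smulLeftCLM_apply_apply hT, smul_eq_mul,
      Complex.real_smul]
    ring

theorem IsFT.lintegral_eq {f g : E d → ℂ} (h : IsFT f g) :
    ∫⁻ x, ‖g x‖ₑ ^ 2 = ∫⁻ x, ‖f x‖ₑ ^ 2 := by
  obtain ⟨g', -, hg', e⟩ := exists_isFT h.left
  rw [← e]
  refine lintegral_congr_ae ?_
  filter_upwards [h.unique hg'] with x hx
  rw [hx]

end Fourier

end

/-! ### Potentials through the weighted norm of their Fourier transform -/

section

variable {d : ℕ}

theorem wt_mul_pow_le (k j : ℕ) (y : E d) : wt k 1 y * ‖y‖ ^ (2 * j) ≤ 2 * wt (k + j) 1 y := by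
  rw [wt_one, wt_one]
  have h0 := norm_nonneg y
  have e : ‖y‖ ^ (2 * (k + j)) = ‖y‖ ^ (2 * k) * ‖y‖ ^ (2 * j) := by ring
  have p1 : 0 ≤ ‖y‖ ^ (2 * k) := by positivity
  have p2 : 0 ≤ ‖y‖ ^ (2 * j) := by positivity
  rw [e]
  rcases le_total ‖y‖ 1 with h | h
  · have := pow_le_one₀ h0 h (n := 2 * j)
    nlinarith
  · have := one_le_pow₀ h (n := 2 * k)
    nlinarith

theorem cw_mul_le (k j : ℕ) {a g : E d → ℂ} {A : ℝ}
    (h : ∀ y, ‖g y‖ ≤ A * ‖y‖ ^ j * ‖a y‖) :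
    cw k g ≤ ENNReal.ofReal (2 * A ^ 2) * cw (k + j) a := by
  unfold cw
  rw [← lintegral_const_mul' _ _ ENNReal.ofReal_ne_top]
  refine lintegral_mono fun y => ?_
  simp only
  rw [← ofReal_norm (g y), ← ofReal_norm (a y), ← ENNReal.ofReal_pow (norm_nonneg _),
    ← ENNReal.ofReal_pow (norm_nonneg _), ← ENNReal.ofReal_mul (wt_pos _ _ _).le,
    ← ENNReal.ofReal_mul (wt_pos _ _ _).le, ← ENNReal.ofReal_mul (by positivity)]
  refine ENNReal.ofReal_le_ofReal ?_
  have h1 : ‖g y‖ ^ 2 ≤ A ^ 2 * ‖y‖ ^ (2 * j) * ‖a y‖ ^ 2 := by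
    calc ‖g y‖ ^ 2 ≤ (A * ‖y‖ ^ j * ‖a y‖) ^ 2 := by gcongr; exact h y
      _ = _ := by ring
  calc wt k 1 y * ‖g y‖ ^ 2 ≤ wt k 1 y * (A ^ 2 * ‖y‖ ^ (2 * j) * ‖a y‖ ^ 2) :=
        mul_le_mul_of_nonneg_left h1 (wt_pos _ _ _).le
    _ = (wt k 1 y * ‖y‖ ^ (2 * j)) * (A ^ 2 * ‖a y‖ ^ 2) := by ring
    _ ≤ (2 * wt (k + j) 1 y) * (A ^ 2 * ‖a y‖ ^ 2) := by
        exact mul_le_mul_of_nonneg_right (wt_mul_pow_le k j y) (by positivity)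
    _ = _ := by ring

theorem lintegral_enorm_lt_top_of_cw {k : ℕ} (hk : d < 2 * k) {a : E d → ℂ} (ha : Measurable a)
    (h : cw k a < ⊤) : ∫⁻ y, ‖a y‖ₑ < ⊤ := by
  have := (lintegral_kernel_sq_le k ha).trans_lt (ENNReal.mul_lt_top (invWt_lt_top hk) h)
  by_contra hcon
  rw [not_lt, top_le_iff] at hcon
  rw [hcon] at this
  simp at this

theorem integrable_of_cw {k : ℕ} (hk : d < 2 * k) {a : E d → ℂ} (ha : Measurable a)
    (h : cw k a < ⊤) : Integrable a :=
  ⟨ha.aestronglyMeasurable, lintegral_enorm_lt_top_of_cw hk ha h⟩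

theorem integral_norm_le_of_cw {k : ℕ} (hk : d < 2 * k) {a : E d → ℂ} (ha : Measurable a) {b : ℝ}
    (hb : 0 ≤ b) (h : cw k a ≤ ENNReal.ofReal b) :
    ∫ y, ‖a y‖ ≤ Real.sqrt ((invWt d k).toReal * b) := by
  rw [integral_norm_eq_lintegral_enorm ha.aestronglyMeasurable]
  refine Real.le_sqrt_of_sq_le ?_
  rw [← ENNReal.toReal_pow]
  have h1 := (lintegral_kernel_sq_le k ha).trans (mul_le_mul_right h (invWt d k))
  have h2 := ENNReal.toReal_mono
    (ENNReal.mul_ne_top (invWt_lt_top hk).ne ENNReal.ofReal_ne_top) h1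
  rwa [ENNReal.toReal_mul, ENNReal.toReal_ofReal hb] at h2

/-- The power mean inequality. Because of it, only the pure derivatives of top order are needed to
control $|\xi|^{2(n+1)}$. -/
theorem norm_pow_le_sum (n : ℕ) (ξ : E d) :
    ‖ξ‖ ^ (2 * (n + 1)) ≤ (d : ℝ) ^ n * ∑ i, |ξ i| ^ (2 * (n + 1)) := by
  have h := pow_sum_div_card_le_sum_pow (s := (Finset.univ : Finset (Fin d)))
    (f := fun i => |ξ i| ^ 2) (fun i _ => by positivity) n
  rw [pow_mul, EuclideanSpace.real_norm_sq_eq]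
  simp only [sq_abs, Finset.card_univ, Fintype.card_fin] at h
  simp_rw [pow_mul, sq_abs]
  rcases Nat.eq_zero_or_pos d with rfl | hd
  · simp
  · rw [div_le_iff₀ (by positivity)] at h
    linarith

/-- The symbol of the derivative with multi-index `I`. -/
def symbol {j : ℕ} (I : Fin j → Fin d) (ξ : E d) : ℂ :=
  ∏ l, (2 * Real.pi * Complex.I * (ξ (I l) : ℝ))

theorem continuous_symbol {j : ℕ} (I : Fin j → Fin d) : Continuous (symbol I) := by
  unfold symbol
  fun_prop

theorem norm_symbol {j : ℕ} (I : Fin j → Fin d) (ξ : E d) :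
    ‖symbol I ξ‖ = ∏ l, (2 * Real.pi * |ξ (I l)|) := by
  unfold symbol
  rw [norm_prod]
  refine Finset.prod_congr rfl fun l _ => ?_
  simp [abs_of_pos Real.pi_pos]

theorem norm_symbol_le {j : ℕ} (I : Fin j → Fin d) (ξ : E d) :
    ‖symbol I ξ‖ ≤ (2 * Real.pi) ^ j * ‖ξ‖ ^ j := by
  rw [norm_symbol, ← mul_pow]
  calc ∏ l, (2 * Real.pi * |ξ (I l)|) ≤ ∏ _l : Fin j, (2 * Real.pi * ‖ξ‖) := by
        refine Finset.prod_le_prod (fun _ _ => by positivity) fun l _ => ?_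
        gcongr
        exact PiLp.norm_apply_le ξ (I l)
    _ = _ := by simp

/-- Induction on the order: the last direction is split off and contributes one factor $2\pi
i\,\xi_l$ by `IsWeak.fourier_eq`. -/
theorem MemSob.fourier {n : ℕ} {V : E d → ℝ} (hV : MemHx n V) {a : E d → ℂ}
    (ha : IsFT (fun x => (V x : ℂ)) a) {j : ℕ} (hj : j ≤ n) (I : Fin j → Fin d) :
    IsFT (fun x => (weakDeriv (fun l => e (I l)) V x : ℂ)) fun ξ => symbol I ξ * a ξ := by
  induction j with
  | zero =>
    have h := (MemSob.weakDeriv_spec hV Measure.AbsolutelyContinuous.rfl hj I).1.ae_eq_of_zero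
    refine ha.congr ?_ (Eventually.of_forall fun ξ => by simp [symbol])
    filter_upwards [h] with x hx
    rw [← hx]
  | succ j ih =>
    have ih' := ih (by omega) (Fin.init I)
    have h1 := MemSob.weakDeriv_spec hV Measure.AbsolutelyContinuous.rfl (by omega : j ≤ n) (Fin.init I)
    have h2 := MemSob.weakDeriv_spec hV Measure.AbsolutelyContinuous.rfl hj I
    have e1 : (fun l => e (I l)) = (Fin.snoc (fun l => e (Fin.init I l)) (e (I (Fin.last j))) :
        Fin (j + 1) → E d) := by
      conv_lhs => rw [← Fin.snoc_init_self I]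
      exact Fin.comp_snoc e (Fin.init I) (I (Fin.last j))
    have h3 := h2.1
    have hw : IsWeak (e (I (Fin.last j))) (weakDeriv (fun l => e (Fin.init I l)) V)
        (weakDeriv (fun l => e (I l)) V) := by
      refine h1.1.isWeak_snoc ?_
      rw [← e1]
      exact h3
    obtain ⟨a', -, ha', -⟩ := exists_isFT (MemLp.ofReal (K := ℂ) h2.2)
    have h4 := hw.fourier_eq h1.2 h2.2 ih' ha'
    refine ha'.congr (ae_eq_refl _) (h4.trans (Eventually.of_forall fun ξ => ?_))
    simp only [symbol, Fin.prod_univ_castSucc, e, EuclideanSpace.inner_single_right, Fin.init]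
    simp
    ring

/-- `a` is the Fourier transform of the potential `V ∈ H^n_x`, with norm bounded through `b`. -/
structure IsPotential (n : ℕ) (b : ℝ) (V : E d → ℝ) (a : E d → ℂ) : Prop where
  meas : Measurable a
  ft : IsFT (fun x => (V x : ℂ)) a
  memHx : MemHx n V
  cw_le : cw n a ≤ ENNReal.ofReal b

/-- By Plancherel the weight $1+|\xi|^{2(n+1)}$ is paid for by $V$ itself and by the $d$ pure
derivatives of order $n+1$. Each has norm at most $R$, and the power mean inequality adds the factor
$d^n$. -/
theorem exists_isPotential (n : ℕ) {R : ℝ} {V : E d → ℝ} (hV : MemHx (n + 1) V)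
    (hR : normHx (n + 1) V ≤ R) :
    ∃ a, IsPotential (n + 1) (R ^ 2 + (d : ℝ) ^ n * (d * R ^ 2)) V a := by
  have hR0 : 0 ≤ R := (Real.sqrt_nonneg _).trans hR
  have hV0 := MemSob.weakDeriv_spec hV Measure.AbsolutelyContinuous.rfl (Nat.zero_le _) Fin.elim0
  have hV2 : MemLp V 2 := hV0.2.ae_eq hV0.1.ae_eq_of_zero.symm
  obtain ⟨a, ham, ha, -⟩ := exists_isFT (MemLp.ofReal (K := ℂ) hV2)
  refine ⟨a, ham, ha, hV, ?_⟩
  have bound : ∀ (j : ℕ) (hj : j ≤ n + 1) (I : Fin j → Fin d),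
      ∫⁻ ξ, ‖symbol I ξ * a ξ‖ₑ ^ 2 ≤ ENNReal.ofReal (R ^ 2) := fun j hj I => by
    rw [(MemSob.fourier hV ha hj I).lintegral_eq]
    have h2 := (MemSob.weakDeriv_spec hV Measure.AbsolutelyContinuous.rfl hj I).2
    have h1 := (eLpNorm_weakDeriv_le (dir := e (d := d)) (μ := volume) V hj I).trans hR
    rw [ENNReal.ofReal_pow hR0]
    have e1 : ∫⁻ x, ‖(weakDeriv (fun l => e (I l)) V x : ℂ)‖ₑ ^ 2 =
        eLpNorm (weakDeriv (fun l => e (I l)) V) 2 volume ^ 2 := by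
      rw [eLpNorm_two_sq]
      refine lintegral_congr fun x => ?_
      rw [← ofReal_norm, Complex.norm_real, ofReal_norm]
    rw [e1]
    gcongr
    exact ENNReal.le_ofReal_iff_toReal_le h2.2.ne hR0 |>.2 h1
  have b0 := bound 0 (Nat.zero_le _) Fin.elim0
  simp only [symbol, Finset.univ_eq_empty, Finset.prod_empty, one_mul] at b0
  unfold cw
  calc ∫⁻ ξ, ENNReal.ofReal (wt (n + 1) 1 ξ) * ‖a ξ‖ₑ ^ 2
      ≤ ∫⁻ ξ, (‖a ξ‖ₑ ^ 2 + ENNReal.ofReal ((d : ℝ) ^ n) *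
          ∑ i : Fin d, ‖symbol (fun _ : Fin (n + 1) => i) ξ * a ξ‖ₑ ^ 2) := by
        refine lintegral_mono fun ξ => ?_
        have hs : ∀ i : Fin d, ENNReal.ofReal (|ξ i| ^ (2 * (n + 1))) * ‖a ξ‖ₑ ^ 2 ≤
            ‖symbol (fun _ : Fin (n + 1) => i) ξ * a ξ‖ₑ ^ 2 := fun i => by
          rw [enorm_mul, mul_pow]
          gcongr
          rw [← ofReal_norm, ← ENNReal.ofReal_pow (norm_nonneg _), norm_symbol]
          refine ENNReal.ofReal_le_ofReal ?_
          simp only [Finset.prod_const, Finset.card_univ, Fintype.card_fin]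
          rw [mul_comm 2, pow_mul]
          gcongr
          -- The factors $2\pi\ge1$ in the symbol are simply dropped.
          have := Real.pi_gt_three
          nlinarith [abs_nonneg (ξ i)]
        calc ENNReal.ofReal (wt (n + 1) 1 ξ) * ‖a ξ‖ₑ ^ 2
            ≤ ENNReal.ofReal (1 + (d : ℝ) ^ n * ∑ i, |ξ i| ^ (2 * (n + 1))) * ‖a ξ‖ₑ ^ 2 := by
              gcongr
              rw [wt_one]
              have := norm_pow_le_sum n ξ
              linarith
          _ = ‖a ξ‖ₑ ^ 2 + ENNReal.ofReal ((d : ℝ) ^ n) *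
              ∑ i : Fin d, ENNReal.ofReal (|ξ i| ^ (2 * (n + 1))) * ‖a ξ‖ₑ ^ 2 := by
              rw [ENNReal.ofReal_add zero_le_one (by positivity), ENNReal.ofReal_mul (by positivity),
                ENNReal.ofReal_sum_of_nonneg (fun i _ => by positivity), ENNReal.ofReal_one, add_mul,
                one_mul, mul_assoc, Finset.sum_mul]
          _ ≤ _ := by
              gcongr with i
              exact hs i
    _ = (∫⁻ ξ, ‖a ξ‖ₑ ^ 2) + ENNReal.ofReal ((d : ℝ) ^ n) *
          ∑ i : Fin d, ∫⁻ ξ, ‖symbol (fun _ : Fin (n + 1) => i) ξ * a ξ‖ₑ ^ 2 := by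
        have hm : ∀ i : Fin d, Measurable fun ξ =>
            ‖symbol (fun _ : Fin (n + 1) => i) ξ * a ξ‖ₑ ^ 2 := fun i =>
          ((continuous_symbol _).measurable.mul ham).enorm.pow_const 2
        rw [lintegral_add_left (ham.enorm.pow_const 2), lintegral_const_mul' _ _ ENNReal.ofReal_ne_top,
          lintegral_finsetSum _ fun i _ => hm i]
    _ ≤ ENNReal.ofReal (R ^ 2) + ENNReal.ofReal ((d : ℝ) ^ n) *
          ∑ i : Fin d, ENNReal.ofReal (R ^ 2) := by
        gcongr with i
        exact bound (n + 1) le_rfl _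
    _ = _ := by
        rw [Finset.sum_const, Finset.card_univ, Fintype.card_fin, nsmul_eq_mul,
          ENNReal.ofReal_add (by positivity) (by positivity), ENNReal.ofReal_mul (p := (d : ℝ) ^ n) (by positivity),
          ENNReal.ofReal_mul (p := (d : ℝ)) (by positivity), ENNReal.ofReal_natCast]

end

section

variable {d : ℕ}

/-! ### The Fourier transform in the velocity -/

section FourierVelocity

open FourierTransform

/-- Passes from the unitary convention to the one with $2\pi$ in the exponent, in which the $L^2$
theory above is formulated. -/
theorem fourierV_eq (f : E d → ℂ) (η : E d) :
    fourierV f η = (((2 * Real.pi) ^ (-(d : ℝ) / 2) : ℝ) : ℂ) * 𝓕 f ((2 * Real.pi)⁻¹ • η) := by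
  rw [fourierV, Real.fourier_eq']
  congr 1
  refine integral_congr_ae (Eventually.of_forall fun v => ?_)
  simp only [smul_eq_mul, inner_smul_right]
  congr 2
  have : (Real.pi : ℂ) ≠ 0 := by exact_mod_cast Real.pi_ne_zero
  push_cast
  field_simp

theorem invFourierV_eq (g : E d → ℂ) (v : E d) :
    invFourierV g v = (((2 * Real.pi) ^ ((d : ℝ) / 2) : ℝ) : ℂ) *
      𝓕⁻ (fun ξ => g ((2 * Real.pi) • ξ)) v := by
  rw [invFourierV, Real.fourierInv_eq']
  have h := Measure.integral_comp_smul (volume : Measure (E d))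
    (fun η => Complex.exp (Complex.I * ((inner ℝ v η : ℝ) : ℂ)) * g η) (2 * Real.pi)
  have hp : (0 : ℝ) < 2 * Real.pi := by positivity
  rw [finrank_euclideanSpace, Fintype.card_fin, abs_of_pos (by positivity)] at h
  have e : ∀ ξ : E d, Complex.exp (((2 * Real.pi * inner ℝ ξ v : ℝ) : ℂ) * Complex.I) •
      g ((2 * Real.pi) • ξ) = Complex.exp (Complex.I * ((inner ℝ v ((2 * Real.pi) • ξ) : ℝ) : ℂ)) *
        g ((2 * Real.pi) • ξ) := fun ξ => by
    rw [inner_smul_right, real_inner_comm, smul_eq_mul, mul_comm Complex.I]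
  simp_rw [e, h, Complex.real_smul]
  rw [← mul_assoc, ← Complex.ofReal_mul]
  congr 2
  rw [← Real.rpow_natCast, ← Real.rpow_neg hp.le, ← Real.rpow_add hp]
  congr 1
  ring

theorem invFourierV_fourierV (f : E d → ℂ) : invFourierV (fourierV f) = 𝓕⁻ (𝓕 f) := by
  ext v
  rw [invFourierV_eq]
  have hp : (0 : ℝ) < 2 * Real.pi := by positivity
  have e : (fun ξ => fourierV f ((2 * Real.pi) • ξ)) =
      (((2 * Real.pi) ^ (-(d : ℝ) / 2) : ℝ) : ℂ) • 𝓕 f := by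
    ext ξ
    rw [fourierV_eq, smul_smul, inv_mul_cancel₀ hp.ne', one_smul]
    rfl
  have e2 : ∀ r : ℂ, 𝓕⁻ (r • 𝓕 f) v = r * 𝓕⁻ (𝓕 f) v := fun r => by
    simp only [Real.fourierInv_eq', Pi.smul_apply, smul_eq_mul, mul_left_comm _ r, integral_const_mul]
  rw [e, e2, ← mul_assoc, ← Complex.ofReal_mul, ← Real.rpow_add hp]
  simp [neg_div]

theorem integrable_fourierV_iff {f : E d → ℂ} : Integrable (fourierV f) ↔ Integrable (𝓕 f) := by
  have hp : (2 * Real.pi)⁻¹ ≠ 0 := by positivity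
  have hp' : (((2 * Real.pi) ^ (-(d : ℝ) / 2) : ℝ) : ℂ) ≠ 0 := by
    have : (0 : ℝ) < (2 * Real.pi) ^ (-(d : ℝ) / 2) := by positivity
    exact_mod_cast this.ne'
  have e : fourierV f = fun η => (((2 * Real.pi) ^ (-(d : ℝ) / 2) : ℝ) : ℂ) *
      𝓕 f ((2 * Real.pi)⁻¹ • η) := funext (fourierV_eq f)
  rw [e, integrable_const_mul_iff (isUnit_iff_ne_zero.2 hp'), integrable_comp_smul_iff _ _ hp]

theorem invFourierV_fourierV_ae_eq {f : E d → ℂ} (hf : Integrable f)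
    (hf' : Integrable (fourierV f)) : invFourierV (fourierV f) =ᵐ[volume] f := by
  rw [invFourierV_fourierV]
  exact (ae_eq_fourierInv_fourier hf (integrable_fourierV_iff.1 hf')).symm

theorem continuous_fourierV {f : E d → ℂ} (hf : Integrable f) : Continuous (fourierV f) := by
  have hcont : Continuous (𝓕 f) :=
    VectorFourier.fourierIntegral_continuous Real.continuous_fourierChar continuous_inner hf
  have e : fourierV f = fun η => (((2 * Real.pi) ^ (-(d : ℝ) / 2) : ℝ) : ℂ) *
      𝓕 f ((2 * Real.pi)⁻¹ • η) := funext (fourierV_eq f)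
  rw [e]
  fun_prop

theorem memLp_fourierV {f : E d → ℂ} (hf : Integrable f) (hf2 : MemLp f 2) :
    MemLp (fourierV f) 2 := by
  have h := (isFT_of_integrable hf hf2).right
  rw [memLp_two_iff_integrable_sq_norm h.1] at h
  rw [memLp_two_iff_integrable_sq_norm (continuous_fourierV hf).aestronglyMeasurable]
  have h1 := ((integrable_comp_smul_iff (volume : Measure (E d)) (fun ξ => ‖𝓕 f ξ‖ ^ 2)
    (R := (2 * Real.pi)⁻¹) (by positivity)).2 h).const_mul (((2 * Real.pi) ^ (-(d : ℝ) / 2)) ^ 2)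
  refine h1.congr (Eventually.of_forall fun η => ?_)
  simp only [fourierV_eq, norm_mul, mul_pow, Complex.norm_real, Real.norm_eq_abs, sq_abs]

theorem fourierV_congr {f g : E d → ℂ} (h : f =ᵐ[volume] g) : fourierV f = fourierV g := by
  ext η
  unfold fourierV
  congr 1
  refine integral_congr_ae ?_
  filter_upwards [h] with v hv
  rw [hv]

theorem invFourierV_congr {f g : E d → ℂ} (h : f =ᵐ[volume] g) : invFourierV f = invFourierV g := by
  ext η
  unfold invFourierV
  congr 1
  refine integral_congr_ae ?_
  filter_upwards [h] with v hv
  rw [hv]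

theorem integrable_exp_mul {f : E d → ℂ} (hf : Integrable f) (η : E d) :
    Integrable fun v => Complex.exp (-(Complex.I * ((inner ℝ v η : ℝ) : ℂ))) * f v := by
  refine hf.bdd_mul (c := 1) (Continuous.aestronglyMeasurable (by fun_prop))
    (Eventually.of_forall fun v => ?_)
  rw [← mul_neg, mul_comm, ← Complex.ofReal_neg, Complex.norm_exp_ofReal_mul_I]

theorem fourierV_add {f g : E d → ℂ} (hf : Integrable f) (hg : Integrable g) (η : E d) :
    fourierV (fun v => f v + g v) η = fourierV f η + fourierV g η := by
  unfold fourierV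
  rw [← mul_add, ← integral_add (integrable_exp_mul hf η) (integrable_exp_mul hg η)]
  simp_rw [mul_add]

theorem fourierV_const_mul (r : ℂ) (f : E d → ℂ) (η : E d) :
    fourierV (fun v => r * f v) η = r * fourierV f η := by
  unfold fourierV
  simp_rw [mul_left_comm _ r, integral_const_mul]
  ring

theorem fourierV_sum {ι : Type*} (s : Finset ι) {f : ι → E d → ℂ} (hf : ∀ i ∈ s, Integrable (f i)) (η : E d) :
    fourierV (fun v => ∑ i ∈ s, f i v) η = ∑ i ∈ s, fourierV (f i) η := by
  unfold fourierV
  simp_rw [Finset.mul_sum]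
  rw [integral_finsetSum s fun i hi => integrable_exp_mul (hf i hi) η, Finset.mul_sum]

theorem fourierV_fderiv {f : E d → ℂ} (hf : Integrable f) (hd : Differentiable ℝ f)
    (hf' : Integrable (fderiv ℝ f)) (b η : E d) :
    fourierV (fun v => fderiv ℝ f v b) η =
      Complex.I * ((inner ℝ η b : ℝ) : ℂ) * fourierV f η := by
  rw [fourierV_eq, fourierV_eq]
  have h := congrFun (Real.fourier_fderiv hf hd hf') ((2 * Real.pi)⁻¹ • η)
  have h1 := congrArg (fun T : E d →L[ℝ] ℂ => T b) h
  have h2 : (𝓕 (fderiv ℝ f) ((2 * Real.pi)⁻¹ • η)) b =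
      𝓕 (fun v => fderiv ℝ f v b) ((2 * Real.pi)⁻¹ • η) := by
    rw [Real.fourier_eq', Real.fourier_eq', ContinuousLinearMap.integral_apply]
    · simp
    · refine hf'.bdd_smul (φ := fun v => Complex.exp (((-2 * Real.pi *
          inner ℝ v ((2 * Real.pi)⁻¹ • η) : ℝ) : ℂ) * Complex.I)) 1
        (Continuous.aestronglyMeasurable (by fun_prop)) (Eventually.of_forall fun v => ?_)
      rw [Complex.norm_exp_ofReal_mul_I]
  simp only [h2] at h1
  rw [h1]
  simp only [VectorFourier.fourierSMulRight_apply]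
  simp
  have : (Real.pi : ℂ) ≠ 0 := by exact_mod_cast Real.pi_ne_zero
  field_simp
  rw [show (innerSL ℝ) η b = inner ℝ η b from rfl]
  ring

/-- Fourier transform of a velocity convolution. -/
theorem fourierV_conv {K g : E d → ℂ} (hK : Integrable K) (hg : Integrable g) (η : E d) :
    fourierV (fun v => ∫ y, K y * g (v + y)) η =
      (∫ y, K y * Complex.exp (Complex.I * ((inner ℝ y η : ℝ) : ℂ))) * fourierV g η := by
  have hmp : MeasurePreserving (fun z : E d × E d => (z.1, z.1 + z.2)) (volume.prod volume)
    (volume.prod volume) := measurePreserving_prod_add volume volume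
  have hint : Integrable (fun z : E d × E d => K z.1 * g (z.1 + z.2)) (volume.prod volume) :=
    hmp.integrable_comp_of_integrable (hK.mul_prod hg)
  have hint2 : Integrable (fun z : E d × E d =>
      Complex.exp (-(Complex.I * ((inner ℝ z.2 η : ℝ) : ℂ))) * (K z.1 * g (z.1 + z.2)))
      (volume.prod volume) := by
    refine hint.bdd_mul (c := 1) (Continuous.aestronglyMeasurable (by fun_prop))
      (Eventually.of_forall fun v => ?_)
    rw [← mul_neg, mul_comm, ← Complex.ofReal_neg, Complex.norm_exp_ofReal_mul_I]
  unfold fourierV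
  rw [mul_left_comm, ← integral_mul_const]
  congr 1
  have e1 : ∀ v, Complex.exp (-(Complex.I * ((inner ℝ v η : ℝ) : ℂ))) * ∫ y, K y * g (v + y) =
      ∫ y, Complex.exp (-(Complex.I * ((inner ℝ v η : ℝ) : ℂ))) * (K y * g (y + v)) := fun v => by
    rw [← integral_const_mul]
    simp_rw [add_comm v]
  simp_rw [e1]
  rw [integral_integral_swap (f := fun v y =>
    Complex.exp (-(Complex.I * ((inner ℝ v η : ℝ) : ℂ))) * (K y * g (y + v))) hint2.swap]
  refine integral_congr_ae (Eventually.of_forall fun y => ?_)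
  simp only
  rw [← integral_add_left_eq_self (fun v => Complex.exp (-(Complex.I * ((inner ℝ v η : ℝ) : ℂ))) * g v) y,
    ← integral_const_mul]
  refine integral_congr_ae (Eventually.of_forall fun v => ?_)
  simp only [inner_add_left]
  have : Complex.exp (-(Complex.I * ((inner ℝ v η : ℝ) : ℂ))) =
      Complex.exp (Complex.I * ((inner ℝ y η : ℝ) : ℂ)) *
        Complex.exp (-(Complex.I * ((inner ℝ y η + inner ℝ v η : ℝ) : ℂ))) := by
    rw [← Complex.exp_add]
    push_cast
    ring_nf
  rw [this]
  ring

end FourierVelocity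

end

section

variable {d : ℕ}

/-! ### The pseudo-differential operator as a velocity convolution -/

section Theta

open FourierTransform

/-- The scaling between the frequency of the potential and the velocity shift. -/
def scale (c : Constants) : ℝ := 2 * Real.pi * (c.hbar / (2 * c.m))

theorem scale_pos (c : Constants) : 0 < scale c := by
  have := c.hbar_pos
  have := c.m_pos
  unfold scale
  positivity

/-- The convolution kernel which belongs to a potential with Fourier transform `a`. -/
def thetaKernel (c : Constants) (a : E d → ℂ) (y : E d) : ℂ :=
  (((scale c ^ d * c.hbar)⁻¹ : ℝ) : ℂ) *
    (a ((scale c)⁻¹ • y) + starRingEnd ℂ (a (-((scale c)⁻¹ • y))))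

/-- The frequency scale `2m/ħ`. -/
def freq (c : Constants) : ℝ := 2 * c.m / c.hbar

theorem freq_mul_scale (c : Constants) : freq c * scale c = 2 * Real.pi := by
  have := c.hbar_pos.ne'
  have := c.m_pos.ne'
  unfold freq scale
  field_simp

theorem measurable_thetaKernel (c : Constants) {a : E d → ℂ} (ha : Measurable a) :
    Measurable (thetaKernel c a) := by
  unfold thetaKernel
  fun_prop

/-- The kernel is symmetrized with the conjugate by construction, so Hermitian symmetry holds
pointwise and not only almost everywhere, without appeal to the reality of the potential. -/
theorem thetaKernel_neg (c : Constants) (a : E d → ℂ) (y : E d) :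
    thetaKernel c a (-y) = starRingEnd ℂ (thetaKernel c a y) := by
  simp [thetaKernel, add_comm]

theorem lintegral_scale (c : Constants) (f : E d → ENNReal) :
    ∫⁻ y, f y = ENNReal.ofReal (scale c ^ d) * ∫⁻ ξ, f (scale c • ξ) := by
  have hs := scale_pos c
  have h := Measure.map_addHaar_smul (volume : Measure (E d)) hs.ne'
  have h1 : ∫⁻ ξ, f (scale c • ξ) = ∫⁻ y, f y ∂(Measure.map (scale c • ·) volume) :=
    ((Homeomorph.smulOfNeZero (scale c) hs.ne').measurableEmbedding.lintegral_map f).symm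
  rw [h1, h, lintegral_smul_measure, finrank_euclideanSpace, Fintype.card_fin,
    abs_of_pos (by positivity), smul_eq_mul, ← mul_assoc, ← ENNReal.ofReal_mul (by positivity),
    mul_inv_cancel₀ (by positivity), ENNReal.ofReal_one, one_mul]

theorem integral_scale {F : Type*} [NormedAddCommGroup F] [NormedSpace ℝ F] (c : Constants)
    (f : E d → F) : ∫ y, f y = (scale c ^ d) • ∫ ξ, f (scale c • ξ) := by
  have hs := scale_pos c
  rw [Measure.integral_comp_smul, finrank_euclideanSpace, Fintype.card_fin, smul_smul,
    abs_of_pos (by positivity), mul_inv_cancel₀ (by positivity), one_smul]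

/-- The bound for the kernel in terms of the bound for the potential. -/
def kernelBound (c : Constants) (d n : ℕ) : ℝ :=
  scale c ^ d * (1 + scale c ^ (2 * n)) * (4 * (scale c ^ d * c.hbar)⁻¹ ^ 2)

theorem kernelBound_nonneg (c : Constants) (d n : ℕ) : 0 ≤ kernelBound c d n := by
  have := (scale_pos c).le
  unfold kernelBound
  positivity

theorem wt_smul_le (n : ℕ) {s : ℝ} (hs : 0 ≤ s) (ξ : E d) :
    wt n 1 (s • ξ) ≤ (1 + s ^ (2 * n)) * wt n 1 ξ := by
  rw [wt_one, wt_one, norm_smul, Real.norm_of_nonneg hs, mul_pow]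
  have : 0 ≤ s ^ (2 * n) := by positivity
  have : 0 ≤ ‖ξ‖ ^ (2 * n) := by positivity
  nlinarith

theorem cw_thetaKernel_le (c : Constants) (n : ℕ) {a : E d → ℂ} (ha : Measurable a) {b : ℝ}
    (h : cw n a ≤ ENNReal.ofReal b) :
    cw n (thetaKernel c a) ≤ ENNReal.ofReal (kernelBound c d n * b) := by
  have hs := scale_pos c
  have hh := c.hbar_pos
  set C : ℝ := (scale c ^ d * c.hbar)⁻¹ with hC
  have hC0 : 0 < C := by positivity
  have hneg : ∫⁻ ξ : E d, ENNReal.ofReal (wt n 1 ξ) * ‖a (-ξ)‖ₑ ^ 2 = cw n a := by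
    rw [cw, ← lintegral_neg_eq_self]
    simp [wt]
  have hpt : ∀ ξ : E d, ENNReal.ofReal (wt n 1 (scale c • ξ)) *
      ‖thetaKernel c a (scale c • ξ)‖ₑ ^ 2 ≤ ENNReal.ofReal ((1 + scale c ^ (2 * n)) * (2 * C ^ 2)) *
        (ENNReal.ofReal (wt n 1 ξ) * ‖a ξ‖ₑ ^ 2 + ENNReal.ofReal (wt n 1 ξ) * ‖a (-ξ)‖ₑ ^ 2) := by
    intro ξ
    have e1 : ‖thetaKernel c a (scale c • ξ)‖ ≤ C * (‖a ξ‖ + ‖a (-ξ)‖) := by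
      rw [thetaKernel, smul_smul, inv_mul_cancel₀ hs.ne', one_smul, norm_mul, Complex.norm_real,
        Real.norm_of_nonneg hC0.le]
      gcongr
      refine (norm_add_le _ _).trans ?_
      rw [RCLike.norm_conj]
    have e2 : wt n 1 (scale c • ξ) * ‖thetaKernel c a (scale c • ξ)‖ ^ 2 ≤
        ((1 + scale c ^ (2 * n)) * (2 * C ^ 2)) *
          (wt n 1 ξ * ‖a ξ‖ ^ 2 + wt n 1 ξ * ‖a (-ξ)‖ ^ 2) := by
      have hw := wt_pos n 1 ξ
      calc wt n 1 (scale c • ξ) * ‖thetaKernel c a (scale c • ξ)‖ ^ 2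
          ≤ ((1 + scale c ^ (2 * n)) * wt n 1 ξ) * (C * (‖a ξ‖ + ‖a (-ξ)‖)) ^ 2 := by
            gcongr
            · exact wt_smul_le n hs.le ξ
        _ = ((1 + scale c ^ (2 * n)) * wt n 1 ξ * C ^ 2) * (‖a ξ‖ + ‖a (-ξ)‖) ^ 2 := by ring
        _ ≤ ((1 + scale c ^ (2 * n)) * wt n 1 ξ * C ^ 2) * (2 * (‖a ξ‖ ^ 2 + ‖a (-ξ)‖ ^ 2)) := by
            gcongr
            nlinarith [sq_nonneg (‖a ξ‖ - ‖a (-ξ)‖)]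
        _ = _ := by ring
    simp only [← ofReal_norm]
    have hw := (wt_pos n 1 ξ).le
    rw [← ENNReal.ofReal_pow (norm_nonneg _), ← ENNReal.ofReal_pow (norm_nonneg _),
      ← ENNReal.ofReal_pow (norm_nonneg _), ← ENNReal.ofReal_mul (wt_pos _ _ _).le,
      ← ENNReal.ofReal_mul (wt_pos _ _ _).le, ← ENNReal.ofReal_mul (wt_pos _ _ _).le,
      ← ENNReal.ofReal_add (by positivity) (by positivity), ← ENNReal.ofReal_mul (by positivity)]
    exact ENNReal.ofReal_le_ofReal e2
  calc cw n (thetaKernel c a) = ENNReal.ofReal (scale c ^ d) * ∫⁻ ξ : E d,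
        ENNReal.ofReal (wt n 1 (scale c • ξ)) * ‖thetaKernel c a (scale c • ξ)‖ₑ ^ 2 :=
        lintegral_scale c _
    _ ≤ ENNReal.ofReal (scale c ^ d) * (ENNReal.ofReal ((1 + scale c ^ (2 * n)) * (2 * C ^ 2)) *
        (cw n a + cw n a)) := by
        gcongr
        refine (lintegral_mono hpt).trans ?_
        have hm : Measurable fun ξ : E d => ENNReal.ofReal (wt n 1 ξ) * ‖a ξ‖ₑ ^ 2 :=
          ((measurable_wt n 1).ennreal_ofReal).mul (ha.enorm.pow_const 2)
        rw [lintegral_const_mul' _ _ ENNReal.ofReal_ne_top, lintegral_add_left hm, hneg]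
        rfl
    _ ≤ ENNReal.ofReal (scale c ^ d) * (ENNReal.ofReal ((1 + scale c ^ (2 * n)) * (2 * C ^ 2)) *
        (2 * ENNReal.ofReal b)) := by
        rw [← two_mul]
        gcongr
    _ = _ := by
        have e2 : (2 : ENNReal) = ENNReal.ofReal 2 := by simp
        rw [e2, ← ENNReal.ofReal_mul (by norm_num), ← ENNReal.ofReal_mul (by positivity),
          ← ENNReal.ofReal_mul (by positivity)]
        congr 1
        unfold kernelBound
        rw [← hC]
        ring

/-- The continuous representative of the potential with Fourier transform `a`. -/
def potential (a : E d → ℂ) (x : E d) : ℝ := (𝓕⁻ a x).re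

theorem continuous_potential {a : E d → ℂ} (ha : Integrable a) : Continuous (potential a) :=
  Complex.continuous_re.comp (continuous_fourierInv_of_integrable ha)

theorem IsFT.ae_eq_potential {V : E d → ℝ} {a : E d → ℂ} (h : IsFT (fun x => (V x : ℂ)) a)
    (ha : Integrable a) : V =ᵐ[volume] potential a := by
  filter_upwards [h.ae_eq_fourierInv ha] with x hx
  rw [potential, ← hx, Complex.ofReal_re]

/-- This identifies the multiplier of the velocity convolution. Put
$b(\xi)=\operatorname{Im}(e^{2\pi i\langle\xi,x\rangle}a(\xi))$. After rescaling, the kernel is a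
multiple of the odd part of $b$, and the difference of the two values of the potential is also an
integral of $b$. Both sides become multiples of $\int b(\xi)\sin(s\langle\xi,\eta\rangle)\,d\xi$
with $s$ = `scale c`. -/
theorem integral_kerK_exp (c : Constants) {a : E d → ℂ} (ha : Integrable a) (x η : E d) :
    ∫ y, ((kerK (freq c) (thetaKernel c a) x y : ℝ) : ℂ) *
        Complex.exp (Complex.I * ((inner ℝ y η : ℝ) : ℂ)) =
      Complex.I * ((deltaV c (potential a) x η : ℝ) : ℂ) := by
  have hs := scale_pos c
  have hh := c.hbar_pos
  set B : E d → ℂ := fun ξ => Complex.exp (((2 * Real.pi * inner ℝ ξ x : ℝ) : ℂ) * Complex.I) * a ξ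
    with hB
  set b : E d → ℝ := fun ξ => (B ξ).im with hb
  have hBi : Integrable B := ha.bdd_mul (c := 1) (Continuous.aestronglyMeasurable (by fun_prop))
    (Eventually.of_forall fun v => by rw [Complex.norm_exp_ofReal_mul_I])
  have hbi : Integrable fun ξ => (b ξ : ℂ) := hBi.im.ofReal
  set t : E d → ℝ := fun ξ => scale c * inner ℝ ξ η with ht
  have hker : ∀ ξ, kerK (freq c) (thetaKernel c a) x (scale c • ξ) =
      -(scale c ^ d * c.hbar)⁻¹ * (b ξ - b (-ξ)) := fun ξ => by
    have e1 : freq c * inner ℝ x (scale c • ξ) = 2 * Real.pi * inner ℝ ξ x := by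
      rw [inner_smul_right, ← mul_assoc, freq_mul_scale, real_inner_comm]
    rw [kerK, thetaKernel, smul_smul, inv_mul_cancel₀ hs.ne', one_smul, e1, hb, hB]
    simp only [inner_neg_left, mul_neg]
    rw [mul_comm Complex.I ((2 * Real.pi * inner ℝ ξ x : ℝ) : ℂ), Complex.exp_ofReal_mul_I,
      Complex.exp_ofReal_mul_I]
    simp only [Complex.mul_re, Complex.mul_im, Complex.add_re, Complex.add_im, Complex.ofReal_re,
      Complex.ofReal_im, Complex.I_re, Complex.I_im, Complex.conj_re, Complex.conj_im,
      Real.cos_neg, Real.sin_neg]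
    ring
  have hexp : ∀ r : ℝ, Integrable fun ξ : E d => Complex.exp (((r * t ξ : ℝ) : ℂ) * Complex.I) * (b ξ : ℂ) :=
    fun r => hbi.bdd_mul (c := 1) (Continuous.aestronglyMeasurable (by fun_prop))
      (Eventually.of_forall fun v => by rw [Complex.norm_exp_ofReal_mul_I])
  have hleft : ∫ y, ((kerK (freq c) (thetaKernel c a) x y : ℝ) : ℂ) *
        Complex.exp (Complex.I * ((inner ℝ y η : ℝ) : ℂ)) =
      -((c.hbar⁻¹ : ℝ) : ℂ) * ∫ ξ, (b ξ : ℂ) * (2 * Complex.I * (Real.sin (t ξ) : ℂ)) := by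
    rw [integral_scale c]
    simp_rw [hker, inner_smul_left]
    have i1 : Integrable fun ξ => Complex.exp (((t ξ : ℝ) : ℂ) * Complex.I) * (b ξ : ℂ) := by
      simpa using hexp 1
    have i2 : Integrable fun ξ => Complex.exp (((t ξ : ℝ) : ℂ) * Complex.I) * (b (-ξ) : ℂ) := by
      have := (hexp (-1)).comp_neg
      simpa [ht] using this
    have e2 : ∀ ξ : E d, ((-(scale c ^ d * c.hbar)⁻¹ * (b ξ - b (-ξ)) : ℝ) : ℂ) *
        Complex.exp (Complex.I * (((starRingEnd ℝ) (scale c) * inner ℝ ξ η : ℝ) : ℂ)) =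
        ((-(scale c ^ d * c.hbar)⁻¹ : ℝ) : ℂ) * (Complex.exp (((t ξ : ℝ) : ℂ) * Complex.I) * (b ξ : ℂ) -
          Complex.exp (((t ξ : ℝ) : ℂ) * Complex.I) * (b (-ξ) : ℂ)) := fun ξ => by
      simp only [ht, conj_trivial]
      push_cast
      ring_nf
    simp_rw [e2]
    rw [integral_const_mul, integral_sub i1 i2, ← integral_neg_eq_self
      (fun ξ => Complex.exp (((t ξ : ℝ) : ℂ) * Complex.I) * (b (-ξ) : ℂ)), ← integral_sub i1]
    · rw [Complex.real_smul, ← mul_assoc, ← Complex.ofReal_mul, ← Complex.ofReal_neg]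
      congr 1
      · congr 1
        field_simp
      · refine integral_congr_ae (Eventually.of_forall fun ξ => ?_)
        simp only [neg_neg]
        have : t (-ξ) = -t ξ := by simp [ht]
        rw [this, Complex.ofReal_neg, Complex.exp_mul_I, Complex.exp_mul_I, Complex.cos_neg,
          Complex.sin_neg, Complex.ofReal_sin]
        ring
    · have := hexp (-1)
      simpa [ht] using this
  have hright : potential a (x + (c.hbar / (2 * c.m)) • η) - potential a (x - (c.hbar / (2 * c.m)) • η)
      = -2 * ∫ ξ, b ξ * Real.sin (t ξ) := by
    have hi : ∀ z : E d, Integrable fun ξ =>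
        Complex.exp (((2 * Real.pi * inner ℝ ξ z : ℝ) : ℂ) * Complex.I) * a ξ := fun z =>
      ha.bdd_mul (c := 1) (Continuous.aestronglyMeasurable (by fun_prop))
        (Eventually.of_forall fun v => by rw [Complex.norm_exp_ofReal_mul_I])
    have hre : ∀ z : E d, potential a z = ∫ ξ,
        (Complex.exp (((2 * Real.pi * inner ℝ ξ z : ℝ) : ℂ) * Complex.I) * a ξ).re := fun z => by
      rw [potential, Real.fourierInv_eq']
      exact (integral_re (hi z)).symm
    have hi' : ∀ z : E d, Integrable fun ξ =>
        (Complex.exp (((2 * Real.pi * inner ℝ ξ z : ℝ) : ℂ) * Complex.I) * a ξ).re :=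
      fun z => (hi z).re
    rw [hre, hre, ← integral_sub (hi' _) (hi' _), ← integral_const_mul]
    refine integral_congr_ae (Eventually.of_forall fun ξ => ?_)
    have e3 : 2 * Real.pi * inner ℝ ξ (x + (c.hbar / (2 * c.m)) • η) =
        2 * Real.pi * inner ℝ ξ x + t ξ := by
      simp only [ht, inner_add_right, inner_smul_right, scale]; ring
    have e4 : 2 * Real.pi * inner ℝ ξ (x - (c.hbar / (2 * c.m)) • η) =
        2 * Real.pi * inner ℝ ξ x - t ξ := by
      simp only [ht, inner_sub_right, inner_smul_right, scale]; ring
    simp only [e3, e4, hb, hB, Complex.exp_ofReal_mul_I, Complex.mul_re, Complex.mul_im,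
      Complex.add_re, Complex.add_im, Complex.ofReal_re, Complex.ofReal_im, Complex.I_re,
      Complex.I_im, Real.cos_add, Real.sin_add, Real.cos_sub, Real.sin_sub]
    ring
  rw [hleft, deltaV, hright]
  have e5 : ∫ ξ, (b ξ : ℂ) * (2 * Complex.I * (Real.sin (t ξ) : ℂ)) =
      2 * Complex.I * ((∫ ξ, b ξ * Real.sin (t ξ) : ℝ) : ℂ) := by
    rw [← integral_complex_ofReal, ← integral_const_mul]
    refine integral_congr_ae (Eventually.of_forall fun ξ => ?_)
    push_cast
    ring
  rw [e5]
  push_cast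
  field_simp

end Theta

end

/-! ### Identification of the pseudo-differential operator with a velocity convolution -/

section

variable {d : ℕ}

theorem ae_slice {k : ℕ} (hk : d < 2 * k) {w : Phase d → ℝ} (hw : Measurable w) (hfin : FinW k w) :
    ∀ᵐ x : E d, (Integrable fun v => w (x, v)) ∧ MemLp (fun v => w (x, v)) 2 := by
  have hm : Measurable fun z : Phase d => ENNReal.ofReal (wt k 1 z.2) * ‖w z‖ₑ ^ 2 :=
    ((measurable_wt k 1).comp measurable_snd).ennreal_ofReal.mul (hw.enorm.pow_const 2)
  have h1 : ∫⁻ x : E d, ∫⁻ v : E d, ENNReal.ofReal (wt k 1 v) * ‖w (x, v)‖ₑ ^ 2 < ⊤ := by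
    have := hfin
    unfold FinW at this
    rwa [volume_phase, lintegral_prod _ hm.aemeasurable] at this
  filter_upwards [ae_lt_top hm.lintegral_prod_right' h1.ne] with x hx
  have hwx : Measurable fun v => w (x, v) := hw.comp measurable_prodMk_left
  refine ⟨⟨hwx.aestronglyMeasurable, ?_⟩, ?_⟩
  · have h2 := (lintegral_sq_le_wt k 1 hwx.enorm).trans_lt (ENNReal.mul_lt_top (invWt_lt_top hk) hx)
    by_contra hcon
    have hcon' : ∫⁻ v, ‖w (x, v)‖ₑ = ⊤ := by
      simpa [HasFiniteIntegral] using hcon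
    rw [hcon'] at h2
    simp at h2
  · refine memLp_two_of_lintegral_lt_top hwx.aestronglyMeasurable (lt_of_le_of_lt ?_ hx)
    refine lintegral_mono fun v => ?_
    refine le_mul_of_one_le_left (by simp) ?_
    rw [← ENNReal.ofReal_one]
    exact ENNReal.ofReal_le_ofReal (one_le_wt _ _ _)

theorem measurable_fourierV_slice {w : Phase d → ℝ} (hw : Measurable w) :
    Measurable fun z : Phase d => fourierV (fun v => ((w (z.1, v) : ℝ) : ℂ)) z.2 := by
  unfold fourierV
  refine measurable_const.mul ?_
  have h : StronglyMeasurable fun p : Phase d × E d =>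
      Complex.exp (-(Complex.I * ((inner ℝ p.2 p.1.2 : ℝ) : ℂ))) * ((w (p.1.1, p.2) : ℝ) : ℂ) := by
    refine Measurable.stronglyMeasurable (Measurable.mul (Continuous.measurable (by fun_prop)) ?_)
    exact Complex.measurable_ofReal.comp (hw.comp (by fun_prop))
  exact (h.integral_prod_right' (ν := (volume : Measure (E d)))).measurable

theorem measurable_invFourierV_slice {g : Phase d → ℂ} (hg : Measurable g) :
    Measurable fun z : Phase d => invFourierV (fun η => g (z.1, η)) z.2 := by
  unfold invFourierV
  refine measurable_const.mul ?_
  have h : StronglyMeasurable fun p : Phase d × E d =>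
      Complex.exp (Complex.I * ((inner ℝ p.1.2 p.2 : ℝ) : ℂ)) * g (p.1.1, p.2) := by
    refine Measurable.stronglyMeasurable (Measurable.mul (Continuous.measurable (by fun_prop)) ?_)
    exact hg.comp (by fun_prop)
  exact (h.integral_prod_right' (ν := (volume : Measure (E d)))).measurable

theorem measurable_deltaV (c : Constants) {V : E d → ℝ} (hV : Measurable V) :
    Measurable fun z : Phase d => deltaV c V z.1 z.2 := by
  unfold deltaV
  exact ((hV.comp (by fun_prop)).sub (hV.comp (by fun_prop))).div_const _

theorem measurable_theta (c : Constants) {V : E d → ℝ} (hV : Measurable V) {w : Phase d → ℝ}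
    (hw : Measurable w) : Measurable (theta c V w) := by
  refine Complex.measurable_re.comp (measurable_invFourierV_slice (g := fun z : Phase d =>
    Complex.I * ((deltaV c V z.1 z.2 : ℝ) : ℂ) *
      fourierV (fun v => ((w (z.1, v) : ℝ) : ℂ)) z.2) ?_)
  exact (measurable_const.mul (Complex.measurable_ofReal.comp (measurable_deltaV c hV))).mul
    (measurable_fourierV_slice hw)

theorem ae_comp_add_smul {p : E d → Prop} (h : ∀ᵐ x, p x) (x : E d) {r : ℝ} (hr : r ≠ 0) :
    ∀ᵐ η : E d, p (x + r • η) := by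
  have h1 := (quasiMeasurePreserving_add_left (volume : Measure (E d)) x).ae h
  have h2 : Measure.QuasiMeasurePreserving (fun η : E d => r • η) volume volume := by
    refine ⟨by fun_prop, ?_⟩
    rw [Measure.map_addHaar_smul _ hr]
    exact Measure.smul_absolutelyContinuous
  exact h2.ae h1

/-- For every fixed $x$ the exceptional set is null in $\eta$, because $\eta\mapsto
x\pm\frac{\hbar}{2m}\eta$ preserves null sets. Hence the operators do not depend on the
representative of $V$. -/
theorem deltaV_congr (c : Constants) {V V' : E d → ℝ} (h : V =ᵐ[volume] V') (x : E d) :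
    deltaV c V x =ᵐ[volume] deltaV c V' x := by
  have hr : c.hbar / (2 * c.m) ≠ 0 := by
    have := c.hbar_pos
    have := c.m_pos
    positivity
  filter_upwards [ae_comp_add_smul h x hr, ae_comp_add_smul h x (neg_ne_zero.2 hr)] with η h1 h2
  rw [neg_smul, ← sub_eq_add_neg] at h2
  rw [deltaV, deltaV, h1, h2]

theorem theta_congr_potential (c : Constants) {V V' : E d → ℝ} (h : V =ᵐ[volume] V')
    (w : Phase d → ℝ) : theta c V w = theta c V' w := by
  ext z
  unfold theta
  congr 1
  refine congrFun (invFourierV_congr ?_) _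
  filter_upwards [deltaV_congr c h z.1] with η hη
  rw [hη]

theorem theta_congr (c : Constants) (V : E d → ℝ) {w w' : Phase d → ℝ} (h : w =ᵐ[volume] w') :
    theta c V w =ᵐ[volume] theta c V w' := by
  filter_upwards [ae_phase_fst (ae_ae_of_ae_phase h)] with z hz
  unfold theta
  have : (fun v => ((w (z.1, v) : ℝ) : ℂ)) =ᵐ[volume] fun v => ((w' (z.1, v) : ℝ) : ℂ) := by
    filter_upwards [hz] with v hv
    rw [hv]
  rw [fourierV_congr this]

theorem density_congr {w w' : Phase d → ℝ} (h : w =ᵐ[volume] w') :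
    density w =ᵐ[volume] density w' := by
  filter_upwards [ae_ae_of_ae_phase h] with x hx
  exact integral_congr_ae hx

theorem integrable_kerK_fst (μ : ℝ) {a : E d → ℂ} (ha : Measurable a) (hi : Integrable a) (x : E d) :
    Integrable fun y => ((kerK μ a x y : ℝ) : ℂ) := by
  refine hi.mono (Complex.measurable_ofReal.comp
    ((measurable_kerK μ ha).comp measurable_prodMk_left)).aestronglyMeasurable
    (Eventually.of_forall fun y => ?_)
  rw [Complex.norm_real]
  exact abs_kerK_le μ a x y

theorem memLp_kerK_fst (μ : ℝ) {a : E d → ℂ} (ha : Measurable a) (hi : MemLp a 2) (x : E d) :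
    MemLp (fun y => ((kerK μ a x y : ℝ) : ℂ)) 2 := by
  refine hi.mono (Complex.measurable_ofReal.comp
    ((measurable_kerK μ ha).comp measurable_prodMk_left)).aestronglyMeasurable
    (Eventually.of_forall fun y => ?_)
  rw [Complex.norm_real]
  exact abs_kerK_le μ a x y

theorem memLp_of_cw {k : ℕ} {a : E d → ℂ} (ha : Measurable a) (h : cw k a < ⊤) : MemLp a 2 := by
  refine memLp_two_of_lintegral_lt_top ha.aestronglyMeasurable (lt_of_le_of_lt ?_ h)
  refine lintegral_mono fun v => ?_
  refine le_mul_of_one_le_left (by simp) ?_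
  rw [← ENNReal.ofReal_one]
  exact ENNReal.ofReal_le_ofReal (one_le_wt _ _ _)

theorem memLp_comp_neg {F : Type*} [NormedAddCommGroup F] {f : E d → F} (h : MemLp f 2) :
    MemLp (fun y => f (-y)) 2 :=
  h.comp_measurePreserving (Measure.measurePreserving_neg volume)

theorem cw_lt_top_thetaKernel (c : Constants) {k : ℕ} {a : E d → ℂ} (ha : Measurable a)
    (h : cw k a < ⊤) : cw k (thetaKernel c a) < ⊤ := by
  have := cw_thetaKernel_le c k ha (b := (cw k a).toReal) (ENNReal.ofReal_toReal h.ne).ge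
  exact this.trans_lt ENNReal.ofReal_lt_top

/-- Up to reflection and a constant, $i\,\delta V(x,\cdot)$ is the Fourier transform of the kernel
at $x$, which lies in $L^1\cap L^2$. With $\mathcal Fw\in L^2$ this makes $\delta V\,\mathcal Fw$
integrable. -/
theorem memLp_deltaV (c : Constants) {k : ℕ} (hk : d < 2 * k) {a : E d → ℂ} (ha : Measurable a)
    (h : cw k a < ⊤) (x : E d) :
    MemLp (fun η => Complex.I * ((deltaV c (potential a) x η : ℝ) : ℂ)) 2 := by
  have hcm := measurable_thetaKernel c ha
  have hcc := cw_lt_top_thetaKernel c ha h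
  have hK1 := integrable_kerK_fst (freq c) hcm (integrable_of_cw hk hcm hcc) x
  have hK2 := memLp_kerK_fst (freq c) hcm (memLp_of_cw hcm hcc) x
  have h1 := (memLp_comp_neg (memLp_fourierV hK1 hK2)).const_mul
    (((2 * Real.pi) ^ ((d : ℝ) / 2) : ℝ) : ℂ)
  refine h1.ae_eq (Eventually.of_forall fun η => ?_)
  simp only [fourierV]
  rw [← integral_kerK_exp c (integrable_of_cw hk ha h), ← mul_assoc, ← Complex.ofReal_mul,
    ← Real.rpow_add (by positivity), neg_div, add_neg_cancel, Real.rpow_zero, Complex.ofReal_one,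
    one_mul]
  refine integral_congr_ae (Eventually.of_forall fun y => ?_)
  simp only [inner_neg_right, Complex.ofReal_neg, mul_neg, neg_neg]
  ring

/-- The pseudo-differential operator acts on almost every fibre as a multiplier. -/
theorem fourierV_convTheta (c : Constants) {k : ℕ} (hk : d < 2 * k) {a : E d → ℂ} (ha : Measurable a)
    (h : cw k a < ⊤) {w : Phase d → ℝ} {x : E d} (hw : Integrable fun v => w (x, v)) (η : E d) :
    fourierV (fun v => ((convTheta (freq c) (thetaKernel c a) w (x, v) : ℝ) : ℂ)) η =
      Complex.I * ((deltaV c (potential a) x η : ℝ) : ℂ) *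
        fourierV (fun v => ((w (x, v) : ℝ) : ℂ)) η := by
  have hcm := measurable_thetaKernel c ha
  have hcc := cw_lt_top_thetaKernel c ha h
  rw [← integral_kerK_exp c (integrable_of_cw hk ha h)]
  refine Eq.trans ?_ (fourierV_conv
    (integrable_kerK_fst (freq c) hcm (integrable_of_cw hk hcm hcc) x) (hw.ofReal (𝕜 := ℂ)) η)
  congr 1
  ext v
  rw [convTheta, ← integral_complex_ofReal]
  push_cast
  rfl

/-- On almost every fibre the transform of the convolution is $i\,\delta V\,\mathcal Fw$. This is a
product of two $L^2$ functions, hence integrable, so the literal inverse transform in `theta`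
recovers the convolution. -/
theorem theta_ae_eq_convTheta (c : Constants) {k : ℕ} (hk : d < 2 * k) {V : E d → ℝ} {a : E d → ℂ}
    (ha : Measurable a) (h : cw k a < ⊤) (hV : IsFT (fun x => (V x : ℂ)) a) {w : Phase d → ℝ}
    (hw : MemLp w 2 (weightMeasure d k)) :
    theta c V w =ᵐ[volume] convTheta (freq c) (thetaKernel c a) w := by
  have hai := integrable_of_cw hk ha h
  have hcm := measurable_thetaKernel c ha
  have hcc := cw_lt_top_thetaKernel c ha h
  rw [theta_congr_potential c (hV.ae_eq_potential hai)]
  obtain ⟨w', hw'm, hww'⟩ := hw.1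
  have hfin : FinW k w' := MemLp.finW (hw.ae_eq hww')
  rw [EventuallyEq, ae_weightMeasure] at hww'
  refine (theta_congr c _ hww').trans (EventuallyEq.trans ?_ (convTheta_congr _ _ hww').symm)
  have hVm := (continuous_potential hai).measurable
  have hTm := measurable_convTheta (freq c) hcm hw'm.measurable
  refine ae_phase_of_ae_ae (measurableSet_eq_fun (measurable_theta c hVm hw'm.measurable) hTm) ?_
  have hfinT : FinW k (convTheta (freq c) (thetaKernel c a) w') := by
    refine lt_of_le_of_lt (lintegral_mono fun z => ?_)
      (lintegral_conv_lt_top hk hcm hcc hw'm.measurable hfin)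
    gcongr
    exact enorm_convTheta_le _ _ _ _
  filter_upwards [ae_slice hk hw'm.measurable hfin, ae_slice hk hTm hfinT] with x h1 h2
  have e : (fun η => Complex.I * ((deltaV c (potential a) x η : ℝ) : ℂ) *
      fourierV (fun v => ((w' (x, v) : ℝ) : ℂ)) η) =
      fourierV (fun v => ((convTheta (freq c) (thetaKernel c a) w' (x, v) : ℝ) : ℂ)) :=
    funext fun η => (fourierV_convTheta c hk ha h h1.1 η).symm
  have hint : Integrable (fourierV
      (fun v => ((convTheta (freq c) (thetaKernel c a) w' (x, v) : ℝ) : ℂ))) := by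
    rw [← e]
    exact (memLp_deltaV c hk ha h x).integrable_mul (memLp_fourierV h1.1.ofReal (MemLp.ofReal (K := ℂ) h1.2))
  filter_upwards [invFourierV_fourierV_ae_eq h2.1.ofReal hint] with v hv
  rw [theta, e]
  exact congrArg Complex.re hv

end

section

variable {d : ℕ}

/-! ### The Maxwellian and its quantum correction -/

section Maxwellian

open FourierTransform

theorem exists_pow_le_exp (n : ℕ) {δ : ℝ} (hδ : 0 < δ) :
    ∃ C, 0 ≤ C ∧ ∀ t : ℝ, 0 ≤ t → t ^ n ≤ C * Real.exp (δ * t ^ 2) := by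
  refine ⟨1 + n.factorial / δ ^ n, by positivity, fun t ht => ?_⟩
  have h1 := Real.pow_div_factorial_le_exp (δ * t ^ 2) (by positivity) n
  have h2 : (t ^ n) ^ 2 ≤ n.factorial / δ ^ n * Real.exp (δ * t ^ 2) := by
    rw [div_le_iff₀ (by positivity)] at h1
    rw [div_mul_eq_mul_div, le_div_iff₀ (by positivity)]
    calc (t ^ n) ^ 2 * δ ^ n = (δ * t ^ 2) ^ n := by ring
      _ ≤ _ := by linarith
  have h3 : 1 ≤ Real.exp (δ * t ^ 2) := Real.one_le_exp (by positivity)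
  nlinarith [sq_nonneg (t ^ n - 1)]

theorem integrable_exp_neg_mul_sq {b : ℝ} (hb : 0 < b) :
    Integrable fun v : E d => Real.exp (-b * ‖v‖ ^ 2) := by
  have h := (GaussianFourier.integrable_cexp_neg_mul_sq_norm_add (V := E d) (b := (b : ℂ))
    (by simpa using hb) 0 0).norm
  refine h.congr (Eventually.of_forall fun v => ?_)
  simp only [zero_mul, add_zero]
  rw [show (-(b : ℂ) * (‖v‖ : ℂ) ^ 2) = ((-b * ‖v‖ ^ 2 : ℝ) : ℂ) by push_cast; ring,
    ← Complex.ofReal_exp, Complex.norm_real, Real.norm_of_nonneg (Real.exp_pos _).le]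

theorem integrable_pow_mul_exp_neg (n : ℕ) {b : ℝ} (hb : 0 < b) :
    Integrable fun v : E d => ‖v‖ ^ n * Real.exp (-b * ‖v‖ ^ 2) := by
  obtain ⟨C, hC, h⟩ := exists_pow_le_exp n (half_pos hb)
  refine ((integrable_exp_neg_mul_sq (d := d) (half_pos hb)).const_mul C).mono'
    (Continuous.aestronglyMeasurable (by fun_prop)) (Eventually.of_forall fun v => ?_)
  rw [Real.norm_of_nonneg (by positivity)]
  calc ‖v‖ ^ n * Real.exp (-b * ‖v‖ ^ 2)
      ≤ C * Real.exp (b / 2 * ‖v‖ ^ 2) * Real.exp (-b * ‖v‖ ^ 2) := by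
        gcongr
        exact h _ (norm_nonneg _)
    _ = _ := by
        rw [mul_assoc, ← Real.exp_add]
        ring_nf

/-- The exponent of the Maxwellian. -/
def gaussRate (c : Constants) : ℝ := c.beta * c.m / 2

theorem gaussRate_pos (c : Constants) : 0 < gaussRate c := by
  have := c.beta_pos
  have := c.m_pos
  unfold gaussRate
  positivity

/-- The normalization of the Maxwellian. -/
def gaussNorm (c : Constants) (d : ℕ) : ℝ := (c.beta * c.m / (2 * Real.pi)) ^ ((d : ℝ) / 2)

theorem gaussNorm_pos (c : Constants) (d : ℕ) : 0 < gaussNorm c d := by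
  have := c.beta_pos
  have := c.m_pos
  unfold gaussNorm
  positivity

theorem maxwellian_eq (c : Constants) (v : E d) :
    maxwellian c v = gaussNorm c d * Real.exp (-gaussRate c * ‖v‖ ^ 2) := by
  rw [maxwellian, gaussNorm, gaussRate]
  congr 2
  ring

theorem contDiff_maxwellian (c : Constants) : ContDiff ℝ ∞ (maxwellian c : E d → ℝ) := by
  have : (maxwellian c : E d → ℝ) = fun v => gaussNorm c d * Real.exp (-gaussRate c * ‖v‖ ^ 2) :=
    funext (maxwellian_eq c)
  rw [this]
  exact contDiff_const.mul (Real.contDiff_exp.comp (contDiff_const.mul (contDiff_norm_sq ℝ)))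

theorem maxwellian_pos (c : Constants) (v : E d) : 0 < maxwellian c v := by
  rw [maxwellian_eq]
  exact mul_pos (gaussNorm_pos c d) (Real.exp_pos _)

theorem integrable_pow_mul_maxwellian (c : Constants) (n : ℕ) :
    Integrable fun v : E d => ‖v‖ ^ n * maxwellian c v := by
  refine ((integrable_pow_mul_exp_neg n (gaussRate_pos c)).const_mul (gaussNorm c d)).congr
    (Eventually.of_forall fun v => ?_)
  simp only [maxwellian_eq]
  ring

theorem integral_maxwellian (c : Constants) : ∫ v : E d, maxwellian c v = 1 := by
  simp_rw [maxwellian_eq]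
  rw [integral_const_mul, GaussianFourier.integral_rexp_neg_mul_sq_norm (gaussRate_pos c),
    finrank_euclideanSpace, Fintype.card_fin, gaussNorm, gaussRate]
  have := c.beta_pos
  have := c.m_pos
  rw [← Real.mul_rpow (by positivity) (by positivity)]
  have : c.beta * c.m / (2 * Real.pi) * (Real.pi / (c.beta * c.m / 2)) = 1 := by
    field_simp
  rw [this, Real.one_rpow]

theorem integrable_pow_mul_fourierV_maxwellian (c : Constants) (n : ℕ) :
    Integrable fun η : E d => ‖η‖ ^ n * ‖fourierV (fun v => ((maxwellian c v : ℝ) : ℂ)) η‖ := by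
  have hb := gaussRate_pos c
  have hF : ∀ η : E d, ‖fourierV (fun v => ((maxwellian c v : ℝ) : ℂ)) η‖ =
      ‖(((2 * Real.pi) ^ (-(d : ℝ) / 2) : ℝ) : ℂ) * ((gaussNorm c d : ℝ) : ℂ) *
        (Real.pi / (gaussRate c : ℂ)) ^ (Module.finrank ℝ (E d) / 2 : ℂ)‖ *
          Real.exp (-(4 * gaussRate c)⁻¹ * ‖η‖ ^ 2) := fun η => by
    rw [fourierV_eq]
    have e : 𝓕 (fun v : E d => ((maxwellian c v : ℝ) : ℂ)) =
        fun ξ => ((gaussNorm c d : ℝ) : ℂ) * 𝓕 (fun v : E d => Complex.exp (-(gaussRate c : ℂ) * (‖v‖ : ℂ) ^ 2)) ξ := by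
      ext ξ
      simp only [Real.fourier_eq', smul_eq_mul]
      rw [← integral_const_mul]
      refine integral_congr_ae (Eventually.of_forall fun v => ?_)
      simp only [maxwellian_eq]
      push_cast
      ring
    rw [e]
    simp only
    rw [fourier_gaussian_innerProductSpace (by simpa using hb), ← mul_assoc, ← mul_assoc, norm_mul]
    congr 1
    rw [norm_smul, show (-(Real.pi : ℂ) ^ 2 * ((‖(2 * Real.pi)⁻¹‖ * ‖η‖ : ℝ) : ℂ) ^ 2 / (gaussRate c : ℂ)) =
      ((-(4 * gaussRate c)⁻¹ * ‖η‖ ^ 2 : ℝ) : ℂ) by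
        rw [Real.norm_of_nonneg (by positivity)]
        have h1 : (Real.pi : ℂ) ≠ 0 := by exact_mod_cast Real.pi_ne_zero
        have h2 : (gaussRate c : ℂ) ≠ 0 := by exact_mod_cast hb.ne'
        push_cast
        field_simp
        ring, ← Complex.ofReal_exp, Complex.norm_real, Real.norm_of_nonneg (Real.exp_pos _).le]
  simp_rw [hF]
  refine ((integrable_pow_mul_exp_neg n (inv_pos.2 (mul_pos four_pos hb))).const_mul
    (‖(((2 * Real.pi) ^ (-(d : ℝ) / 2) : ℝ) : ℂ) * ((gaussNorm c d : ℝ) : ℂ) *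
        (Real.pi / (gaussRate c : ℂ)) ^ (Module.finrank ℝ (E d) / 2 : ℂ)‖)).congr
    (Eventually.of_forall fun η => ?_)
  simp only
  ring

theorem hasFDerivAt_maxwellian (c : Constants) (v : E d) :
    HasFDerivAt (maxwellian c : E d → ℝ) ((-2 * gaussRate c * maxwellian c v) • innerSL ℝ v) v := by
  have : (maxwellian c : E d → ℝ) = fun v => gaussNorm c d * Real.exp (-gaussRate c * ‖v‖ ^ 2) :=
    funext (maxwellian_eq c)
  have h := ((((hasStrictFDerivAt_norm_sq v).hasFDerivAt).const_mul (-gaussRate c)).exp).const_mul (gaussNorm c d)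
  rw [← this] at h
  refine h.congr_fderiv ?_
  ext b
  simp only [maxwellian_eq, smul_apply, smul_eq_mul, nsmul_eq_mul]
  simp
  ring

/-- The part of the equilibrium which is proportional to the second derivative `∂²V/∂x_r∂x_s`. -/
def correction (c : Constants) (r s : Fin d) (v : E d) : ℝ :=
  c.hbar ^ 2 * (c.beta ^ 2 / 24) * (c.beta * (v r * v s) - (1 / c.m) * (if r = s then 1 else 0)) *
    maxwellian c v

theorem continuous_correction (c : Constants) (r s : Fin d) : Continuous (correction c r s) := by
  unfold correction
  have := (contDiff_maxwellian (d := d) c).continuous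
  fun_prop

/-- A common constant for the bounds of the corrections. -/
def corrConst (c : Constants) : ℝ := c.hbar ^ 2 * (c.beta ^ 2 / 24) * (c.beta + 1 / c.m)

theorem corrConst_nonneg (c : Constants) : 0 ≤ corrConst c := by
  have := c.beta_pos
  have := c.m_pos
  unfold corrConst
  positivity

theorem abs_correction_le (c : Constants) (r s : Fin d) (v : E d) :
    |correction c r s v| ≤ corrConst c * ((1 + ‖v‖ ^ 2) * maxwellian c v) := by
  have hb := c.beta_pos
  have hm := c.m_pos
  have hF := maxwellian_pos c v
  have h1 : |v r * v s| ≤ ‖v‖ ^ 2 := by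
    rw [abs_mul, sq]
    exact mul_le_mul (PiLp.norm_apply_le v r) (PiLp.norm_apply_le v s) (abs_nonneg _) (norm_nonneg _)
  have h2 : |c.beta * (v r * v s) - (1 / c.m) * (if r = s then 1 else 0)| ≤
      (c.beta + 1 / c.m) * (1 + ‖v‖ ^ 2) := by
    have h3 : |(1 / c.m) * (if r = s then (1 : ℝ) else 0)| ≤ 1 / c.m := by
      rw [abs_mul, abs_of_pos (by positivity : 0 < 1 / c.m)]
      refine mul_le_of_le_one_right (by positivity) ?_
      split_ifs <;> simp
    refine (abs_sub _ _).trans ?_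
    rw [abs_mul, abs_of_pos hb]
    have : 0 < 1 / c.m := by positivity
    nlinarith [mul_le_mul_of_nonneg_left h1 hb.le, sq_nonneg ‖v‖]
  rw [correction, abs_mul, abs_mul, abs_of_pos hF, abs_of_nonneg (by positivity : 0 ≤ c.hbar ^ 2 * (c.beta ^ 2 / 24)),
    corrConst]
  calc _ ≤ c.hbar ^ 2 * (c.beta ^ 2 / 24) * ((c.beta + 1 / c.m) * (1 + ‖v‖ ^ 2)) * maxwellian c v := by
        gcongr
    _ = _ := by ring

theorem integrable_one_add_sq_mul_maxwellian (c : Constants) :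
    Integrable fun v : E d => (1 + ‖v‖ ^ 2) * maxwellian c v := by
  refine ((integrable_pow_mul_maxwellian c 0).add (integrable_pow_mul_maxwellian c 2)).congr
    (Eventually.of_forall fun v => ?_)
  simp only [Pi.add_apply]
  ring

theorem integrable_correction (c : Constants) (r s : Fin d) : Integrable (correction c r s) :=
  ((integrable_one_add_sq_mul_maxwellian c).const_mul (corrConst c)).mono'
    (continuous_correction c r s).aestronglyMeasurable
    (Eventually.of_forall fun v => abs_correction_le c r s v)

theorem integrable_maxwellian (c : Constants) : Integrable (maxwellian c : E d → ℝ) := by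
  simpa using integrable_pow_mul_maxwellian (d := d) c 0

/-- Since $\nabla F=-\beta m\,vF$, multiplication by $v_s$ is a derivative of the Gaussian up to a
constant. -/
theorem fourierV_coord_mul_maxwellian (c : Constants) (s : Fin d) (η : E d) :
    fourierV (fun v => ((v s * maxwellian c v : ℝ) : ℂ)) η =
      -(Complex.I * (η s : ℂ) / ((c.beta * c.m : ℝ) : ℂ)) *
        fourierV (fun v => ((maxwellian c v : ℝ) : ℂ)) η := by
  have hfd : ∀ v : E d, HasFDerivAt (fun v : E d => ((maxwellian c v : ℝ) : ℂ))
      (Complex.ofRealCLM.comp ((-2 * gaussRate c * maxwellian c v) • innerSL ℝ v)) v := fun v =>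
    Complex.ofRealCLM.hasFDerivAt.comp v (hasFDerivAt_maxwellian c v)
  have hfd' : fderiv ℝ (fun v : E d => ((maxwellian c v : ℝ) : ℂ)) = fun v =>
      Complex.ofRealCLM.comp ((-2 * gaussRate c * maxwellian c v) • innerSL ℝ v) :=
    funext fun v => (hfd v).fderiv
  have hi : Integrable (fderiv ℝ (fun v : E d => ((maxwellian c v : ℝ) : ℂ))) := by
    refine ((integrable_pow_mul_maxwellian c 1).const_mul (2 * gaussRate c)).mono'
      (Continuous.aestronglyMeasurable (ContDiff.continuous_fderiv (n := ∞)
        (Complex.ofRealCLM.contDiff.comp (contDiff_maxwellian c)) (by simp)))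
      (Eventually.of_forall fun v => ?_)
    rw [hfd']
    refine (ContinuousLinearMap.opNorm_comp_le _ _).trans ?_
    rw [Complex.ofRealCLM_norm, one_mul, norm_smul, innerSL_apply_norm, norm_mul, norm_mul,
      Real.norm_of_nonneg (maxwellian_pos c v).le, Real.norm_of_nonneg (gaussRate_pos c).le]
    norm_num
    linarith
  have h := fourierV_fderiv (f := fun v : E d => ((maxwellian c v : ℝ) : ℂ))
    (integrable_maxwellian c).ofReal (fun v => (hfd v).differentiableAt) hi (e s) η
  have hb : ((c.beta * c.m : ℝ) : ℂ) ≠ 0 := by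
    have := c.beta_pos
    have := c.m_pos
    exact_mod_cast (by positivity : c.beta * c.m ≠ 0)
  have e1 : (fun v : E d => fderiv ℝ (fun v : E d => ((maxwellian c v : ℝ) : ℂ)) v (e s)) =
      fun v : E d => -((c.beta * c.m : ℝ) : ℂ) * ((v s * maxwellian c v : ℝ) : ℂ) := by
    ext v
    rw [hfd']
    simp [e, EuclideanSpace.inner_single_right, gaussRate]
    ring
  rw [e1, fourierV_const_mul] at h
  have e2 : inner ℝ η (e s) = η s := by simp [e, EuclideanSpace.inner_single_right]
  rw [e2] at h
  field_simp
  linear_combination (-1 : ℂ) * h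

/-- The correction is a multiple of a derivative: $\partial_r(v_sF)=-m\big(\beta
v_rv_s-\frac1m\delta_{rs}\big)F$. Together with the formula for $\mathcal F(v_sF)$ this produces
$\eta_r\eta_s\,\mathcal FF$, and so reconciles the bracket in $\Omega$ with the one in $M$. -/
theorem fourierV_correction (c : Constants) (r s : Fin d) (η : E d) :
    fourierV (fun v => ((correction c r s v : ℝ) : ℂ)) η =
      -((c.beta * c.hbar ^ 2 / (24 * c.m ^ 2) * (η r * η s) : ℝ) : ℂ) *
        fourierV (fun v => ((maxwellian c v : ℝ) : ℂ)) η := by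
  have hcoord : ∀ v : E d, HasFDerivAt (fun v : E d => v s) (EuclideanSpace.proj s : E d →L[ℝ] ℝ) v :=
    fun v => (EuclideanSpace.proj s : E d →L[ℝ] ℝ).hasFDerivAt
  have hfd : ∀ v : E d, HasFDerivAt (fun v : E d => ((v s * maxwellian c v : ℝ) : ℂ))
      (Complex.ofRealCLM.comp (v s • ((-2 * gaussRate c * maxwellian c v) • innerSL ℝ v) +
        maxwellian c v • (EuclideanSpace.proj s : E d →L[ℝ] ℝ))) v := fun v =>
    Complex.ofRealCLM.hasFDerivAt.comp v ((hcoord v).mul (hasFDerivAt_maxwellian c v))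
  have hcd : ContDiff ℝ ∞ (fun v : E d => v s * maxwellian c v) :=
    (EuclideanSpace.proj s : E d →L[ℝ] ℝ).contDiff.mul (contDiff_maxwellian c)
  have hi0 : Integrable (fun v : E d => v s * maxwellian c v) := by
    refine (integrable_pow_mul_maxwellian c 1).mono' hcd.continuous.aestronglyMeasurable
      (Eventually.of_forall fun v => ?_)
    rw [norm_mul, Real.norm_of_nonneg (maxwellian_pos c v).le, pow_one]
    exact mul_le_mul_of_nonneg_right (PiLp.norm_apply_le v s) (maxwellian_pos c v).le
  have hfd' : fderiv ℝ (fun v : E d => ((v s * maxwellian c v : ℝ) : ℂ)) = fun v =>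
      Complex.ofRealCLM.comp (v s • ((-2 * gaussRate c * maxwellian c v) • innerSL ℝ v) +
        maxwellian c v • (EuclideanSpace.proj s : E d →L[ℝ] ℝ)) :=
    funext fun v => (hfd v).fderiv
  have hg := gaussRate_pos c
  have hi : Integrable (fderiv ℝ (fun v : E d => ((v s * maxwellian c v : ℝ) : ℂ))) := by
    refine ((integrable_one_add_sq_mul_maxwellian c).const_mul
      (2 * gaussRate c + ‖(EuclideanSpace.proj s : E d →L[ℝ] ℝ)‖)).mono'
      (Continuous.aestronglyMeasurable (ContDiff.continuous_fderiv (n := ∞)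
        (Complex.ofRealCLM.contDiff.comp hcd) (by simp)))
      (Eventually.of_forall fun v => ?_)
    rw [hfd']
    have hF := maxwellian_pos c v
    refine (ContinuousLinearMap.opNorm_comp_le _ _).trans ?_
    rw [Complex.ofRealCLM_norm, one_mul]
    refine (norm_add_le _ _).trans ?_
    rw [norm_smul, norm_smul, norm_smul, innerSL_apply_norm, norm_mul, norm_mul,
      Real.norm_of_nonneg hF.le, Real.norm_of_nonneg hg.le]
    have h1 : ‖v s‖ ≤ ‖v‖ := PiLp.norm_apply_le v s
    have h0 := norm_nonneg v
    have hp := norm_nonneg (EuclideanSpace.proj s : E d →L[ℝ] ℝ)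
    calc ‖v s‖ * (‖(-2 : ℝ)‖ * gaussRate c * maxwellian c v * ‖v‖) +
          maxwellian c v * ‖(EuclideanSpace.proj s : E d →L[ℝ] ℝ)‖
        ≤ ‖v‖ * (2 * gaussRate c * maxwellian c v * ‖v‖) +
          maxwellian c v * ‖(EuclideanSpace.proj s : E d →L[ℝ] ℝ)‖ := by
          norm_num
          gcongr
          exact h1
      _ ≤ _ := by
          have a1 : 0 ≤ gaussRate c * maxwellian c v := by positivity
          have a2 : 0 ≤ ‖(EuclideanSpace.proj s : E d →L[ℝ] ℝ)‖ * maxwellian c v * ‖v‖ ^ 2 := by positivity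
          nlinarith
  have h := fourierV_fderiv (f := fun v : E d => ((v s * maxwellian c v : ℝ) : ℂ))
    hi0.ofReal (fun v => (hfd v).differentiableAt) hi (e r) η
  have hb : ((c.beta * c.m : ℝ) : ℂ) ≠ 0 := by
    have := c.beta_pos
    have := c.m_pos
    exact_mod_cast (by positivity : c.beta * c.m ≠ 0)
  have hm : (c.m : ℂ) ≠ 0 := by exact_mod_cast c.m_pos.ne'
  have e1 : (fun v : E d => fderiv ℝ (fun v : E d => ((v s * maxwellian c v : ℝ) : ℂ)) v (e r)) =
      fun v : E d => -(((c.hbar ^ 2 * (c.beta ^ 2 / 24) / c.m)⁻¹ : ℝ) : ℂ) *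
        ((correction c r s v : ℝ) : ℂ) := by
    ext v
    rw [hfd']
    have hh := c.hbar_pos
    have hbb := c.beta_pos
    have hmm := c.m_pos
    have e3 : v s * (-2 * gaussRate c * maxwellian c v * v r) + maxwellian c v * (if r = s then 1 else 0) =
        -(c.hbar ^ 2 * (c.beta ^ 2 / 24) / c.m)⁻¹ * correction c r s v := by
      unfold correction gaussRate
      field_simp
      ring
    have e4 : (EuclideanSpace.proj s : E d →L[ℝ] ℝ) (e r) = if r = s then 1 else 0 := by
      simp [e, eq_comm]
    have e5 : (innerSL ℝ v) (e r) = v r := by simp [e, EuclideanSpace.inner_single_right]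
    rw [← Complex.ofReal_neg, ← Complex.ofReal_mul, ← e3, ← e4, ← e5]
    simp only [ContinuousLinearMap.comp_apply, add_apply,
      smul_apply, smul_eq_mul, Complex.ofRealCLM_apply]
  rw [e1, fourierV_const_mul, fourierV_coord_mul_maxwellian] at h
  have e2 : inner ℝ η (e r) = η r := by simp [e, EuclideanSpace.inner_single_right]
  rw [e2] at h
  have hh : (c.hbar : ℂ) ≠ 0 := by exact_mod_cast c.hbar_pos.ne'
  have hbb : (c.beta : ℂ) ≠ 0 := by exact_mod_cast c.beta_pos.ne'
  push_cast at h ⊢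
  field_simp at h ⊢
  rw [Complex.I_sq] at h
  linear_combination (-1 : ℂ) * h

end Maxwellian

end

section

variable {d : ℕ}

/-! ### The equilibrium operator and the projections -/

/-- The local equilibrium with the functions `H r s` in place of the second derivatives of the
potential. -/
def omegaKer (c : Constants) (H : Fin d → Fin d → E d → ℝ) (z : Phase d) : ℝ :=
  c.nu * maxwellian c z.2 *
    (1 + c.hbar ^ 2 * (c.beta ^ 2 / 24) *
      (-(1 / c.m) * ∑ r, H r r z.1 + c.beta * ∑ r, ∑ s, z.2 r * z.2 s * H r s z.1))

theorem omegaKer_eq (c : Constants) (H : Fin d → Fin d → E d → ℝ) (z : Phase d) :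
    omegaKer c H z = c.nu * (maxwellian c z.2 + ∑ r, ∑ s, correction c r s z.2 * H r s z.1) := by
  have h1 : ∑ r, ∑ s, correction c r s z.2 * H r s z.1 =
      c.hbar ^ 2 * (c.beta ^ 2 / 24) * maxwellian c z.2 *
        (c.beta * ∑ r, ∑ s, z.2 r * z.2 s * H r s z.1 -
          (1 / c.m) * ∑ r, ∑ s, (if r = s then 1 else 0) * H r s z.1) := by
    simp only [Finset.mul_sum, ← Finset.sum_sub_distrib]
    refine Finset.sum_congr rfl fun r _ => Finset.sum_congr rfl fun s _ => ?_
    rw [correction]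
    ring
  have h2 : ∀ r : Fin d, ∑ s, (if r = s then (1 : ℝ) else 0) * H r s z.1 = H r r z.1 := fun r => by
    simp
  rw [h1, omegaKer]
  simp_rw [h2]
  ring

theorem measurable_omegaKer (c : Constants) {H : Fin d → Fin d → E d → ℝ}
    (hH : ∀ r s, Measurable (H r s)) : Measurable (omegaKer c H) := by
  have : omegaKer c H = fun z =>
    c.nu * (maxwellian c z.2 + ∑ r, ∑ s, correction c r s z.2 * H r s z.1) := funext (omegaKer_eq c H)
  rw [this]
  refine measurable_const.mul (((contDiff_maxwellian c).continuous.measurable.comp measurable_snd).add ?_)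
  refine Finset.measurable_sum _ fun r _ => Finset.measurable_sum _ fun s _ => ?_
  exact ((continuous_correction c r s).measurable.comp measurable_snd).mul ((hH r s).comp measurable_fst)

/-- The constant in the bound of the local equilibrium. -/
def omegaConst (c : Constants) (d : ℕ) (B : ℝ) : ℝ :=
  c.nu * (1 + d * (d * (corrConst c * B)))

theorem abs_omegaKer_le (c : Constants) {H : Fin d → Fin d → E d → ℝ} {B : ℝ}
    (hH : ∀ r s x, |H r s x| ≤ B) (z : Phase d) :
    |omegaKer c H z| ≤ omegaConst c d B * ((1 + ‖z.2‖ ^ 2) * maxwellian c z.2) := by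
  have hν := c.nu_pos
  have hF := maxwellian_pos c z.2
  have hC := corrConst_nonneg c
  rw [omegaKer_eq, abs_mul, abs_of_pos hν, omegaConst, mul_assoc]
  gcongr
  have h1 : |∑ r, ∑ s, correction c r s z.2 * H r s z.1| ≤
      ∑ _r : Fin d, ∑ _s : Fin d, corrConst c * ((1 + ‖z.2‖ ^ 2) * maxwellian c z.2) * B := by
    refine (Finset.abs_sum_le_sum_abs _ _).trans (Finset.sum_le_sum fun r _ => ?_)
    refine (Finset.abs_sum_le_sum_abs _ _).trans (Finset.sum_le_sum fun s _ => ?_)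
    rw [abs_mul]
    exact mul_le_mul (abs_correction_le c r s z.2) (hH r s z.1) (abs_nonneg _) (by positivity)
  simp only [Finset.sum_const, Finset.card_univ, Fintype.card_fin, nsmul_eq_mul] at h1
  refine (abs_add_le _ _).trans ?_
  rw [abs_of_pos hF]
  have h2 : 0 ≤ ‖z.2‖ ^ 2 * maxwellian c z.2 := by positivity
  calc _ ≤ maxwellian c z.2 + _ := by gcongr
    _ ≤ _ := by nlinarith

/-- The weighted norm of the velocity profile which bounds the local equilibrium. -/
def gaussWt (c : Constants) (d k : ℕ) : ENNReal :=
  ∫⁻ v : E d, ENNReal.ofReal (wt k 1 v) * ENNReal.ofReal ((1 + ‖v‖ ^ 2) * maxwellian c v) ^ 2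

theorem gaussWt_lt_top (c : Constants) (d k : ℕ) : gaussWt c d k < ⊤ := by
  have hi : Integrable fun v : E d => gaussNorm c d * ((‖v‖ ^ 0 * maxwellian c v +
      2 * (‖v‖ ^ 2 * maxwellian c v) + ‖v‖ ^ 4 * maxwellian c v) +
      (‖v‖ ^ (2 * k) * maxwellian c v + 2 * (‖v‖ ^ (2 * k + 2) * maxwellian c v) +
        ‖v‖ ^ (2 * k + 4) * maxwellian c v)) := by
    have := integrable_pow_mul_maxwellian (d := d) c
    exact ((((this 0).add ((this 2).const_mul 2)).add (this 4)).add
      (((this (2 * k)).add ((this (2 * k + 2)).const_mul 2)).add (this (2 * k + 4)))).const_mul _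
  refine lt_of_le_of_lt (lintegral_mono fun v => ?_) hi.lintegral_lt_top
  have hF := maxwellian_pos c v
  have hF2 : maxwellian c v ≤ gaussNorm c d := by
    rw [maxwellian_eq]
    refine mul_le_of_le_one_right (gaussNorm_pos c d).le (Real.exp_le_one_iff.2 ?_)
    have := gaussRate_pos c
    rw [neg_mul]
    exact neg_nonpos.2 (by positivity)
  rw [← ENNReal.ofReal_pow (by positivity), ← ENNReal.ofReal_mul (wt_pos _ _ _).le]
  refine ENNReal.ofReal_le_ofReal ?_
  rw [wt_one]
  calc (1 + ‖v‖ ^ (2 * k)) * ((1 + ‖v‖ ^ 2) * maxwellian c v) ^ 2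
      = ((1 + ‖v‖ ^ (2 * k)) * (1 + ‖v‖ ^ 2) ^ 2 * maxwellian c v) * maxwellian c v := by ring
    _ ≤ ((1 + ‖v‖ ^ (2 * k)) * (1 + ‖v‖ ^ 2) ^ 2 * maxwellian c v) * gaussNorm c d := by gcongr
    _ = _ := by ring

theorem measurable_density {w : Phase d → ℝ} (hw : Measurable w) : Measurable (density w) :=
  (hw.stronglyMeasurable.integral_prod_right').measurable

/-- Cauchy–Schwarz in $v$ against the inverse weight, on every fibre. -/
theorem lintegral_density_sq_le (k : ℕ) {w : Phase d → ℝ} (hw : Measurable w) :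
    ∫⁻ x, ‖density w x‖ₑ ^ 2 ≤ invWt d k *
      ∫⁻ z : Phase d, ENNReal.ofReal (wt k 1 z.2) * ‖w z‖ₑ ^ 2 := by
  have hm : Measurable fun z : Phase d => ENNReal.ofReal (wt k 1 z.2) * ‖w z‖ₑ ^ 2 :=
    ((measurable_wt k 1).comp measurable_snd).ennreal_ofReal.mul (hw.enorm.pow_const 2)
  rw [volume_phase, lintegral_prod _ hm.aemeasurable, ← lintegral_const_mul _ hm.lintegral_prod_right']
  refine lintegral_mono fun x => ?_
  have hwx : Measurable fun v => w (x, v) := hw.comp measurable_prodMk_left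
  refine le_trans ?_ (lintegral_sq_le_wt k 1 hwx.enorm)
  gcongr
  exact enorm_integral_le_lintegral_enorm _

theorem density_add_ae {k : ℕ} (hk : d < 2 * k) {w w' : Phase d → ℝ} (hw : Measurable w) (hf : FinW k w)
    (hw' : Measurable w') (hf' : FinW k w') : density (w + w') =ᵐ[volume] density w + density w' := by
  filter_upwards [ae_slice hk hw hf, ae_slice hk hw' hf'] with x h1 h2
  exact integral_add h1.1 h2.1

theorem density_smul (r : ℝ) (w : Phase d → ℝ) : density (r • w) = r • density w := by
  ext x
  exact integral_const_mul r _

/-- Multiplication of the density with a function which is dominated by a velocity profile. -/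
theorem exists_mul_density {k : ℕ} (hk : d < 2 * k) (k' : ℕ) {m : Phase d → ℝ} (hm : Measurable m)
    {g : E d → ENNReal} (hmg : ∀ z, ‖m z‖ₑ ≤ g z.2) (hgm : Measurable g) {B : ℝ} (hB : 0 ≤ B)
    (hg : ∫⁻ v, ENNReal.ofReal (wt k' 1 v) * g v ^ 2 ≤ ENNReal.ofReal B) :
    ∃ T : X d k →L[ℝ] X d k', ‖T‖ ≤ Real.sqrt (B * (invWt d k).toReal) ∧
      ∀ w : X d k, T w =ᵐ[volume] fun z => m z * density w z.1 := by
  have h := exists_clm_of_pointwise (μ := weightMeasure d k) (ν := weightMeasure d k')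
    (fun w z => m z * density w z.1) (C := Real.sqrt (B * (invWt d k).toReal)) (Real.sqrt_nonneg _)
    (fun w hw _ => (hm.mul ((measurable_density hw.measurable).comp measurable_fst)).aestronglyMeasurable)
    (fun w hw hL => by
      rw [lintegral_weightMeasure, lintegral_weightMeasure, Real.sq_sqrt (by positivity),
        ENNReal.ofReal_mul hB, ENNReal.ofReal_toReal (invWt_lt_top hk).ne]
      have hD := measurable_density hw.measurable
      calc ∫⁻ z : Phase d, ENNReal.ofReal (wt k' 1 z.2) * ‖m z * density w z.1‖ₑ ^ 2
          ≤ ∫⁻ z : Phase d, ‖density w z.1‖ₑ ^ 2 * (ENNReal.ofReal (wt k' 1 z.2) * g z.2 ^ 2) := by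
            refine lintegral_mono fun z => ?_
            rw [enorm_mul, mul_pow, ← mul_assoc, mul_comm]
            gcongr
            exact hmg z
        _ = (∫⁻ x, ‖density w x‖ₑ ^ 2) * ∫⁻ v, ENNReal.ofReal (wt k' 1 v) * g v ^ 2 := by
            rw [volume_phase]
            exact lintegral_prod_mul (f := fun x => ‖density w x‖ₑ ^ 2)
              (g := fun v => ENNReal.ofReal (wt k' 1 v) * g v ^ 2) (hD.enorm.pow_const 2).aemeasurable
              ((measurable_wt k' 1).ennreal_ofReal.mul (hgm.pow_const 2)).aemeasurable
        _ ≤ (invWt d k * ∫⁻ z : Phase d, ENNReal.ofReal (wt k 1 z.2) * ‖w z‖ₑ ^ 2) *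
            ENNReal.ofReal B := by
            gcongr
            exact lintegral_density_sq_le k hw.measurable
        _ = _ := by ring)
    (fun w w' h => by
      rw [EventuallyEq, ae_weightMeasure] at h ⊢
      filter_upwards [ae_phase_fst (density_congr h)] with z hz
      rw [hz])
    (fun w w' hw hL hw' hL' => by
      rw [EventuallyEq, ae_weightMeasure]
      filter_upwards [ae_phase_fst (density_add_ae hk hw.measurable (MemLp.finW hL) hw'.measurable
        (MemLp.finW hL'))] with z hz
      simp only [hz, Pi.add_apply, mul_add])
    (fun r w hw hL => by
      refine Eventually.of_forall fun z => ?_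
      simp only [density_smul, Pi.smul_apply, smul_eq_mul]
      ring)
  obtain ⟨T, hT, hTw⟩ := h
  refine ⟨T, hT, fun w => ?_⟩
  have := hTw w
  rwa [EventuallyEq, ae_weightMeasure] at this

/-- The bound of the equilibrium operator. -/
def omegaBound (c : Constants) (d k k' : ℕ) (B : ℝ) : ℝ :=
  Real.sqrt (omegaConst c d B ^ 2 * (gaussWt c d k').toReal * (invWt d k).toReal)

theorem exists_omega {k : ℕ} (hk : d < 2 * k) (k' : ℕ) (c : Constants) {H : Fin d → Fin d → E d → ℝ}
    (hHm : ∀ r s, Measurable (H r s)) {B : ℝ} (hB : 0 ≤ B) (hH : ∀ r s x, |H r s x| ≤ B) :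
    ∃ T : X d k →L[ℝ] X d k', ‖T‖ ≤ omegaBound c d k k' B ∧
      ∀ w : X d k, T w =ᵐ[volume] fun z => omegaKer c H z * density w z.1 := by
  have hC : 0 ≤ omegaConst c d B := by
    have := c.nu_pos
    have := corrConst_nonneg c
    unfold omegaConst
    positivity
  have hgm : Measurable fun v : E d => (1 + ‖v‖ ^ 2) * maxwellian c v :=
    Measurable.mul (by fun_prop) (contDiff_maxwellian c).continuous.measurable
  refine exists_mul_density hk k' (measurable_omegaKer c hHm)
    (g := fun v => ENNReal.ofReal (omegaConst c d B * ((1 + ‖v‖ ^ 2) * maxwellian c v)))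
    (fun z => ?_) (measurable_const.mul hgm).ennreal_ofReal (by positivity) ?_
  · rw [← ofReal_norm]
    exact ENNReal.ofReal_le_ofReal (abs_omegaKer_le c hH z)
  · rw [ENNReal.ofReal_mul (by positivity), ENNReal.ofReal_toReal (gaussWt_lt_top c d k').ne, gaussWt,
      ← lintegral_const_mul' _ _ ENNReal.ofReal_ne_top]
    refine lintegral_mono fun v => ?_
    simp only
    rw [ENNReal.ofReal_mul hC, mul_pow, ENNReal.ofReal_pow hC, mul_left_comm]

theorem fourierV_omegaKer (c : Constants) (H : Fin d → Fin d → E d → ℝ) (x η : E d) :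
    fourierV (fun v => ((omegaKer c H (x, v) : ℝ) : ℂ)) η =
      (c.nu : ℂ) * (fourierV (fun v => ((maxwellian c v : ℝ) : ℂ)) η *
        ((1 - c.beta * c.hbar ^ 2 / (24 * c.m ^ 2) * ∑ r, ∑ s, η r * η s * H r s x : ℝ) : ℂ)) := by
  have hi : ∀ r s : Fin d, Integrable fun v : E d => (H r s x : ℂ) * ((correction c r s v : ℝ) : ℂ) :=
    fun r s => (integrable_correction c r s).ofReal.const_mul _
  have e1 : (fun v => ((omegaKer c H (x, v) : ℝ) : ℂ)) = fun v => (c.nu : ℂ) *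
      (((maxwellian c v : ℝ) : ℂ) + ∑ r, ∑ s, (H r s x : ℂ) * ((correction c r s v : ℝ) : ℂ)) := by
    ext v
    rw [omegaKer_eq]
    push_cast
    simp_rw [mul_comm (H _ _ x : ℂ)]
  have hF : Integrable fun v : E d => ((maxwellian c v : ℝ) : ℂ) := (integrable_maxwellian c).ofReal
  rw [e1, fourierV_const_mul, fourierV_add hF
    (integrable_finsetSum _ fun r _ => integrable_finsetSum _ fun s _ => hi r s),
    fourierV_sum _ (fun r _ => integrable_finsetSum _ fun s _ => hi r s)]
  congr 1
  have e2 : ∀ r : Fin d, fourierV (fun v => ∑ s, (H r s x : ℂ) * ((correction c r s v : ℝ) : ℂ)) η =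
      ∑ s, (H r s x : ℂ) * (-((c.beta * c.hbar ^ 2 / (24 * c.m ^ 2) * (η r * η s) : ℝ) : ℂ) *
        fourierV (fun v => ((maxwellian c v : ℝ) : ℂ)) η) := fun r => by
    rw [fourierV_sum _ (fun s _ => hi r s)]
    refine Finset.sum_congr rfl fun s _ => ?_
    rw [fourierV_const_mul, fourierV_correction]
  simp_rw [e2]
  push_cast
  rw [mul_sub, mul_one, sub_eq_add_neg]
  congr 1
  simp only [Finset.mul_sum, ← Finset.sum_neg_distrib]
  refine Finset.sum_congr rfl fun r _ => Finset.sum_congr rfl fun s _ => ?_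
  ring

theorem integrable_fourierV_omegaKer (c : Constants) (H : Fin d → Fin d → E d → ℝ) (x : E d) :
    Integrable fun η => (c.nu : ℂ) * (fourierV (fun v => ((maxwellian c v : ℝ) : ℂ)) η *
        ((1 - c.beta * c.hbar ^ 2 / (24 * c.m ^ 2) * ∑ r, ∑ s, η r * η s * H r s x : ℝ) : ℂ)) := by
  refine Integrable.const_mul ?_ _
  set A : ℝ := |c.beta * c.hbar ^ 2 / (24 * c.m ^ 2)| * ∑ r, ∑ s, |H r s x| with hA
  have h := (integrable_pow_mul_fourierV_maxwellian (d := d) c 0).add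
    ((integrable_pow_mul_fourierV_maxwellian (d := d) c 2).const_mul A)
  refine h.mono' ?_ (Eventually.of_forall fun η => ?_)
  · refine Continuous.aestronglyMeasurable ((continuous_fourierV (integrable_maxwellian c).ofReal).mul ?_)
    fun_prop
  · rw [norm_mul, Complex.norm_real, Pi.add_apply, pow_zero, one_mul]
    have hs : |∑ r, ∑ s, η r * η s * H r s x| ≤ ‖η‖ ^ 2 * ∑ r, ∑ s, |H r s x| := by
      refine (Finset.abs_sum_le_sum_abs _ _).trans ?_
      rw [Finset.mul_sum]
      refine Finset.sum_le_sum fun r _ => (Finset.abs_sum_le_sum_abs _ _).trans ?_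
      rw [Finset.mul_sum]
      refine Finset.sum_le_sum fun s _ => ?_
      rw [abs_mul, abs_mul, sq]
      gcongr
      · exact PiLp.norm_apply_le η r
      · exact PiLp.norm_apply_le η s
    have h1 : ‖1 - c.beta * c.hbar ^ 2 / (24 * c.m ^ 2) * ∑ r, ∑ s, η r * η s * H r s x‖ ≤
        1 + ‖η‖ ^ 2 * A := by
      refine (norm_sub_le _ _).trans ?_
      rw [norm_one, norm_mul, Real.norm_eq_abs, Real.norm_eq_abs, hA]
      have := mul_le_mul_of_nonneg_left hs (abs_nonneg (c.beta * c.hbar ^ 2 / (24 * c.m ^ 2)))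
      linarith
    calc _ ≤ ‖fourierV (fun v => ((maxwellian c v : ℝ) : ℂ)) η‖ * (1 + ‖η‖ ^ 2 * A) := by gcongr
      _ = _ := by ring

/-- The symbol of the function `M`. -/
def kerSymbol (c : Constants) (V : E d → ℝ) (H : Fin d → Fin d → E d → ℝ) (z : Phase d) : ℂ :=
  fourierV (fun v => ((maxwellian c v : ℝ) : ℂ)) z.2 /
      ((c.nu : ℂ) - Complex.I * ((deltaV c V z.1 z.2 : ℝ) : ℂ)) *
    ((1 - c.beta * c.hbar ^ 2 / (24 * c.m ^ 2) * ∑ r, ∑ s, z.2 r * z.2 s * H r s z.1 : ℝ) : ℂ)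

/-- The function `M` with the functions `H r s` in place of the second derivatives. -/
def kerMOf (c : Constants) (V : E d → ℝ) (H : Fin d → Fin d → E d → ℝ) (z : Phase d) : ℝ :=
  ((c.nu : ℂ) * invFourierV (fun η => kerSymbol c V H (z.1, η)) z.2).re

theorem measurable_kerMOf (c : Constants) {V : E d → ℝ} (hV : Measurable V)
    {H : Fin d → Fin d → E d → ℝ} (hH : ∀ r s, Measurable (H r s)) : Measurable (kerMOf c V H) := by
  refine Complex.measurable_re.comp (measurable_const.mul (measurable_invFourierV_slice ?_))
  unfold kerSymbol
  refine Measurable.mul (Measurable.div ?_ ?_) (Complex.measurable_ofReal.comp ?_)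
  · exact (continuous_fourierV (integrable_maxwellian c).ofReal).measurable.comp measurable_snd
  · exact measurable_const.sub
      (measurable_const.mul (Complex.measurable_ofReal.comp (measurable_deltaV c hV)))
  · refine measurable_const.sub (measurable_const.mul ?_)
    refine Finset.measurable_sum _ fun r _ => Finset.measurable_sum _ fun s _ => ?_
    exact Measurable.mul (Continuous.measurable (by fun_prop)) ((hH r s).comp measurable_fst)

theorem kerM_ae_eq (c : Constants) {V V' : E d → ℝ} (hV : V =ᵐ[volume] V')
    {H : Fin d → Fin d → E d → ℝ} (hH : ∀ r s, hess V r s =ᵐ[volume] H r s) :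
    kerM c V =ᵐ[volume] kerMOf c V' H := by
  have h : ∀ᵐ x : E d, ∀ r s, hess V r s x = H r s x := by
    rw [ae_all_iff]
    intro r
    rw [ae_all_iff]
    exact fun s => hH r s
  filter_upwards [ae_phase_fst h] with z hz
  unfold kerM kerMOf kerSymbol
  simp_rw [hz]
  congr 2
  refine congrFun (invFourierV_congr ?_) _
  filter_upwards [deltaV_congr c hV z.1] with η hη
  rw [hη]

theorem omega_ae_eq (c : Constants) {V : E d → ℝ} {H : Fin d → Fin d → E d → ℝ}
    (hH : ∀ r s, hess V r s =ᵐ[volume] H r s) (w : Phase d → ℝ) :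
    omega c V w =ᵐ[volume] fun z => omegaKer c H z * density w z.1 := by
  have h : ∀ᵐ x : E d, ∀ r s, hess V r s x = H r s x := by
    rw [ae_all_iff]
    intro r
    rw [ae_all_iff]
    exact fun s => hH r s
  filter_upwards [ae_phase_fst h] with z hz
  unfold omega omegaKer
  simp_rw [hz]

theorem fourierV_zero (f : E d → ℝ) : fourierV (fun v => ((f v : ℝ) : ℂ)) 0 =
    (((2 * Real.pi) ^ (-(d : ℝ) / 2) : ℝ) : ℂ) * ((∫ v, f v : ℝ) : ℂ) := by
  rw [fourierV, ← integral_complex_ofReal]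
  simp

theorem integral_eq_of_fourierV_zero {f g : E d → ℝ}
    (h : fourierV (fun v => ((f v : ℝ) : ℂ)) 0 = fourierV (fun v => ((g v : ℝ) : ℂ)) 0) :
    ∫ v, f v = ∫ v, g v := by
  rw [fourierV_zero, fourierV_zero] at h
  have hp : (((2 * Real.pi) ^ (-(d : ℝ) / 2) : ℝ) : ℂ) ≠ 0 := by
    have : (0 : ℝ) < (2 * Real.pi) ^ (-(d : ℝ) / 2) := by positivity
    exact_mod_cast this.ne'
  exact_mod_cast mul_left_cancel₀ hp h

/-- At $\eta=0$ the quadratic correction vanishes, so the mass is $\nu$ whatever the functions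
$H_{rs}$ are. -/
theorem integral_omegaKer (c : Constants) (H : Fin d → Fin d → E d → ℝ) (x : E d) :
    ∫ v, omegaKer c H (x, v) = c.nu := by
  have : ∫ v, omegaKer c H (x, v) = ∫ v : E d, c.nu * maxwellian c v := by
    refine integral_eq_of_fourierV_zero ?_
    rw [fourierV_omegaKer]
    simp only [Complex.ofReal_mul]
    rw [fourierV_const_mul]
    simp
  rw [this, integral_const_mul, integral_maxwellian, mul_one]

theorem density_omegaKer_mul (c : Constants) (H : Fin d → Fin d → E d → ℝ) (n : E d → ℝ) :
    density (fun z => omegaKer c H z * n z.1) = fun x => c.nu * n x := by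
  ext x
  simp only [density]
  rw [integral_mul_const, integral_omegaKer]

/-- The multiplier vanishes at $\eta=0$, because $\delta V(x,0)=0$. -/
theorem density_convTheta (c : Constants) {k : ℕ} (hk : d < 2 * k) {a : E d → ℂ} (ha : Measurable a)
    (h : cw k a < ⊤) {w : Phase d → ℝ} (hw : MemLp w 2 (weightMeasure d k)) :
    density (convTheta (freq c) (thetaKernel c a) w) =ᵐ[volume] 0 := by
  obtain ⟨w', hw'm, hww'⟩ := hw.1
  have hfin : FinW k w' := MemLp.finW (hw.ae_eq hww')
  rw [EventuallyEq, ae_weightMeasure] at hww'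
  refine (density_congr (convTheta_congr _ _ hww')).trans ?_
  filter_upwards [ae_slice hk hw'm.measurable hfin] with x hx
  have := integral_eq_of_fourierV_zero (f := fun v => convTheta (freq c) (thetaKernel c a) w' (x, v))
    (g := fun _ => 0) (by
      rw [fourierV_convTheta c hk ha h hx.1, fourierV_zero (fun _ : E d => (0 : ℝ))]
      simp [deltaV])
  simpa [density] using this

theorem ae_slice_of_memLp {k : ℕ} {w : Phase d → ℝ} (hw : MemLp w 2 (weightMeasure d k)) :
    ∃ w', Measurable w' ∧ w =ᵐ[volume] w' ∧ FinW k w' := by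
  obtain ⟨w', hw'm, hww'⟩ := hw.1
  have hfin : FinW k w' := MemLp.finW (hw.ae_eq hww')
  rw [EventuallyEq, ae_weightMeasure] at hww'
  exact ⟨w', hw'm.measurable, hww', hfin⟩

/-- The projection `𝒫` is the resolvent of `𝒜 - ν` applied to the equilibrium operator. -/
theorem kerMOf_mul_density_ae_eq (c : Constants) {k : ℕ} (hk : d < 2 * k) {a : E d → ℂ}
    (ha : Measurable a) (h : cw k a < ⊤) {H : Fin d → Fin d → E d → ℝ}
    (hHm : ∀ r s, Measurable (H r s)) {n : E d → ℝ} (hn : Measurable n) {p : Phase d → ℝ}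
    (hp : MemLp p 2 (weightMeasure d k))
    (heq : (fun z => c.nu * p z - convTheta (freq c) (thetaKernel c a) p z) =ᵐ[volume]
      fun z => omegaKer c H z * n z.1) :
    (fun z => kerMOf c (potential a) H z * n z.1) =ᵐ[volume] p ∧ density p =ᵐ[volume] n := by
  have hai := integrable_of_cw hk ha h
  have hcm := measurable_thetaKernel c ha
  have hcc := cw_lt_top_thetaKernel c ha h
  obtain ⟨p', hp'm, hpp', hfin⟩ := ae_slice_of_memLp hp
  have hVm := (continuous_potential hai).measurable
  have heq' : ∀ᵐ z : Phase d, c.nu * p' z - convTheta (freq c) (thetaKernel c a) p' z =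
      omegaKer c H z * n z.1 := by
    filter_upwards [heq, hpp', convTheta_congr (freq c) (thetaKernel c a) hpp'] with z h1 h2 h3
    rw [← h2, ← h3, h1]
  have hTm := measurable_convTheta (freq c) hcm hp'm
  have hfinT : FinW k (convTheta (freq c) (thetaKernel c a) p') := by
    refine lt_of_le_of_lt (lintegral_mono fun z => ?_)
      (lintegral_conv_lt_top hk hcm hcc hp'm hfin)
    gcongr
    exact enorm_convTheta_le _ _ _ _
  -- The equation on a fibre after the Fourier transform. It holds for every $\eta$, because the
  -- slices are integrable; this allows evaluation at $\eta=0$ below.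
  have key : ∀ᵐ x : E d, (∀ η, fourierV (fun v => ((p' (x, v) : ℝ) : ℂ)) η *
      ((c.nu : ℂ) - Complex.I * ((deltaV c (potential a) x η : ℝ) : ℂ)) =
      (n x : ℂ) * fourierV (fun v => ((omegaKer c H (x, v) : ℝ) : ℂ)) η) ∧
      Integrable fun v => p' (x, v) := by
    filter_upwards [ae_slice hk hp'm hfin, ae_slice hk hTm hfinT, ae_ae_of_ae_phase heq']
      with x h1 h2 h3
    refine ⟨fun η => ?_, h1.1⟩
    have e1 : (fun v => (n x : ℂ) * ((omegaKer c H (x, v) : ℝ) : ℂ)) =ᵐ[volume] fun v =>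
        (c.nu : ℂ) * ((p' (x, v) : ℝ) : ℂ) +
          (-1) * ((convTheta (freq c) (thetaKernel c a) p' (x, v) : ℝ) : ℂ) := by
      filter_upwards [h3] with v hv
      rw [mul_comm, ← Complex.ofReal_mul, ← hv]
      push_cast
      ring
    have i1 : Integrable fun v => (c.nu : ℂ) * ((p' (x, v) : ℝ) : ℂ) := h1.1.ofReal.const_mul _
    have i2 : Integrable fun v =>
        (-1 : ℂ) * ((convTheta (freq c) (thetaKernel c a) p' (x, v) : ℝ) : ℂ) :=
      h2.1.ofReal.const_mul _
    rw [← fourierV_const_mul, fourierV_congr e1, fourierV_add i1 i2, fourierV_const_mul, fourierV_const_mul,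
      fourierV_convTheta c hk ha h h1.1]
    ring
  have hne : ∀ t : ℝ, (c.nu : ℂ) - Complex.I * (t : ℂ) ≠ 0 := fun t hcon => by
    have := congrArg Complex.re hcon
    simp at this
    exact c.nu_pos.ne' this
  have hnorm : ∀ t : ℝ, c.nu ≤ ‖(c.nu : ℂ) - Complex.I * (t : ℂ)‖ := fun t => by
    refine le_trans ?_ (Complex.re_le_norm _)
    simp
  constructor
  · refine EventuallyEq.trans ?_ hpp'.symm
    refine ae_phase_of_ae_ae (measurableSet_eq_fun
      ((measurable_kerMOf c hVm hHm).mul (hn.comp measurable_fst)) hp'm) ?_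
    filter_upwards [key] with x ⟨hx, hi⟩
    have hhat : fourierV (fun v => ((p' (x, v) : ℝ) : ℂ)) = fun η =>
        ((c.nu : ℂ) * (n x : ℂ)) * kerSymbol c (potential a) H (x, η) := by
      ext η
      have h1 := hx η
      rw [fourierV_omegaKer] at h1
      rw [kerSymbol, eq_div_of_mul_eq (hne _) h1]
      simp only
      field_simp
    -- Since $|\nu-i\,\delta V|\ge\nu$, the transform of $p'$ is dominated by a Gaussian times a
    -- polynomial, and Fourier inversion applies.
    have hint : Integrable (fourierV (fun v => ((p' (x, v) : ℝ) : ℂ))) := by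
      refine ((integrable_fourierV_omegaKer c H x).norm.const_mul (c.nu⁻¹ * ‖(n x : ℂ)‖)).mono'
        (continuous_fourierV hi.ofReal).aestronglyMeasurable (Eventually.of_forall fun η => ?_)
      rw [← fourierV_omegaKer, mul_assoc, ← norm_mul, ← hx η, norm_mul]
      have h1 := hnorm (deltaV c (potential a) x η)
      have h2 := norm_nonneg (fourierV (fun v => ((p' (x, v) : ℝ) : ℂ)) η)
      rw [inv_mul_eq_div, le_div_iff₀ c.nu_pos]
      gcongr
    filter_upwards [invFourierV_fourierV_ae_eq hi.ofReal hint] with v hv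
    have e2 : ∀ (r : ℂ) (g : E d → ℂ), invFourierV (fun η => r * g η) v = r * invFourierV g v :=
      fun r g => by
        simp only [invFourierV, mul_left_comm _ r, integral_const_mul]
    have h3 : (c.nu : ℂ) * (n x : ℂ) * invFourierV (fun η => kerSymbol c (potential a) H (x, η)) v =
        ((p' (x, v) : ℝ) : ℂ) := by
      rw [← e2, ← hhat]
      exact hv
    have h4 := congrArg Complex.re h3
    rw [Complex.ofReal_re] at h4
    rw [← h4, kerMOf, mul_comm (c.nu : ℂ) (n x : ℂ), mul_assoc, Complex.re_ofReal_mul (n x), mul_comm]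
  -- At $\eta=0$ the multiplier vanishes and the equation reads $\nu\int p'\,dv=\nu\,n$.
  · refine (density_congr hpp').trans ?_
    filter_upwards [key] with x ⟨hx, hi⟩
    have h1 := hx 0
    have h2 : deltaV c (potential a) x 0 = 0 := by simp [deltaV]
    rw [h2, Complex.ofReal_zero, mul_zero, sub_zero, fourierV_zero (fun v => p' (x, v)),
      fourierV_zero (fun v => omegaKer c H (x, v)), integral_omegaKer] at h1
    have hp0 : (((2 * Real.pi) ^ (-(d : ℝ) / 2) : ℝ) : ℂ) ≠ 0 := by
      have : (0 : ℝ) < (2 * Real.pi) ^ (-(d : ℝ) / 2) := by positivity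
      exact_mod_cast this.ne'
    have hν : (c.nu : ℂ) ≠ 0 := by exact_mod_cast c.nu_pos.ne'
    have h3 : ((∫ v, p' (x, v) : ℝ) : ℂ) = (n x : ℂ) :=
      mul_left_cancel₀ (mul_ne_zero hp0 hν) (by linear_combination h1)
    exact_mod_cast h3

end

section

variable {d : ℕ}

/-! ### Weak derivatives in phase space -/

theorem memLp_volume_of_weight {k : ℕ} {w : Phase d → ℝ} (hw : MemLp w 2 (weightMeasure d k)) :
    MemLp w 2 := by
  refine hw.mono_measure (Measure.le_iff.2 fun s hs => ?_)
  rw [weightMeasure, withDensity_apply _ hs]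
  calc volume s = ∫⁻ _ in s, 1 := by simp
    _ ≤ _ := by
      refine lintegral_mono fun z => ?_
      rw [← ENNReal.ofReal_one]
      exact ENNReal.ofReal_le_ofReal (by rw [← wt_one]; exact one_le_wt _ _ _)

theorem memLp_test {F : Type*} [NormedAddCommGroup F] [NormedSpace ℝ F] [MeasureSpace F]
    [BorelSpace F] [FiniteDimensional ℝ F] [IsFiniteMeasureOnCompacts (volume : Measure F)]
    {g : F → ℝ} (hg : Continuous g) (hc : HasCompactSupport g) :
    MemLp g 2 := hg.memLp_of_hasCompactSupport hc

theorem lintegral_inv_wt_mul_lt_top (k : ℕ) {g : Phase d → ℝ} (hg : MemLp g 2) :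
    ∫⁻ z : Phase d, ENNReal.ofReal (wt k 1 z.2)⁻¹ * ‖g z‖ₑ ^ 2 < ⊤ := by
  refine lt_of_le_of_lt (lintegral_mono fun z => ?_) (MemLp.lintegral_sq_lt_top hg)
  refine mul_le_of_le_one_left (by simp) ?_
  rw [← ENNReal.ofReal_one]
  exact ENNReal.ofReal_le_ofReal (inv_le_one_of_one_le₀ (one_le_wt _ _ _))

/-- Pairing with a test function is a continuous functional on $X_k$: it is the inner product with
the test function divided by the weight. -/
theorem exists_pairing (k : ℕ) {g : Phase d → ℝ} (hg : Continuous g) (hc : HasCompactSupport g) :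
    ∃ L : X d k →L[ℝ] ℝ, ∀ w, L w = ∫ z, w z * g z := by
  have hcont : Continuous fun z : Phase d => (wt k 1 z.2)⁻¹ * g z :=
    (((continuous_wt k 1).comp continuous_snd).inv₀ fun z => (wt_pos _ _ _).ne').mul hg
  have hmem : MemLp (fun z : Phase d => (wt k 1 z.2)⁻¹ * g z) 2 (weightMeasure d k) := by
    refine memLp_two_of_lintegral_lt_top hcont.aestronglyMeasurable ?_
    rw [lintegral_weightMeasure]
    refine lt_of_le_of_lt (le_of_eq ?_) (lintegral_inv_wt_mul_lt_top k (memLp_test hg hc))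
    refine lintegral_congr fun z => ?_
    have hw := wt_pos k 1 z.2
    rw [enorm_mul, mul_pow, ← mul_assoc, ← ofReal_norm, Real.norm_of_nonneg (inv_pos.2 hw).le,
      ← ENNReal.ofReal_pow (inv_pos.2 hw).le, ← ENNReal.ofReal_mul hw.le, sq,
      mul_inv_cancel_left₀ hw.ne']
  refine ⟨innerSL ℝ (hmem.toLp : X d k), fun w => ?_⟩
  change inner ℝ (hmem.toLp : X d k) w = _
  rw [inner_X_eq]
  refine integral_congr_ae ?_
  have h := hmem.coeFn_toLp
  rw [EventuallyEq, ae_weightMeasure] at h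
  filter_upwards [h] with z hz
  rw [hz]
  field_simp [(wt_pos k 1 z.2).ne']

/-- The kernel of the `x_j`-derivative of a velocity convolution. -/
def derivKernel (μ : ℝ) (j : Fin d) (c : E d → ℂ) (y : E d) : ℂ :=
  Complex.I * ((μ * y j : ℝ) : ℂ) * c y

theorem kerK_eq (μ : ℝ) (c : E d → ℂ) (x y : E d) :
    kerK μ c x y = -(c y).im * Real.cos (μ * inner ℝ x y) - (c y).re * Real.sin (μ * inner ℝ x y) := by
  rw [kerK, mul_comm Complex.I ((μ * inner ℝ x y : ℝ) : ℂ), Complex.exp_ofReal_mul_I]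
  simp only [Complex.mul_re, Complex.mul_im, Complex.add_re, Complex.add_im, Complex.ofReal_re,
    Complex.ofReal_im, Complex.I_re, Complex.I_im]
  ring

theorem contDiff_kerK (μ : ℝ) (c : E d → ℂ) (y : E d) : ContDiff ℝ ∞ fun x => kerK μ c x y := by
  simp_rw [kerK_eq]
  have h : ContDiff ℝ ∞ fun x : E d => μ * inner ℝ x y :=
    contDiff_const.mul (contDiff_id.inner ℝ contDiff_const)
  exact (contDiff_const.mul (Real.contDiff_cos.comp h)).sub (contDiff_const.mul (Real.contDiff_sin.comp h))

/-- Differentiation in $x_j$ multiplies the coefficient by $i\mu y_j$, so the derivative is a kernel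
of the same class at the price of one order of the weight. -/
theorem fderiv_kerK (μ : ℝ) (c : E d → ℂ) (x y : E d) (j : Fin d) :
    fderiv ℝ (fun x => kerK μ c x y) x (e j) = kerK μ (derivKernel μ j c) x y := by
  have h : HasFDerivAt (fun x : E d => μ * inner ℝ x y) (μ • innerSL ℝ y) x := by
    have := ((innerSL ℝ y).hasFDerivAt (x := x)).const_mul μ
    refine this.congr_of_eventuallyEq (Eventually.of_forall fun z => ?_)
    simp [real_inner_comm]
  have h2 := ((h.cos.const_mul (-(c y).im)).sub (h.sin.const_mul (c y).re)).fderiv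
  have h3 : (fun x => kerK μ c x y) = fun x =>
      -(c y).im * Real.cos (μ * inner ℝ x y) - (c y).re * Real.sin (μ * inner ℝ x y) :=
    funext fun x => kerK_eq μ c x y
  rw [h3]
  refine (congrArg (fun T : E d →L[ℝ] ℝ => T (e j)) h2).trans ?_
  rw [kerK_eq, derivKernel]
  simp [e, EuclideanSpace.inner_single_right]
  ring

theorem fderiv_fst_mul (f : E d → ℝ) (hf : ContDiff ℝ ∞ f) {φ : Phase d → ℝ} (hφ : ContDiff ℝ ∞ φ)
    (z : Phase d) (b : E d) :
    fderiv ℝ (fun z : Phase d => f z.1 * φ z) z (b, 0) =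
      f z.1 * fderiv ℝ φ z (b, 0) + fderiv ℝ f z.1 b * φ z := by
  have h1 : HasFDerivAt (fun z : Phase d => f z.1)
      ((fderiv ℝ f z.1).comp (ContinuousLinearMap.fst ℝ (E d) (E d))) z :=
    HasFDerivAt.comp z ((hf.differentiable (by simp)) z.1).hasFDerivAt hasFDerivAt_fst
  have h2 := (h1.mul ((hφ.differentiable (by simp)) z).hasFDerivAt).fderiv
  refine (congrArg (fun T : Phase d →L[ℝ] ℝ => T (b, 0)) h2).trans ?_
  simp
  ring

theorem fderiv_snd_mul (f : E d → ℝ) (hf : ContDiff ℝ ∞ f) {φ : Phase d → ℝ} (hφ : ContDiff ℝ ∞ φ)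
    (z : Phase d) (b : E d) :
    fderiv ℝ (fun z : Phase d => f z.2 * φ z) z (b, 0) = f z.2 * fderiv ℝ φ z (b, 0) := by
  have h1 : HasFDerivAt (fun z : Phase d => f z.2)
      ((fderiv ℝ f z.2).comp (ContinuousLinearMap.snd ℝ (E d) (E d))) z :=
    HasFDerivAt.comp z ((hf.differentiable (by simp)) z.2).hasFDerivAt hasFDerivAt_snd
  have h2 := (h1.mul ((hφ.differentiable (by simp)) z).hasFDerivAt).fderiv
  refine (congrArg (fun T : Phase d →L[ℝ] ℝ => T (b, 0)) h2).trans ?_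
  simp

theorem continuous_fderiv_test {F : Type*} [NormedAddCommGroup F] [NormedSpace ℝ F] {φ : F → ℝ}
    (hφ : ContDiff ℝ ∞ φ) (b : F) : Continuous fun z => fderiv ℝ φ z b :=
  (hφ.continuous_fderiv (by simp)).clm_apply continuous_const

/-- Translation in the velocity. -/
def vshift (y : E d) : Phase d ≃ₜ Phase d := (Homeomorph.refl (E d)).prodCongr (Homeomorph.addRight y)

theorem integral_vshift (y : E d) (f : Phase d → ℝ) : ∫ z : Phase d, f (z.1, z.2 + y) = ∫ z, f z := by
  have h : MeasurePreserving (fun z : Phase d => (z.1, z.2 + y)) volume volume :=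
    (MeasurePreserving.id (volume : Measure (E d))).prod
      (measurePreserving_add_right (volume : Measure (E d)) y)
  exact h.integral_comp (vshift y).measurableEmbedding f

theorem hasCompactSupport_vshift {φ : Phase d → ℝ} (hs : HasCompactSupport φ) (y : E d) :
    HasCompactSupport fun z : Phase d => φ (z.1, z.2 + y) :=
  hs.comp_homeomorph (vshift y)

theorem fderiv_vshift (φ : Phase d → ℝ) (y b : E d) (z : Phase d) :
    fderiv ℝ (fun z : Phase d => φ (z.1, z.2 + y)) z (b, 0) = fderiv ℝ φ (z.1, z.2 + y) (b, 0) := by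
  have e1 : (fun z : Phase d => φ (z.1, z.2 + y)) = fun z : Phase d => φ (z + (0, y)) := by
    ext z
    congr 1
    simp [Prod.ext_iff]
  have e2 : ((z.1, z.2 + y) : Phase d) = z + (0, y) := by simp [Prod.ext_iff]
  rw [e1, fderiv_comp_add_right, e2]

/-- The `x_j`-derivative of a velocity convolution. -/
theorem IsWeak.convTheta {k : ℕ} (hk : d < 2 * k) (μ : ℝ) {c : E d → ℂ} (hc : Measurable c)
    (hcw : cw k c < ⊤) (j : Fin d) (hcj : cw k (derivKernel μ j c) < ⊤) {w g : X d k}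
    (h : IsWeak (ex j) (w : Phase d → ℝ) g) :
    IsWeak (ex j) (convTheta μ c w) fun z => convTheta μ c g z + convTheta μ (derivKernel μ j c) w z := by
  intro φ hφ hs
  have hcm : Measurable (derivKernel μ j c) := by
    unfold derivKernel
    fun_prop
  have hwm := (Lp.stronglyMeasurable w).measurable
  have hgm := (Lp.stronglyMeasurable g).measurable
  have hwf := MemLp.finW (Lp.memLp w)
  have hgf := MemLp.finW (Lp.memLp g)
  have hw2 := memLp_volume_of_weight (Lp.memLp w)
  have hg2 := memLp_volume_of_weight (Lp.memLp g)
  have hφ' := continuous_fderiv_test hφ (ex j)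
  have hs' : HasCompactSupport fun z => fderiv ℝ φ z (ex j) := hs.fderiv_apply ℝ (ex j)
  have f1 := lintegral_inv_wt_mul_lt_top k (memLp_test hφ.continuous hs)
  have f2 := lintegral_inv_wt_mul_lt_top k (memLp_test hφ' hs')
  have p1 := integrable_pairing hk μ hc hcw hwm hwf hφ'.measurable f2
  have p2 := integrable_pairing hk μ hc hcw hgm hgf hφ.continuous.measurable f1
  have p3 := integrable_pairing hk μ hcm hcj hwm hwf hφ.continuous.measurable f1
  -- For a fixed shift $y$ the kernel is smooth in $x$. It can be moved, together with the
  -- translation, onto the test function, and the product rule there produces the two terms.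
  -- Integration over $y$ is left to Fubini.
  have key : ∀ y : E d, ∫ z : Phase d, kerK μ c z.1 y * w (z.1, z.2 + y) * fderiv ℝ φ z (ex j) =
      -((∫ z : Phase d, kerK μ c z.1 y * g (z.1, z.2 + y) * φ z) +
        ∫ z : Phase d, kerK μ (derivKernel μ j c) z.1 y * w (z.1, z.2 + y) * φ z) := by
    intro y
    have hφy : ContDiff ℝ ∞ fun z : Phase d => φ (z.1, z.2 + -y) := hφ.comp (by fun_prop)
    have hsy := hasCompactSupport_vshift hs (-y)
    have hK := contDiff_kerK μ c y
    have hΦ : ContDiff ℝ ∞ fun z : Phase d => kerK μ c z.1 y * φ (z.1, z.2 + -y) :=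
      (hK.comp contDiff_fst).mul hφy
    have hΦs : HasCompactSupport fun z : Phase d => kerK μ c z.1 y * φ (z.1, z.2 + -y) := hsy.mul_left
    have h0 := h _ hΦ hΦs
    have hKj : Continuous fun z : Phase d => kerK μ (derivKernel μ j c) z.1 y :=
      (contDiff_kerK μ (derivKernel μ j c) y).continuous.comp continuous_fst
    have hd : ∀ z : Phase d, fderiv ℝ (fun z : Phase d => kerK μ c z.1 y * φ (z.1, z.2 + -y)) z (ex j) =
        kerK μ c z.1 y * fderiv ℝ φ (z.1, z.2 + -y) (ex j) +
          kerK μ (derivKernel μ j c) z.1 y * φ (z.1, z.2 + -y) := fun z => by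
      have := fderiv_fst_mul (fun x => kerK μ c x y) hK hφy z (e j)
      rw [fderiv_vshift φ, fderiv_kerK] at this
      exact this
    have hs'y := hasCompactSupport_vshift hs' (-y)
    have c1 : Continuous fun z : Phase d => fderiv ℝ φ (z.1, z.2 + -y) (ex j) :=
      hφ'.comp (by fun_prop)
    have i1 : Integrable fun z : Phase d => w z * (kerK μ c z.1 y * fderiv ℝ φ (z.1, z.2 + -y) (ex j)) :=
      hw2.integrable_mul (memLp_test ((hK.continuous.comp continuous_fst).mul c1) hs'y.mul_left)
    have i2 : Integrable fun z : Phase d => w z * (kerK μ (derivKernel μ j c) z.1 y * φ (z.1, z.2 + -y)) :=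
      hw2.integrable_mul (memLp_test (hKj.mul hφy.continuous) hsy.mul_left)
    simp_rw [hd, mul_add] at h0
    rw [integral_add i1 i2] at h0
    have s : ∀ (K : E d → ℝ) (u ψ : Phase d → ℝ), ∫ z : Phase d, K z.1 * u (z.1, z.2 + y) * ψ z =
        ∫ z : Phase d, u z * (K z.1 * ψ (z.1, z.2 + -y)) := fun K u ψ => by
      rw [← integral_vshift y fun z : Phase d => u z * (K z.1 * ψ (z.1, z.2 + -y))]
      refine integral_congr_ae (Eventually.of_forall fun z => ?_)
      simp only [add_neg_cancel_right]
      ring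
    rw [s (fun x => kerK μ c x y) w (fun z => fderiv ℝ φ z (ex j)), s (fun x => kerK μ c x y) g φ,
      s (fun x => kerK μ (derivKernel μ j c) x y) w φ]
    linarith
  have hgi : ∀ (c' : E d → ℂ) (u : Phase d → ℝ), Measurable c' → cw k c' < ⊤ → Measurable u →
      FinW k u → Integrable fun z => WignerBGK.convTheta μ c' u z * φ z := by
    intro c' u hc' hcc hu huf
    have h1 := (integrable_pairing hk μ hc' hcc hu huf hφ.continuous.measurable f1).integral_prod_right
    refine h1.congr (Eventually.of_forall fun z => ?_)
    simp only [WignerBGK.convTheta]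
    rw [integral_mul_const]
  simp_rw [add_mul]
  rw [integral_add (hgi c g hc hcw hgm hgf) (hgi _ w hcm hcj hwm hwf),
    integral_convTheta_mul hk μ hc hcw hwm hwf hφ'.measurable f2,
    integral_convTheta_mul hk μ hc hcw hgm hgf hφ.continuous.measurable f1,
    integral_convTheta_mul hk μ hcm hcj hwm hwf hφ.continuous.measurable f1,
    integral_prod _ p1, integral_prod _ p2, integral_prod _ p3,
    ← integral_add p2.integral_prod_left p3.integral_prod_left, ← integral_neg]
  exact integral_congr_ae (Eventually.of_forall key)

/-- Streaming in terms of the weak derivatives. -/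
theorem integral_streaming {w : Phase d → ℝ} {g : Fin d → Phase d → ℝ} (hw : MemLp w 2)
    (hg : ∀ j, MemLp (g j) 2) (h : ∀ j, IsWeak (ex j) w (g j)) {φ : Phase d → ℝ}
    (hφ : ContDiff ℝ ∞ φ) (hs : HasCompactSupport φ) :
    ∫ z, w z * fderiv ℝ φ z (z.2, 0) = ∫ z, (-∑ j, z.2 j * g j z) * φ z := by
  have hcj : ∀ j : Fin d, ContDiff ℝ ∞ fun v : E d => v j := fun j =>
    (EuclideanSpace.proj j : E d →L[ℝ] ℝ).contDiff
  -- The component $v_j$ does not depend on $x$, so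
  -- $v\cdot\nabla_x\varphi=\sum_j\partial_{x_j}(v_j\varphi)$ and each $v_j\varphi$ is again a test
  -- function.
  have hd : ∀ z : Phase d, fderiv ℝ φ z (z.2, 0) =
      ∑ j, fderiv ℝ (fun z : Phase d => z.2 j * φ z) z (ex j) := fun z => by
    have e1 : ((z.2, 0) : Phase d) = ∑ j, z.2 j • (ex j : Phase d) := by
      refine Prod.ext ?_ ?_
      · simp only [Prod.fst_sum, Prod.smul_fst, ex]
        ext i
        simp [e, Pi.single_apply]
      · simp [Prod.snd_sum, ex]
    rw [e1, map_sum]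
    refine Finset.sum_congr rfl fun j _ => ?_
    rw [map_smul, smul_eq_mul]
    exact (fderiv_snd_mul _ (hcj j) hφ z (e j)).symm
  have hΦ : ∀ j : Fin d, ContDiff ℝ ∞ fun z : Phase d => z.2 j * φ z := fun j =>
    ((hcj j).comp contDiff_snd).mul hφ
  have hΦs : ∀ j : Fin d, HasCompactSupport fun z : Phase d => z.2 j * φ z := fun j => hs.mul_left
  simp_rw [hd, Finset.mul_sum]
  have hi : ∀ j : Fin d, Integrable fun z : Phase d =>
      w z * fderiv ℝ (fun z : Phase d => z.2 j * φ z) z (ex j) := fun j =>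
    hw.integrable_mul (memLp_test (continuous_fderiv_test (hΦ j) (ex j))
      ((hΦs j).fderiv_apply ℝ (ex j)))
  have hi' : ∀ j : Fin d, Integrable fun z : Phase d => -(g j z * (z.2 j * φ z)) := fun j =>
    ((hg j).integrable_mul (memLp_test (hΦ j).continuous (hΦs j))).neg
  rw [integral_finsetSum _ fun j _ => hi j]
  have e2 : ∀ z : Phase d, (-∑ j, z.2 j * g j z) * φ z = ∑ j, -(g j z * (z.2 j * φ z)) := fun z => by
    rw [neg_mul, Finset.sum_mul, ← Finset.sum_neg_distrib]
    refine Finset.sum_congr rfl fun j _ => ?_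
    ring
  simp_rw [e2]
  rw [integral_finsetSum _ fun j _ => hi' j]
  refine Finset.sum_congr rfl fun j _ => ?_
  rw [integral_neg]
  exact h j _ (hΦ j) (hΦs j)

theorem IsStreaming.unique {k : ℕ} {q s s' : X d k} (h : IsStreaming q s) (h' : IsStreaming q s') :
    s = s' := by
  refine Lp.ext ?_
  rw [EventuallyEq, ae_weightMeasure]
  have hl : ∀ u : X d k, LocallyIntegrable (u : Phase d → ℝ) := fun u =>
    (memLp_volume_of_weight (Lp.memLp u)).locallyIntegrable (by norm_num)
  refine ae_eq_of_integral_contDiff_smul_eq (hl s) (hl s') fun φ hφ hs => ?_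
  have := (h φ hφ hs).symm.trans (h' φ hφ hs)
  simpa [mul_comm] using this

end

section

variable {d : ℕ}

/-! ### Products of square-integrable functions -/

section Products

open FourierTransform SchwartzMap

theorem exists_isFT_of_right {g : E d → ℂ} (hg : MemLp g 2) : ∃ f, IsFT f g := by
  set F : Lp ℂ 2 (volume : Measure (E d)) := hg.toLp with hF
  have hFg : F =ᵐ[volume] g := hg.coeFn_toLp
  refine ⟨(𝓕⁻ F : Lp ℂ 2 (volume : Measure (E d))), Lp.memLp _, hg, fun φ => ?_⟩
  have h := congrArg (fun T => T φ)
    (Lp.fourier_toTemperedDistribution_eq (𝓕⁻ F : Lp ℂ 2 (volume : Measure (E d))))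
  rw [FourierTransform.fourier_fourierInv_eq] at h
  simp only [TemperedDistribution.fourier_apply, Lp.toTemperedDistribution_apply] at h
  calc ∫ x, g x * φ x = ∫ x, F x * φ x := by
        refine integral_congr_ae ?_
        filter_upwards [hFg] with x hx
        rw [hx]
    _ = _ := by simpa [mul_comm] using h.symm

/-- An integrable function whose transform is in $L^2$ is itself in $L^2$: it has the same pairings
with Schwartz functions as the inverse $L^2$ transform. This turns frequency estimates for a
product, known a priori only to be integrable, into $L^2$ estimates. -/
theorem isFT_of_fourier_memLp {h : E d → ℂ} (hi : Integrable h) (h2 : MemLp (𝓕 h) 2) :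
    IsFT h (𝓕 h) := by
  obtain ⟨u, hu⟩ := exists_isFT_of_right h2
  have : u =ᵐ[volume] h := by
    refine ae_eq_of_schwartz (locallyIntegrable_of_memLp_two hu.left) hi.locallyIntegrable fun φ => ?_
    have h1 := hu.pair (𝓕⁻ φ)
    rw [FourierTransform.fourier_fourierInv_eq] at h1
    rw [← h1, integral_fourier_mul_eq hi (𝓕⁻ φ).integrable, ← SchwartzMap.fourier_coe,
      FourierTransform.fourier_fourierInv_eq]
  exact hu.congr this (ae_eq_refl _)

theorem IsFT.translate {n B : E d → ℂ} (h : IsFT n B) (ξ : E d) :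
    IsFT (fun x => B (ξ - x))
      (fun x => Complex.exp (((-2 * Real.pi * inner ℝ x ξ : ℝ) : ℂ) * Complex.I) * n x) := by
  have hmp : MeasurePreserving (fun x : E d => ξ - x) volume volume :=
    Measure.measurePreserving_sub_left volume ξ
  have hcont : Continuous fun x : E d =>
      Complex.exp (((-2 * Real.pi * inner ℝ x ξ : ℝ) : ℂ) * Complex.I) := by fun_prop
  have hnorm : ∀ x : E d, ‖Complex.exp (((-2 * Real.pi * inner ℝ x ξ : ℝ) : ℂ) * Complex.I)‖ = 1 :=
    fun x => Complex.norm_exp_ofReal_mul_I _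
  refine ⟨h.right.comp_measurePreserving hmp, ?_, fun φ => ?_⟩
  · refine (memLp_congr_norm (hcont.aestronglyMeasurable.mul h.left.1) h.left.1
      (Eventually.of_forall fun x => ?_)).2 h.left
    simp only [Pi.mul_apply, norm_mul, hnorm, one_mul]
  · set χ : 𝓢(E d, ℂ) := (𝓕⁻ φ).compSubConstCLM ℂ ξ with hχ
    have e1 : ∀ x, 𝓕 χ x = Complex.exp (((-2 * Real.pi * inner ℝ x ξ : ℝ) : ℂ) * Complex.I) * φ x := by
      intro x
      have h2 : φ x = 𝓕 (𝓕⁻ φ) x := by rw [FourierTransform.fourier_fourierInv_eq]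
      rw [h2, SchwartzMap.fourier_coe, SchwartzMap.fourier_coe, Real.fourier_eq', Real.fourier_eq',
        ← integral_const_mul, ← integral_add_right_eq_self _ ξ]
      refine integral_congr_ae (Eventually.of_forall fun y => ?_)
      simp only [hχ, compSubConstCLM_apply, add_sub_cancel_right, smul_eq_mul, ← mul_assoc, ← Complex.exp_add]
      congr 2
      rw [inner_add_left, real_inner_comm x ξ]
      push_cast
      ring
    have h1 := h.pair χ
    calc ∫ x, Complex.exp (((-2 * Real.pi * inner ℝ x ξ : ℝ) : ℂ) * Complex.I) * n x * φ x
        = ∫ x, n x * 𝓕 χ x := by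
          refine integral_congr_ae (Eventually.of_forall fun x => ?_)
          simp only [e1]
          ring
      _ = ∫ x, B x * χ x := h1.symm
      _ = ∫ x, B (ξ - x) * χ (ξ - x) := (integral_sub_left_eq_self (fun x => B x * χ x) volume ξ).symm
      _ = _ := by
          refine integral_congr_ae (Eventually.of_forall fun x => ?_)
          simp only [hχ, compSubConstCLM_apply]
          congr 1
          rw [show ξ - x - ξ = -x by abel, SchwartzMap.fourierInv_coe, SchwartzMap.fourier_coe,
            Real.fourierInv_eq_fourier_neg, neg_neg]

/-- The Fourier transform of a product is a convolution. -/
theorem IsFT.fourier_mul {f A n B : E d → ℂ} (hf : IsFT f A) (hn : IsFT n B) (ξ : E d) :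
    𝓕 (fun x => f x * n x) ξ = ∫ y, A y * B (ξ - y) := by
  rw [hf.integral_mul (hn.translate ξ), Real.fourier_eq']
  refine integral_congr_ae (Eventually.of_forall fun x => ?_)
  simp only [smul_eq_mul]
  ring

/-- The convolution estimate behind the product estimate. -/
theorem lintegral_conv_sq_le_weights {m : ℕ} (f g : E d → ENNReal)
    (hf : Measurable f) (hg : Measurable g) :
    ∫⁻ v, (∫⁻ y, f y * g (v + y)) ^ 2 ≤ 4 * (invWt d (m + 1) *
      ((∫⁻ y, ENNReal.ofReal (wt m 1 y) * f y ^ 2) * ∫⁻ y, ENNReal.ofReal (wt 1 1 y) * g y ^ 2)) := by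
  set s : ℕ → E d → ENNReal := fun j y => ENNReal.ofReal (Real.sqrt (wt j 1 y)) with hs
  set t : ℕ → E d → ENNReal := fun j y => ENNReal.ofReal (Real.sqrt (wt j 1 y))⁻¹ with ht
  have hsm : ∀ j, Measurable (s j) := fun j => (measurable_wt j 1).sqrt.ennreal_ofReal
  have htm : ∀ j, Measurable (t j) := fun j => (measurable_wt j 1).sqrt.inv.ennreal_ofReal
  have hst : ∀ j y, t j y * s j y = 1 := fun j y => by
    have : 0 < Real.sqrt (wt j 1 y) := Real.sqrt_pos.2 (wt_pos _ _ _)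
    simp only [hs, ht]
    rw [← ENNReal.ofReal_mul (inv_nonneg.2 this.le), inv_mul_cancel₀ this.ne', ENNReal.ofReal_one]
  have hs2 : ∀ j y, s j y ^ 2 = ENNReal.ofReal (wt j 1 y) := fun j y => by
    simp only [hs]
    rw [← ENNReal.ofReal_pow (Real.sqrt_nonneg _), Real.sq_sqrt (wt_pos _ _ _).le]
  have ht2 : ∀ j y, t j y ^ 2 = ENNReal.ofReal (wt j 1 y)⁻¹ := fun j y => by
    simp only [ht]
    rw [← ENNReal.ofReal_pow (inv_nonneg.2 (Real.sqrt_nonneg _)), inv_pow,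
      Real.sq_sqrt (wt_pos _ _ _).le]
  have hmono : ∀ j (y z : E d), ‖y‖ ≤ ‖z‖ → s j y ≤ s j z := fun j y z h => by
    refine ENNReal.ofReal_le_ofReal (Real.sqrt_le_sqrt ?_)
    rw [wt_one, wt_one]
    gcongr
  -- The weights of orders $1$ and $m$ together dominate the weight of order $m+1$, whose inverse is
  -- integrable for $d<2(m+1)$.
  have hbnd : ∀ y : E d, t 1 y ^ 2 * t m y ^ 2 ≤ ENNReal.ofReal (wt (m + 1) 1 y)⁻¹ := fun y => by
    rw [ht2, ht2, ← ENNReal.ofReal_mul (inv_nonneg.2 (wt_pos _ _ _).le), ← mul_inv]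
    refine ENNReal.ofReal_le_ofReal (inv_anti₀ (wt_pos _ _ _) ?_)
    rw [wt_one, wt_one, wt_one]
    have h1 : 0 ≤ ‖y‖ ^ (2 * 1) := by positivity
    have h2 : 0 ≤ ‖y‖ ^ (2 * m) := by positivity
    have h3 : ‖y‖ ^ (2 * (m + 1)) = ‖y‖ ^ (2 * 1) * ‖y‖ ^ (2 * m) := by ring
    rw [h3]
    nlinarith
  have hL1 : ∀ u : E d → ENNReal, Measurable u → ∀ i j : ℕ, (i = 1 ∧ j = m) ∨ (i = m ∧ j = 1) →
      (∫⁻ y, t i y * u y) ^ 2 ≤ invWt d (m + 1) * ∫⁻ y, ENNReal.ofReal (wt j 1 y) * u y ^ 2 := by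
    intro u hu i j hij
    have h1 := lintegral_mul_sq_le (μ := (volume : Measure (E d))) (f := fun y => t i y * t j y)
      (g := fun y => s j y * u y) ((htm i).mul (htm j)).aemeasurable ((hsm j).mul hu).aemeasurable
    have e1 : ∀ y, t i y * t j y * (s j y * u y) = t i y * u y := fun y => by
      rw [mul_assoc, ← mul_assoc (t j y), hst, one_mul]
    simp_rw [e1, mul_pow, hs2] at h1
    refine h1.trans ?_
    gcongr
    unfold invWt
    refine lintegral_mono fun y => ?_
    rcases hij with ⟨rfl, rfl⟩ | ⟨rfl, rfl⟩
    · exact hbnd y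
    · rw [mul_comm]
      exact hbnd y
  -- Split by the larger frequency. If it is $v+y$, the weight of order $1$ is moved from $y$ to
  -- $g$; if it is $y$, the weight of order $m$ is moved from $v+y$ to $f$. In each case one factor
  -- lies in $L^1$ and the other in $L^2$.
  have hpt : ∀ v y : E d, f y * g (v + y) ≤
      (t 1 y * f y) * (s 1 (v + y) * g (v + y)) + (s m y * f y) * (t m (v + y) * g (v + y)) := by
    intro v y
    rcases le_total ‖y‖ ‖v + y‖ with h | h
    · refine le_trans ?_ le_self_add
      calc f y * g (v + y) = (t 1 y * f y) * (s 1 y * g (v + y)) := by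
            rw [mul_mul_mul_comm, hst, one_mul]
        _ ≤ _ := by gcongr; exact hmono 1 _ _ h
    · refine le_trans ?_ le_add_self
      calc f y * g (v + y) = (s m (v + y) * f y) * (t m (v + y) * g (v + y)) := by
            rw [mul_mul_mul_comm, mul_comm (s m (v + y)), hst, one_mul]
        _ ≤ _ := by gcongr; exact hmono m _ _ h
  have hshift : ∀ u : E d → ENNReal, Measurable u → ∀ v : E d, Measurable fun y => u (v + y) :=
    fun u hu v => hu.comp (measurable_const_add v)
  have m1 : Measurable fun y => t 1 y * f y := (htm 1).mul hf
  have m2 : Measurable fun y => s 1 y * g y := (hsm 1).mul hg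
  have m3 : Measurable fun y => s m y * f y := (hsm m).mul hf
  have m4 : Measurable fun y => t m y * g y := (htm m).mul hg
  have c1 := lintegral_conv_sq_le_left (μ := (volume : Measure (E d))) m1 m2
  have c2 := lintegral_conv_sq_le_right (μ := (volume : Measure (E d))) m3 m4
  simp only [mul_pow, hs2] at c1 c2
  have d1 := hL1 f hf 1 m (Or.inl ⟨rfl, rfl⟩)
  have d2 := hL1 g hg m 1 (Or.inr ⟨rfl, rfl⟩)
  set U := ∫⁻ y, ENNReal.ofReal (wt m 1 y) * f y ^ 2
  set W := ∫⁻ y, ENNReal.ofReal (wt 1 1 y) * g y ^ 2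
  have hin : ∀ v, Measurable fun y => t 1 y * f y * (s 1 (v + y) * g (v + y)) := fun v =>
    m1.mul (hshift _ m2 v)
  have hJ : Measurable fun v => 2 * (∫⁻ y, t 1 y * f y * (s 1 (v + y) * g (v + y))) ^ 2 :=
    ((Measurable.lintegral_prod_right'
      (f := fun p : E d × E d => t 1 p.2 * f p.2 * (s 1 (p.1 + p.2) * g (p.1 + p.2)))
      ((m1.comp measurable_snd).mul (m2.comp (measurable_fst.add measurable_snd)))).pow_const
        2).const_mul 2
  calc ∫⁻ v, (∫⁻ y, f y * g (v + y)) ^ 2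
      ≤ ∫⁻ v, (2 * (∫⁻ y, (t 1 y * f y) * (s 1 (v + y) * g (v + y))) ^ 2 +
          2 * (∫⁻ y, (s m y * f y) * (t m (v + y) * g (v + y))) ^ 2) := by
        refine lintegral_mono fun v => ?_
        rw [← mul_add]
        refine le_trans ?_ (add_sq_le_two_mul _ _)
        rw [← lintegral_add_left (hin v)]
        gcongr with y
        exact hpt v y
    _ = 2 * (∫⁻ v, (∫⁻ y, (t 1 y * f y) * (s 1 (v + y) * g (v + y))) ^ 2) +
          2 * ∫⁻ v, (∫⁻ y, (s m y * f y) * (t m (v + y) * g (v + y))) ^ 2 := by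
        rw [lintegral_add_left hJ,
          lintegral_const_mul' _ _ (by simp), lintegral_const_mul' _ _ (by simp)]
    _ ≤ 2 * ((invWt d (m + 1) * U) * W) + 2 * (U * (invWt d (m + 1) * W)) := by
        gcongr
        · exact c1.trans (by gcongr)
        · exact c2.trans (by gcongr)
    _ = _ := by ring

/-- The product of functions with `m` and with one derivative is square integrable if
`d < 2 (m + 1)`. -/
theorem lintegral_product_sq_le {m : ℕ} (hm : d < 2 * (m + 1)) {f A n B : E d → ℂ} (hf : IsFT f A)
    (hn : IsFT n B) (hA : Measurable A) (hB : Measurable B) (hAf : cw m A < ⊤) (hBf : cw 1 B < ⊤) :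
    MemLp (fun x => f x * n x) 2 ∧
      ∫⁻ x, ‖f x * n x‖ₑ ^ 2 ≤ 4 * (invWt d (m + 1) * (cw m A * cw 1 B)) := by
  have hi : Integrable fun x => f x * n x := hf.left.integrable_mul hn.left
  have hcont : Continuous (𝓕 fun x => f x * n x) :=
    VectorFourier.fourierIntegral_continuous Real.continuous_fourierChar continuous_inner hi
  have hbound : ∫⁻ ξ, ‖𝓕 (fun x => f x * n x) ξ‖ₑ ^ 2 ≤
      4 * (invWt d (m + 1) * (cw m A * cw 1 B)) := by
    have h1 := lintegral_conv_sq_le_weights (m := m) (fun y => ‖A (-y)‖ₑ) (fun y => ‖B y‖ₑ)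
      (hA.comp measurable_neg).enorm hB.enorm
    have e1 : ∫⁻ y : E d, ENNReal.ofReal (wt m 1 y) * ‖A (-y)‖ₑ ^ 2 = cw m A := by
      rw [cw, ← lintegral_neg_eq_self]
      simp [wt]
    rw [e1] at h1
    refine le_trans (lintegral_mono fun ξ => ?_) h1
    simp only
    rw [hf.fourier_mul hn]
    gcongr
    refine (enorm_integral_le_lintegral_enorm _).trans ?_
    rw [← lintegral_neg_eq_self]
    refine lintegral_mono fun y => ?_
    rw [enorm_mul, sub_neg_eq_add]
  have hfin : 4 * (invWt d (m + 1) * (cw m A * cw 1 B)) < ⊤ :=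
    ENNReal.mul_lt_top (by simp) (ENNReal.mul_lt_top (invWt_lt_top hm) (ENNReal.mul_lt_top hAf hBf))
  have h2 := isFT_of_fourier_memLp hi
    (memLp_two_of_lintegral_lt_top hcont.aestronglyMeasurable (hbound.trans_lt hfin))
  exact ⟨h2.left, by rw [← h2.lintegral_eq]; exact hbound⟩

end Products

end

section

variable {d : ℕ}

/-! ### Weak derivatives of products and of velocity averages -/

section WeakProducts

open FourierTransform

theorem isFT_fourierInv {h : E d → ℂ} (hi : Integrable h) (h2 : MemLp h 2) : IsFT (𝓕⁻ h) h := by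
  refine ⟨?_, h2, fun φ => ?_⟩
  · have := memLp_comp_neg (isFT_of_integrable hi h2).right
    refine this.ae_eq (Eventually.of_forall fun x => ?_)
    simp only [Real.fourierInv_eq_fourier_neg]
  · have h1 := integral_fourierInv_mul_eq hi (𝓕 φ).integrable
    rw [← SchwartzMap.fourierInv_coe, FourierTransform.fourierInv_fourier_eq] at h1
    exact h1.symm

/-- The factor $-i$ cancels the $i$ built into `kerK`, so a potential becomes a superposition of
kernels to which `fderiv_kerK` applies. -/
theorem kerK_potential (α : E d → ℂ) (x ξ : E d) :
    kerK (2 * Real.pi) (fun ξ => -Complex.I * α ξ) x ξ =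
      (Complex.exp (((2 * Real.pi * inner ℝ ξ x : ℝ) : ℂ) * Complex.I) • α ξ).re := by
  rw [kerK, real_inner_comm, smul_eq_mul, mul_comm Complex.I ((2 * Real.pi * inner ℝ ξ x : ℝ) : ℂ)]
  congr 1
  rw [← mul_assoc, mul_neg, Complex.I_mul_I]
  ring

theorem potential_eq_integral {α : E d → ℂ} (hα : Integrable α) (x : E d) :
    potential α x = ∫ ξ, kerK (2 * Real.pi) (fun ξ => -Complex.I * α ξ) x ξ := by
  rw [potential, Real.fourierInv_eq']
  simp_rw [kerK_potential]
  refine (integral_re (𝕜 := ℂ) ?_).symm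
  exact hα.bdd_mul (c := 1) (Continuous.aestronglyMeasurable (by fun_prop))
    (Eventually.of_forall fun v => by rw [Complex.norm_exp_ofReal_mul_I])

theorem integrable_kerK_potential {α : E d → ℂ} (hαm : Measurable α) (hα : Integrable α) {h : E d → ℝ}
    (hh : Integrable h) : Integrable (fun p : E d × E d =>
      kerK (2 * Real.pi) (fun ξ => -Complex.I * α ξ) p.1 p.2 * h p.1) (volume.prod volume) := by
  have hm : Measurable fun ξ => -Complex.I * α ξ := by fun_prop
  refine (hh.norm.mul_prod hα.norm).mono' ((measurable_kerK _ hm).aestronglyMeasurable.mul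
    hh.1.comp_fst) (Eventually.of_forall fun p => ?_)
  rw [norm_mul, mul_comm]
  gcongr
  refine (abs_kerK_le _ _ _ _).trans ?_
  simp

theorem integral_potential_mul {α : E d → ℂ} (hαm : Measurable α) (hα : Integrable α) {h : E d → ℝ}
    (hh : Integrable h) : ∫ x, potential α x * h x =
      ∫ ξ, ∫ x, kerK (2 * Real.pi) (fun ξ => -Complex.I * α ξ) x ξ * h x := by
  rw [integral_integral_swap (f := fun ξ x =>
    kerK (2 * Real.pi) (fun ξ => -Complex.I * α ξ) x ξ * h x) (integrable_kerK_potential hαm hα hh).swap]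
  refine integral_congr_ae (Eventually.of_forall fun x => ?_)
  simp only
  rw [potential_eq_integral hα, integral_mul_const]

/-- Write the potential as a superposition of plane waves, apply the smooth product rule to each,
and integrate over the frequency. The function $\xi_j\alpha$ is only square integrable, so the term
with the derivative of the potential is not obtained by Fubini but by Parseval, with $n\varphi$ as
the second function. -/
theorem IsWeak.potential_mul {α : E d → ℂ} (hαm : Measurable α) (hα : Integrable α) {j : Fin d}
    {f n n' : E d → ℝ} (hf : IsFT (fun x => (f x : ℂ))
      fun ξ => 2 * Real.pi * Complex.I * (ξ j : ℝ) * α ξ) (hn : MemLp n 2) (hn' : MemLp n' 2)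
    (h : IsWeak (e j) n n') :
    IsWeak (e j) (fun x => potential α x * n x) fun x => f x * n x + potential α x * n' x := by
  intro φ hφ hs
  have hφ' := continuous_fderiv_test hφ (e j)
  have hs' : HasCompactSupport fun z => fderiv ℝ φ z (e j) := hs.fderiv_apply ℝ (e j)
  have t0 := memLp_test hφ.continuous hs
  have t1 := memLp_test hφ' hs'
  have i1 : Integrable fun x => n x * fderiv ℝ φ x (e j) := hn.integrable_mul t1
  have i2 : Integrable fun x => n' x * φ x := hn'.integrable_mul t0
  have i0 : Integrable fun x => n x * φ x := hn.integrable_mul t0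
  set c : E d → ℂ := fun ξ => -Complex.I * α ξ with hc
  set β : E d → ℂ := fun ξ => 2 * Real.pi * Complex.I * (ξ j : ℝ) * α ξ with hβ
  have m0 : MemLp (fun x => n x * φ x) 2 := by
    obtain ⟨C, hC⟩ := hφ.continuous.bounded_above_of_compact_support hs
    refine MemLp.of_le_mul hn (hn.1.mul hφ.continuous.aestronglyMeasurable) (c := C)
      (Eventually.of_forall fun x => ?_)
    rw [norm_mul, mul_comm]
    gcongr
    exact hC x
  set u : E d → ℂ := 𝓕⁻ (fun x => ((n x * φ x : ℝ) : ℂ)) with hu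
  have huFT : IsFT u (fun x => ((n x * φ x : ℝ) : ℂ)) := isFT_fourierInv i0.ofReal (MemLp.ofReal (K := ℂ) m0)
  have hβu : Integrable fun ξ => β ξ * u ξ := hf.right.integrable_mul huFT.left
  -- Parseval between the derivative `f` of the potential and $n\varphi$; no boundedness of `f` is
  -- used.
  have hpair : ∫ ξ, (β ξ * u ξ).re = ∫ x, f x * (n x * φ x) := by
    have h1 := hf.integral_mul huFT
    have h2 := congrArg Complex.re h1
    rw [show (∫ ξ, β ξ * u ξ).re = ∫ ξ, (β ξ * u ξ).re from (integral_re (𝕜 := ℂ) hβu).symm] at h2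
    rw [h2, ← Complex.ofReal_re (∫ x, f x * (n x * φ x)), ← integral_complex_ofReal]
    push_cast
    rfl
  have hB : ∀ ξ, ∫ x, kerK (2 * Real.pi) (derivKernel (2 * Real.pi) j c) x ξ * (n x * φ x) =
      (β ξ * u ξ).re := fun ξ => by
    have hi : Integrable fun x => Complex.exp (((2 * Real.pi * inner ℝ x ξ : ℝ) : ℂ) * Complex.I) *
        ((n x * φ x : ℝ) : ℂ) :=
      i0.ofReal.bdd_mul (c := 1) (Continuous.aestronglyMeasurable (by fun_prop))
        (Eventually.of_forall fun v => by rw [Complex.norm_exp_ofReal_mul_I])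
    have e1 : β ξ * u ξ = ∫ x, β ξ * (Complex.exp (((2 * Real.pi * inner ℝ x ξ : ℝ) : ℂ) * Complex.I) *
        ((n x * φ x : ℝ) : ℂ)) := by
      rw [hu, Real.fourierInv_eq', integral_const_mul]
      rfl
    rw [e1]
    refine Eq.trans ?_ (integral_re (𝕜 := ℂ) (hi.const_mul _))
    refine integral_congr_ae (Eventually.of_forall fun x => ?_)
    simp only [RCLike.re_to_complex]
    rw [← mul_assoc (β ξ), Complex.re_mul_ofReal, kerK, derivKernel, hc, hβ, mul_comm Complex.I ((2 * Real.pi * inner ℝ x ξ : ℝ) : ℂ)]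
    congr 2
    simp only
    generalize Complex.exp _ = E'
    push_cast
    linear_combination (-2 * Real.pi * (ξ j : ℂ) * α ξ * E' * Complex.I) * Complex.I_mul_I
  have key : ∀ ξ, ∫ x, kerK (2 * Real.pi) c x ξ * (n x * fderiv ℝ φ x (e j)) =
      -(∫ x, kerK (2 * Real.pi) c x ξ * (n' x * φ x)) - (β ξ * u ξ).re := fun ξ => by
    have hK := contDiff_kerK (2 * Real.pi) c ξ
    have hKj := contDiff_kerK (2 * Real.pi) (derivKernel (2 * Real.pi) j c) ξ
    have h0 := h (fun x => kerK (2 * Real.pi) c x ξ * φ x) (hK.mul hφ) hs.mul_left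
    have hd : ∀ x, fderiv ℝ (fun x => kerK (2 * Real.pi) c x ξ * φ x) x (e j) =
        kerK (2 * Real.pi) c x ξ * fderiv ℝ φ x (e j) +
          kerK (2 * Real.pi) (derivKernel (2 * Real.pi) j c) x ξ * φ x := fun x => by
      have h2 := (((hK.differentiable (by simp)) x).hasFDerivAt.mul
        ((hφ.differentiable (by simp)) x).hasFDerivAt).fderiv
      refine (congrArg (fun T : E d →L[ℝ] ℝ => T (e j)) h2).trans ?_
      simp [fderiv_kerK]
      ring
    simp_rw [hd, mul_add] at h0
    have j1 : Integrable fun x => n x * (kerK (2 * Real.pi) c x ξ * fderiv ℝ φ x (e j)) :=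
      hn.integrable_mul (memLp_test (hK.continuous.mul hφ') hs'.mul_left)
    have j2 : Integrable fun x =>
        n x * (kerK (2 * Real.pi) (derivKernel (2 * Real.pi) j c) x ξ * φ x) :=
      hn.integrable_mul (memLp_test (hKj.continuous.mul hφ.continuous) hs.mul_left)
    rw [integral_add j1 j2] at h0
    rw [← hB]
    simp only [mul_left_comm (kerK _ _ _ _)]
    linarith
  have p1 := integral_potential_mul hαm hα i1
  have p2 := integral_potential_mul hαm hα i2
  have p2i : Integrable fun ξ => ∫ x, kerK (2 * Real.pi) c x ξ * (n' x * φ x) :=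
    (integrable_kerK_potential hαm hα i2).swap.integral_prod_left
  have hcont := continuous_potential hα
  have k1 : Integrable fun x => f x * (n x * φ x) := by
    have h1 := hf.left.re
    have h2 : MemLp f 2 := h1
    exact h2.integrable_mul m0
  have k2 : Integrable fun x => potential α x * (n' x * φ x) := by
    have : Integrable fun x => n' x * (potential α x * φ x) :=
      hn'.integrable_mul (memLp_test (hcont.mul hφ.continuous) hs.mul_left)
    simpa only [mul_left_comm] using this
  simp_rw [add_mul, mul_assoc]
  rw [integral_add k1 k2, p1, p2, ← hpair]
  rw [show (fun ξ => _) = _ from funext key]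
  refine (integral_sub p2i.neg hβu.re).trans ?_
  rw [Pi.neg_def, integral_neg]
  simp only [RCLike.re_to_complex, hc]
  ring

theorem memLp_tensor {g u : E d → ℝ} (hg : MemLp g 2) (hu : MemLp u 2) :
    MemLp (fun z : Phase d => g z.2 * u z.1) 2 := by
  refine memLp_two_of_lintegral_lt_top (hg.1.comp_snd.mul hu.1.comp_fst) ?_
  calc ∫⁻ z : Phase d, ‖g z.2 * u z.1‖ₑ ^ 2 = ∫⁻ z : Phase d, ‖u z.1‖ₑ ^ 2 * ‖g z.2‖ₑ ^ 2 := by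
        refine lintegral_congr fun z => ?_
        rw [enorm_mul, mul_pow, mul_comm]
    _ = (∫⁻ x, ‖u x‖ₑ ^ 2) * ∫⁻ v, ‖g v‖ₑ ^ 2 := by
        rw [volume_phase]
        exact lintegral_prod_mul (hu.1.enorm.pow_const 2) (hg.1.enorm.pow_const 2)
    _ < ⊤ := ENNReal.mul_lt_top (MemLp.lintegral_sq_lt_top hu) (MemLp.lintegral_sq_lt_top hg)

/-- Functions of the velocity times functions of the position. -/
theorem IsWeak.tensor {j : Fin d} {u u' g : E d → ℝ} (hu : MemLp u 2) (hu' : MemLp u' 2)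
    (h : IsWeak (e j) u u') (hg : MemLp g 2) :
    IsWeak (ex j) (fun z : Phase d => g z.2 * u z.1) fun z => g z.2 * u' z.1 := by
  have hten : ∀ f : E d → ℝ, MemLp f 2 → MemLp (fun z : Phase d => g z.2 * f z.1) 2 := fun f hf =>
    memLp_tensor hg hf
  intro φ hφ hs
  have hφ' := continuous_fderiv_test hφ (ex j)
  have hs' : HasCompactSupport fun z => fderiv ℝ φ z (ex j) := hs.fderiv_apply ℝ (ex j)
  have i1 : Integrable (fun z : Phase d => g z.2 * u z.1 * fderiv ℝ φ z (ex j))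
      (volume.prod volume) := (hten u hu).integrable_mul (memLp_test hφ' hs')
  have i2 : Integrable (fun z : Phase d => g z.2 * u' z.1 * φ z) (volume.prod volume) :=
    (hten u' hu').integrable_mul (memLp_test hφ.continuous hs)
  rw [volume_phase, integral_prod_symm _ i1, integral_prod_symm _ i2, ← integral_neg]
  refine integral_congr_ae (Eventually.of_forall fun v => ?_)
  simp only [mul_assoc]
  rw [integral_const_mul, integral_const_mul, ← mul_neg]
  congr 1
  have hφv : ContDiff ℝ ∞ fun x => φ (x, v) := hφ.comp (by fun_prop)
  have hsv : HasCompactSupport fun x => φ (x, v) := by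
    refine HasCompactSupport.intro (hs.image continuous_fst) fun x hx => ?_
    by_contra hne
    exact hx ⟨(x, v), subset_tsupport φ hne, rfl⟩
  have h0 := h _ hφv hsv
  rw [← h0]
  refine integral_congr_ae (Eventually.of_forall fun x => ?_)
  simp only
  congr 1
  have h1 : HasFDerivAt (fun x : E d => ((x, v) : Phase d)) (ContinuousLinearMap.inl ℝ (E d) (E d)) x :=
    hasFDerivAt_prodMk_left x v
  have h2 := (HasFDerivAt.comp x ((hφ.differentiable (by simp)) (x, v)).hasFDerivAt h1).fderiv
  exact (congrArg (fun T : E d →L[ℝ] ℝ => T (e j)) h2).symm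

/-- A function of $x$ alone is square integrable for the inverse weight, because the inverse weight
is integrable in $v$; the duality of `lintegral_mul_sq_le_wt` then applies. -/
theorem integrable_mul_fst {k : ℕ} (hk : d < 2 * k) (w : X d k) {g : E d → ℝ} (hg : MemLp g 2)
    (hgm : Measurable g) : Integrable fun z : Phase d => w z * g z.1 := by
  have hwm := (Lp.stronglyMeasurable w).measurable
  refine ⟨(hwm.mul (hgm.comp measurable_fst)).aestronglyMeasurable, ?_⟩
  have h1 := lintegral_mul_sq_le_wt k hwm.enorm (hgm.comp measurable_fst).enorm
  have h2 : ∫⁻ z : Phase d, ENNReal.ofReal (wt k 1 z.2)⁻¹ * ‖g z.1‖ₑ ^ 2 < ⊤ := by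
    have : ∫⁻ z : Phase d, ENNReal.ofReal (wt k 1 z.2)⁻¹ * ‖g z.1‖ₑ ^ 2 =
        (∫⁻ x, ‖g x‖ₑ ^ 2) * invWt d k := by
      rw [volume_phase]
      simp_rw [mul_comm (ENNReal.ofReal _)]
      exact lintegral_prod_mul (f := fun x => ‖g x‖ₑ ^ 2) (hgm.enorm.pow_const 2).aemeasurable
        ((measurable_wt k 1).inv.ennreal_ofReal).aemeasurable
    rw [this]
    exact ENNReal.mul_lt_top (MemLp.lintegral_sq_lt_top hg) (invWt_lt_top hk)
  have h3 := h1.trans_lt (ENNReal.mul_lt_top (MemLp.finW (Lp.memLp w)) h2)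
  by_contra hcon
  have hcon' : ∫⁻ z : Phase d, ‖w z‖ₑ * ‖g z.1‖ₑ = ⊤ := by
    simpa [HasFiniteIntegral, enorm_mul] using hcon
  simp only [Function.comp_apply] at h3
  rw [hcon'] at h3
  simp at h3

theorem integral_mul_fst {k : ℕ} (hk : d < 2 * k) (w : X d k) {g : E d → ℝ} (hg : MemLp g 2)
    (hgm : Measurable g) : ∫ z : Phase d, w z * g z.1 = ∫ x, density w x * g x := by
  have h := integrable_mul_fst hk w hg hgm
  rw [volume_phase] at h ⊢
  rw [integral_prod _ h]
  refine integral_congr_ae (Eventually.of_forall fun x => ?_)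
  simp only
  rw [integral_mul_const]
  rfl

/-- The weak derivative of the density is the density of the weak derivative. -/
theorem IsWeak.density {k : ℕ} (hk : d < 2 * k) {j : Fin d} {w g : X d k}
    (h : IsWeak (ex j) (w : Phase d → ℝ) g) : IsWeak (e j) (density w) (density g) := by
  intro φ hφ hs
  have hφ' := continuous_fderiv_test hφ (e j)
  have hs' : HasCompactSupport fun z => fderiv ℝ φ z (e j) := hs.fderiv_apply ℝ (e j)
  have t0 := memLp_test hφ.continuous hs
  have t1 := memLp_test hφ' hs'
  rw [← integral_mul_fst hk w t1 hφ'.measurable, ← integral_mul_fst hk g t0 hφ.continuous.measurable]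
  -- A test function of $x$ alone has no compact support in phase space. It is multiplied by a
  -- cutoff in $v$, which does not interfere with $x$-derivatives and disappears by dominated
  -- convergence.
  have hlim : ∀ (u : X d k) (ψ : E d → ℝ), MemLp ψ 2 → Measurable ψ →
      Tendsto (fun n : ℕ => ∫ z : Phase d, u z * (cutoff n z.2 * ψ z.1)) atTop
        (𝓝 (∫ z : Phase d, u z * ψ z.1)) := by
    intro u ψ hψ hψm
    have hi := integrable_mul_fst hk u hψ hψm
    have hum := (Lp.stronglyMeasurable u).measurable
    refine tendsto_integral_of_dominated_convergence (fun z => ‖u z * ψ z.1‖) (fun n => ?_) hi.norm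
      (fun n => Eventually.of_forall fun z => ?_) (Eventually.of_forall fun z => ?_)
    · exact (hum.mul (((contDiff_cutoff n).continuous.measurable.comp measurable_snd).mul
        (hψm.comp measurable_fst))).aestronglyMeasurable
    · rw [mul_left_comm, norm_mul]
      exact mul_le_of_le_one_left (norm_nonneg _) (abs_cutoff_le n z.2)
    · have := ((tendsto_cutoff z.2).mul_const (ψ z.1)).const_mul (u z)
      simpa using this
  refine tendsto_nhds_unique (hlim w _ t1 hφ'.measurable) ?_
  refine (hlim g φ t0 hφ.continuous.measurable).neg.congr fun n => ?_
  have hφ1 : ContDiff ℝ ∞ fun z : Phase d => φ z.1 := hφ.comp contDiff_fst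
  have hΦ : ContDiff ℝ ∞ fun z : Phase d => cutoff n z.2 * φ z.1 :=
    ((contDiff_cutoff n).comp contDiff_snd).mul hφ1
  have hΦs : HasCompactSupport fun z : Phase d => cutoff n z.2 * φ z.1 := by
    refine HasCompactSupport.intro (hs.isCompact.prod (hasCompactSupport_cutoff (d := d) n).isCompact)
      fun z hz => ?_
    by_contra hne
    exact hz ⟨subset_tsupport φ (right_ne_zero_of_mul hne),
      subset_tsupport _ (left_ne_zero_of_mul hne)⟩
  rw [← h _ hΦ hΦs]
  refine integral_congr_ae (Eventually.of_forall fun z => ?_)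
  simp only
  congr 1
  have h1 := fderiv_snd_mul (cutoff n) (contDiff_cutoff n) hφ1 z (e j)
  have h2 := (HasFDerivAt.comp z ((hφ.differentiable (by simp)) z.1).hasFDerivAt
    (hasFDerivAt_fst (𝕜 := ℝ) (p := z))).fderiv
  have h3 := congrArg (fun T : Phase d →L[ℝ] ℝ => T (e j, 0)) h2
  refine h1.trans ?_
  congr 1

end WeakProducts

end

section

variable {d : ℕ}

/-! ### The local equilibrium of a density with one weak derivative -/

/-- Taking $j$ derivatives of the potential trades $j$ orders of the weight on its transform for a
constant. -/
theorem cw_symbol_mul_le {k j n : ℕ} (hn : n = k + j) {b : ℝ} {V : E d → ℝ} {a : E d → ℂ}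
    (h : IsPotential n b V a) (I : Fin j → Fin d) :
    cw k (fun ξ => symbol I ξ * a ξ) ≤ ENNReal.ofReal (2 * ((2 * Real.pi) ^ j) ^ 2 * b) := by
  subst hn
  refine (cw_mul_le k j (a := a) (A := (2 * Real.pi) ^ j) fun y => ?_).trans ?_
  · rw [norm_mul]
    gcongr
    exact norm_symbol_le I y
  · rw [ENNReal.ofReal_mul (p := 2 * ((2 * Real.pi) ^ j) ^ 2) (by positivity)]
    exact mul_le_mul_right h.cw_le _

theorem measurable_symbol_mul {j : ℕ} (I : Fin j → Fin d) {a : E d → ℂ} (ha : Measurable a) :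
    Measurable fun ξ => symbol I ξ * a ξ := (continuous_symbol I).measurable.mul ha

/-- The continuous representative of the second derivatives of a potential. -/
def hessPot (a : E d → ℂ) (r s : Fin d) : E d → ℝ := potential fun ξ => symbol ![r, s] ξ * a ξ

theorem integrable_symbol_mul {k j n : ℕ} (hk : d < 2 * k) (hn : n = k + j) {b : ℝ} {V : E d → ℝ}
    {a : E d → ℂ} (h : IsPotential n b V a) (I : Fin j → Fin d) :
    Integrable fun ξ => symbol I ξ * a ξ :=
  integrable_of_cw hk (measurable_symbol_mul I h.meas) ((cw_symbol_mul_le hn h I).trans_lt ENNReal.ofReal_lt_top)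

theorem measurable_hessPot {k : ℕ} (hk : d < 2 * k) {b : ℝ} {V : E d → ℝ} {a : E d → ℂ}
    (h : IsPotential (k + 2) b V a) (r s : Fin d) : Measurable (hessPot a r s) :=
  (continuous_potential (integrable_symbol_mul hk rfl h _)).measurable

theorem abs_potential_le {α : E d → ℂ} (x : E d) : |potential α x| ≤ ∫ ξ, ‖α ξ‖ := by
  refine (Complex.abs_re_le_norm _).trans ?_
  rw [Real.fourierInv_eq]
  refine (norm_integral_le_integral_norm _).trans (le_of_eq ?_)
  simp

/-- A bound of the second derivatives of a potential. -/
def hessBound (d k : ℕ) (b : ℝ) : ℝ :=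
  Real.sqrt ((invWt d k).toReal * (2 * ((2 * Real.pi) ^ 2) ^ 2 * b))

/-- The transform of a second derivative keeps $k$ orders of the weight and is therefore integrable
for $d<2k$, which bounds the continuous representative everywhere. -/
theorem abs_hessPot_le {k : ℕ} (hk : d < 2 * k) {b : ℝ} (hb : 0 ≤ b) {V : E d → ℝ} {a : E d → ℂ}
    (h : IsPotential (k + 2) b V a) (r s : Fin d) (x : E d) : |hessPot a r s x| ≤ hessBound d k b :=
  (abs_potential_le x).trans (integral_norm_le_of_cw hk (measurable_symbol_mul _ h.meas) (by positivity)
    (cw_symbol_mul_le rfl h _))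

theorem hess_ae_eq_hessPot {k : ℕ} (hk : d < 2 * k) {b : ℝ} {V : E d → ℝ} {a : E d → ℂ}
    (h : IsPotential (k + 2) b V a) (r s : Fin d) : hess V r s =ᵐ[volume] hessPot a r s := by
  have h1 := MemSob.fourier h.memHx h.ft (by omega : 2 ≤ k + 2) ![r, s]
  have h2 : (fun l => e (![r, s] l)) = (![e r, e s] : Fin 2 → E d) := by
    ext l : 1
    fin_cases l <;> rfl
  rw [h2] at h1
  exact IsFT.ae_eq_potential h1 (integrable_symbol_mul hk rfl h _)

/-- The first order weight of the Fourier transform of a function with weak derivatives in `L²`. -/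
theorem cw_one_le {n : E d → ℝ} {n' : Fin d → E d → ℝ} (hn : MemLp n 2) (hn' : ∀ j, MemLp (n' j) 2)
    (h : ∀ j, IsWeak (e j) n (n' j)) {B : E d → ℂ} (hBm : Measurable B)
    (hB : IsFT (fun x => (n x : ℂ)) B) :
    cw 1 B ≤ (∫⁻ x, ‖n x‖ₑ ^ 2) + ∑ j, ∫⁻ x, ‖n' j x‖ₑ ^ 2 := by
  have hr : ∀ t : ℝ, ‖(t : ℂ)‖ₑ = ‖t‖ₑ := fun t => by
    rw [← ofReal_norm, Complex.norm_real, ofReal_norm]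
  have h0 : ∫⁻ ξ, ‖B ξ‖ₑ ^ 2 = ∫⁻ x, ‖n x‖ₑ ^ 2 := by
    rw [hB.lintegral_eq]
    simp only [hr]
  have h1 : ∀ j, ∫⁻ ξ, ‖2 * Real.pi * Complex.I * (inner ℝ ξ (e j) : ℝ) * B ξ‖ₑ ^ 2 =
      ∫⁻ x, ‖n' j x‖ₑ ^ 2 := fun j => by
    obtain ⟨a', -, ha', -⟩ := exists_isFT (MemLp.ofReal (K := ℂ) (hn' j))
    have h2 := (h j).fourier_eq hn (hn' j) hB ha'
    have h3 : ∫⁻ ξ, ‖a' ξ‖ₑ ^ 2 = ∫⁻ x, ‖n' j x‖ₑ ^ 2 := by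
      rw [ha'.lintegral_eq]
      exact lintegral_congr fun x => congrArg (· ^ 2) (hr _)
    refine (lintegral_congr_ae ?_).trans h3
    filter_upwards [h2] with ξ hξ
    rw [hξ]
  rw [← h0]
  simp only [← h1]
  rw [← lintegral_finsetSum' _ fun j _ => by fun_prop, ← lintegral_add_left (by fun_prop)]
  refine lintegral_mono fun ξ => ?_
  have e1 : ∀ j, ‖2 * Real.pi * Complex.I * (inner ℝ ξ (e j) : ℝ) * B ξ‖ₑ ^ 2 =
      ENNReal.ofReal ((2 * Real.pi) ^ 2 * (ξ j) ^ 2 * ‖B ξ‖ ^ 2) := fun j => by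
    rw [← ofReal_norm, ← ENNReal.ofReal_pow (norm_nonneg _)]
    congr 1
    simp only [norm_mul, Complex.norm_real, Complex.norm_I, e, EuclideanSpace.inner_single_right]
    simp [mul_pow]
  simp only [e1]
  rw [← ofReal_norm, ← ENNReal.ofReal_pow (norm_nonneg _), ← ENNReal.ofReal_mul (wt_pos _ _ _).le,
    ← ENNReal.ofReal_sum_of_nonneg fun j _ => by positivity, ← ENNReal.ofReal_add (by positivity)
      (Finset.sum_nonneg fun j _ => by positivity)]
  refine ENNReal.ofReal_le_ofReal ?_
  rw [wt_one, ← Finset.sum_mul, ← Finset.mul_sum]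
  have e2 : ‖ξ‖ ^ (2 * 1) = ∑ j, ξ j ^ 2 := by
    rw [mul_one, EuclideanSpace.norm_sq_eq]
    simp
  rw [e2]
  have e3 : (0 : ℝ) ≤ ∑ j, ξ j ^ 2 := Finset.sum_nonneg fun j _ => sq_nonneg _
  have e4 : (1 : ℝ) ≤ (2 * Real.pi) ^ 2 := one_le_pow₀ (by linarith [Real.pi_gt_three])
  nlinarith [mul_le_mul_of_nonneg_right (mul_le_mul_of_nonneg_right e4 e3) (sq_nonneg ‖B ξ‖)]

theorem lintegral_tensor_le (k : ℕ) {g u : E d → ℝ} (hg : Measurable g) (hu : AEMeasurable u) :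
    ∫⁻ z : Phase d, ‖g z.2 * u z.1‖ₑ ^ 2 ∂(weightMeasure d k) =
      (∫⁻ v, ENNReal.ofReal (wt k 1 v) * ‖g v‖ₑ ^ 2) * ∫⁻ x, ‖u x‖ₑ ^ 2 := by
  rw [lintegral_weightMeasure, mul_comm]
  calc ∫⁻ z : Phase d, ENNReal.ofReal (wt k 1 z.2) * ‖g z.2 * u z.1‖ₑ ^ 2
      = ∫⁻ z : Phase d, ‖u z.1‖ₑ ^ 2 * (ENNReal.ofReal (wt k 1 z.2) * ‖g z.2‖ₑ ^ 2) := by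
        refine lintegral_congr fun z => ?_
        rw [enorm_mul, mul_pow]
        ring
    _ = _ := by
        rw [volume_phase]
        exact lintegral_prod_mul (hu.enorm.pow_const 2)
          (((measurable_wt k 1).ennreal_ofReal.mul (hg.enorm.pow_const 2)).aemeasurable)

/-- Functions `g(v) u(x)` as elements of `X_k`. -/
theorem exists_tensor (k : ℕ) {g u : E d → ℝ} (hg : Measurable g) (hu : MemLp u 2) {G U : ℝ}
    (hG : 0 ≤ G) (hU : 0 ≤ U) (hgG : ∫⁻ v, ENNReal.ofReal (wt k 1 v) * ‖g v‖ₑ ^ 2 ≤ ENNReal.ofReal (G ^ 2))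
    (huU : ∫⁻ x, ‖u x‖ₑ ^ 2 ≤ ENNReal.ofReal (U ^ 2)) :
    ∃ y : X d k, ‖y‖ ≤ G * U ∧ y =ᵐ[volume] fun z => g z.2 * u z.1 := by
  have h0 : ∫⁻ z : Phase d, ‖g z.2 * u z.1‖ₑ ^ 2 ∂(weightMeasure d k) ≤ ENNReal.ofReal ((G * U) ^ 2) := by
    rw [lintegral_tensor_le k hg hu.1.aemeasurable, mul_pow, ENNReal.ofReal_mul (sq_nonneg _)]
    exact mul_le_mul' hgG huU
  have hm : AEStronglyMeasurable (fun z : Phase d => g z.2 * u z.1) (weightMeasure d k) := by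
    rw [aestronglyMeasurable_weightMeasure_iff]
    exact ((hg.comp measurable_snd).aestronglyMeasurable).mul hu.1.comp_fst
  have hL := memLp_two_of_lintegral_lt_top hm (h0.trans_lt ENNReal.ofReal_lt_top)
  refine ⟨hL.toLp, ?_, ?_⟩
  · have h1 : ‖hL.toLp‖ₑ ^ 2 ≤ ENNReal.ofReal (G * U) ^ 2 := by
      rw [enorm_sq_eq_lintegral, ← ENNReal.ofReal_pow (by positivity)]
      refine le_trans (le_of_eq (lintegral_congr_ae ?_)) h0
      filter_upwards [hL.coeFn_toLp] with z hz
      rw [hz]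
    have h2 := (ENNReal.pow_right_strictMono two_ne_zero).le_iff_le.1 h1
    rw [← ofReal_norm] at h2
    exact (ENNReal.ofReal_le_ofReal_iff (by positivity)).1 h2
  · have := hL.coeFn_toLp
    rwa [EventuallyEq, ae_weightMeasure] at this

theorem IsWeak.congr {F : Type*} [NormedAddCommGroup F] [NormedSpace ℝ F] [MeasureSpace F] {b : F}
    {u u' g g' : F → ℝ} (h : IsWeak b u g) (hu : u =ᵐ[volume] u') (hg : g =ᵐ[volume] g') :
    IsWeak b u' g' := by
  intro φ hφ hs
  have e1 : ∫ z, u' z * fderiv ℝ φ z b = ∫ z, u z * fderiv ℝ φ z b :=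
    integral_congr_ae (by filter_upwards [hu] with z hz; rw [hz])
  have e2 : ∫ z, g' z * φ z = ∫ z, g z * φ z :=
    integral_congr_ae (by filter_upwards [hg] with z hz; rw [hz])
  rw [e1, e2, h φ hφ hs]

theorem memLp_X {k : ℕ} (w : X d k) : MemLp (w : Phase d → ℝ) 2 := memLp_volume_of_weight (Lp.memLp w)

theorem coeFn_add_X {k : ℕ} (w w' : X d k) : ⇑(w + w') =ᵐ[volume] (w + w' : Phase d → ℝ) := by
  have := Lp.coeFn_add w w'
  rwa [EventuallyEq, ae_weightMeasure] at this

theorem coeFn_sub_X {k : ℕ} (w w' : X d k) : ⇑(w - w') =ᵐ[volume] (w - w' : Phase d → ℝ) := by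
  have := Lp.coeFn_sub w w'
  rwa [EventuallyEq, ae_weightMeasure] at this

theorem coeFn_smul_X {k : ℕ} (r : ℝ) (w : X d k) : ⇑(r • w) =ᵐ[volume] (r • w : Phase d → ℝ) := by
  have := Lp.coeFn_smul r w
  rwa [EventuallyEq, ae_weightMeasure] at this

theorem coeFn_zero_X {k : ℕ} : ⇑(0 : X d k) =ᵐ[volume] (0 : Phase d → ℝ) := by
  have := Lp.coeFn_zero ℝ 2 (weightMeasure d k)
  rwa [EventuallyEq, ae_weightMeasure] at this

theorem ext_X {k : ℕ} {w w' : X d k} (h : w =ᵐ[volume] w') : w = w' := by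
  refine Lp.ext ?_
  rwa [EventuallyEq, ae_weightMeasure]

end

/-! ### One weak position derivative of the local equilibrium -/

section

variable {d : ℕ}

section Weak

theorem integrable_mul_test {F : Type*} [NormedAddCommGroup F] [MeasureSpace F] [OpensMeasurableSpace F]
    [IsFiniteMeasureOnCompacts (volume : Measure F)] {u φ : F → ℝ} (hu : MemLp u 2) (hφ : Continuous φ)
    (hs : HasCompactSupport φ) : Integrable fun z => u z * φ z :=
  hu.integrable_mul (hφ.memLp_of_hasCompactSupport hs : MemLp φ 2 volume)

section

variable {F : Type*} [NormedAddCommGroup F] [NormedSpace ℝ F] [MeasureSpace F]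

theorem IsWeak.const_mul {b : F} {u g : F → ℝ} (h : IsWeak b u g) (r : ℝ) :
    IsWeak b (fun z => r * u z) fun z => r * g z := by
  intro φ hφ hs
  simp only [mul_assoc, integral_const_mul]
  rw [h φ hφ hs]
  ring

theorem isWeak_zero (b : F) : IsWeak b (0 : F → ℝ) 0 := fun φ _ _ => by simp

end

variable {F : Type*} [NormedAddCommGroup F] [NormedSpace ℝ F] [MeasureSpace F] [OpensMeasurableSpace F]
  [IsFiniteMeasureOnCompacts (volume : Measure F)]

theorem IsWeak.add {b : F} {u u' g g' : F → ℝ} (hu : MemLp u 2) (hu' : MemLp u' 2) (hg : MemLp g 2)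
    (hg' : MemLp g' 2) (h : IsWeak b u g) (h' : IsWeak b u' g') : IsWeak b (u + u') (g + g') := by
  intro φ hφ hs
  have c1 : Continuous fun z => fderiv ℝ φ z b :=
    (hφ.continuous_fderiv (by simp)).clm_apply continuous_const
  have s1 : HasCompactSupport fun z => fderiv ℝ φ z b := hs.fderiv_apply ℝ b
  simp only [Pi.add_apply, add_mul]
  rw [integral_add (integrable_mul_test hu c1 s1) (integrable_mul_test hu' c1 s1),
    integral_add (integrable_mul_test hg hφ.continuous hs) (integrable_mul_test hg' hφ.continuous hs),
    h φ hφ hs, h' φ hφ hs]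
  ring

theorem IsWeak.sum {b : F} {ι : Type*} (s : Finset ι) {u g : ι → F → ℝ} (hu : ∀ i, MemLp (u i) 2)
    (hg : ∀ i, MemLp (g i) 2) (h : ∀ i, IsWeak b (u i) (g i)) :
    IsWeak b (∑ i ∈ s, u i) (∑ i ∈ s, g i) := by
  classical
  induction s using Finset.induction_on with
  | empty => simpa using isWeak_zero b
  | insert i s hi ih =>
    rw [Finset.sum_insert hi, Finset.sum_insert hi]
    exact (h i).add (hu i) (memLp_finsetSum' _ fun i _ => hu i) (hg i)
      (memLp_finsetSum' _ fun i _ => hg i) ih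

end Weak

/-- The velocity profiles of the correction terms are bounded in the weighted norm. -/
theorem lintegral_correction_le (c : Constants) (k : ℕ) (r s : Fin d) :
    ∫⁻ v, ENNReal.ofReal (wt k 1 v) * ‖correction c r s v‖ₑ ^ 2 ≤
      ENNReal.ofReal (Real.sqrt (corrConst c ^ 2 * (gaussWt c d k).toReal) ^ 2) := by
  rw [Real.sq_sqrt (by positivity), ENNReal.ofReal_mul (sq_nonneg _),
    ENNReal.ofReal_toReal (gaussWt_lt_top c d k).ne, gaussWt,
    ← lintegral_const_mul' _ _ ENNReal.ofReal_ne_top]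
  refine lintegral_mono fun v => ?_
  simp only
  rw [mul_left_comm, ENNReal.ofReal_pow (corrConst_nonneg c), ← mul_pow,
    ← ENNReal.ofReal_mul (corrConst_nonneg c)]
  gcongr
  rw [← ofReal_norm]
  exact ENNReal.ofReal_le_ofReal (abs_correction_le c r s v)

theorem lintegral_maxwellian_le (c : Constants) (k : ℕ) :
    ∫⁻ v : E d, ENNReal.ofReal (wt k 1 v) * ‖maxwellian c v‖ₑ ^ 2 ≤
      ENNReal.ofReal (Real.sqrt (gaussWt c d k).toReal ^ 2) := by
  rw [Real.sq_sqrt ENNReal.toReal_nonneg, ENNReal.ofReal_toReal (gaussWt_lt_top c d k).ne, gaussWt]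
  refine lintegral_mono fun v => ?_
  gcongr
  rw [← ofReal_norm]
  refine ENNReal.ofReal_le_ofReal ?_
  have := maxwellian_pos c v
  rw [Real.norm_of_nonneg this.le]
  nlinarith [mul_nonneg (sq_nonneg ‖v‖) this.le]

/-- The density of an element of `X_k`, with its bound. -/
theorem lintegral_density_sq_le_norm {k : ℕ} (hk : d < 2 * k) (w : X d k) :
    ∫⁻ x, ‖density w x‖ₑ ^ 2 ≤ ENNReal.ofReal (Real.sqrt (invWt d k).toReal * ‖w‖) ^ 2 := by
  refine (lintegral_density_sq_le k (Lp.stronglyMeasurable w).measurable).trans (le_of_eq ?_)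
  rw [← lintegral_weightMeasure, ← enorm_sq_eq_lintegral, ← ENNReal.ofReal_pow (by positivity), mul_pow,
    Real.sq_sqrt ENNReal.toReal_nonneg, ENNReal.ofReal_mul ENNReal.toReal_nonneg,
    ENNReal.ofReal_toReal (invWt_lt_top hk).ne, ENNReal.ofReal_pow (norm_nonneg _), ofReal_norm]

theorem measurable_density_X {k : ℕ} (w : X d k) : Measurable (density (w : Phase d → ℝ)) :=
  measurable_density (Lp.stronglyMeasurable w).measurable

theorem memLp_density {k : ℕ} (hk : d < 2 * k) (w : X d k) : MemLp (density (w : Phase d → ℝ)) 2 :=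
  memLp_two_of_lintegral_lt_top (measurable_density_X w).aestronglyMeasurable
    ((lintegral_density_sq_le_norm hk w).trans_lt (ENNReal.pow_lt_top ENNReal.ofReal_lt_top))

/-- The constant in the bound of a third derivative of the potential times a density. -/
def thirdBound (d m : ℕ) (b : ℝ) : ℝ :=
  Real.sqrt (4 * ((invWt d (m + 1)).toReal * (2 * ((2 * Real.pi) ^ 3) ^ 2 * b *
    ((1 + d) * (invWt d (m + 2)).toReal))))

/-- Products of second derivatives of the potential with densities have weak derivatives. -/
theorem exists_hessPot_mul_density {m : ℕ} (hk : d < 2 * (m + 1)) {b : ℝ} (hb : 0 ≤ b) {V : E d → ℝ}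
    {a : E d → ℂ} (h : IsPotential (m + 1 + 2) b V a) (r s : Fin d) {w : X d (m + 2)}
    {χ : Fin d → X d (m + 2)} (hw : ∀ j, IsWeak (ex j) (w : Phase d → ℝ) (χ j)) (j : Fin d) :
    ∃ q : E d → ℝ, MemLp q 2 ∧
      ∫⁻ x, ‖q x‖ₑ ^ 2 ≤ ENNReal.ofReal ((thirdBound d m b * ‖(w, χ)‖) ^ 2) ∧
      IsWeak (e j) (fun x => hessPot a r s x * density w x)
        fun x => q x + hessPot a r s x * density (χ j) x := by
  have hk2 : d < 2 * (m + 2) := by omega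
  set n := density (w : Phase d → ℝ) with hn
  have hnL : MemLp n 2 := memLp_density hk2 w
  have hnj : ∀ j, MemLp (density (χ j : Phase d → ℝ)) 2 := fun j => memLp_density hk2 (χ j)
  have hwd : ∀ j, IsWeak (e j) n (density (χ j)) := fun j => (hw j).density hk2
  obtain ⟨B, hBm, hB, -⟩ := exists_isFT (MemLp.ofReal (K := ℂ) hnL)
  set p := ‖(w, χ)‖ with hp
  have hp1 : ‖w‖ ≤ p := norm_fst_le (w, χ)
  have hp2 : ∀ j, ‖χ j‖ ≤ p := fun j => (norm_le_pi_norm χ j).trans (norm_snd_le (w, χ))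
  have hcwB : cw 1 B ≤ ENNReal.ofReal ((1 + d) * (invWt d (m + 2)).toReal * p ^ 2) := by
    refine (cw_one_le hnL hnj hwd hBm hB).trans ?_
    have h1 : ∀ y : X d (m + 2), ‖y‖ ≤ p → ∫⁻ x, ‖density y x‖ₑ ^ 2 ≤
        ENNReal.ofReal ((invWt d (m + 2)).toReal * p ^ 2) := fun y hy => by
      refine (lintegral_density_sq_le_norm hk2 y).trans ?_
      rw [← ENNReal.ofReal_pow (by positivity), mul_pow, Real.sq_sqrt ENNReal.toReal_nonneg]
      gcongr
    refine (add_le_add (h1 w hp1) (Finset.sum_le_sum fun j _ => h1 (χ j) (hp2 j))).trans (le_of_eq ?_)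
    rw [← ENNReal.ofReal_sum_of_nonneg fun j _ => by positivity,
      ← ENNReal.ofReal_add (by positivity) (by positivity)]
    congr 1
    simp
    ring
  -- Of the $m+3$ orders of weight on the transform of the potential, $m$ remain after three
  -- derivatives. The density has one weak derivative, so the product estimate applies exactly under
  -- $d<2(m+1)$.
  have hf0 := MemSob.fourier h.memHx h.ft (by omega : 3 ≤ m + 1 + 2) ![r, s, j]
  set f := weakDeriv (fun l => e ((![r, s, j] : Fin 3 → Fin d) l)) V with hfdef
  have hsym : ∀ ξ : E d, symbol ![r, s, j] ξ * a ξ =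
      2 * Real.pi * Complex.I * (ξ j : ℝ) * (symbol ![r, s] ξ * a ξ) := fun ξ => by
    simp [symbol, Fin.prod_univ_succ]
    ring
  have hcwA : cw m (fun ξ => symbol ![r, s, j] ξ * a ξ) ≤
      ENNReal.ofReal (2 * ((2 * Real.pi) ^ 3) ^ 2 * b) := cw_symbol_mul_le (by omega) h _
  obtain ⟨hL, hbd⟩ := lintegral_product_sq_le hk hf0 hB (measurable_symbol_mul _ h.meas) hBm
    (hcwA.trans_lt ENNReal.ofReal_lt_top) (hcwB.trans_lt ENNReal.ofReal_lt_top)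
  have hre : ∀ x, (f x : ℂ) * (n x : ℂ) = ((f x * n x : ℝ) : ℂ) := fun x => by push_cast; rfl
  refine ⟨fun x => f x * n x, hL.re.ae_eq (Eventually.of_forall fun x =>
    (congrArg Complex.re (hre x)).trans (Complex.ofReal_re _)), ?_, ?_⟩
  · have e1 : ∀ x, ‖f x * n x‖ₑ ^ 2 = ‖(f x : ℂ) * (n x : ℂ)‖ₑ ^ 2 := fun x => by
      rw [hre, ← ofReal_norm, ← ofReal_norm, Complex.norm_real]
    refine (lintegral_congr e1).trans_le ?_
    refine hbd.trans ?_
    rw [thirdBound, mul_pow, Real.sq_sqrt (by positivity)]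
    calc _ ≤ 4 * (ENNReal.ofReal (invWt d (m + 1)).toReal *
          (ENNReal.ofReal (2 * ((2 * Real.pi) ^ 3) ^ 2 * b) *
            ENNReal.ofReal ((1 + d) * (invWt d (m + 2)).toReal * p ^ 2))) := by
          rw [ENNReal.ofReal_toReal (invWt_lt_top hk).ne]
          gcongr
      _ = _ := by
          rw [show (4 : ENNReal) = ENNReal.ofReal 4 by simp, ← ENNReal.ofReal_mul (by positivity),
            ← ENNReal.ofReal_mul (by positivity), ← ENNReal.ofReal_mul (by positivity)]
          congr 1
          ring
  · exact IsWeak.potential_mul (measurable_symbol_mul _ h.meas) (integrable_symbol_mul hk rfl h _)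
      (hf0.congr (ae_eq_refl _) (Eventually.of_forall hsym)) hnL (hnj j) (hwd j)

theorem memLp_two_of_weight (k : ℕ) {g : E d → ℝ} (hg : AEStronglyMeasurable g)
    (h : ∫⁻ v, ENNReal.ofReal (wt k 1 v) * ‖g v‖ₑ ^ 2 < ⊤) : MemLp g 2 := by
  refine memLp_two_of_lintegral_lt_top hg (lt_of_le_of_lt (lintegral_mono fun v => ?_) h)
  exact le_mul_of_one_le_left' (ENNReal.one_le_ofReal.2 (one_le_wt k 1 v))

theorem coeFn_sum_X {k : ℕ} {ι : Type*} (s : Finset ι) (f : ι → X d k) :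
    ⇑(∑ i ∈ s, f i) =ᵐ[volume] fun z => ∑ i ∈ s, f i z := by
  classical
  induction s using Finset.induction_on with
  | empty =>
    simp only [Finset.sum_empty]
    exact coeFn_zero_X
  | insert i s hi ih =>
    rw [Finset.sum_insert hi]
    filter_upwards [coeFn_add_X (f i) (∑ i ∈ s, f i), ih] with z h1 h2
    rw [h1, Pi.add_apply, h2, Finset.sum_insert hi]

/-- The constant in the bound of the derivatives of the local equilibrium. -/
def omegaDerivBound (c : Constants) (d m : ℕ) (b : ℝ) : ℝ :=
  omegaBound c d (m + 2) (m + 2) (hessBound d (m + 1) b) +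
    c.nu * (d * (d * (Real.sqrt (corrConst c ^ 2 * (gaussWt c d (m + 2)).toReal) * thirdBound d m b)))

/-- The local equilibrium has weak derivatives in the position. -/
theorem exists_omega_deriv {m : ℕ} (hk : d < 2 * (m + 1)) (c : Constants) {b : ℝ} (hb : 0 ≤ b) {V : E d → ℝ}
    {a : E d → ℂ} (h : IsPotential (m + 1 + 2) b V a) {w : X d (m + 2)}
    {χ : Fin d → X d (m + 2)} (hw : ∀ j, IsWeak (ex j) (w : Phase d → ℝ) (χ j)) :
    ∃ (y : X d (m + 2)) (y' : Fin d → X d (m + 2)),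
      y =ᵐ[volume] (fun z => omegaKer c (hessPot a) z * density w z.1) ∧
      (∀ j, IsWeak (ex j) (y : Phase d → ℝ) (y' j)) ∧
      ‖(y, y')‖ ≤ omegaDerivBound c d m b * ‖(w, χ)‖ := by
  have hk2 : d < 2 * (m + 2) := by omega
  have hν := c.nu_pos
  obtain ⟨T, hTn, hT⟩ := exists_omega hk2 (m + 2) c (measurable_hessPot hk h) (Real.sqrt_nonneg _)
    (abs_hessPot_le hk hb h)
  choose q hq hqn hqw using fun r s => exists_hessPot_mul_density hk hb h r s hw
  have hcont : ∀ r s : Fin d, Measurable (correction c r s : E d → ℝ) := fun r s =>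
    (continuous_correction c r s).measurable
  choose t htn ht using fun r s j => exists_tensor (m + 2) (hcont r s) (hq r s j) (Real.sqrt_nonneg _)
    (by unfold thirdBound; positivity : 0 ≤ thirdBound d m b * ‖(w, χ)‖) (lintegral_correction_le c (m + 2) r s)
    (hqn r s j)
  -- The product rule: `T (χ j)` is the equilibrium of the differentiated density, and the sum
  -- collects the terms in which the derivative falls on the second derivatives of the potential.
  refine ⟨T w, fun j => T (χ j) + c.nu • ∑ r, ∑ s, t r s j, hT w, fun j => ?_, ?_⟩
  · have hF2 : MemLp (maxwellian c : E d → ℝ) 2 := memLp_two_of_weight (m + 2)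
      (contDiff_maxwellian c).continuous.aestronglyMeasurable
      ((lintegral_maxwellian_le c (m + 2)).trans_lt ENNReal.ofReal_lt_top)
    have hC2 : ∀ r s, MemLp (correction c r s : E d → ℝ) 2 := fun r s => memLp_two_of_weight (m + 2)
      (hcont r s).aestronglyMeasurable
      ((lintegral_correction_le c (m + 2) r s).trans_lt ENNReal.ofReal_lt_top)
    have hn := memLp_density hk2 w
    have hnj := memLp_density hk2 (χ j)
    have hHn : ∀ (y : X d (m + 2)) (r s : Fin d), MemLp (fun x => hessPot a r s x * density y x) 2 :=
      fun y r s => (memLp_density hk2 y).of_le_mul (c := hessBound d (m + 1) b)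
        ((measurable_hessPot hk h r s).mul (measurable_density_X y)).aestronglyMeasurable
        (Eventually.of_forall fun x => by
          rw [norm_mul]
          gcongr
          exact abs_hessPot_le hk hb h r s x)
    have w1 := IsWeak.tensor hn hnj ((hw j).density hk2) hF2
    have w2 : ∀ r s, IsWeak (ex j) (fun z : Phase d => correction c r s z.2 *
        (hessPot a r s z.1 * density w z.1)) fun z => correction c r s z.2 *
          (q r s j z.1 + hessPot a r s z.1 * density (χ j) z.1) := fun r s =>
      IsWeak.tensor (hHn w r s) ((hq r s j).add (hHn (χ j) r s)) (hqw r s j) (hC2 r s)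
    have m2 := fun r s => memLp_tensor (hC2 r s) (hHn w r s)
    have m3 := fun r s => memLp_tensor (hC2 r s) ((hq r s j).add (hHn (χ j) r s))
    have w3 := IsWeak.sum Finset.univ (fun r => memLp_finsetSum' Finset.univ fun s _ => m2 r s)
      (fun r => memLp_finsetSum' Finset.univ fun s _ => m3 r s)
      fun r => IsWeak.sum Finset.univ (m2 r) (m3 r) (w2 r)
    have w4 := (w1.add (memLp_tensor hF2 hn) (memLp_finsetSum' _ fun r _ => memLp_finsetSum' _ fun s _ => m2 r s)
      (memLp_tensor hF2 hnj) (memLp_finsetSum' _ fun r _ => memLp_finsetSum' _ fun s _ => m3 r s) w3).const_mul c.nu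
    refine w4.congr ?_ ?_
    · filter_upwards [hT w] with z hz
      rw [hz, omegaKer_eq]
      simp only [Pi.add_apply, Finset.sum_apply]
      rw [mul_assoc, add_mul, Finset.sum_mul]
      simp only [Finset.sum_mul, mul_assoc]
    · have hs := coeFn_sum_X Finset.univ fun r => ∑ s, t r s j
      have hs' := fun r => coeFn_sum_X Finset.univ fun s => t r s j
      filter_upwards [hT (χ j), coeFn_add_X (T (χ j)) (c.nu • ∑ r, ∑ s, t r s j),
        coeFn_smul_X c.nu (∑ r, ∑ s, t r s j), hs, ae_all_iff.2 hs', ae_all_iff.2 fun r => ae_all_iff.2 fun s => ht r s j]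
        with z h1 h2 h3 h4 h5 h6
      rw [h2]
      simp only [Pi.add_apply, Finset.sum_apply, h1, h3, Pi.smul_apply, h4, h5, h6, smul_eq_mul, omegaKer_eq]
      rw [mul_assoc, add_mul, Finset.sum_mul]
      simp only [Finset.sum_mul, mul_add, Finset.sum_add_distrib, mul_assoc]
      ring
  · have hC := corrConst_nonneg c
    have hp := norm_nonneg (w, χ)
    have hTb : ∀ y : X d (m + 2), ‖y‖ ≤ ‖(w, χ)‖ → ‖T y‖ ≤ omegaBound c d (m + 2) (m + 2)
        (hessBound d (m + 1) b) * ‖(w, χ)‖ := fun y hy =>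
      (T.le_opNorm y).trans (mul_le_mul hTn hy (norm_nonneg _) (Real.sqrt_nonneg _))
    have hE : 0 ≤ c.nu * (d * (d * (Real.sqrt (corrConst c ^ 2 * (gaussWt c d (m + 2)).toReal) *
      thirdBound d m b))) := by unfold thirdBound; positivity
    have hO : 0 ≤ omegaBound c d (m + 2) (m + 2) (hessBound d (m + 1) b) := Real.sqrt_nonneg _
    rw [omegaDerivBound, add_mul]
    refine norm_prod_le_iff.2 ⟨?_, (pi_norm_le_iff_of_nonneg (by positivity)).2 fun j => ?_⟩
    · exact (hTb w (norm_fst_le (w, χ))).trans (le_add_of_nonneg_right (by positivity))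
    · refine (norm_add_le _ _).trans (add_le_add
        (hTb _ ((norm_le_pi_norm χ j).trans (norm_snd_le (w, χ)))) ?_)
      rw [norm_smul, Real.norm_of_nonneg hν.le, mul_assoc]
      gcongr
      refine (norm_sum_le_of_le _ fun r _ => norm_sum_le_of_le _ fun s _ => htn r s j).trans (le_of_eq ?_)
      simp
      ring

end

section

variable {d : ℕ}

/-! ### Elements of `X_k` with weak derivatives in `X_k` -/

theorem isWeak_coeFn_add {k : ℕ} {j : Fin d} {w w' g g' : X d k} (h : IsWeak (ex j) (w : Phase d → ℝ) g)
    (h' : IsWeak (ex j) (w' : Phase d → ℝ) g') :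
    IsWeak (ex j) ((w + w' : X d k) : Phase d → ℝ) ((g + g' : X d k) : Phase d → ℝ) :=
  (h.add (memLp_X w) (memLp_X w') (memLp_X g) (memLp_X g') h').congr (coeFn_add_X w w').symm
    (coeFn_add_X g g').symm

theorem isWeak_coeFn_smul {k : ℕ} {j : Fin d} {w g : X d k} (r : ℝ) (h : IsWeak (ex j) (w : Phase d → ℝ) g) :
    IsWeak (ex j) ((r • w : X d k) : Phase d → ℝ) ((r • g : X d k) : Phase d → ℝ) :=
  (h.const_mul r).congr (coeFn_smul_X r w).symm (coeFn_smul_X r g).symm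

/-- The graph of the weak gradient in the position, for functions in `X_k`. -/
def SobX (d k : ℕ) : Submodule ℝ (X d k × (Fin d → X d k)) where
  carrier := {y | ∀ j, IsWeak (ex j) (y.1 : Phase d → ℝ) (y.2 j)}
  add_mem' h h' j := isWeak_coeFn_add (h j) (h' j)
  zero_mem' j := (isWeak_zero (ex j)).congr coeFn_zero_X.symm coeFn_zero_X.symm
  smul_mem' r _ h j := isWeak_coeFn_smul r (h j)

theorem mem_SobX {k : ℕ} {y : X d k × (Fin d → X d k)} :
    y ∈ SobX d k ↔ ∀ j, IsWeak (ex j) (y.1 : Phase d → ℝ) (y.2 j) := Iff.rfl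

/-- Each defining condition is an equality of two continuous functionals. Closedness makes the space
complete, as the exponential of the generator and the inversion argument require. -/
theorem isClosed_SobX (d k : ℕ) : IsClosed (SobX d k : Set (X d k × (Fin d → X d k))) := by
  have e : (SobX d k : Set (X d k × (Fin d → X d k))) = ⋂ (j : Fin d) (φ : Phase d → ℝ)
      (_ : ContDiff ℝ ∞ φ) (_ : HasCompactSupport φ),
      {y | ∫ z, y.1 z * fderiv ℝ φ z (ex j) = -∫ z, y.2 j z * φ z} := by
    ext y
    simp only [SetLike.mem_coe, mem_SobX, mem_iInter]
    rfl
  rw [e]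
  refine isClosed_iInter fun j => isClosed_iInter fun φ => isClosed_iInter fun hφ => isClosed_iInter fun hs => ?_
  obtain ⟨L, hL⟩ := exists_pairing k (continuous_fderiv_test hφ (ex j)) (hs.fderiv_apply ℝ (ex j))
  obtain ⟨L', hL'⟩ := exists_pairing k hφ.continuous hs
  simp only [← hL, ← hL']
  exact isClosed_eq (by fun_prop) (by fun_prop)

instance (d k : ℕ) : CompleteSpace (SobX d k) := (isClosed_SobX d k).completeSpace_coe

theorem cw_derivKernel_le (k : ℕ) (μ : ℝ) (j : Fin d) (c : E d → ℂ) :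
    cw k (derivKernel μ j c) ≤ ENNReal.ofReal (2 * |μ| ^ 2) * cw (k + 1) c := by
  refine cw_mul_le k 1 (A := |μ|) fun y => ?_
  rw [derivKernel, norm_mul, norm_mul, Complex.norm_I, one_mul, Complex.norm_real, norm_mul, pow_one,
    Real.norm_eq_abs]
  gcongr
  exact PiLp.norm_apply_le y j

theorem measurable_derivKernel (μ : ℝ) (j : Fin d) {c : E d → ℂ} (hc : Measurable c) :
    Measurable (derivKernel μ j c) := by
  unfold derivKernel
  fun_prop

/-- The transport free evolution on functions with weak derivatives in the position. -/
theorem exists_sob_dissipative {k : ℕ} (hk : d < 2 * k) (μ : ℝ) {b : ℝ} (hb : 0 ≤ b) {ν γ : ℝ} (hγ : γ < ν) :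
    ∃ c₀ C₀ : ℝ, 0 < c₀ ∧ 0 ≤ C₀ ∧ ∀ c : E d → ℂ, Measurable c →
      (∀ y, c (-y) = starRingEnd ℂ (c y)) → cw (k + 1) c ≤ ENNReal.ofReal b →
      ∃ (T : X d k →L[ℝ] X d k) (D : SobX d k →L[ℝ] SobX d k),
        (∀ w, T w =ᵐ[volume] convTheta μ c w) ∧ Dissipative c₀ C₀ γ D ∧
          ∀ y, (D y).1.1 = (T - ν • 1) y.1.1 := by
  -- The rate $(\gamma+\nu)/2$ leaves room for the loss in the triangular step below.
  obtain ⟨c₁, C₁, hc₁, hC₁, h1⟩ := exists_dissipative hk μ hb (show (γ + ν) / 2 < ν by linarith)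
  have hB : 0 ≤ 2 * |μ| ^ 2 * b := by positivity
  have hC₂ : 0 ≤ Fintype.card (Fin d) * C₁ := by positivity
  obtain ⟨c₀, C₀, hc₀, hC₀, h2⟩ := Dissipative.triangular (H₁ := X d k) (H₂ := Fin d → X d k)
    (κ := thetaBound d k (2 * |μ| ^ 2 * b)) hc₁ hc₁ hC₁ hC₂ (show γ < (γ + ν) / 2 by linarith)
  refine ⟨c₀, C₀, hc₀, hC₀, fun c hc hherm hcw => ?_⟩
  have hcw0 : cw k c ≤ ENNReal.ofReal (2 * b) := by
    rw [ENNReal.ofReal_mul (by norm_num), ENNReal.ofReal_ofNat]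
    exact (cw_le_cw_succ k c).trans (by gcongr)
  obtain ⟨T, -, hT⟩ := exists_theta hk μ (by positivity) hc hcw0
  have hcwj : ∀ j, cw k (derivKernel μ j c) ≤ ENNReal.ofReal (2 * |μ| ^ 2 * b) := fun j => by
    rw [ENNReal.ofReal_mul (by positivity)]
    exact (cw_derivKernel_le k μ j c).trans (by gcongr)
  -- `T' j` is the commutator of $\partial_{x_j}$ with the convolution. It is bounded because its
  -- kernel carries just one extra factor $y_j$. Hence $(w,\nabla_xw)$ evolves under a triangular
  -- operator, which is built on the full product space and then restricted to the graph of the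
  -- gradient.
  choose T' hT'n hT' using fun j => exists_theta hk μ hB (measurable_derivKernel μ j hc) (hcwj j)
  have hd := h1 c hc hherm hcw T hT
  have hd2 := h2 (T - ν • 1) _ (ContinuousLinearMap.pi T') hd (hd.pi (ι := Fin d) hC₁ hc₁.le)
    (ContinuousLinearMap.opNorm_le_bound _ (Real.sqrt_nonneg _) fun w =>
      (pi_norm_le_iff_of_nonneg (mul_nonneg (Real.sqrt_nonneg _) (norm_nonneg _))).2 fun j =>
        ((T' j).le_opNorm w).trans (by gcongr; exact hT'n j))
  refine ⟨T, _, hT, hd2.restrict (SobX d k) fun y => ?_, fun y => rfl⟩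
  rw [mem_SobX]
  intro j
  have hy := (mem_SobX.1 y.2) j
  have hw := hy.convTheta hk μ hc (hcw0.trans_lt ENNReal.ofReal_lt_top) j
    ((hcwj j).trans_lt ENNReal.ofReal_lt_top)
  have e1 : T y.1.1 =ᵐ[volume] convTheta μ c y.1.1 := hT _
  have e2 : ⇑(T (y.1.2 j) + T' j y.1.1) =ᵐ[volume] fun z =>
      convTheta μ c (y.1.2 j) z + convTheta μ (derivKernel μ j c) y.1.1 z := by
    filter_upwards [coeFn_add_X (T (y.1.2 j)) (T' j y.1.1), hT (y.1.2 j), hT' j y.1.1] with z h1 h2 h3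
    rw [h1, Pi.add_apply, h2, h3]
  have hw' : IsWeak (ex j) (T y.1.1 : Phase d → ℝ) (T (y.1.2 j) + T' j y.1.1 : X d k) :=
    hw.congr e1.symm e2.symm
  have h3 := isWeak_coeFn_add hw' (isWeak_coeFn_smul (-ν) hy)
  rw [show T (y.1.2 j) + T' j y.1.1 + -ν • y.1.2 j = T (y.1.2 j) - ν • y.1.2 j + T' j y.1.1 by
    rw [neg_smul]; abel, neg_smul, ← sub_eq_add_neg] at h3
  exact h3

/-- Multiplication with a function of the velocity which is dominated by the quotient of the weights. -/
theorem exists_mul_velocity {k k' : ℕ} {m : E d → ℝ} (hm : Measurable m)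
    (h : ∀ v, wt k 1 v * m v ^ 2 ≤ 2 * wt k' 1 v) :
    ∃ T : X d k' →L[ℝ] X d k, ‖T‖ ≤ Real.sqrt 2 ∧ ∀ w : X d k', T w =ᵐ[volume] fun z => m z.2 * w z := by
  have hT := exists_clm_of_pointwise (μ := weightMeasure d k') (ν := weightMeasure d k)
    (fun w z => m z.2 * w z) (C := Real.sqrt 2) (Real.sqrt_nonneg _)
    (fun w hw _ => ((hm.comp measurable_snd).mul hw.measurable).aestronglyMeasurable)
    (fun w hw _ => by
      rw [lintegral_weightMeasure, lintegral_weightMeasure, Real.sq_sqrt (by norm_num),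
        ← lintegral_const_mul' _ _ ENNReal.ofReal_ne_top]
      refine lintegral_mono fun z => ?_
      rw [enorm_mul, mul_pow, ← mul_assoc, ← mul_assoc, ← ENNReal.ofReal_mul (by norm_num),
        ← ofReal_norm (m z.2), ← ENNReal.ofReal_pow (norm_nonneg _), ← ENNReal.ofReal_mul (wt_pos _ _ _).le,
        Real.norm_eq_abs, sq_abs]
      exact mul_le_mul' (ENNReal.ofReal_le_ofReal (h z.2)) le_rfl)
    (fun w w' hww' => by
      rw [EventuallyEq, ae_weightMeasure] at hww' ⊢
      filter_upwards [hww'] with z hz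
      rw [hz])
    (fun w w' _ _ _ _ => Eventually.of_forall fun z => mul_add _ _ _)
    (fun r w _ _ => Eventually.of_forall fun z => mul_left_comm _ _ _)
  obtain ⟨T, hTn, hT⟩ := hT
  refine ⟨T, hTn, fun w => ?_⟩
  have := hT w
  rwa [EventuallyEq, ae_weightMeasure] at this

theorem exists_embed (d k : ℕ) :
    ∃ T : X d (k + 1) →L[ℝ] X d k, ‖T‖ ≤ Real.sqrt 2 ∧ ∀ w : X d (k + 1), T w =ᵐ[volume] w := by
  obtain ⟨T, h1, h2⟩ := exists_mul_velocity (d := d) (k := k) (k' := k + 1) (m := fun _ => 1) measurable_const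
    fun v => by
      rw [wt_one, wt_one, one_pow, mul_one]
      have h0 := norm_nonneg v
      have e : ‖v‖ ^ (2 * (k + 1)) = ‖v‖ ^ (2 * k) * ‖v‖ ^ 2 := by ring
      have p1 : 0 ≤ ‖v‖ ^ (2 * k) := by positivity
      rcases le_total ‖v‖ 1 with h | h
      · have := pow_le_one₀ h0 h (n := 2 * k)
        nlinarith [sq_nonneg ‖v‖, mul_nonneg p1 (sq_nonneg ‖v‖)]
      · have := one_le_pow₀ h (n := 2)
        rw [e]
        nlinarith
  exact ⟨T, h1, fun w => (h2 w).trans (Eventually.of_forall fun z => one_mul _)⟩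

/-- The streaming operator on functions with weak derivatives in the position. -/
theorem exists_streaming (d k : ℕ) :
    ∃ S : SobX d (k + 1) →L[ℝ] X d k, ‖S‖ ≤ d * Real.sqrt 2 ∧
      ∀ (y : SobX d (k + 1)) (q : X d k), q =ᵐ[volume] y.1.1 → IsStreaming q (S y) := by
  choose T hTn hT using fun j : Fin d => exists_mul_velocity (d := d) (k := k) (k' := k + 1)
    (m := fun v => v j) (by fun_prop) fun v => by
      refine le_trans ?_ (wt_mul_pow_le k 1 v)
      rw [mul_one, ← sq_abs]
      have := (wt_pos k 1 v).le
      gcongr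
      exact PiLp.norm_apply_le v j
  -- $S=-\sum_jv_j\,\partial_{x_j}$. Multiplication by $v_j$ costs one order of the weight, which is
  -- why the derivatives are kept in $X_{k+1}$.
  refine ⟨-∑ j, (T j).comp ((ContinuousLinearMap.proj j).comp ((ContinuousLinearMap.snd ℝ _ _).comp
    (SobX d (k + 1)).subtypeL)), ?_, fun y q hq φ hφ hs => ?_⟩
  · refine ContinuousLinearMap.opNorm_le_bound _ (by positivity) fun y => ?_
    have h1 : ∀ j, ‖T j (y.1.2 j)‖ ≤ Real.sqrt 2 * ‖y‖ := fun j =>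
      ((T j).le_opNorm _).trans (mul_le_mul (hTn j)
        ((norm_le_pi_norm y.1.2 j).trans (norm_snd_le y.1)) (norm_nonneg _) (Real.sqrt_nonneg _))
    have h2 := norm_sum_le_of_le Finset.univ fun j _ => h1 j
    simp only [Finset.sum_const, Finset.card_univ, Fintype.card_fin, nsmul_eq_mul] at h2
    rw [mul_assoc]
    refine le_trans (le_of_eq ?_) h2
    rw [neg_apply, norm_neg, _root_.sum_apply]
    rfl
  · have h1 := integral_streaming (memLp_X y.1.1) (fun j => memLp_X (y.1.2 j)) (mem_SobX.1 y.2) hφ hs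
    refine ((integral_congr_ae ?_).trans h1).trans (integral_congr_ae ?_)
    · filter_upwards [hq] with z hz
      rw [hz]
    · have h2 : ⇑(-∑ j, T j (y.1.2 j)) =ᵐ[volume] fun z => -∑ j, T j (y.1.2 j) z := by
        have h3 := coeFn_smul_X (-1) (∑ j, T j (y.1.2 j))
        rw [neg_one_smul] at h3
        filter_upwards [h3, coeFn_sum_X Finset.univ fun j => T j (y.1.2 j)] with z h4 h5
        rw [h4, Pi.smul_apply, h5]
        simp
      have h6 : (-∑ j, (T j).comp ((ContinuousLinearMap.proj j).comp ((ContinuousLinearMap.snd ℝ _ _).comp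
          (SobX d (k + 1)).subtypeL))) y = -∑ j, T j (y.1.2 j) := by
        rw [neg_apply, _root_.sum_apply]
        rfl
      rw [h6]
      filter_upwards [h2, ae_all_iff.2 fun j => hT j (y.1.2 j)] with z h3 h4
      rw [h3]
      simp only [h4]

end

section

variable {d : ℕ}

/-! ### The initial layer of an abstract system -/

section Abstract

variable {X Y : Type*} [NormedAddCommGroup X] [NormedSpace ℝ X] [NormedAddCommGroup Y] [NormedSpace ℝ Y]

/-- `T` is the operator `𝒜 - ν`, `P` the projection along the kernel of `Ω` onto the kernel of `T + Ω`. -/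
structure IsCollision (ν : ℝ) (T Ω P : X →L[ℝ] X) : Prop where
  pos : 0 < ν
  inj : Function.Injective T
  TP : ∀ w, T (P w) = -Ω w
  ΩT : ∀ w, Ω (T w) = -ν • Ω w
  ΩΩ : ∀ w, Ω (Ω w) = ν • Ω w

namespace IsCollision

variable {ν : ℝ} {T Ω P : X →L[ℝ] X}

/-- Evaluate $\Omega TP$ in two ways: as $-\nu\Omega P$ and as $-\Omega^2=-\nu\Omega$. -/
theorem omega_P (h : IsCollision ν T Ω P) (w : X) : Ω (P w) = Ω w := by
  have h1 := h.ΩT (P w)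
  rw [h.TP, map_neg, h.ΩΩ, neg_smul, neg_inj] at h1
  exact (smul_right_injective X h.pos.ne' h1).symm

theorem P_P (h : IsCollision ν T Ω P) (w : X) : P (P w) = P w :=
  h.inj (by rw [h.TP, h.TP, h.omega_P])

theorem P_eq_zero (h : IsCollision ν T Ω P) {w : X} (hw : Ω w = 0) : P w = 0 :=
  h.inj (by rw [h.TP, hw, neg_zero, map_zero])

theorem P_T (h : IsCollision ν T Ω P) {w : X} (hw : Ω w = 0) : P (T w) = 0 :=
  h.P_eq_zero (by rw [h.ΩT, hw, smul_zero])

theorem omega_of_T (h : IsCollision ν T Ω P) {w : X} (hw : Ω (T w) = 0) : Ω w = 0 := by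
  rw [h.ΩT] at hw
  exact (smul_eq_zero.1 hw).resolve_left (neg_ne_zero.2 h.pos.ne')

theorem omega_sub_P (h : IsCollision ν T Ω P) (w : X) : Ω (w - P w) = 0 := by
  rw [map_sub, h.omega_P, sub_self]

/-- The kernel of `Ω` is invariant under the evolution. -/
theorem omega_eq_zero (h : IsCollision ν T Ω P) {ψ r : ℝ → X} (hψ : ∀ t, HasDerivAt ψ (T (ψ t) + r t) t)
    (hr : ∀ t, Ω (r t) = 0) (h0 : Ω (ψ 0) = 0) {t : ℝ} (ht : 0 ≤ t) : Ω (ψ t) = 0 := by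
  -- $\Omega\psi$ solves $z'=-\nu z$ with zero initial value.
  have h1 := eqOn_of_linear_ode (-ν • (1 : X →L[ℝ] X)) (f := fun t => Ω (ψ t)) (g := fun _ => 0)
    (r := fun _ => 0) (fun t _ => by
      have h2 := Ω.hasFDerivAt.comp_hasDerivAt t (hψ t)
      rw [map_add, hr, h.ΩT] at h2
      exact h2.hasDerivWithinAt) (fun t _ => by simpa using hasDerivWithinAt_const t (Ici 0) (0 : X)) h0
  exact h1 ht

end IsCollision

/-- The evolution in the initial layer. The space `Y` with the evolution `D` is embedded into the
domain of the streaming operator `S` through `J`. -/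
theorem exists_layer [CompleteSpace X] [CompleteSpace Y] {c₁ C₁ c₂ C₂ γ γ' ν CΩ CS CY : ℝ}
    (hc₁ : 0 < c₁) (hC₁ : 0 ≤ C₁) (hc₂ : 0 < c₂) (hC₂ : 0 ≤ C₂) (hγ' : 0 < γ') (hγ : γ' < γ) (hCΩ : 0 ≤ CΩ)
    (hCS : 0 ≤ CS) (hCY : 0 ≤ CY) :
    ∃ M₁ M₂ M₃ : ℝ, ∀ (T Ω P : X →L[ℝ] X) (D : Y →L[ℝ] Y) (J S : Y →L[ℝ] X), IsCollision ν T Ω P →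
      Dissipative c₁ C₁ γ T → Dissipative c₂ C₂ γ D → (∀ y, J (D y) = T (J y)) → ‖Ω‖ ≤ CΩ → ‖S‖ ≤ CS →
      ∀ y₀ yΩ : Y, J yΩ = Ω (J y₀) → ‖yΩ‖ ≤ CY * ‖y₀‖ →
      ∃ (ψ₀ φ₁ ψ₁ : ℝ → X) (y : ℝ → Y) (yP : Y), (∀ t, HasDerivAt ψ₀ (T (ψ₀ t)) t) ∧
        ψ₀ 0 = J y₀ - P (J y₀) ∧ (∀ t, 0 ≤ t → J (y t) = ψ₀ t) ∧ (∀ t, 0 ≤ t → Ω (ψ₀ t) = 0) ∧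
        Continuous y ∧ (∀ t, HasDerivAt φ₁ (P (S (y t))) t) ∧ (∀ t, P (φ₁ t) = φ₁ t) ∧
        (∀ t, HasDerivAt ψ₁ (T (ψ₁ t) + (S (y t) - P (S (y t)))) t) ∧
        (∀ t, 0 ≤ t → Ω (ψ₁ t) = 0) ∧ J yP = P (J y₀) ∧ T (ψ₁ 0) = S yP - P (S yP) ∧
        ∀ t, 0 ≤ t → ‖ψ₀ t‖ ≤ M₁ * Real.exp (-γ' * t) * ‖J y₀‖ ∧
          ‖φ₁ t‖ ≤ M₂ * Real.exp (-γ' * t) * ‖y₀‖ ∧ ‖ψ₁ t‖ ≤ M₃ * Real.exp (-γ' * t) * ‖y₀‖ := by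
  have hγ0 : 0 < γ := hγ'.trans hγ
  -- `kT` and `kD` bound the norms of $T^{-1}$ and $D^{-1}$. All constants are built from these
  -- bounds before the operators are introduced.
  set kT : ℝ := C₁ / (c₁ * γ) with hkT
  set kD : ℝ := C₂ / (c₂ * γ) with hkD
  have hkT0 : 0 ≤ kT := by positivity
  have hkD0 : 0 ≤ kD := by positivity
  obtain ⟨c₃, C₃, hc₃, hC₃, htri⟩ := Dissipative.triangular (H₁ := Y) (H₂ := X) (κ := (1 + kT * CΩ) * CS)
    hc₂ hc₁ hC₂ hC₁ hγ
  refine ⟨Real.sqrt (C₁ / c₁) * (1 + kT * CΩ), kT * CΩ * CS * kD * Real.sqrt (C₂ / c₂) * (1 + kD * CY),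
    Real.sqrt (C₃ / c₃) * ((1 + kD * CY) + kT * (1 + kT * CΩ) * CS * (kD * CY)), ?_⟩
  intro T Ω P D J S h hT hD hJD hΩ hS y₀ yΩ hyΩ hyΩn
  obtain ⟨Ti, hTTi, hTiT, hTin⟩ := hT.exists_inverse hc₁ hγ0
  obtain ⟨Di, hDDi, hDiD, hDin⟩ := hD.exists_inverse hc₂ hγ0
  have hP : ∀ w, ‖P w‖ ≤ kT * CΩ * ‖w‖ := fun w => by
    -- $P=-T^{-1}\Omega$, so its norm is controlled by those of $T^{-1}$ and $\Omega$.
    have h1 : P w = Ti (-Ω w) := h.inj (by rw [h.TP, hTTi])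
    rw [h1, mul_assoc]
    refine (hTin _).trans ?_
    rw [norm_neg]
    gcongr
    exact (Ω.le_opNorm w).trans (by gcongr)
  have hQ : ∀ w, ‖w - P w‖ ≤ (1 + kT * CΩ) * ‖w‖ := fun w => by
    refine (norm_sub_le _ _).trans ?_
    rw [add_mul, one_mul]
    gcongr
    exact hP w
  have hSn : ∀ y, ‖S y‖ ≤ CS * ‖y‖ := fun y => (S.le_opNorm y).trans (by gcongr)
  -- The lift of $PJy_0$ to $Y$: the relation $P=-T^{-1}\Omega$ is imitated upstairs with $D^{-1}$
  -- and the lift `yΩ`. This is what puts $PJy_0$, and hence $J y_0-PJy_0$, in the domain of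
  -- streaming.
  set yP : Y := Di (-yΩ) with hyP
  have hyPn : ‖yP‖ ≤ kD * CY * ‖y₀‖ := by
    refine (hDin _).trans ?_
    rw [norm_neg, mul_assoc]
    gcongr
  have hJyP : J yP = P (J y₀) := h.inj (by rw [← hJD, hyP, hDDi, map_neg, hyΩ, h.TP])
  set z₀ : Y := y₀ - yP with hz₀
  have hz₀n : ‖z₀‖ ≤ (1 + kD * CY) * ‖y₀‖ := by
    refine (norm_sub_le _ _).trans ?_
    rw [add_mul, one_mul]
    gcongr
  have hJz₀ : J z₀ = J y₀ - P (J y₀) := by rw [hz₀, map_sub, hJyP]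
  set QS : Y →L[ℝ] X := S - P.comp S with hQS
  have hQSa : ∀ y, QS y = S y - P (S y) := fun y => rfl
  have hQSn : ∀ y, ‖QS y‖ ≤ (1 + kT * CΩ) * CS * ‖y‖ := fun y => by
    rw [hQSa, mul_assoc]
    refine (hQ _).trans ?_
    gcongr
    exact hSn y
  -- The lift of $\psi_0$ and $\psi_1$ form one triangular system, so $\psi_1$ decays with rate
  -- $\gamma'$ without a Duhamel integral.
  have hW := htri D T QS hD hT (QS.opNorm_le_bound (by positivity) hQSn)
  set W := triangular D T QS with hWdef
  set ψ₀ : ℝ → X := fun t => NormedSpace.exp (t • T) (J z₀) with hψ₀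
  set u : ℝ → Y × X := fun t => NormedSpace.exp (t • W) (z₀, Ti (QS yP)) with hu
  have hud : ∀ t, HasDerivAt u (W (u t)) t := hasDerivAt_exp_apply W _
  have hψ₀d : ∀ t, HasDerivAt ψ₀ (T (ψ₀ t)) t := hasDerivAt_exp_apply T _
  have hu0 : u 0 = (z₀, Ti (QS yP)) := by simp [hu, NormedSpace.exp_zero]
  have hψ0 : ψ₀ 0 = J z₀ := by simp [hψ₀, NormedSpace.exp_zero]
  have hu1 : ∀ t, HasDerivAt (fun t => (u t).1) (D (u t).1) t := fun t =>
    (ContinuousLinearMap.fst ℝ Y X).hasFDerivAt.comp_hasDerivAt t (hud t)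
  have hu2 : ∀ t, HasDerivAt (fun t => (u t).2) (T (u t).2 + QS (u t).1) t := fun t =>
    (ContinuousLinearMap.snd ℝ Y X).hasFDerivAt.comp_hasDerivAt t (hud t)
  have hJu : EqOn (fun t => J (u t).1) ψ₀ (Ici 0) := by
    refine eqOn_of_linear_ode T (r := fun _ => 0) (fun t _ => ?_) (fun t _ => ?_) ?_
    · have := J.hasFDerivAt.comp_hasDerivAt t (hu1 t)
      rw [hJD] at this
      rw [add_zero]
      exact this.hasDerivWithinAt
    · rw [add_zero]
      exact (hψ₀d t).hasDerivWithinAt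
    · rw [hψ0, hu0]
  have hu1e : ∀ t, 0 ≤ t → (u t).1 = NormedSpace.exp (t • D) z₀ := fun t ht => by
    refine eqOn_of_linear_ode D (f := fun t => (u t).1) (g := fun t => NormedSpace.exp (t • D) z₀)
      (r := fun _ => 0) (fun t _ => ?_) (fun t _ => ?_) ?_ ht
    · rw [add_zero]
      exact (hu1 t).hasDerivWithinAt
    · rw [add_zero]
      exact (hasDerivAt_exp_apply D z₀ t).hasDerivWithinAt
    · simp [hu0, NormedSpace.exp_zero]
  have hΩQ : ∀ y, Ω (QS y) = 0 := fun y => h.omega_sub_P _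
  have hexp : ∀ t : ℝ, 0 ≤ t → Real.exp (-γ * t) ≤ Real.exp (-γ' * t) := fun t ht =>
    Real.exp_le_exp.2 (by nlinarith)
  -- Since $y'=Dy$, the function $PSD^{-1}y$ is a primitive of $PSy$. It decays with $y$, which is
  -- the normalization required of $\varphi_1$ at infinity.
  refine ⟨ψ₀, fun t => P (S (Di (u t).1)), fun t => (u t).2, fun t => (u t).1, yP, hψ₀d, hψ0.trans hJz₀,
    fun t ht => hJu ht, fun t ht => ?_, ?_, fun t => ?_, fun t => h.P_P _, hu2, fun t ht => ?_, hJyP, ?_,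
    fun t ht => ⟨?_, ?_, ?_⟩⟩
  · exact h.omega_eq_zero (r := fun _ => 0) (fun t => by rw [add_zero]; exact hψ₀d t) (fun _ => map_zero _)
      (by rw [hψ0, hJz₀, h.omega_sub_P]) ht
  · exact continuous_iff_continuousAt.2 fun t => (hu1 t).continuousAt
  · have := (P.comp (S.comp Di)).hasFDerivAt.comp_hasDerivAt t (hu1 t)
    have e : (P.comp (S.comp Di)) (D (u t).1) = P (S (u t).1) := by
      simp [hDiD]
    rw [e] at this
    exact this
  · refine h.omega_eq_zero (ψ := fun t => (u t).2) hu2 (fun t => hΩQ _) ?_ ht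
    rw [hu0]
    exact h.omega_of_T (by rw [hTTi, hΩQ])
  · change T (u 0).2 = _
    rw [hu0, hTTi]
    exact hQSa _
  · refine (hT.norm_exp_le hc₁ ht _).trans ?_
    have h1 : ‖J z₀‖ ≤ (1 + kT * CΩ) * ‖J y₀‖ := by
      rw [hJz₀]
      exact hQ _
    calc _ ≤ Real.sqrt (C₁ / c₁) * Real.exp (-γ' * t) * ((1 + kT * CΩ) * ‖J y₀‖) := by
          gcongr
      _ = _ := by ring
  · have h1 : ‖(u t).1‖ ≤ Real.sqrt (C₂ / c₂) * Real.exp (-γ' * t) * ((1 + kD * CY) * ‖y₀‖) := by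
      rw [hu1e t ht]
      refine (hD.norm_exp_le hc₂ ht _).trans ?_
      gcongr
    calc ‖P (S (Di (u t).1))‖ ≤ kT * CΩ * (CS * (kD * (Real.sqrt (C₂ / c₂) * Real.exp (-γ' * t) *
          ((1 + kD * CY) * ‖y₀‖)))) := by
          refine (hP _).trans ?_
          gcongr
          refine (hSn _).trans ?_
          gcongr
          refine (hDin _).trans ?_
          gcongr
      _ = _ := by ring
  · refine (norm_snd_le (u t)).trans ((hW.norm_exp_le hc₃ ht _).trans ?_)
    have h2 : ‖Ti (QS yP)‖ ≤ kT * ((1 + kT * CΩ) * CS * (kD * CY * ‖y₀‖)) := by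
      refine (hTin _).trans ?_
      gcongr
      refine (hQSn _).trans ?_
      gcongr
    have h1 : ‖(z₀, Ti (QS yP))‖ ≤ (1 + kD * CY) * ‖y₀‖ + kT * ((1 + kT * CΩ) * CS * (kD * CY * ‖y₀‖)) :=
      norm_prod_le_iff.2 ⟨hz₀n.trans (le_add_of_nonneg_right (by positivity)),
        h2.trans (le_add_of_nonneg_left (by positivity))⟩
    calc _ ≤ Real.sqrt (C₃ / c₃) * Real.exp (-γ' * t) *
          ((1 + kD * CY) * ‖y₀‖ + kT * ((1 + kT * CΩ) * CS * (kD * CY * ‖y₀‖))) := by gcongr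
      _ = _ := by ring

end Abstract

end

section

variable {d : ℕ}

/-! ### The operators of the Wigner-BGK equation in `X_k` -/

/-- `T`, `Ω`, `P` are the operators `𝒜 - ν`, `Ω` and `𝒫` in `X_k`. -/
structure IsRealization (c : Constants) (V : E d → ℝ) {k : ℕ} (T Ω P : X d k →L[ℝ] X d k) : Prop where
  projP : ∀ {f : Phase d → ℝ} {w : X d k}, f =ᵐ[volume] w → projP c V f =ᵐ[volume] P w
  ac : ∀ {f : Phase d → ℝ} {w : X d k}, f =ᵐ[volume] w → AC c V f =ᵐ[volume] (T w + Ω w : X d k)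
  meanZero : ∀ {w : X d k}, MeanZero w ↔ Ω w = 0

theorem density_X_add {k : ℕ} (hk : d < 2 * k) (w w' : X d k) :
    density ((w + w' : X d k) : Phase d → ℝ) =ᵐ[volume] density w + density w' := by
  have hfin : ∀ w : X d k, FinW k w := fun w => MemLp.finW (Lp.memLp w)
  exact (density_congr (coeFn_add_X w w')).trans (density_add_ae hk (Lp.stronglyMeasurable w).measurable
    (hfin w) (Lp.stronglyMeasurable w').measurable (hfin w'))

theorem density_X_smul {k : ℕ} (r : ℝ) (w : X d k) :
    density ((r • w : X d k) : Phase d → ℝ) =ᵐ[volume] r • density w := by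
  refine (density_congr (coeFn_smul_X r w)).trans ?_
  rw [density_smul]

/-- `P` is defined as $-T^{-1}\Omega$. The algebra comes from densities: $\Omega w$ depends on $w$
only through $n[w]$, while $n[\Omega w]=\nu\,n[w]$ and $n[Tw]=-\nu\,n[w]$. That `P` is the explicit
projection onto multiples of $M$ is the Fourier division in `kerMOf_mul_density_ae_eq`. -/
theorem exists_collision {k : ℕ} (hk : d < 2 * k) (c : Constants) {b : ℝ} (hb : 0 ≤ b) {V : E d → ℝ}
    {a : E d → ℂ} (h : IsPotential (k + 2) b V a) {Θ : X d k →L[ℝ] X d k}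
    (hΘ : ∀ w, Θ w =ᵐ[volume] convTheta (freq c) (thetaKernel c a) w) {c₀ C₀ γ : ℝ} (hc₀ : 0 < c₀) (hγ : 0 < γ)
    (hT : Dissipative c₀ C₀ γ (Θ - c.nu • 1)) :
    ∃ Ω P : X d k →L[ℝ] X d k, ‖Ω‖ ≤ omegaBound c d k k (hessBound d k b) ∧
      (∀ w : X d k, Ω w =ᵐ[volume] fun z => omegaKer c (hessPot a) z * density w z.1) ∧
      IsCollision c.nu (Θ - c.nu • 1) Ω P ∧ IsRealization c V (Θ - c.nu • 1) Ω P := by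
  have hν := c.nu_pos
  have hcw : cw k a < ⊤ := by
    have h1 := (cw_le_cw_succ k a).trans (mul_le_mul_right (cw_le_cw_succ (k + 1) a) 2)
    refine h1.trans_lt (ENNReal.mul_lt_top (by simp) (ENNReal.mul_lt_top (by simp) ?_))
    exact h.cw_le.trans_lt ENNReal.ofReal_lt_top
  have hHm := measurable_hessPot hk h
  obtain ⟨Ω, hΩn, hΩ⟩ := exists_omega hk k c hHm (Real.sqrt_nonneg _) (abs_hessPot_le hk hb h)
  obtain ⟨Ti, hTTi, hTiT, -⟩ := hT.exists_inverse hc₀ hγ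
  set T : X d k →L[ℝ] X d k := Θ - c.nu • 1 with hTdef
  have hΩd : ∀ w, density (Ω w : Phase d → ℝ) =ᵐ[volume] c.nu • density w := fun w => by
    refine (density_congr (hΩ w)).trans ?_
    rw [density_omegaKer_mul]
    rfl
  have hTd : ∀ w, density (T w : Phase d → ℝ) =ᵐ[volume] (-c.nu) • density w := fun w => by
    have e : T w = Θ w + (-c.nu) • w := by
      rw [hTdef, neg_smul, ← sub_eq_add_neg]
      rfl
    rw [e]
    filter_upwards [density_X_add hk (Θ w) ((-c.nu) • w), density_X_smul (-c.nu) w,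
      (density_congr (hΘ w)).trans (density_convTheta c hk h.meas hcw (Lp.memLp w))] with x h1 h2 h3
    rw [h1, Pi.add_apply, h2, h3]
    simp
  have hΩcongr : ∀ (w w' : X d k) (r : ℝ), density (w : Phase d → ℝ) =ᵐ[volume] r • density w' →
      Ω w = r • Ω w' := fun w w' r hd => by
    refine ext_X ?_
    filter_upwards [hΩ w, coeFn_smul_X r (Ω w'), hΩ w', ae_phase_fst hd] with z h1 h2 h3 h4
    rw [h1, h2, Pi.smul_apply, h3, h4]
    simp
    ring
  set P : X d k →L[ℝ] X d k := -(Ti.comp Ω) with hP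
  have hTP : ∀ w, T (P w) = -Ω w := fun w => by
    rw [hP, neg_apply, map_neg, ContinuousLinearMap.comp_apply, hTTi]
  have hess : ∀ r s, hess V r s =ᵐ[volume] hessPot a r s := hess_ae_eq_hessPot hk h
  refine ⟨Ω, P, hΩn, hΩ, ⟨hν, fun w w' hww' => ?_, hTP, fun w => hΩcongr _ _ _ (hTd w),
    fun w => hΩcongr _ _ _ (hΩd w)⟩, ⟨fun {f w} hf => ?_, fun {f w} hf => ?_, fun {w} => ⟨fun hw => ?_, fun hw => ?_⟩⟩⟩
  · rw [← hTiT w, hww', hTiT]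
  · have heq : (fun z => c.nu * P w z - convTheta (freq c) (thetaKernel c a) (P w) z) =ᵐ[volume]
        fun z => omegaKer c (hessPot a) z * density w z.1 := by
      have e1 : Θ (P w) + (-c.nu) • P w = (-1 : ℝ) • Ω w := by
        rw [neg_one_smul, ← hTP, hTdef, neg_smul, ← sub_eq_add_neg]
        rfl
      have e2 := congrArg (fun y : X d k => (y : Phase d → ℝ)) e1
      filter_upwards [hΘ (P w), hΩ w, coeFn_add_X (Θ (P w)) ((-c.nu) • P w), coeFn_smul_X (-c.nu) (P w),
        coeFn_smul_X (-1) (Ω w)] with z h1 h2 h3 h4 h5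
      have e3 := congrFun e2 z
      simp only [h3, h5, Pi.add_apply, Pi.smul_apply, h4, smul_eq_mul] at e3
      rw [← h2, ← h1]
      linarith
    have h1 := (kerMOf_mul_density_ae_eq c hk h.meas hcw hHm (measurable_density_X w) (Lp.memLp (P w)) heq).1
    have h2 := kerM_ae_eq c (IsFT.ae_eq_potential h.ft (integrable_of_cw hk h.meas hcw)) hess
    filter_upwards [h1, h2, ae_phase_fst (density_congr hf)] with z h3 h4 h5
    rw [WignerBGK.projP, h4, h5, h3]
  · have hf' : MemLp f 2 (weightMeasure d k) := (Lp.memLp w).ae_eq (by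
      rw [EventuallyEq, ae_weightMeasure]
      exact hf.symm)
    have e : T w + Ω w = Θ w + ((-c.nu) • w + Ω w) := by
      rw [hTdef, neg_smul, ← add_assoc, ← sub_eq_add_neg]
      rfl
    rw [e]
    filter_upwards [theta_congr c V hf, theta_ae_eq_convTheta c hk h.meas hcw h.ft (Lp.memLp w), hΘ w, hf,
      omega_ae_eq c hess f, ae_phase_fst (density_congr hf), hΩ w, coeFn_add_X (Θ w) ((-c.nu) • w + Ω w),
      coeFn_add_X ((-c.nu) • w) (Ω w), coeFn_smul_X (-c.nu) w] with z h1 h2 h3 h4 h5 h6 h7 h8 h9 h10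
    rw [AC, h1, h2, ← h3, h4, h5, h6, ← h7, h8, Pi.add_apply, h9, Pi.add_apply, h10]
    simp
    ring
  · have := hΩcongr w 0 0 (hw.trans (by rw [zero_smul]))
    rw [this, zero_smul]
  · have h1 := hΩd w
    have h2 : density (Ω w : Phase d → ℝ) =ᵐ[volume] 0 := by
      rw [hw]
      refine (density_congr coeFn_zero_X).trans (Eventually.of_forall fun x => ?_)
      simp [density]
    filter_upwards [h1, h2] with x h3 h4
    rw [h4] at h3
    exact (smul_eq_zero.1 h3.symm).resolve_left hν.ne'

namespace IsRealization

variable {c : Constants} {V : E d → ℝ} {k : ℕ} {T Ω P : X d k →L[ℝ] X d k}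

theorem projQ (h : IsRealization c V T Ω P) {f : Phase d → ℝ} {w : X d k} (hf : f =ᵐ[volume] w) :
    projQ c V f =ᵐ[volume] (w - P w : X d k) := by
  filter_upwards [h.projP hf, coeFn_sub_X w (P w), hf] with z h1 h2 h3
  rw [h2, WignerBGK.projQ, h1, h3, Pi.sub_apply]

/-- On the kernel of $\Omega$ the projection $\mathcal Q$ is the identity and $\mathcal A+\mathcal
C$ is $T$, and $T$ maps this kernel into itself. This reduces the equations of the layer to linear
equations with generator $T$. -/
theorem qacq (h : IsRealization c V T Ω P) (hI : IsCollision c.nu T Ω P) {w : X d k} (hw : Ω w = 0) :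
    QACQ c V w =ᵐ[volume] T w := by
  have h1 := h.projQ (ae_eq_refl (w : Phase d → ℝ))
  rw [hI.P_eq_zero hw, sub_zero] at h1
  have h2 := h.ac h1
  rw [hw, add_zero] at h2
  have h3 := h.projQ h2
  rwa [hI.P_T hw, sub_zero] at h3

end IsRealization

end

section

variable {d : ℕ}

/-! ### The initial layer of the Wigner-BGK equation -/

section Layer

variable {c : Constants} {V : E d → ℝ} {k : ℕ} {T Ω P : X d k →L[ℝ] X d k}

theorem hasDerivWithinAt_of_contDiffOn {ψ : ℝ → X d k} (h : ContDiffOn ℝ 1 ψ (Ici 0)) {t : ℝ} (ht : 0 ≤ t) :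
    HasDerivWithinAt ψ (derivWithin ψ (Ici 0) t) (Ici 0) t :=
  (h.differentiableOn (by simp) t ht).hasDerivWithinAt

/-- Mean-zero solutions obey linear equations with the bounded generator $T$, so $\psi_0$ is
determined by its datum. Then $\psi_0$ determines the streaming terms, since a distribution has at
most one representative in $X_k$. The function $\varphi_1$ is fixed by its derivative and its limit,
and $\psi_1(0)$ by injectivity of $T$. -/
theorem IsInitialLayer.unique (hR : IsRealization c V T Ω P) (hI : IsCollision c.nu T Ω P) {w₀ : Phase d → ℝ}
    {ψ₀ φ₁ ψ₁ ψ₀' φ₁' ψ₁' : ℝ → X d k} (h' : IsInitialLayer c V k w₀ ψ₀' φ₁' ψ₁')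
    (h : IsInitialLayer c V k w₀ ψ₀ φ₁ ψ₁) :
    EqOn ψ₀' ψ₀ (Ici 0) ∧ EqOn φ₁' φ₁ (Ici 0) ∧ EqOn ψ₁' ψ₁ (Ici 0) := by
  have d0 : ∀ {ψ φ χ : ℝ → X d k}, IsInitialLayer c V k w₀ ψ φ χ → ∀ t, 0 ≤ t →
      HasDerivWithinAt ψ (T (ψ t) + 0) (Ici 0) t := fun {ψ φ χ} h t ht => by
    have h1 := hasDerivWithinAt_of_contDiffOn h.psi0_c1 ht
    rwa [ext_X ((h.psi0_eq t ht).trans (hR.qacq hI (hR.meanZero.1 (h.psi0_mem t ht)))), ← add_zero (T (ψ t))] at h1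
  have e0 : EqOn ψ₀' ψ₀ (Ici 0) := eqOn_of_linear_ode T (r := fun _ => 0) (d0 h') (d0 h)
    (ext_X (h'.psi0_init.trans h.psi0_init.symm))
  have sandwich : ∀ {L R : (Phase d → ℝ) → Phase d → ℝ} {w g g' : Phase d → ℝ},
      IsSandwichS k L R w g → IsSandwichS k L R w g' → g =ᵐ[volume] g' := by
    rintro L R w g g' ⟨q, s, hq, hs, hg⟩ ⟨q', s', hq', hs', hg'⟩
    obtain rfl : q = q' := ext_X (hq.trans hq'.symm)
    obtain rfl : s = s' := hs.unique hs'
    exact hg.trans hg'.symm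
  refine ⟨e0, ?_, ?_⟩
  · have hd : ∀ t, 0 ≤ t → derivWithin φ₁' (Ici 0) t = derivWithin φ₁ (Ici 0) t := fun t ht => by
      refine ext_X (sandwich ?_ (h.phi1_eq t ht))
      rw [← e0 ht]
      exact h'.phi1_eq t ht
    have hc : EqOn (fun t => φ₁' t - φ₁ t) (fun _ => φ₁' 0 - φ₁ 0) (Ici 0) := by
      refine eqOn_of_linear_ode (0 : X d k →L[ℝ] X d k) (r := fun _ => 0) (fun t ht => ?_) (fun t _ => ?_) rfl
      · have := (hasDerivWithinAt_of_contDiffOn h'.phi1_c1 ht).sub (hasDerivWithinAt_of_contDiffOn h.phi1_c1 ht)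
        rw [hd t ht, sub_self] at this
        rw [add_zero]
        exact this
      · rw [add_zero]
        exact hasDerivWithinAt_const _ _ _
    have hlim : Tendsto (fun t => φ₁' t - φ₁ t) atTop (𝓝 0) := by
      simpa using h'.phi1_lim.sub h.phi1_lim
    have hlim' : Tendsto (fun t => φ₁' t - φ₁ t) atTop (𝓝 (φ₁' 0 - φ₁ 0)) :=
      tendsto_const_nhds.congr' (by filter_upwards [eventually_ge_atTop 0] with t ht using (hc ht).symm)
    intro t ht
    have h1 := hc ht
    rw [tendsto_nhds_unique hlim' hlim] at h1
    exact sub_eq_zero.1 h1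
  · have d1 : ∀ {ψ φ χ : ℝ → X d k}, IsInitialLayer c V k w₀ ψ φ χ → ∀ t, 0 ≤ t → ∃ g : Phase d → ℝ,
        IsSandwichS k (WignerBGK.projQ c V) (WignerBGK.projQ c V) (ψ t) g ∧
          (derivWithin χ (Ici 0) t : X d k) =ᵐ[volume] T (χ t) + g := fun {ψ φ χ} h t ht => by
      obtain ⟨g, hg, hgd⟩ := h.psi1_eq t ht
      refine ⟨g, hg, hgd.trans ?_⟩
      filter_upwards [hR.qacq hI (hR.meanZero.1 (h.psi1_mem t ht))] with z hz
      rw [Pi.add_apply, Pi.add_apply, hz]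
    -- The source term is read off from one of the solutions; it suffices to show that the other has
    -- the same source.
    refine eqOn_of_linear_ode T (r := fun t => derivWithin ψ₁ (Ici 0) t - T (ψ₁ t)) (fun t ht => ?_)
      (fun t ht => ?_) ?_
    · obtain ⟨g, hg, hgd⟩ := d1 h t ht
      obtain ⟨g', hg', hgd'⟩ := d1 h' t ht
      rw [e0 ht] at hg'
      have e1 : derivWithin ψ₁' (Ici 0) t = T (ψ₁' t) + (derivWithin ψ₁ (Ici 0) t - T (ψ₁ t)) := by
        refine ext_X ?_
        filter_upwards [hgd, hgd', sandwich hg' hg, coeFn_add_X (T (ψ₁' t)) (derivWithin ψ₁ (Ici 0) t - T (ψ₁ t)),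
          coeFn_sub_X (derivWithin ψ₁ (Ici 0) t) (T (ψ₁ t))] with z h1 h2 h3 h4 h5
        rw [h2, h4, Pi.add_apply, Pi.add_apply, h5, Pi.sub_apply, h1, h3, Pi.add_apply]
        ring
      have := hasDerivWithinAt_of_contDiffOn h'.psi1_c1 ht
      rwa [e1] at this
    · rw [add_sub_cancel]
      exact hasDerivWithinAt_of_contDiffOn h.psi1_c1 ht
    · have m : ∀ {ψ φ χ : ℝ → X d k}, IsInitialLayer c V k w₀ ψ φ χ → QACQ c V (χ 0) =ᵐ[volume] T (χ 0) :=
        fun {ψ φ χ} h => hR.qacq hI (hR.meanZero.1 (h.psi1_mem 0 le_rfl))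
      exact hI.inj (ext_X ((m h').symm.trans ((sandwich h'.psi1_init h.psi1_init).trans (m h))))

theorem contDiffOn_of_hasDerivAt {ψ ψ' : ℝ → X d k} (h : ∀ t, HasDerivAt ψ (ψ' t) t) (hc : Continuous ψ') :
    ContDiffOn ℝ 1 ψ (Ici 0) := by
  refine ContDiff.contDiffOn (contDiff_one_iff_deriv.2 ⟨fun t => (h t).differentiableAt, ?_⟩)
  rwa [show deriv ψ = ψ' from funext fun t => (h t).deriv]

theorem derivWithin_of_hasDerivAt {ψ : ℝ → X d k} {x : X d k} {t : ℝ} (h : HasDerivAt ψ x t) (ht : 0 ≤ t) :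
    derivWithin ψ (Ici 0) t = x :=
  h.hasDerivWithinAt.derivWithin (uniqueDiffOn_Ici 0 t ht)

theorem isInitialLayer_of_system {Y : Type*} [NormedAddCommGroup Y] [NormedSpace ℝ Y] {J S : Y →L[ℝ] X d k}
    (hR : IsRealization c V T Ω P) (hI : IsCollision c.nu T Ω P) (hS : ∀ y, IsStreaming (J y) (S y))
    {w₀ : Phase d → ℝ} {w : X d k} (hw : w₀ =ᵐ[volume] w) {ψ₀ φ₁ ψ₁ : ℝ → X d k} {y : ℝ → Y} {yP : Y}
    (h0 : ∀ t, HasDerivAt ψ₀ (T (ψ₀ t)) t) (h00 : ψ₀ 0 = w - P w) (hJ : ∀ t, 0 ≤ t → J (y t) = ψ₀ t)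
    (hΩ0 : ∀ t, 0 ≤ t → Ω (ψ₀ t) = 0) (hy : Continuous y) (h1 : ∀ t, HasDerivAt φ₁ (P (S (y t))) t)
    (hP1 : ∀ t, P (φ₁ t) = φ₁ t) (hlim : Tendsto φ₁ atTop (𝓝 0))
    (h2 : ∀ t, HasDerivAt ψ₁ (T (ψ₁ t) + (S (y t) - P (S (y t)))) t) (hΩ1 : ∀ t, 0 ≤ t → Ω (ψ₁ t) = 0)
    (hJP : J yP = P w) (h20 : T (ψ₁ 0) = S yP - P (S yP)) : IsInitialLayer c V k w₀ ψ₀ φ₁ ψ₁ := by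
  have hc0 : Continuous ψ₀ := continuous_iff_continuousAt.2 fun t => (h0 t).continuousAt
  have hc1 : Continuous ψ₁ := continuous_iff_continuousAt.2 fun t => (h2 t).continuousAt
  have hQ0 : ∀ t, 0 ≤ t → J (y t) =ᵐ[volume] WignerBGK.projQ c V (ψ₀ t) := fun t ht => by
    have := hR.projQ (ae_eq_refl (ψ₀ t : Phase d → ℝ))
    rw [hI.P_eq_zero (hΩ0 t ht), sub_zero] at this
    rw [hJ t ht]
    exact this.symm
  refine ⟨contDiffOn_of_hasDerivAt h0 (T.continuous.comp hc0), fun t ht => hR.meanZero.2 (hΩ0 t ht),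
    fun t ht => ?_, ?_, contDiffOn_of_hasDerivAt h1 (P.continuous.comp (S.continuous.comp hy)), fun t ht => ?_,
    fun t ht => ?_, hlim, contDiffOn_of_hasDerivAt h2 (by fun_prop), fun t ht => hR.meanZero.2 (hΩ1 t ht),
    fun t ht => ?_, ?_⟩
  · rw [derivWithin_of_hasDerivAt (h0 t) ht]
    exact (hR.qacq hI (hΩ0 t ht)).symm
  · rw [h00]
    exact (hR.projQ hw).symm
  · have := hR.projP (ae_eq_refl (φ₁ t : Phase d → ℝ))
    rwa [hP1] at this
  · rw [derivWithin_of_hasDerivAt (h1 t) ht]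
    exact ⟨J (y t), S (y t), hQ0 t ht, hS _, (hR.projP (ae_eq_refl _)).symm⟩
  · refine ⟨((S (y t) - P (S (y t)) : X d k) : Phase d → ℝ), ⟨J (y t), S (y t), hQ0 t ht, hS _,
      (hR.projQ (ae_eq_refl _)).symm⟩, ?_⟩
    rw [derivWithin_of_hasDerivAt (h2 t) ht]
    filter_upwards [coeFn_add_X (T (ψ₁ t)) (S (y t) - P (S (y t))), hR.qacq hI (hΩ1 t ht)] with z h3 h4
    rw [h3, Pi.add_apply, Pi.add_apply, h4]
  · refine ⟨J yP, S yP, ?_, hS _, ?_⟩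
    · have := hR.projP (hR.projP hw)
      rw [hI.P_P, ← hJP] at this
      exact this.symm
    · refine (hR.qacq hI (hΩ1 0 le_rfl)).trans ?_
      rw [h20]
      exact (hR.projQ (ae_eq_refl _)).symm

end Layer

theorem exists_omega_sob {k : ℕ} (hd : 0 < d) (hk : d < 2 * k) (c : Constants) {b : ℝ} (hb : 0 ≤ b) :
    ∃ CY : ℝ, 0 ≤ CY ∧ ∀ (V : E d → ℝ) (a : E d → ℂ), IsPotential (k + 2) b V a → ∀ y : SobX d (k + 1),
      ∃ yΩ : SobX d (k + 1), yΩ.1.1 =ᵐ[volume] (fun z => omegaKer c (hessPot a) z * density y.1.1 z.1) ∧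
        ‖yΩ‖ ≤ CY * ‖y‖ := by
  -- With $k=m+1$ the functions live in $X_{m+2}=X_{k+1}$ and the potential has $m+3=k+2$ orders of
  -- weight, as `exists_omega_deriv` requires.
  obtain ⟨m, rfl⟩ : ∃ m, k = m + 1 := ⟨k - 1, by omega⟩
  refine ⟨omegaDerivBound c d m b, ?_, fun V a h y => ?_⟩
  · have := c.nu_pos
    unfold omegaDerivBound omegaBound thirdBound
    positivity
  · obtain ⟨u, u', h1, h2, h3⟩ := exists_omega_deriv hk c hb h (mem_SobX.1 y.2)
    exact ⟨⟨(u, u'), mem_SobX.2 h2⟩, h1, h3⟩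

theorem exists_mem_sobX {k : ℕ} {w₀ : Phase d → ℝ} (h : MemH 1 k w₀) :
    ∃ y : SobX d k, w₀ =ᵐ[volume] y.1.1 ∧ ‖y‖ ≤ normH 1 k w₀ := by
  have hac : weightMeasure d k ≪ volume := withDensity_absolutelyContinuous _ _
  have s0 := MemSob.weakDeriv_spec h hac (Nat.zero_le 1) Fin.elim0
  have s1 := fun j : Fin d => MemSob.weakDeriv_spec h hac le_rfl (fun _ : Fin 1 => j)
  have e0 := s0.2.coeFn_toLp
  have e1 := fun j => (s1 j).2.coeFn_toLp
  simp only [EventuallyEq, ae_weightMeasure] at e0 e1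
  refine ⟨⟨(s0.2.toLp, fun j => (s1 j).2.toLp), mem_SobX.2 fun j => ?_⟩,
    s0.1.ae_eq_of_zero.trans (EventuallyEq.symm e0), ?_⟩
  · refine IsWeak.congr ?_ (EventuallyEq.symm e0) (EventuallyEq.symm (e1 j))
    refine s0.1.isWeak_snoc (b := ex j) ?_
    rw [show (Fin.snoc (fun l : Fin 0 => ex (Fin.elim0 l)) (ex j) : Fin 1 → Phase d) = fun _ => ex j by
      ext l : 1
      rw [Subsingleton.elim (α := Fin 1) l (Fin.last 0), Fin.snoc_last]]
    exact (s1 j).1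
  · refine norm_prod_le_iff.2 ⟨?_, (pi_norm_le_iff_of_nonneg (Real.sqrt_nonneg _)).2 fun j => ?_⟩
    · exact (Lp.norm_toLp _ s0.2).trans_le (eLpNorm_weakDeriv_le w₀ (Nat.zero_le 1) _)
    · exact (Lp.norm_toLp _ (s1 j).2).trans_le (eLpNorm_weakDeriv_le w₀ le_rfl _)

end

/-! ### Uniform constants and assembly of the theorem -/

section

variable {d : ℕ}

theorem cw_le_of_cw_succ_le {k : ℕ} {c : E d → ℂ} {b : ℝ} (h : cw (k + 1) c ≤ ENNReal.ofReal b) :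
    cw k c ≤ ENNReal.ofReal (2 * b) := by
  rw [ENNReal.ofReal_mul (by norm_num), ENNReal.ofReal_ofNat]
  exact (cw_le_cw_succ k c).trans (mul_le_mul_right h 2)

/-- The operators of the equation in `X_k` and on the functions in `X_{k+1}` with weak derivatives. -/
theorem exists_system {k : ℕ} (hk : d < 2 * k) (c : Constants) {b γ : ℝ} (hb : 0 ≤ b) (hγ : 0 < γ)
    (hγν : γ < c.nu) :
    ∃ c₁ C₁ c₂ C₂ : ℝ, 0 < c₁ ∧ 0 ≤ C₁ ∧ 0 < c₂ ∧ 0 ≤ C₂ ∧ ∀ (V : E d → ℝ) (a : E d → ℂ),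
      IsPotential (k + 2) b V a →
      ∃ (T Ω P : X d k →L[ℝ] X d k) (D : SobX d (k + 1) →L[ℝ] SobX d (k + 1)), IsCollision c.nu T Ω P ∧
        IsRealization c V T Ω P ∧ Dissipative c₁ C₁ γ T ∧ Dissipative c₂ C₂ γ D ∧
        ‖Ω‖ ≤ omegaBound c d k k (hessBound d k b) ∧
        (∀ w : X d k, Ω w =ᵐ[volume] fun z => omegaKer c (hessPot a) z * density w z.1) ∧
        ∀ (y : SobX d (k + 1)) (w w' : X d k), w =ᵐ[volume] y.1.1 → w' =ᵐ[volume] (D y).1.1 → w' = T w := by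
  set b₁ : ℝ := kernelBound c d (k + 2) * b with hb₁
  have hb₁0 : 0 ≤ b₁ := mul_nonneg (kernelBound_nonneg c d _) hb
  -- Dissipativity always needs one order of kernel weight more than the space: $k+1$ for $T$ on
  -- $X_k$, and $k+2$ for $D$ on `SobX d (k + 1)`. The latter uses all of $V\in H^{k+2}_x$.
  obtain ⟨c₁, C₁, hc₁, hC₁, hdiss⟩ := exists_dissipative hk (freq c) (by positivity : 0 ≤ 2 * b₁) hγν
  obtain ⟨c₂, C₂, hc₂, hC₂, hsob⟩ := exists_sob_dissipative (by omega : d < 2 * (k + 1)) (freq c) hb₁0 hγν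
  refine ⟨c₁, C₁, c₂, C₂, hc₁, hC₁, hc₂, hC₂, fun V a h => ?_⟩
  set κ := thetaKernel c a with hκ
  have hκm : Measurable κ := measurable_thetaKernel c h.meas
  have hκ2 : cw (k + 2) κ ≤ ENNReal.ofReal b₁ := cw_thetaKernel_le c (k + 2) h.meas h.cw_le
  have hκ1 : cw (k + 1) κ ≤ ENNReal.ofReal (2 * b₁) := cw_le_of_cw_succ_le hκ2
  have hκ0 : cw k κ ≤ ENNReal.ofReal (2 * (2 * b₁)) := cw_le_of_cw_succ_le hκ1
  obtain ⟨Θ, -, hΘ⟩ := exists_theta hk (freq c) (by positivity) hκm hκ0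
  have hT := hdiss κ hκm (thetaKernel_neg c a) hκ1 Θ hΘ
  obtain ⟨Θ', D, hΘ', hD, hDΘ⟩ := hsob κ hκm (thetaKernel_neg c a) hκ2
  obtain ⟨Ω, P, hΩn, hΩ, hI, hR⟩ := exists_collision hk c hb h hΘ hc₁ hγ hT
  refine ⟨_, Ω, P, D, hI, hR, hT, hD, hΩn, hΩ, fun y w w' hw hw' => ext_X (hw'.trans ?_)⟩
  rw [hDΘ]
  filter_upwards [hw, hΘ w, hΘ' y.1.1, convTheta_congr (freq c) κ hw, coeFn_sub_X (Θ' y.1.1) (c.nu • y.1.1),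
    coeFn_smul_X c.nu y.1.1, coeFn_sub_X (Θ w) (c.nu • w), coeFn_smul_X c.nu w] with z h1 h2 h3 h4 h5 h6 h7 h8
  refine h5.trans (Eq.trans ?_ h7.symm)
  rw [Pi.sub_apply, Pi.sub_apply, h6, h8, h2, h3, h4, Pi.smul_apply, Pi.smul_apply, h1]

theorem norm_eq_normX {k : ℕ} {w₀ : Phase d → ℝ} {w : X d k} (h : w₀ =ᵐ[volume] w) : ‖w‖ = normX k w₀ := by
  rw [Lp.norm_def, normX]
  congr 1
  refine eLpNorm_congr_ae ?_
  rw [EventuallyEq, ae_weightMeasure]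
  exact h.symm

/-- Weakens the rate and enlarges the norm of the datum at once. The absolute value of the constant
is needed because its sign is not recorded. -/
theorem mul_exp_mul_le (M : ℝ) {r r' τ u U : ℝ} (hr : r ≤ r') (hτ : 0 ≤ τ) (hu : 0 ≤ u) (hU : u ≤ U) :
    M * Real.exp (-r' * τ) * u ≤ |M| * Real.exp (-r * τ) * U := by
  have : Real.exp (-r' * τ) ≤ Real.exp (-r * τ) :=
    Real.exp_le_exp.2 (mul_le_mul_of_nonneg_right (neg_le_neg hr) hτ)
  gcongr
  exact le_abs_self M

theorem tendsto_zero_of_norm_le_exp {X : Type*} [NormedAddCommGroup X] {φ : ℝ → X} {M r u : ℝ} (hr : 0 < r)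
    (h : ∀ t, 0 ≤ t → ‖φ t‖ ≤ M * Real.exp (-r * t) * u) : Tendsto φ atTop (𝓝 0) := by
  refine squeeze_zero_norm' (a := fun t => M * Real.exp (-r * t) * u) ?_ ?_
  · filter_upwards [eventually_ge_atTop 0] with t ht using h t ht
  · have : Tendsto (fun t : ℝ => Real.exp (-r * t)) atTop (𝓝 0) :=
      Real.tendsto_exp_atBot.comp (tendsto_id.const_mul_atTop_of_neg (neg_lt_zero.2 hr))
    simpa using (this.const_mul M).mul_const u

set_option maxHeartbeats 400000 in
/-- Existence, uniqueness and decay of the initial layer. -/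
theorem exists_unique_initialLayer {d k : ℕ} (hd : 0 < d) (hk : d < 2 * k) (c : Constants)
    (νk νk2 R : ℝ) (hνk : 0 < νk) (hνk' : νk < c.nu) (hνk2' : νk2 < c.nu) :
    ∃ M₁ M₂ M₃ : ℝ, ∀ V : E d → ℝ, MemHx (k + 2) V → normHx (k + 2) V ≤ R →
      ∀ w₀ : Phase d → ℝ, MemH 1 (k + 1) w₀ →
        ∃ ψ₀ φ₁ ψ₁ : ℝ → X d k,
          IsInitialLayer c V k w₀ ψ₀ φ₁ ψ₁ ∧
          (∀ ψ₀' φ₁' ψ₁' : ℝ → X d k, IsInitialLayer c V k w₀ ψ₀' φ₁' ψ₁' →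
            EqOn ψ₀' ψ₀ (Ici 0) ∧ EqOn φ₁' φ₁ (Ici 0) ∧
              EqOn ψ₁' ψ₁ (Ici 0)) ∧
          ∀ τ : ℝ, 0 ≤ τ →
            ‖ψ₀ τ‖ ≤ M₁ * Real.exp (-νk * τ) * normX k w₀ ∧
            ‖φ₁ τ‖ ≤ M₂ * Real.exp (-νk2 * τ) * normH 1 (k + 1) w₀ ∧
            ‖ψ₁ τ‖ ≤ M₃ * Real.exp (-νk2 * τ) * normH 1 (k + 1) w₀ := by
  -- One rate, the larger of the two, serves all three estimates. The rate $\gamma$ halfway between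
  -- it and $\nu$ is that of the two generators, and the gap $\gamma-\gamma'$ is spent on the
  -- triangular system.
  set γ' : ℝ := max νk νk2 with hγ'
  set γ : ℝ := (γ' + c.nu) / 2 with hγ
  have hγ'ν : γ' < c.nu := max_lt hνk' hνk2'
  have hγ'0 : 0 < γ' := hνk.trans_le (le_max_left _ _)
  have hγν : γ < c.nu := by rw [hγ]; linarith
  have hγ'γ : γ' < γ := by rw [hγ]; linarith
  set b : ℝ := R ^ 2 + (d : ℝ) ^ (k + 1) * (d * R ^ 2) with hb
  have hb0 : 0 ≤ b := by positivity
  obtain ⟨c₁, C₁, c₂, C₂, hc₁, hC₁, hc₂, hC₂, hsys⟩ := exists_system hk c hb0 (hγ'0.trans hγ'γ) hγν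
  obtain ⟨CY, hCY, homega⟩ := exists_omega_sob hd hk c hb0
  obtain ⟨S, hSn, hS⟩ := exists_streaming d k
  obtain ⟨ι, -, hι⟩ := exists_embed d k
  obtain ⟨M₁, M₂, M₃, hlayer⟩ := exists_layer (X := X d k) (Y := SobX d (k + 1)) (ν := c.nu)
    (CΩ := omegaBound c d k k (hessBound d k b)) (CS := d * Real.sqrt 2) (CY := CY) hc₁ hC₁ hc₂ hC₂ hγ'0 hγ'γ
    (Real.sqrt_nonneg _) (by positivity) hCY
  refine ⟨|M₁|, |M₂|, |M₃|, fun V hV hVR w₀ hw₀ => ?_⟩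
  obtain ⟨a, h⟩ := exists_isPotential (k + 1) hV hVR
  obtain ⟨T, Ω, P, D, hI, hR, hT, hD, hΩn, hΩ, hDT⟩ := hsys V a h
  -- Forgets the gradient and embeds $X_{k+1}$ into $X_k$. It intertwines the two generators, so the
  -- evolution with one derivative is a lift of the one in $X_k$.
  set J : SobX d (k + 1) →L[ℝ] X d k :=
    ι.comp ((ContinuousLinearMap.fst ℝ _ _).comp (SobX d (k + 1)).subtypeL) with hJ
  have hJι : ∀ y, J y =ᵐ[volume] y.1.1 := fun y => hι y.1.1
  have hJD : ∀ y, J (D y) = T (J y) := fun y => hDT y _ _ (hJι y) (hJι (D y))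
  obtain ⟨y₀, hy₀, hy₀n⟩ := exists_mem_sobX hw₀
  obtain ⟨yΩ, hyΩ, hyΩn⟩ := homega V a h y₀
  have hJ₀ : w₀ =ᵐ[volume] J y₀ := hy₀.trans (hJι y₀).symm
  have hJΩ : J yΩ = Ω (J y₀) := by
    refine ext_X ((hJι yΩ).trans (hyΩ.trans (EventuallyEq.trans ?_ (hΩ (J y₀)).symm)))
    filter_upwards [ae_phase_fst (density_congr (hJι y₀))] with z hz
    rw [hz]
  obtain ⟨ψ₀, φ₁, ψ₁, y, yP, h0, h00, hJy, hΩ0, hy, h1, hP1, h2, hΩ1, hJP, h20, hbound⟩ :=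
    hlayer _ Ω P D J S hI hT hD hJD hΩn hSn y₀ yΩ hJΩ hyΩn
  have hmain := isInitialLayer_of_system hR hI (fun y => hS y (J y) (hJι y)) hJ₀ h0 h00 hJy hΩ0 hy h1 hP1
    (tendsto_zero_of_norm_le_exp hγ'0 fun t ht => (hbound t ht).2.1) h2 hΩ1 hJP h20
  refine ⟨ψ₀, φ₁, ψ₁, hmain, fun _ _ _ h' => h'.unique hR hI hmain, fun τ hτ => ?_⟩
  obtain ⟨b0, b1, b2⟩ := hbound τ hτ
  exact ⟨b0.trans (mul_exp_mul_le _ (le_max_left _ _) hτ (norm_nonneg _) (norm_eq_normX hJ₀).le),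
    b1.trans (mul_exp_mul_le _ (le_max_right _ _) hτ (norm_nonneg _) hy₀n),
    b2.trans (mul_exp_mul_le _ (le_max_right _ _) hτ (norm_nonneg _) hy₀n)⟩

end

end WignerBGK

end

open WignerBGK in
theorem mainTheorem8 (d k : ℕ) (hd : 0 < d) (hk : d < 2 * k) (c : Constants)
    (νk νk2 : ℝ) (hνk : 0 < νk) (hνk' : νk < c.nu) (hνk2 : 0 < νk2) (hνk2' : νk2 < c.nu)
    (R : ℝ) :
    ∃ M₁ M₂ M₃ : ℝ, ∀ V : E d → ℝ, MemHx (k + 2) V → normHx (k + 2) V ≤ R →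
      ∀ w₀ : Phase d → ℝ, MemH 1 (k + 1) w₀ →
        ∃ ψ₀ φ₁ ψ₁ : ℝ → X d k,
          IsInitialLayer c V k w₀ ψ₀ φ₁ ψ₁ ∧
          (∀ ψ₀' φ₁' ψ₁' : ℝ → X d k, IsInitialLayer c V k w₀ ψ₀' φ₁' ψ₁' →
            Set.EqOn ψ₀' ψ₀ (Set.Ici 0) ∧ Set.EqOn φ₁' φ₁ (Set.Ici 0) ∧
              Set.EqOn ψ₁' ψ₁ (Set.Ici 0)) ∧
          ∀ τ : ℝ, 0 ≤ τ →
            ‖ψ₀ τ‖ ≤ M₁ * Real.exp (-νk * τ) * normX k w₀ ∧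
            ‖φ₁ τ‖ ≤ M₂ * Real.exp (-νk2 * τ) * normH 1 (k + 1) w₀ ∧
            ‖ψ₁ τ‖ ≤ M₃ * Real.exp (-νk2 * τ) * normH 1 (k + 1) w₀ :=
  exists_unique_initialLayer hd hk c νk νk2 R hνk hνk' hνk2'
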